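/- Let $L$ be a closed smooth manifold of dimension $l$. A compact $n$-dimensional pseudomanifold with fibered $L$-singularities (possibly with boundary) is a compact, second countable Hausdorff space $X$ with a closed singular stratum $Y$ (possibly empty) of codimension $l+1\ge 2$ and dense regular stratum $X_{reg}=X\setminus Y$, both smooth manifolds (with boundary), together with control data: an open neighbourhood $T$ of $Y$, a continuous retraction $\pi\colon T\to Y$ and a continuous $\rho\colon T\to[0,\infty)$ with $\rho^{-1}(0)=Y$, both smooth on $T\cap X_{reg}$, such that $\pi$ is locally trivial, the trivialisations being homeomorphisms $\pi^{-1}(U)\cong U\times c(L)$ onto the product with the open cone $c(L)=L\times[0,\infty)/L\times\{0\}$, which carry $\rho$ to the radial coordinate and are diffeomorphisms on the regular stratum. Its boundary $\partial X$ is the union of the boundaries of the strata; it is a pseudomanifold with fibered $L$-singularities with strata $X_{reg}\cap\partial X$, $Y\cap\partial X$, and has a collar $\partial X\times[0,1]\hookrightarrow X$ that respects strata and control data. A wedge metric $g$ on $X$ is a Riemannian metric on $X_{reg}$ with an induced metric $g_Y$ on $Y$ such that near $Y$, locally in suitable trivialisations, $g=dr^2+\pi^*g_Y+r^2\kappa+O(r)$,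 where $\pi^*g_Y+\kappa$ is a Riemannian metric on the link bundle which submerses onto $g_Y$; on a collar of the boundary $g=dx^2+g_{\partial X}$ with $g_{\partial X}$ a wedge metric. A spin structure on $X$ consists of spin structures on $X_{reg}$ and on $Y$. Let $W$ be a compact $(n+1)$-dimensional pseudomanifold with fibered $L$-singularities, with strata $W_{reg}$, $Y$ and boundary $\partial W=X_1\sqcup X_2$ ($X_1$, $X_2$ may be empty), and let $(f,g)$ be a special Morse pair on $(W,X_1,X_2)$, that is: * $g$ is a wedge metric, $f\colon W\to[a,b]$ is continuous and smooth on each stratum, $f^{-1}(a)=X_1$, $f^{-1}(b)=X_2$; * all critical points of $f$ (points which are critical for the restriction of $f$ to the stratum containing them) lie in the interior of $W$ and are non-degenerate: the Hessian of the restriction of $f$ to the stratum is non-degenerate, and near a critical point on $Y$ the field $-\nabla_gf$ is a radial extension of $-\nabla_{g_Y}f|_Y$, that is, the sum of a controlled lift of it, of a term $O(\rho^2)$ and of a controlled lift of $-\lambda t\,\partial_t$ along $\rho$, for a constant $\lambda>0$; * near $Y$, the field $\xi=-\nabla_gf$ satisfies $\pi_*\xi(x)=\xi(\pi(x))+\rho(x)^2\chi(\pi(x))$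 with a bounded vector field $\chi$ on $Y$, $|\rho_*\xi(x)|<A\rho(x)$ for a constant $A>0$, and $\rho_*\xi\le 0$, with $\rho_*\xi=0$ near $\partial W$. Then: 1. For every regular value $c\in[a,b]$ of $f$ (no critical point of $f$ lies on $f^{-1}(c)$), the level set $f^{-1}(c)$ is a compact $n$-dimensional pseudomanifold with fibered $L$-singularities, without boundary, with strata the smooth submanifolds $f^{-1}(c)\cap W_{reg}$ and $f^{-1}(c)\cap Y$. 2. For all regular values $c<d$ in $[a,b]$, the set $f^{-1}([c,d])$, with strata $f^{-1}([c,d])\cap W_{reg}$ and $f^{-1}([c,d])\cap Y$, is a compact pseudomanifold with fibered $L$-singularities with boundary $f^{-1}(c)\sqcup f^{-1}(d)$ (with the structures of part 1 for a choice of control data on each regular level set that does not depend on the pair $c,d$). If $W$ is spin then, with the spin structures inherited from $W$, it is a bordism in $\Omega^{spin,L\text{-}fib}_{n}$ between $f^{-1}(c)$ and $f^{-1}(d)$. -/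

import Mathlib

open Set Topology Bundle Manifold ContDiff

noncomputable section

namespace FibSing

universe u v w

/-! ## Manifolds with (possibly empty) boundary, of any dimension -/

/-- The local model of a `k`-manifold with boundary: a closed half-space of `ℝ^k`
(a point for `k = 0`). -/
def HSpace : ℕ → Type
  | 0 => EuclideanSpace ℝ (Fin 0)
  | k + 1 => EuclideanHalfSpace (k + 1)

instance instTopologicalSpaceHSpace : (k : ℕ) → TopologicalSpace (HSpace k)
  | 0 => inferInstanceAs (TopologicalSpace (EuclideanSpace ℝ (Fin 0)))
  | k + 1 => inferInstanceAs (TopologicalSpace (EuclideanHalfSpace (k + 1)))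

/-- The model with corners of `k`-manifolds with boundary. -/
def HModel : (k : ℕ) → ModelWithCorners ℝ (EuclideanSpace ℝ (Fin k)) (HSpace k)
  | 0 => 𝓡 0
  | k + 1 => 𝓡∂ (k + 1)

/-- Smooth Riemannian metrics on a manifold. -/
abbrev Riem {E : Type*} [NormedAddCommGroup E] [NormedSpace ℝ E] {H : Type*} [TopologicalSpace H]
    (I : ModelWithCorners ℝ E H) (M : Type*) [TopologicalSpace M] [ChartedSpace H M]
    [IsManifold I ∞ M] :=
  ContMDiffRiemannianMetric I ∞ E (fun x : M => TangentSpace I x)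

/-- The differential of a real valued function, as a linear form. -/
def dform {k : ℕ} {M : Type*} [TopologicalSpace M] [ChartedSpace (HSpace k) M]
    (f : M → ℝ) (x : M) : TangentSpace (HModel k) x →L[ℝ] ℝ :=
  mfderiv (HModel k) 𝓘(ℝ, ℝ) f x

theorem exists_grad {k : ℕ} {M : Type*} [TopologicalSpace M] [ChartedSpace (HSpace k) M]
    [IsManifold (HModel k) ∞ M] (g : Riem (HModel k) M) (f : M → ℝ) (x : M) :
    ∃ G : TangentSpace (HModel k) x, ∀ v, g.inner x G v = dform (k := k) f x v := by
  let V := EuclideanSpace ℝ (Fin k)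
  let B : V →ₗ[ℝ] (V →L[ℝ] ℝ) := (g.inner x : V →L[ℝ] (V →L[ℝ] ℝ)).toLinearMap
  let C : V →ₗ[ℝ] (V →ₗ[ℝ] ℝ) := (ContinuousLinearMap.coeLM ℝ).comp B
  have hinj : Function.Injective C := by
    rw [← LinearMap.ker_eq_bot, LinearMap.ker_eq_bot']
    intro v hv
    by_contra hne
    have h1 : 0 < g.inner x v v := g.pos x v hne
    have h2 : C v v = 0 := by rw [hv]; rfl
    exact absurd h2 (ne_of_gt h1)
  have hfr : Module.finrank ℝ V = Module.finrank ℝ (V →ₗ[ℝ] ℝ) := by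
    have := Subspace.dual_finrank_eq (K := ℝ) (V := V)
    exact this.symm
  have hsurj : Function.Surjective C :=
    (LinearMap.injective_iff_surjective_of_finrank_eq_finrank hfr).1 hinj
  obtain ⟨G, hG⟩ := hsurj ((dform (k := k) f x : V →L[ℝ] ℝ).toLinearMap)
  exact ⟨G, fun v => by exact congrArg (fun φ : V →ₗ[ℝ] ℝ => φ v) hG⟩

/-- The gradient: the vector with `g (∇ f, v) = df (v)` for all `v`. -/
def grad {k : ℕ} {M : Type*} [TopologicalSpace M] [ChartedSpace (HSpace k) M]
    [IsManifold (HModel k) ∞ M] (g : Riem (HModel k) M) (f : M → ℝ) (x : M) :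
    TangentSpace (HModel k) x :=
  (exists_grad (k := k) g f x).choose

/-- `p` is a non-degenerate critical point of the smooth function `f`, for an interior point `p`:
`df = 0` at `p`, and the Hessian of `f` at `p`, read in a chart, is a non-degenerate form. -/
def IsNondegCritical {k : ℕ} {M : Type*} [TopologicalSpace M] [ChartedSpace (HSpace k) M]
    (f : M → ℝ) (p : M) : Prop :=
  dform (k := k) f p = 0 ∧
    ∀ v : EuclideanSpace ℝ (Fin k),
      (∀ v' : EuclideanSpace ℝ (Fin k),
        fderiv ℝ (fderiv ℝ (f ∘ (extChartAt (HModel k) p).symm)) (extChartAt (HModel k) p p) v v'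
          = 0) → v = 0

/-! ## Stratified spaces with two strata -/

/-- The data of a compact stratified space with (at most) two strata: a closed stratum `sing`,
an `m`-manifold, and its dense complement, an `n`-manifold, both allowed to have a boundary;
with the control data `(T, π, ρ)` of the closed stratum. -/
structure StratData (n m : ℕ) (X : Type u) [TopologicalSpace X] where
  compact : CompactSpace X
  hausdorff : T2Space X
  secondCountable : SecondCountableTopology X
  sing : Set X
  isClosed_sing : IsClosed sing
  dense_reg : Dense singᶜ
  [regCharted : ChartedSpace (HSpace n) ↥(singᶜ)]
  [regManifold : IsManifold (HModel n) ∞ ↥(singᶜ)]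
  [singCharted : ChartedSpace (HSpace m) ↥sing]
  [singManifold : IsManifold (HModel m) ∞ ↥sing]
  tube : Set X
  isOpen_tube : IsOpen tube
  sing_subset_tube : sing ⊆ tube
  proj : ↥tube → ↥sing
  continuous_proj : Continuous proj
  proj_sing : ∀ (y : X) (hy : y ∈ sing), proj ⟨y, sing_subset_tube hy⟩ = ⟨y, hy⟩
  rad : ↥tube → ℝ
  continuous_rad : Continuous rad
  rad_nonneg : ∀ x, 0 ≤ rad x
  rad_eq_zero_iff : ∀ x, rad x = 0 ↔ x.1 ∈ sing

namespace StratData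

variable {n m : ℕ} {X : Type u} [TopologicalSpace X]

/-- The regular stratum. -/
abbrev Reg (W : StratData n m X) : Type u := ↥(W.singᶜ)

/-- The singular stratum. -/
abbrev Sing (W : StratData n m X) : Type u := ↥W.sing

instance (W : StratData n m X) : ChartedSpace (HSpace n) ↥(W.singᶜ) := W.regCharted
instance (W : StratData n m X) : IsManifold (HModel n) ∞ ↥(W.singᶜ) := W.regManifold
instance (W : StratData n m X) : ChartedSpace (HSpace m) ↥W.sing := W.singCharted
instance (W : StratData n m X) : IsManifold (HModel m) ∞ ↥W.sing := W.singManifold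

open Classical in
/-- The retraction `π` on the regular part of the tube, extended by the irrelevant constant value
`y₀` outside the tube. -/
def projExt (W : StratData n m X) (y₀ : W.Sing) (x : W.Reg) : W.Sing :=
  if h : x.1 ∈ W.tube then W.proj ⟨x.1, h⟩ else y₀

open Classical in
/-- The radial function `ρ` on the regular part of the tube, extended by `0` outside the tube. -/
def radExt (W : StratData n m X) (x : W.Reg) : ℝ :=
  if h : x.1 ∈ W.tube then W.rad ⟨x.1, h⟩ else 0

/-- `π_*` on tangent vectors of the regular stratum at points of the tube. -/
def dproj (W : StratData n m X) (y₀ : W.Sing) (x : W.Reg) :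
    TangentSpace (HModel n) x →L[ℝ] TangentSpace (HModel m) (W.projExt y₀ x) :=
  mfderiv (HModel n) (HModel m) (W.projExt y₀) x

/-- `ρ_*` on tangent vectors of the regular stratum at points of the tube. -/
def drad (W : StratData n m X) (x : W.Reg) : TangentSpace (HModel n) x →L[ℝ] ℝ :=
  dform (k := n) W.radExt x

/-- The boundary of the stratified space: the union of the boundaries of the strata. -/
def boundary (W : StratData n m X) : Set X :=
  Subtype.val '' (HModel n).boundary W.Reg ∪ Subtype.val '' (HModel m).boundary W.Sing

end StratData

/-- A trivialisation of the tube over the open subset `U` of the singular stratum, as a bundle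
with fibre the open cone `c(L) = L × [0,∞) / L × {0}`: an identification of `π⁻¹(U)` with
`U × c(L)` compatible with `π` and `ρ` which is a diffeomorphism `U × L × (0,∞) ≅ π⁻¹(U) \ U`
on the regular stratum (with inverse `(π, link, ρ)`) and is continuous up to the vertices.
As `L` is compact, its inverse is then continuous too. -/
structure ConeChart {n m : ℕ} {X : Type u} [TopologicalSpace X] (W : StratData n m X)
    (l : ℕ) (L : Type v) [TopologicalSpace L] [ChartedSpace (EuclideanSpace ℝ (Fin l)) L]
    (U : Set W.Sing) where
  param : W.Sing × L × ℝ → W.Reg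
  link : W.Reg → L
  param_mem : ∀ y ∈ U, ∀ (q : L) (r : ℝ), 0 < r →
    ∃ h : (param (y, q, r)).1 ∈ W.tube, W.proj ⟨_, h⟩ = y ∧ W.rad ⟨_, h⟩ = r
  link_param : ∀ y ∈ U, ∀ (q : L) (r : ℝ), 0 < r → link (param (y, q, r)) = q
  param_link : ∀ (x : W.Reg) (h : x.1 ∈ W.tube), W.proj ⟨x.1, h⟩ ∈ U →
    param (W.proj ⟨x.1, h⟩, link x, W.rad ⟨x.1, h⟩) = x
  smooth_param : ContMDiffOn ((HModel m).prod ((𝓡 l).prod 𝓘(ℝ, ℝ))) (HModel n) ∞ param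
    {q | q.1 ∈ U ∧ 0 < q.2.2}
  smooth_link : ∀ (x : W.Reg) (h : x.1 ∈ W.tube), W.proj ⟨x.1, h⟩ ∈ U →
    ContMDiffAt (HModel n) (𝓡 l) ∞ link x
  continuous_cone : ContinuousOn
    (fun q : W.Sing × L × ℝ => open Classical in if 0 < q.2.2 then (param q).1 else q.1.1)
    {q | q.1 ∈ U ∧ 0 ≤ q.2.2}

/-- A compact `n`-dimensional pseudomanifold (possibly with boundary) with fibered
`L`-singularities, with `l = dim L`: a smoothly stratified space with singular stratum of
dimension `m` and codimension at least two, whose tube is a locally trivial bundle of cones over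
`L` over the singular stratum. The singular stratum may be empty (then `m` is irrelevant).
The trivialisations make `(π, ρ)` a proper submersion of the regular part of the tube onto
`Y × (0,∞)`, and their transition functions are stratified isomorphisms preserving `ρ`. -/
structure FibPM (l : ℕ) (L : Type v) [TopologicalSpace L]
    [ChartedSpace (EuclideanSpace ℝ (Fin l)) L] (n m : ℕ) (X : Type u) [TopologicalSpace X]
    extends StratData n m X where
  smooth_proj : ∀ (y₀ : toStratData.Sing) (x : toStratData.Reg), x.1 ∈ toStratData.tube →
    ContMDiffAt (HModel n) (HModel m) ∞ (toStratData.projExt y₀) x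
  smooth_rad : ∀ x : toStratData.Reg, x.1 ∈ toStratData.tube →
    ContMDiffAt (HModel n) 𝓘(ℝ, ℝ) ∞ toStratData.radExt x
  dim_eq : toStratData.sing.Nonempty → m + l + 1 = n
  codim : toStratData.sing.Nonempty → m + 2 ≤ n
  exists_coneChart : ∀ y : toStratData.Sing, ∃ U : Set toStratData.Sing, IsOpen U ∧ y ∈ U ∧
    Nonempty (ConeChart toStratData l L U)

/-! ## Maps of stratified spaces, collars, bordisms -/

/-- A continuous map which maps strata to strata. -/
structure StratMap {n m n' m' : ℕ} {A : Type u} {X : Type v} [TopologicalSpace A]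
    [TopologicalSpace X] (M : StratData n' m' A) (W : StratData n m X) where
  toFun : A → X
  continuous_toFun : Continuous toFun
  mem_sing : ∀ a, toFun a ∈ W.sing ↔ a ∈ M.sing

namespace StratMap

variable {n m n' m' : ℕ} {A : Type u} {X : Type v} [TopologicalSpace A]
    [TopologicalSpace X] {M : StratData n' m' A} {W : StratData n m X}

/-- The restriction to the regular strata. -/
def reg (j : StratMap M W) (a : M.Reg) : W.Reg :=
  ⟨j.toFun a.1, fun h => a.2 ((j.mem_sing a.1).1 h)⟩

/-- The restriction to the singular strata. -/
def sing (j : StratMap M W) (a : M.Sing) : W.Sing :=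
  ⟨j.toFun a.1, (j.mem_sing a.1).2 a.2⟩

/-- The map is a smooth immersion on each stratum. -/
structure IsImmersion (j : StratMap M W) : Prop where
  smooth_reg : ContMDiff (HModel n') (HModel n) ∞ j.reg
  smooth_sing : ContMDiff (HModel m') (HModel m) ∞ j.sing
  injective_reg : ∀ a, Function.Injective (mfderiv (HModel n') (HModel n) j.reg a)
  injective_sing : ∀ a, Function.Injective (mfderiv (HModel m') (HModel m) j.sing a)

end StratMap

/-- The stratified space `M` carried by a subset of `X` has as strata the intersections with the
strata of `W`, as smoothly embedded submanifolds of these; `j` is the inclusion. -/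
def IsStratSubmanifold {n m n' m' : ℕ} {X : Type v} [TopologicalSpace X]
    (W : StratData n m X) {S : Set X} (M : StratData n' m' ↥S) (j : StratMap M W) : Prop :=
  j.toFun = Subtype.val ∧ j.IsImmersion

/-- The underlying map `M × [0,1] → W` of a collar; it maps strata to strata. -/
structure CollarMap {n m n' m' : ℕ} {A : Type u} {X : Type v} [TopologicalSpace A]
    [TopologicalSpace X] (M : StratData n' m' A) (W : StratData n m X) where
  toFun : A × unitInterval → X
  mem_sing : ∀ a t, toFun (a, t) ∈ W.sing ↔ a ∈ M.sing

namespace CollarMap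

variable {n m n' m' : ℕ} {A : Type u} {X : Type v} [TopologicalSpace A]
    [TopologicalSpace X] {M : StratData n' m' A} {W : StratData n m X}

/-- The restriction to the regular strata. -/
def reg (e : CollarMap M W) (q : M.Reg × unitInterval) : W.Reg :=
  ⟨e.toFun (q.1.1, q.2), fun h => q.1.2 ((e.mem_sing q.1.1 q.2).1 h)⟩

/-- The restriction to the singular strata. -/
def sing (e : CollarMap M W) (q : M.Sing × unitInterval) : W.Sing :=
  ⟨e.toFun (q.1.1, q.2), (e.mem_sing q.1.1 q.2).2 q.1.2⟩

/-- The differential of the collar on the regular stratum. -/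
def dreg (e : CollarMap M W) (q : M.Reg × unitInterval) (v : EuclideanSpace ℝ (Fin n'))
    (s : EuclideanSpace ℝ (Fin 1)) : TangentSpace (HModel n) (e.reg q) :=
  mfderiv ((HModel n').prod (𝓡∂ 1)) (HModel n) e.reg q (v, s)

/-- The differential of the collar on the singular stratum. -/
def dsing (e : CollarMap M W) (q : M.Sing × unitInterval) (v : EuclideanSpace ℝ (Fin m'))
    (s : EuclideanSpace ℝ (Fin 1)) : TangentSpace (HModel m) (e.sing q) :=
  mfderiv ((HModel m').prod (𝓡∂ 1)) (HModel m) e.sing q (v, s)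

end CollarMap

/-- The form `dt` on the tangent spaces of `[0,1]`. -/
def dtI (t : unitInterval) (s : EuclideanSpace ℝ (Fin 1)) : ℝ :=
  mfderiv (𝓡∂ 1) 𝓘(ℝ, ℝ) (Subtype.val : unitInterval → ℝ) t s

/-- A collar: a stratified isomorphism of `M × [0,1]` onto a closed neighbourhood of (the image of)
`M × {0}` in `W`, where `M` has no boundary and `M × {0}` is mapped into the boundary of `W`.
The control data of `W` on the collar are those of `M`, times `[0,1]`. -/
structure Collar {n m n' m' : ℕ} {A : Type u} {X : Type v} [TopologicalSpace A]
    [TopologicalSpace X] (M : StratData n' m' A) (W : StratData n m X)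
    extends CollarMap M W where
  closed : M.boundary = ∅
  isClosedEmbedding : IsClosedEmbedding toFun
  mem_boundary : ∀ a, toFun (a, 0) ∈ W.boundary
  range_mem_nhds : ∀ a, range toFun ∈ 𝓝 (toFun (a, 0))
  smooth_reg : ContMDiff ((HModel n').prod (𝓡∂ 1)) (HModel n) ∞ toCollarMap.reg
  smooth_sing : ContMDiff ((HModel m').prod (𝓡∂ 1)) (HModel m) ∞ toCollarMap.sing
  bijective_reg : ∀ q,
    Function.Bijective (mfderiv ((HModel n').prod (𝓡∂ 1)) (HModel n) toCollarMap.reg q)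
  bijective_sing : ∀ q,
    Function.Bijective (mfderiv ((HModel m').prod (𝓡∂ 1)) (HModel m) toCollarMap.sing q)
  mem_tube : ∀ a t, toFun (a, t) ∈ W.tube ↔ a ∈ M.tube
  proj_eq : ∀ a t (ha : a ∈ M.tube),
    (W.proj ⟨toFun (a, t), (mem_tube a t).2 ha⟩).1 = toFun ((M.proj ⟨a, ha⟩).1, t)
  rad_eq : ∀ a t (ha : a ∈ M.tube),
    W.rad ⟨toFun (a, t), (mem_tube a t).2 ha⟩ = M.rad ⟨a, ha⟩

/-- `W` has boundary `M₀ ⊔ M₁`, with collars. For pseudomanifolds with fibered `L`-singularities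
this says that `W` is a bordism between `M₀` and `M₁` (spin structures disregarded). -/
structure Cobordism {n m n' m' : ℕ} {A : Type u} {B : Type v} {X : Type w}
    [TopologicalSpace A] [TopologicalSpace B] [TopologicalSpace X]
    (M₀ : StratData n' m' A) (M₁ : StratData n' m' B) (W : StratData n m X) where
  c₀ : Collar M₀ W
  c₁ : Collar M₁ W
  disjoint : Disjoint (range c₀.toFun) (range c₁.toFun)
  boundary_eq : W.boundary = range (fun a => c₀.toFun (a, 0)) ∪ range (fun b => c₁.toFun (b, 0))

/-! ## Wedge metrics -/

/-- A wedge metric on a pseudomanifold with fibered `L`-singularities: metrics on the two strata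
such that near each point of the singular stratum there is a trivialisation of the tube by cones
in which `g = dr² + π^* g_Y + r² κ + O(r)`. Here `κ = h - π^* g_Y` for a metric `h` on the link
bundle, that is on `U × L`, for which the projection to `(U, g_Y)` is a Riemannian submersion, and
`O(r)` is understood relative to the leading part. -/
structure WedgeMetric {l : ℕ} {L : Type v} [TopologicalSpace L]
    [ChartedSpace (EuclideanSpace ℝ (Fin l)) L] [IsManifold (𝓡 l) ∞ L] {n m : ℕ} {X : Type u}
    [TopologicalSpace X] (W : FibPM l L n m X) where
  reg : Riem (HModel n) W.Reg
  sing : Riem (HModel m) W.Sing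
  conic : ∀ p : W.Sing, ∃ (U : Set W.Sing) (τ : ConeChart W.toStratData l L U)
    (h : Riem ((HModel m).prod (𝓡 l)) (W.Sing × L)) (C ε : ℝ),
    IsOpen U ∧ p ∈ U ∧ 0 < ε ∧
    (∀ y ∈ U, ∀ (q : L) (v : EuclideanSpace ℝ (Fin m)) (w : EuclideanSpace ℝ (Fin l)),
      (∀ w' : EuclideanSpace ℝ (Fin l), h.inner (y, q) (v, w) ((0 : EuclideanSpace ℝ (Fin m)), w')
        = 0) → h.inner (y, q) (v, w) (v, w) = sing.inner y v v) ∧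
    ∀ y ∈ U, ∀ (q : L) (r : ℝ), 0 < r → r < ε →
      ∀ (v : EuclideanSpace ℝ (Fin m)) (w : EuclideanSpace ℝ (Fin l)) (s : ℝ),
        let ζ : TangentSpace (HModel n) (τ.param (y, q, r)) :=
          mfderiv ((HModel m).prod ((𝓡 l).prod 𝓘(ℝ, ℝ))) (HModel n) τ.param (y, q, r) (v, w, s)
        let Q : ℝ := s ^ 2 + sing.inner y v v
          + r ^ 2 * (h.inner (y, q) (v, w) (v, w) - sing.inner y v v)
        |reg.inner _ ζ ζ - Q| ≤ C * r * Q

/-- The wedge metric `g` is, on the collar `e`, of the form `dx² + g_M`, for a wedge metric `g_M`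
on `M`, where `x = c t` is a normal coordinate, with `t` the coordinate of the collar. -/
def WedgeMetric.IsProductOn {l : ℕ} {L : Type w} [TopologicalSpace L]
    [ChartedSpace (EuclideanSpace ℝ (Fin l)) L] [IsManifold (𝓡 l) ∞ L] {n m n' m' : ℕ}
    {A : Type u} {X : Type v} [TopologicalSpace A] [TopologicalSpace X]
    {M : FibPM l L n' m' A} {W : FibPM l L n m X} (g : WedgeMetric W)
    (e : Collar M.toStratData W.toStratData) : Prop :=
  ∃ (gM : WedgeMetric M) (c : ℝ), 0 < c ∧
    (∀ (a : M.Reg) (t : unitInterval) (v v' : EuclideanSpace ℝ (Fin n')) (s s' : EuclideanSpace ℝ (Fin 1)),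
      g.reg.inner _ (e.dreg (a, t) v s) (e.dreg (a, t) v' s')
        = c ^ 2 * dtI t s * dtI t s' + gM.reg.inner a v v') ∧
    (∀ (a : M.Sing) (t : unitInterval) (v v' : EuclideanSpace ℝ (Fin m')) (s s' : EuclideanSpace ℝ (Fin 1)),
      g.sing.inner _ (e.dsing (a, t) v s) (e.dsing (a, t) v' s')
        = c ^ 2 * dtI t s * dtI t s' + gM.sing.inner a v v')

/-! ## Stratified vector fields and special Morse pairs -/

/-- A stratified vector field. -/
structure StratVF {n m : ℕ} {X : Type u} [TopologicalSpace X] (W : StratData n m X) where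
  reg : ∀ x : W.Reg, TangentSpace (HModel n) x
  sing : ∀ y : W.Sing, TangentSpace (HModel m) y

section Morse

variable {l : ℕ} {L : Type w} [TopologicalSpace L]
    [ChartedSpace (EuclideanSpace ℝ (Fin l)) L] [IsManifold (𝓡 l) ∞ L] {n m : ℕ}
    {X : Type v} [TopologicalSpace X] {W : FibPM l L n m X}

/-- A function restricted to the regular stratum. -/
def onReg (W : StratData n m X) (f : X → ℝ) : W.Reg → ℝ := fun x => f x.1

/-- A function restricted to the singular stratum. -/
def onSing (W : StratData n m X) (f : X → ℝ) : W.Sing → ℝ := fun x => f x.1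

/-- A smooth function on a stratified space: continuous, and smooth on each stratum. -/
structure IsSmoothFun (W : StratData n m X) (f : X → ℝ) : Prop where
  continuous : Continuous f
  smooth_reg : ContMDiff (HModel n) 𝓘(ℝ, ℝ) ∞ (onReg W f)
  smooth_sing : ContMDiff (HModel m) 𝓘(ℝ, ℝ) ∞ (onSing W f)

/-- `p` is a critical point of the restriction of `f` to the stratum containing `p`. -/
def IsCriticalPoint (W : StratData n m X) (f : X → ℝ) (p : X) : Prop :=
  (∃ h : p ∈ W.singᶜ, dform (k := n) (onReg W f) ⟨p, h⟩ = 0) ∨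
    (∃ h : p ∈ W.sing, dform (k := m) (onSing W f) ⟨p, h⟩ = 0)

/-- `c` is a regular value of `f`: no critical point lies on `f⁻¹(c)`. -/
def IsRegularValue (W : StratData n m X) (f : X → ℝ) (c : ℝ) : Prop :=
  ∀ p, f p = c → ¬ IsCriticalPoint W f p

/-- The negative gradient vector field `-∇_g f`. -/
def negGrad (g : WedgeMetric W) (f : X → ℝ) : StratVF W.toStratData where
  reg x := -grad (k := n) g.reg (onReg W.toStratData f) x
  sing y := -grad (k := m) g.sing (onSing W.toStratData f) y

/-- The first weak control condition `π_* ξ (x) = ξ (π x) + ρ(x)² χ (π x)`, for a bounded field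
`χ`, on the part `0 < ρ < ε` of the tube. -/
def WeakControlProj (g : WedgeMetric W) (ξ : StratVF W.toStratData) (ε : ℝ) : Prop :=
  ∃ (χ : ∀ y : W.Sing, TangentSpace (HModel m) y) (C : ℝ),
    (∀ y, g.sing.inner y (χ y) (χ y) ≤ C) ∧
    ∀ (y₀ : W.Sing) (x : W.Reg), x.1 ∈ W.tube → W.radExt x < ε →
      W.dproj y₀ x (ξ.reg x)
        = ξ.sing (W.projExt y₀ x) + (W.radExt x) ^ 2 • χ (W.projExt y₀ x)

/-- The second weak control condition `|ρ_* ξ (x)| < A ρ(x)`, on the part `0 < ρ < ε` of the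
tube. -/
def WeakControlRad (W : StratData n m X) (ξ : StratVF W) (ε : ℝ) : Prop :=
  ∃ A : ℝ, 0 < A ∧ ∀ x : W.Reg, x.1 ∈ W.tube → W.radExt x < ε →
    |W.drad x (ξ.reg x)| < A * W.radExt x

/-- Near the point `p` of the singular stratum, `ξ` is a radial extension of its restriction to
the singular stratum: the sum of a controlled lift `η` of this restriction, of a term
`o = O(ρ²)`, and of a radial vector field `ν`, that is a controlled lift of `-c t ∂_t` along `ρ`
(with `c > 0`). -/
def IsRadialExtensionAt (g : WedgeMetric W) (ξ : StratVF W.toStratData) (p : W.Sing) : Prop :=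
  ∃ (O : Set X) (c C : ℝ) (η o ν : ∀ x : W.Reg, TangentSpace (HModel n) x),
    IsOpen O ∧ p.1 ∈ O ∧ 0 < c ∧
    ∀ (y₀ : W.Sing) (x : W.Reg), x.1 ∈ W.tube → x.1 ∈ O →
      ξ.reg x = η x + o x + ν x ∧
      W.dproj y₀ x (η x) = ξ.sing (W.projExt y₀ x) ∧ W.drad x (η x) = 0 ∧
      W.dproj y₀ x (ν x) = 0 ∧ W.drad x (ν x) = -(c * W.radExt x) ∧
      √(g.reg.inner x (o x) (o x)) ≤ C * (W.radExt x) ^ 2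

/-- `(f, g)` is a special Morse pair on the triple `(W, X₁, X₂)`, with `f : W → [a, b]`. -/
structure IsSpecialMorsePair {n' m' : ℕ} {A : Type*} {B : Type*} [TopologicalSpace A]
    [TopologicalSpace B] {X₁ : FibPM l L n' m' A} {X₂ : FibPM l L n' m' B}
    (T : Cobordism X₁.toStratData X₂.toStratData W.toStratData)
    (f : X → ℝ) (g : WedgeMetric W) (a b : ℝ) : Prop where
  smooth : IsSmoothFun W.toStratData f
  mem_Icc : ∀ x, f x ∈ Icc a b
  preimage_a : f ⁻¹' {a} = range (fun x => T.c₀.toFun (x, 0))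
  preimage_b : f ⁻¹' {b} = range (fun x => T.c₁.toFun (x, 0))
  /-- the wedge metric is of product type on some collar of each boundary component -/
  product₁ : ∃ e : Collar X₁.toStratData W.toStratData,
    (∀ x, e.toFun (x, 0) = T.c₀.toFun (x, 0)) ∧ g.IsProductOn e
  product₂ : ∃ e : Collar X₂.toStratData W.toStratData,
    (∀ x, e.toFun (x, 0) = T.c₁.toFun (x, 0)) ∧ g.IsProductOn e
  critical_interior : ∀ p, IsCriticalPoint W.toStratData f p → p ∉ W.boundary
  nondeg_reg : ∀ p : W.Reg, IsCriticalPoint W.toStratData f p.1 →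
    IsNondegCritical (k := n) (onReg W.toStratData f) p
  nondeg_sing : ∀ p : W.Sing, IsCriticalPoint W.toStratData f p.1 →
    IsNondegCritical (k := m) (onSing W.toStratData f) p ∧ IsRadialExtensionAt g (negGrad g f) p
  /-- the control conditions hold on some neighbourhood of the singular stratum -/
  control : ∃ ε : ℝ, 0 < ε ∧ WeakControlProj g (negGrad g f) ε ∧
    WeakControlRad W.toStratData (negGrad g f) ε ∧
    (∀ x : W.Reg, x.1 ∈ W.tube → W.radExt x < ε → W.drad x ((negGrad g f).reg x) ≤ 0) ∧
    ∃ O : Set X, IsOpen O ∧ W.boundary ⊆ O ∧ ∀ x : W.Reg, x.1 ∈ W.tube → W.radExt x < ε →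
      x.1 ∈ O → W.drad x ((negGrad g f).reg x) = 0

end Morse

/-! ## Spin structures -/

/-- A frame of the stabilised tangent space `T_x M ⊕ ℝ³`. -/
structure StabFrame (k : ℕ) (M : Type u) [TopologicalSpace M] [ChartedSpace (HSpace k) M] where
  pt : M
  vec : Fin (k + 3) → TangentSpace (HModel k) pt × EuclideanSpace ℝ (Fin 3)
  indep : LinearIndependent ℝ vec

section Spin

variable {k : ℕ} {M : Type u} [TopologicalSpace M] [ChartedSpace (HSpace k) M]
  [IsManifold (HModel k) ∞ M]

/-- The topology of the frame bundle, as a subspace of a power of `T M × ℝ³`. -/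
instance : TopologicalSpace (StabFrame k M) :=
  TopologicalSpace.induced
    (fun F : StabFrame k M => fun i : Fin (k + 3) =>
      ((⟨F.pt, (F.vec i).1⟩ : TangentBundle (HModel k) M), (F.vec i).2))
    inferInstance

end Spin

/-- The family of vectors `v`, rotated by the angle `θ` in the plane of `v i` and `v j`. -/
def rotate {N : ℕ} {V : Type*} [AddCommGroup V] [Module ℝ V] (v : Fin N → V) (i j : Fin N)
    (θ : ℝ) : Fin N → V :=
  Function.update (Function.update v i (Real.cos θ • v i + Real.sin θ • v j)) j
    (-Real.sin θ • v i + Real.cos θ • v j)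

/-- A spin structure on a `k`-manifold: an orientation, that is a clopen set `pos` of positive
frames of `T M ⊕ ℝ³`, and a class in `H¹(pos; ℤ/2) = Hom(π₁, ℤ/2)` whose restriction to each fibre
is non-trivial, that is: it takes the value `1` on the loops rotating a frame once in a coordinate
plane. -/
structure SpinStr (k : ℕ) (M : Type u) [TopologicalSpace M] [ChartedSpace (HSpace k) M]
    [IsManifold (HModel k) ∞ M] where
  pos : Set (StabFrame k M)
  isClopen_pos : IsClopen pos
  pos_iff : ∀ (x : M) (v v' : Fin (k + 3) → TangentSpace (HModel k) x × EuclideanSpace ℝ (Fin 3))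
    (hv : LinearIndependent ℝ v) (hv' : LinearIndependent ℝ v')
    (P : Matrix (Fin (k + 3)) (Fin (k + 3)) ℝ), (∀ i, v' i = ∑ j, P i j • v j) →
    (((⟨x, v', hv'⟩ : StabFrame k M) ∈ pos ↔ (⟨x, v, hv⟩ : StabFrame k M) ∈ pos) ↔ 0 < P.det)
  cls : ∀ {F : ↥pos}, Path F F → ZMod 2
  cls_homotopic : ∀ {F : ↥pos} (γ γ' : Path F F), γ.Homotopic γ' → cls γ = cls γ'
  cls_trans : ∀ {F : ↥pos} (γ γ' : Path F F), cls (γ.trans γ') = cls γ + cls γ'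
  cls_conj : ∀ {F F' : ↥pos} (γ : Path F F) (δ : Path F F'),
    cls ((δ.symm.trans γ).trans δ) = cls γ
  cls_rotate : ∀ (F : ↥pos) (i j : Fin (k + 3)) (γ : Path F F), i ≠ j →
    (∀ t : unitInterval, ∃ h, (γ t).1 = ⟨F.1.pt, rotate F.1.vec i j (2 * Real.pi * t), h⟩) → cls γ = 1

/-- Two spin structures correspond under the relation `R` between frames of the two manifolds
(which will stand for an embedding of codimension zero or one): frames related by `R` have the
same orientation, and loops of frames related by `R` have the same class. -/
def SpinStr.Corresponds {k k' : ℕ} {M : Type u} {N : Type v} [TopologicalSpace M]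
    [ChartedSpace (HSpace k) M] [IsManifold (HModel k) ∞ M] [TopologicalSpace N]
    [ChartedSpace (HSpace k') N] [IsManifold (HModel k') ∞ N]
    (σM : SpinStr k M) (σN : SpinStr k' N) (R : StabFrame k M → StabFrame k' N → Prop) : Prop :=
  (∀ F F', R F F' → (F ∈ σM.pos ↔ F' ∈ σN.pos)) ∧
    ∀ (F : ↥σM.pos) (F' : ↥σN.pos) (γ : Path F F) (γ' : Path F' F'),
      (∀ t, R (γ t).1 (γ' t).1) → σM.cls γ = σN.cls γ'

/-- The frame `F'` of `N` is the image of the frame `F` of `M` under `j : M → N`, a map between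
manifolds of the same dimension. -/
def FrameImage {k : ℕ} {M : Type u} {N : Type v} [TopologicalSpace M]
    [ChartedSpace (HSpace k) M] [TopologicalSpace N] [ChartedSpace (HSpace k) N]
    (j : M → N) (F : StabFrame k M) (F' : StabFrame k N) : Prop :=
  ∃ h, F' = ⟨j F.pt, fun i => (mfderiv (HModel k) (HModel k) j F.pt (F.vec i).1, (F.vec i).2), h⟩

/-- The frame `F'` of `N` consists of a transverse vector `ν` with `Pos ν`, followed by the image
of the frame `F` of `M` under `j : M → N`, an immersion of codimension one. -/
def FrameExtension {k k' : ℕ} {M : Type u} {N : Type v} [TopologicalSpace M]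
    [ChartedSpace (HSpace k) M] [TopologicalSpace N] [ChartedSpace (HSpace k') N]
    (j : M → N) (Pos : ∀ a : M, TangentSpace (HModel k') (j a) → Prop)
    (F : StabFrame k M) (F' : StabFrame k' N) : Prop :=
  ∃ (ν : TangentSpace (HModel k') (j F.pt))
    (v : Fin (k' + 3) → TangentSpace (HModel k') (j F.pt) × EuclideanSpace ℝ (Fin 3))
    (h : LinearIndependent ℝ v), F' = ⟨j F.pt, v, h⟩ ∧ Pos F.pt ν ∧
    (∀ i, i.val = 0 → v i = (ν, 0)) ∧
    ∀ (i : Fin (k' + 3)) (i' : Fin (k + 3)), i.val = i'.val + 1 →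
      v i = (mfderiv (HModel k) (HModel k') j F.pt (F.vec i').1, (F.vec i').2)

/-- A spin structure on a stratified space: one on each stratum. -/
structure SpinPM {n m : ℕ} {X : Type u} [TopologicalSpace X] (W : StratData n m X) where
  reg : SpinStr n W.Reg
  sing : SpinStr m W.Sing

namespace SpinPM

variable {n m n' m' : ℕ} {A : Type u} {X : Type v} [TopologicalSpace A] [TopologicalSpace X]

/-- `σM` is the restriction of `σ` along an immersion `j` of codimension zero. -/
def IsRestriction {M : StratData n m A} {W : StratData n m X} (σM : SpinPM M) (σ : SpinPM W)
    (j : StratMap M W) : Prop :=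
  σM.reg.Corresponds σ.reg (FrameImage j.reg) ∧ σM.sing.Corresponds σ.sing (FrameImage j.sing)

/-- `σM` is induced by `σ` on a codimension one subspace, included by `j` in a level set of `f`,
and cooriented by the direction in which `f` increases. -/
def IsInducedOnLevel {M : StratData n' m' A} {W : StratData n m X} (σM : SpinPM M)
    (σ : SpinPM W) (j : StratMap M W) (f : X → ℝ) : Prop :=
  σM.reg.Corresponds σ.reg
      (FrameExtension j.reg (fun a ν => 0 < dform (k := n) (onReg W f) (j.reg a) ν)) ∧
    σM.sing.Corresponds σ.sing
      (FrameExtension j.sing (fun a ν => 0 < dform (k := m) (onSing W f) (j.sing a) ν))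

/-- `σM` is induced by `σ` on the boundary component with collar `e`, cooriented by the inward
pointing vectors (`sgn = 1`) or by the outward pointing vectors (`sgn = -1`). -/
def IsInducedOnBoundary {M : StratData n' m' A} {W : StratData n m X} (σM : SpinPM M)
    (σ : SpinPM W) (e : Collar M W) (sgn : ℝ) : Prop :=
  σM.reg.Corresponds σ.reg
      (FrameExtension (fun a => e.reg (a, 0))
        (fun a ν => ∃ v s, 0 < sgn * dtI 0 s ∧ ν = e.dreg (a, 0) v s)) ∧
    σM.sing.Corresponds σ.sing
      (FrameExtension (fun a => e.sing (a, 0))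
        (fun a ν => ∃ v s, 0 < sgn * dtI 0 s ∧ ν = e.dsing (a, 0) v s))

end SpinPM

/-- `(W, σ)` is a spin bordism from `(M₀, σ₀)` to `(M₁, σ₁)`: `σ` induces `σ₁` on `M₁`, cooriented
by the outward normal, and `σ₀` on `M₀`, cooriented by the inward normal, so that the oriented
boundary of `W` is `M₁ ⊔ -M₀`. -/
def Cobordism.IsSpin {n m n' m' : ℕ} {A : Type u} {B : Type v} {X : Type w}
    [TopologicalSpace A] [TopologicalSpace B] [TopologicalSpace X]
    {M₀ : StratData n' m' A} {M₁ : StratData n' m' B} {W : StratData n m X}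
    (T : Cobordism M₀ M₁ W) (σ₀ : SpinPM M₀) (σ₁ : SpinPM M₁) (σ : SpinPM W) : Prop :=
  σ₀.IsInducedOnBoundary σ T.c₀ 1 ∧ σ₁.IsInducedOnBoundary σ T.c₁ (-1)

end FibSing

end

/-!
The difficulty is that `f` is not constant on the fibres of the retraction `π`, so a level set is
not saturated and `π` cannot simply be restricted to it. It is corrected by a flow.

Near a regular value `c` the wedge metric and the weak control of `-∇f` give a field on the regular
stratum that lifts a field on `Y`, preserves `ρ` near `Y` and increases `f` along `f = c`
(`exists_lift_increasing`, `exists_levelFields`). Its stratified flow `Φ` (`exists_levelFlow`) meets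
the level once on each flow line; let `u` be the difference of the times at which `x` and `π x`
cross it (`LevelFlow.lag`). As `Φ` commutes with `π`, `u` is `Φ`-invariant, and it tends to `0` at
`Y`. The map `Θ` that slides `x` along its flow line by `u` therefore makes `π ∘ Θ` a retraction onto
`f⁻¹(c) ∩ Y`, and with `ρ / (1 - κρ)` it forms control data: this function still runs through
`[0, ∞)` on the smaller tube `κρ < 1`. `Retube` is the general form of this change of control data,
`Retube.fibPM` the resulting structure on a subspace whose strata are slices (`SubStructure`).

On a slab, `Θ` must agree with the correction near each end and with the identity away from it. The
sliding is interpolated by the flow of a bump field on the line (`TimeChange`), while `κ` grows to a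
constant so large that the tube is thin in the middle (`Taper`, glued in `Taper.slabRetube`). A level
that is a part of `∂W` uses the given collar instead of a flow, with `Θ = id` (`boundaryTaper`,
`Collar.exists_level`). The control data of the level never depend on that constant, hence not on
the opposite end: `IsLevelEnd` asks for ends with all large constants (`exists_level`, `exists_slab`).

The spin structures are pulled back along the derivatives of the inclusions, completed by a vector
transverse to the level (`IsFrameMap`, `SpinStr.pullback`). They match on the collars as transverse
vectors form a convex set and pullbacks are invariant under homotopy, and because a nonnegative
function vanishing on the base of a collar increases inwards (`SpinStr.corresponds_boundary`).
-/

noncomputable section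

namespace FibSing

universe u v w

/-- The Euclidean space of dimension `k`. -/
local notation:max "𝔼" k:max => EuclideanSpace ℝ (Fin k)

/-- The strata and the control data underlying a pseudomanifold with fibered singularities. -/
local postfix:max "♭" => FibPM.toStratData

/-! ### Smooth local flows in Banach spaces -/

section ODE

open Metric

variable {K : Type*} [TopologicalSpace K] [CompactSpace K]

/-- The superposition operator `γ ↦ V ∘ γ` on spaces of continuous maps. -/
def superpose (K : Type*) [TopologicalSpace K] {E F : Type u} [NormedAddCommGroup E]
    [NormedAddCommGroup F] (V : E → F) (hV : Continuous V) (γ : C(K, E)) : C(K, F) :=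
  (⟨V, hV⟩ : C(E, F)).comp γ

/-- A bounded bilinear map, applied pointwise to continuous maps. -/
def pointwiseCLM (K : Type*) [TopologicalSpace K] [CompactSpace K] {E F G : Type*}
    [NormedAddCommGroup E] [NormedSpace ℝ E] [NormedAddCommGroup F] [NormedSpace ℝ F]
    [NormedAddCommGroup G] [NormedSpace ℝ G] (b : G →L[ℝ] E →L[ℝ] F) :
    C(K, G) →L[ℝ] (C(K, E) →L[ℝ] C(K, F)) :=
  LinearMap.mkContinuous₂
    (LinearMap.mk₂ ℝ
      (fun (A : C(K, G)) (h : C(K, E)) => (⟨fun t => b (A t) (h t), by fun_prop⟩ : C(K, F)))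
      (fun A A' h => by ext t; simp) (fun c A h => by ext t; simp)
      (fun A h h' => by ext t; simp) (fun c A h => by ext t; simp)) ‖b‖
    (fun A h => by
      refine (ContinuousMap.norm_le _ (by positivity)).2 fun t => ?_
      refine (b.le_opNorm₂ (A t) (h t)).trans ?_
      gcongr
      · exact A.norm_coe_le_norm t
      · exact h.norm_coe_le_norm t)

/-- Pointwise application of a continuous family of linear maps. -/
def applyCLM (K : Type*) [TopologicalSpace K] [CompactSpace K] (E F : Type u)
    [NormedAddCommGroup E] [NormedSpace ℝ E] [NormedAddCommGroup F] [NormedSpace ℝ F] :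
    C(K, E →L[ℝ] F) →L[ℝ] (C(K, E) →L[ℝ] C(K, F)) :=
  pointwiseCLM K (ContinuousLinearMap.id ℝ (E →L[ℝ] F))

set_option synthInstance.maxHeartbeats 200000 in
/-- The derivative at `γ` is pointwise: the remainder is uniform along the compact image of `γ`. -/
theorem hasFDerivAt_superpose {E F : Type u} [NormedAddCommGroup E] [NormedSpace ℝ E]
    [NormedAddCommGroup F] [NormedSpace ℝ F] {V : E → F} {V' : E → E →L[ℝ] F}
    (hV : Continuous V) (hV' : Continuous V') (h : ∀ x, HasFDerivAt V (V' x) x) (γ : C(K, E)) :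
    HasFDerivAt (superpose K V hV) (applyCLM K E F (superpose K V' hV' γ)) γ := by
  refine HasFDerivAt.of_isLittleO (Asymptotics.isLittleO_iff.2 fun c hc => ?_)
  have hcomp : IsCompact (range γ) := isCompact_range γ.continuous
  have hu := hcomp.uniformContinuousAt_of_continuousAt V'
    (fun x _ => hV'.continuousAt) (dist_mem_uniformity hc)
  obtain ⟨δ, hδ, hu⟩ := mem_uniformity_dist.1 hu
  filter_upwards [ball_mem_nhds γ hδ] with γ' hγ'
  refine (ContinuousMap.norm_le _ (by positivity)).2 fun t => ?_
  have hd : dist (γ' t) (γ t) < δ := lt_of_le_of_lt (ContinuousMap.dist_apply_le_dist t) hγ'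
  have key := (convex_ball (γ t) δ).norm_image_sub_le_of_norm_hasFDerivWithin_le (𝕜 := ℝ)
    (f := fun y => V y - V' (γ t) y) (f' := fun y => V' y - V' (γ t)) (C := c)
    (x := γ t) (y := γ' t)
    (fun y _ => ((h y).sub (V' (γ t)).hasFDerivAt).hasFDerivWithinAt)
    (fun y hy => by
      have := hu (show dist (γ t) y < δ by rw [dist_comm]; exact hy) (mem_range_self t)
      have h2 : dist (V' (γ t)) (V' y) < c := this
      rw [dist_comm, dist_eq_norm] at h2
      exact h2.le) (mem_ball_self hδ) hd
  calc ‖(superpose K V hV γ' - superpose K V hV γ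
        - applyCLM K E F (superpose K V' hV' γ) (γ' - γ)) t‖
      = ‖(V (γ' t) - V' (γ t) (γ' t)) - (V (γ t) - V' (γ t) (γ t))‖ := by
        congr 1
        change V (γ' t) - V (γ t) - V' (γ t) (γ' t - γ t) = _
        rw [map_sub]; abel
    _ ≤ c * ‖γ' t - γ t‖ := key
    _ ≤ c * ‖γ' - γ‖ := by
        gcongr
        exact (γ' - γ).norm_coe_le_norm t

set_option synthInstance.maxHeartbeats 200000 in
theorem contDiff_superpose {E F : Type u} [NormedAddCommGroup E] [NormedSpace ℝ E]
    [NormedAddCommGroup F] [NormedSpace ℝ F] {V : E → F} (hV : ContDiff ℝ ∞ V) :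
    ContDiff ℝ ∞ (superpose K V hV.continuous) := by
  have main : ∀ (n : ℕ) (F : Type u) [NormedAddCommGroup F] [NormedSpace ℝ F] (V : E → F)
      (hV : ContDiff ℝ ∞ V), ContDiff ℝ n (superpose K V hV.continuous) := by
    intro n
    induction n with
    | zero =>
      intro F _ _ V hV
      exact contDiff_zero.2 (ContinuousMap.continuous_postcomp _)
    | succ n ih =>
      intro F _ _ V hV
      have h1 : ContDiff ℝ ∞ (fderiv ℝ V) := (contDiff_infty_iff_fderiv.1 hV).2
      refine contDiff_succ_iff_hasFDerivAt.2
        ⟨fun γ => applyCLM K E F (superpose K (fderiv ℝ V) h1.continuous γ), ?_, fun γ => ?_⟩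
      · exact (applyCLM K E F).contDiff.comp (ih _ _ h1)
      · exact hasFDerivAt_superpose hV.continuous h1.continuous
          (fun x => ((contDiff_infty_iff_fderiv.1 hV).1 x).hasFDerivAt) γ
  exact contDiff_infty.2 fun n => main n F V hV

variable {E : Type u} [NormedAddCommGroup E] [NormedSpace ℝ E]

/-- Integration from the left end point, as an operator on `C([0,1], E)`. -/
def primitiveCLM (E : Type u) [NormedAddCommGroup E] [NormedSpace ℝ E] :
    C(unitInterval, E) →L[ℝ] C(unitInterval, E) :=
  LinearMap.mkContinuous
    { toFun := fun γ => ⟨fun t => ∫ s in (0 : ℝ)..t, IccExtend zero_le_one γ s, by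
          have : Continuous fun t : ℝ => ∫ s in (0 : ℝ)..t, IccExtend zero_le_one γ s :=
            intervalIntegral.continuous_primitive
              (fun a b => (γ.continuous.Icc_extend' (h := zero_le_one)).intervalIntegrable a b) 0
          exact this.comp continuous_subtype_val⟩
      map_add' := fun γ γ' => by
        ext t
        exact intervalIntegral.integral_add
          ((γ.continuous.Icc_extend' (h := zero_le_one)).intervalIntegrable _ _)
          ((γ'.continuous.Icc_extend' (h := zero_le_one)).intervalIntegrable _ _)
      map_smul' := fun c γ => by
        ext t
        exact intervalIntegral.integral_smul c _ } 1
    (fun γ => by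
      refine (ContinuousMap.norm_le _ (by positivity)).2 fun t => ?_
      have := intervalIntegral.norm_integral_le_of_norm_le_const (a := (0 : ℝ)) (b := t)
        (C := ‖γ‖) (f := IccExtend zero_le_one γ)
        (fun s _ => γ.norm_coe_le_norm _)
      refine this.trans ?_
      rw [sub_zero, abs_of_nonneg t.2.1, one_mul]
      exact mul_le_of_le_one_right (norm_nonneg _) t.2.2)

/-- The curve on `[0, t]`, rescaled to `[0, 1]`, solves `γ = x + t ∫ V(γ)` in `C([0, 1], E)`; at `t = 0`
the inverse function theorem gives a solution that depends smoothly on `(x, t)`. -/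
theorem exists_smooth_local_flow_of_contDiff [CompleteSpace E] {V : E → E}
    (hV : ContDiff ℝ ∞ V) (x₀ : E) :
    ∃ ε > 0, ∃ φ : ℝ × E → E,
      ContDiffOn ℝ ∞ φ (Ioo (-ε) ε ×ˢ ball x₀ ε) ∧
      ∀ x ∈ ball x₀ ε, φ (0, x) = x ∧
        ∀ t ∈ Ioo (-ε) ε, HasDerivAt (fun s => φ (s, x)) (V (φ (t, x))) t := by
  let C := C(unitInterval, E)
  let N : C → C := superpose unitInterval V hV.continuous
  have hN : ContDiff ℝ ∞ N := contDiff_superpose hV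
  let cst : E →L[ℝ] C := (ContinuousLinearMap.const ℝ unitInterval : E →L[ℝ] C)
  let G : (E × ℝ) × C → (E × ℝ) × C :=
    fun q => (q.1, q.2 - cst q.1.1 - q.1.2 • primitiveCLM E (N q.2))
  have hG : ContDiff ℝ ∞ G := by
    refine contDiff_fst.prodMk ((contDiff_snd.sub ?_).sub ?_)
    · exact cst.contDiff.comp (contDiff_fst.comp contDiff_fst)
    · exact (contDiff_snd.comp contDiff_fst).smul
        ((primitiveCLM E).contDiff.comp (hN.comp contDiff_snd))
  let q₀ : (E × ℝ) × C := ((x₀, 0), cst x₀)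
  let Lp : E × ℝ →L[ℝ] C := cst.comp (ContinuousLinearMap.fst ℝ E ℝ)
    + (ContinuousLinearMap.snd ℝ E ℝ).smulRight (primitiveCLM E (N (cst x₀)))
  let A : ((E × ℝ) × C) ≃L[ℝ] ((E × ℝ) × C) :=
    ContinuousLinearEquiv.equivOfInverse
      ((ContinuousLinearMap.fst ℝ (E × ℝ) C).prod
        (ContinuousLinearMap.snd ℝ (E × ℝ) C - Lp.comp (ContinuousLinearMap.fst ℝ (E × ℝ) C)))
      ((ContinuousLinearMap.fst ℝ (E × ℝ) C).prod
        (ContinuousLinearMap.snd ℝ (E × ℝ) C + Lp.comp (ContinuousLinearMap.fst ℝ (E × ℝ) C)))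
      (fun q => by ext <;> simp) (fun q => by ext <;> simp)
  have hA : HasFDerivAt G (A : ((E × ℝ) × C) →L[ℝ] ((E × ℝ) × C)) q₀ := by
    have h1 : HasFDerivAt (fun q : (E × ℝ) × C => q.1) (ContinuousLinearMap.fst ℝ (E × ℝ) C) q₀ :=
      hasFDerivAt_fst
    have h2 : HasFDerivAt (fun q : (E × ℝ) × C => q.2) (ContinuousLinearMap.snd ℝ (E × ℝ) C) q₀ :=
      hasFDerivAt_snd
    have h3 : HasFDerivAt (fun q : (E × ℝ) × C => cst q.1.1)
        (cst.comp ((ContinuousLinearMap.fst ℝ E ℝ).comp (ContinuousLinearMap.fst ℝ (E × ℝ) C))) q₀ :=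
      cst.hasFDerivAt.comp q₀ (hasFDerivAt_fst.comp q₀ h1)
    have h4 : HasFDerivAt (fun q : (E × ℝ) × C => primitiveCLM E (N q.2))
        (((primitiveCLM E).comp (fderiv ℝ N (cst x₀))).comp
          (ContinuousLinearMap.snd ℝ (E × ℝ) C)) q₀ :=
      HasFDerivAt.comp (f := fun q : (E × ℝ) × C => q.2)
        (g := fun γ : C => primitiveCLM E (N γ)) q₀
        ((primitiveCLM E).hasFDerivAt.comp (cst x₀)
        (hN.contDiffAt.differentiableAt (by simp)).hasFDerivAt) h2
    have h5 : HasFDerivAt (fun q : (E × ℝ) × C => q.1.2)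
        ((ContinuousLinearMap.snd ℝ E ℝ).comp (ContinuousLinearMap.fst ℝ (E × ℝ) C)) q₀ :=
      hasFDerivAt_snd.comp q₀ h1
    have h6 := h1.prodMk ((h2.sub h3).sub (h5.smul h4))
    refine h6.congr_fderiv ?_
    refine ContinuousLinearMap.ext fun q => ?_
    refine Prod.ext rfl ?_
    change q.2 - cst q.1.1 - ((0 : ℝ) • _ + q.1.2 • primitiveCLM E (N (cst x₀)))
      = q.2 - (cst q.1.1 + q.1.2 • primitiveCLM E (N (cst x₀)))
    rw [zero_smul, zero_add, sub_sub]
  let e := hG.contDiffAt.toOpenPartialHomeomorph G hA (by simp)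
  have heG : ∀ q, e q = G q := fun q => rfl
  have hq₀ : q₀ ∈ e.source := hG.contDiffAt.mem_toOpenPartialHomeomorph_source hA (by simp)
  have hGq₀ : G q₀ = ((x₀, 0), 0) := by
    refine Prod.ext rfl ?_
    change cst x₀ - cst x₀ - (0 : ℝ) • _ = 0
    rw [zero_smul, sub_self, sub_zero]
  -- points at which the derivative of `G` is invertible
  have hinv : ∀ᶠ q in 𝓝 q₀, ∃ B : ((E × ℝ) × C) ≃L[ℝ] ((E × ℝ) × C),
      (B : ((E × ℝ) × C) →L[ℝ] ((E × ℝ) × C)) = fderiv ℝ G q := by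
    have hc : ContinuousAt (fderiv ℝ G) q₀ :=
      ((contDiff_infty_iff_fderiv.1 hG).2.continuous).continuousAt
    have h1 := ContinuousLinearEquiv.nhds A
    rw [← hA.fderiv] at h1
    exact hc.eventually h1
  obtain ⟨O, hO, hOo, hqO⟩ := _root_.eventually_nhds_iff.1 (hinv.and (e.open_source.mem_nhds hq₀))
  obtain ⟨r, hr, hrO⟩ := isOpen_iff.1 hOo q₀ hqO
  have hsymm₀ : e.symm ((x₀, 0), 0) = q₀ := by
    rw [← hGq₀, ← heG, e.left_inv hq₀]
  have hT : ((x₀, (0 : ℝ)), (0 : C)) ∈ e.target := by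
    rw [← hGq₀, ← heG]; exact e.map_source hq₀
  have hnear : ∀ᶠ q in 𝓝 (((x₀, (0 : ℝ)), (0 : C))), q ∈ e.target ∧ e.symm q ∈ ball q₀ r := by
    refine Filter.Eventually.and (e.open_target.mem_nhds hT)
      ((e.continuousAt_symm hT).eventually ?_)
    rw [hsymm₀]; exact ball_mem_nhds _ hr
  obtain ⟨ε₁, hε₁, hε⟩ := eventually_nhds_iff_ball.1 hnear
  let ε := min ε₁ r
  have hε0 : 0 < ε := lt_min hε₁ hr
  have hin : ∀ s ∈ Ioo (-ε) ε, ∀ x ∈ ball x₀ ε,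
      ((x, s), (0 : C)) ∈ ball ((x₀, (0 : ℝ)), (0 : C)) ε₁ := by
    intro s hs x hx
    have h1 : dist x x₀ < ε₁ := lt_of_lt_of_le hx (min_le_left _ _)
    have h2 : dist s 0 < ε₁ := by
      rw [Real.dist_eq, sub_zero]
      exact lt_of_lt_of_le (abs_lt.2 hs) (min_le_left _ _)
    simp only [mem_ball, Prod.dist_eq, dist_self]
    exact max_lt (max_lt h1 h2) hε₁
  let sol : ℝ → E → C := fun s x => (e.symm ((x, s), 0)).2
  have hsol : ∀ s ∈ Ioo (-ε) ε, ∀ x ∈ ball x₀ ε,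
      e.symm ((x, s), 0) = ((x, s), sol s x) ∧
      sol s x = cst x + s • primitiveCLM E (N (sol s x)) ∧
      dist (sol s x) (cst x₀) < r := by
    intro s hs x hx
    obtain ⟨ht, hb⟩ := hε _ (hin s hs x hx)
    have h1 : G (e.symm ((x, s), 0)) = ((x, s), 0) := e.right_inv ht
    have h2 : (e.symm ((x, s), 0)).1 = (x, s) := congrArg Prod.fst h1
    have h3 : e.symm ((x, s), 0) = ((x, s), sol s x) := Prod.ext h2 rfl
    refine ⟨h3, ?_, ?_⟩
    · rw [h3] at h1
      have h4 : sol s x - cst x - s • primitiveCLM E (N (sol s x)) = 0 := congrArg Prod.snd h1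
      rw [sub_sub, sub_eq_zero] at h4
      exact h4
    · rw [h3] at hb
      simp only [mem_ball, Prod.dist_eq, q₀] at hb
      exact lt_of_le_of_lt (le_max_right _ _) hb
  have huniq : ∀ s ∈ Ioo (-ε) ε, ∀ x ∈ ball x₀ ε, ∀ γ : C, dist γ (cst x₀) < r →
      γ = cst x + s • primitiveCLM E (N γ) → sol s x = γ := by
    intro s hs x hx γ hγ hγ'
    have hmem : ((x, s), γ) ∈ ball q₀ r := by
      have h1 : dist x x₀ < r := lt_of_lt_of_le hx (min_le_right _ _)
      have h2 : dist s 0 < r := by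
        rw [Real.dist_eq, sub_zero]
        exact lt_of_lt_of_le (abs_lt.2 hs) (min_le_right _ _)
      simp only [mem_ball, Prod.dist_eq, q₀]
      exact max_lt (max_lt h1 h2) hγ
    have hsrc : ((x, s), γ) ∈ e.source := (hO _ (hrO hmem)).2
    have h1 : e ((x, s), γ) = ((x, s), 0) := by
      rw [heG]
      refine Prod.ext rfl ?_
      change γ - cst x - s • primitiveCLM E (N γ) = 0
      rw [sub_sub, sub_eq_zero]; exact hγ'
    have h2 := e.left_inv hsrc
    rw [h1, (hsol s hs x hx).1] at h2
    exact congrArg Prod.snd h2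
  -- rescaling time
  have hscale : ∀ s ∈ Ioo (-ε) ε, ∀ x ∈ ball x₀ ε, ∀ τ : unitInterval,
      sol (τ * s) x 1 = sol s x τ := by
    intro s hs x hx τ
    let γ : C := (sol s x).comp ⟨fun t => τ * t, by fun_prop⟩
    have hτs : (τ : ℝ) * s ∈ Ioo (-ε) ε := by
      have : |(τ : ℝ) * s| < ε := by
        rw [abs_mul, abs_of_nonneg τ.2.1]
        exact lt_of_le_of_lt (mul_le_of_le_one_left (abs_nonneg _) τ.2.2) (abs_lt.2 hs)
      exact abs_lt.1 this
    have hγ : sol (τ * s) x = γ := by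
      refine huniq _ hτs x hx γ ?_ ?_
      · refine lt_of_le_of_lt ?_ (hsol s hs x hx).2.2
        exact (ContinuousMap.dist_le dist_nonneg).2 fun t =>
          ContinuousMap.dist_apply_le_dist (f := sol s x) (g := cst x₀) (τ * t)
      · ext t
        have h1 := congrArg (fun c : C => c (τ * t)) (hsol s hs x hx).2.1
        change sol s x (τ * t) = x + s • ∫ r in (0 : ℝ)..(((τ * t : unitInterval) : ℝ)),
          IccExtend zero_le_one (N (sol s x)) r at h1
        change sol s x (τ * t) = x + ((τ : ℝ) * s) • ∫ r in (0 : ℝ)..t,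
          IccExtend zero_le_one (N γ) r
        rw [h1]
        congr 1
        rw [mul_comm (τ : ℝ) s, mul_smul]
        congr 1
        have h2 : ((τ * t : unitInterval) : ℝ) = τ * t := rfl
        have h3 := intervalIntegral.smul_integral_comp_mul_left (a := (0 : ℝ)) (b := t)
          (IccExtend zero_le_one (N (sol s x))) (τ : ℝ)
        rw [mul_zero] at h3
        rw [h2, ← h3]
        congr 1
        refine intervalIntegral.integral_congr fun r hr => ?_
        rw [uIcc_of_le t.2.1] at hr
        have hr1 : r ∈ Icc (0 : ℝ) 1 := ⟨hr.1, hr.2.trans t.2.2⟩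
        have hr2 : (τ : ℝ) * r ∈ Icc (0 : ℝ) 1 := unitInterval.mul_mem τ.2 hr1
        change IccExtend zero_le_one (N (sol s x)) (τ * r) = IccExtend zero_le_one (N γ) r
        rw [IccExtend_of_mem _ _ hr2, IccExtend_of_mem _ _ hr1]
        rfl
    rw [hγ]
    change sol s x (τ * 1) = _
    rw [mul_one]
  let φ : ℝ × E → E := fun p => sol p.1 p.2 1
  have hφsmooth : ContDiffOn ℝ ∞ φ (Ioo (-ε) ε ×ˢ ball x₀ ε) := by
    rintro ⟨s, x⟩ ⟨hs, hx⟩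
    refine ContDiffAt.contDiffWithinAt ?_
    obtain ⟨ht, hb⟩ := hε _ (hin s hs x hx)
    obtain ⟨B, hB⟩ := (hO _ (hrO hb)).1
    have h1 : ContDiffAt ℝ ∞ e.symm ((x, s), 0) := by
      refine e.contDiffAt_symm (f₀' := B) ht ?_ hG.contDiffAt
      rw [hB]
      exact (hG.contDiffAt.differentiableAt (by simp)).hasFDerivAt
    have h2 : ContDiffAt ℝ ∞ (fun p : ℝ × E => e.symm ((p.2, p.1), (0 : C))) (s, x) := by
      refine h1.comp (s, x) (f := fun p : ℝ × E => ((p.2, p.1), (0 : C))) ?_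
      fun_prop
    exact (ContinuousMap.evalCLM ℝ (1 : unitInterval) : C →L[ℝ] E).contDiff.contDiffAt.comp (s, x)
      (contDiffAt_snd.comp (s, x) h2)
  have hφint : ∀ s ∈ Ioo (-ε) ε, ∀ x ∈ ball x₀ ε,
      φ (s, x) = x + ∫ r in (0 : ℝ)..s, V (φ (r, x)) := by
    intro s hs x hx
    have h1 := congrArg (fun c : C => c 1) (hsol s hs x hx).2.1
    change sol s x 1 = x + s • ∫ r in (0 : ℝ)..1, IccExtend zero_le_one (N (sol s x)) r at h1
    change sol s x 1 = _
    rw [h1]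
    congr 1
    have h3 := intervalIntegral.smul_integral_comp_mul_left (a := (0 : ℝ)) (b := 1)
      (fun r => V (φ (r, x))) s
    rw [mul_zero, mul_one] at h3
    rw [← h3]
    congr 1
    refine intervalIntegral.integral_congr fun r hr => ?_
    rw [uIcc_of_le zero_le_one] at hr
    change IccExtend zero_le_one (N (sol s x)) r = V (sol (s * r) x 1)
    rw [IccExtend_of_mem _ _ hr, mul_comm, hscale s hs x hx ⟨r, hr⟩]
    rfl
  refine ⟨ε, hε0, φ, hφsmooth, fun x hx => ⟨?_, fun t ht => ?_⟩⟩
  · rw [hφint 0 ⟨by linarith, hε0⟩ x hx, intervalIntegral.integral_same, add_zero]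
  · have hcont : ContinuousOn (fun r => V (φ (r, x))) (Ioo (-ε) ε) := by
      refine hV.continuous.comp_continuousOn (hφsmooth.continuousOn.comp (by fun_prop) ?_)
      intro r hr
      exact ⟨hr, hx⟩
    have hsub : ∀ s ∈ Ioo (-ε) ε, uIcc 0 s ⊆ Ioo (-ε) ε := fun s hs =>
      (convex_Ioo (-ε) ε).ordConnected.uIcc_subset ⟨by linarith, hε0⟩ hs
    have hd : HasDerivAt (fun s => x + ∫ r in (0 : ℝ)..s, V (φ (r, x))) (V (φ (t, x))) t := by
      refine HasDerivAt.const_add _ (intervalIntegral.integral_hasDerivAt_right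
        ((hcont.mono (hsub t ht)).intervalIntegrable) ?_
        (hcont.continuousAt (Ioo_mem_nhds ht.1 ht.2)))
      exact hcont.stronglyMeasurableAtFilter isOpen_Ioo t ht
    refine hd.congr_of_eventuallyEq ?_
    filter_upwards [Ioo_mem_nhds ht.1 ht.2] with s hs
    exact hφint s hs x hx

end ODE

/-! ### Complete smooth flows on manifolds -/

section Flow

open Metric

variable {E : Type u} [NormedAddCommGroup E] [NormedSpace ℝ E]
  {H : Type v} [TopologicalSpace H] {I : ModelWithCorners ℝ E H}
  {M : Type w} [TopologicalSpace M] [ChartedSpace H M] [IsManifold I ∞ M]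

/-- A smooth vector field. -/
def IsSmoothVF (I : ModelWithCorners ℝ E H) {M : Type w} [TopologicalSpace M] [ChartedSpace H M]
    [IsManifold I ∞ M] (V : ∀ x : M, TangentSpace I x) : Prop :=
  ContMDiff I I.tangent ∞ (fun x => (⟨x, V x⟩ : TangentBundle I M))

theorem exists_contDiff_eq_near [FiniteDimensional ℝ E] {F : Type*} [NormedAddCommGroup F]
    [NormedSpace ℝ F] {v : E → F} {O : Set E} (hO : IsOpen O) (hv : ContDiffOn ℝ ∞ v O) {x₀ : E}
    (hx₀ : x₀ ∈ O) : ∃ v' : E → F, ContDiff ℝ ∞ v' ∧ v' =ᶠ[𝓝 x₀] v := by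
  obtain ⟨r, hr, hrO⟩ := isOpen_iff.1 hO x₀ hx₀
  let χ : ContDiffBump x₀ := ⟨r / 4, r / 2, by positivity, by linarith⟩
  refine ⟨fun y => χ y • v y, contDiff_iff_contDiffAt.2 fun y => ?_, ?_⟩
  · by_cases hy : y ∈ O
    · exact χ.contDiff.contDiffAt.smul (hv.contDiffAt (hO.mem_nhds hy))
    · have hy' : y ∈ (closedBall x₀ (r / 2))ᶜ := fun h => hy (hrO
        (closedBall_subset_ball (by linarith) h))
      refine (contDiffAt_const (c := (0 : F))).congr_of_eventuallyEq ?_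
      filter_upwards [isClosed_closedBall.isOpen_compl.mem_nhds hy'] with z hz
      have : χ z = 0 := χ.zero_of_le_dist (le_of_lt (not_le.1 hz))
      rw [this, zero_smul]
  · filter_upwards [χ.eventuallyEq_one] with y hy
    rw [hy]; exact one_smul _ _

/-- At an interior point a smooth vector field has a smooth local flow. -/
theorem exists_local_flow_interior [FiniteDimensional ℝ E] {V : ∀ x : M, TangentSpace I x}
    (hV : IsSmoothVF I V) {x₀ : M} (hx₀ : I.IsInteriorPoint x₀) :
    ∃ ε > 0, ∃ U ∈ 𝓝 x₀, ∃ φ : ℝ × M → M,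
      ContMDiffOn (𝓘(ℝ, ℝ).prod I) I ∞ φ (Ioo (-ε) ε ×ˢ U) ∧
      ∀ x ∈ U, φ (0, x) = x ∧ IsMIntegralCurveOn (fun t => φ (t, x)) V (Ioo (-ε) ε) := by
  have : IsManifold I 1 M := IsManifold.of_le (n := ∞) (by exact_mod_cast le_top)
  let e := trivializationAt E (TangentSpace I) x₀
  let c := extChartAt I x₀
  let v : E → E := fun y => (e ⟨c.symm y, V (c.symm y)⟩).2
  have hsrc : e.baseSet = (chartAt H x₀).source := rfl
  have hc : c.source = (chartAt H x₀).source := extChartAt_source I x₀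
  have hv : ContDiffOn ℝ ∞ v (interior c.target) := by
    rw [← contMDiffOn_iff_contDiffOn]
    have h1 : ContMDiffOn I 𝓘(ℝ, E) ∞ (fun x => (e ⟨x, V x⟩).2) (chartAt H x₀).source :=
      (e.contMDiffOn_section_iff (chartAt H x₀).open_source hsrc.ge).1 hV.contMDiffOn
    refine h1.comp ((contMDiffOn_extChartAt_symm x₀).mono interior_subset) fun y hy => ?_
    rw [mem_preimage, ← hc]
    exact c.map_target (interior_subset hy)
  have hint : c x₀ ∈ interior c.target := I.isInteriorPoint_iff.1 hx₀
  obtain ⟨v', hv', hvv'⟩ := exists_contDiff_eq_near isOpen_interior hv hint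
  have : CompleteSpace E := FiniteDimensional.complete ℝ E
  obtain ⟨ε, hε, φ, hφ, hφ'⟩ := exists_smooth_local_flow_of_contDiff hv' (c x₀)
  -- shrink so that the flow stays where `v' = v`
  have hmem : ((0 : ℝ), c x₀) ∈ Ioo (-ε) ε ×ˢ ball (c x₀) ε :=
    ⟨⟨by linarith, hε⟩, mem_ball_self hε⟩
  have hopen : IsOpen (Ioo (-ε) ε ×ˢ ball (c x₀) ε) := isOpen_Ioo.prod isOpen_ball
  have hcont : ContinuousAt φ (0, c x₀) := hφ.continuousOn.continuousAt (hopen.mem_nhds hmem)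
  have hφ0 : φ (0, c x₀) = c x₀ := (hφ' _ (mem_ball_self hε)).1
  have hev : ∀ᶠ p in 𝓝 ((0 : ℝ), c x₀), φ p ∈ interior c.target ∧ v' (φ p) = v (φ p) := by
    refine hcont.eventually (p := fun y => y ∈ interior c.target ∧ v' y = v y) ?_
    rw [hφ0]
    exact Filter.Eventually.and (isOpen_interior.mem_nhds hint) hvv'
  obtain ⟨δ, hδ, hδ'⟩ := eventually_nhds_iff_ball.1 hev
  let η := min δ ε
  have hη : 0 < η := lt_min hδ hε
  have hin : ∀ t ∈ Ioo (-η) η, ∀ y ∈ ball (c x₀) η,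
      φ (t, y) ∈ interior c.target ∧ v' (φ (t, y)) = v (φ (t, y)) := by
    intro t ht y hy
    refine hδ' _ ?_
    have h1 : dist t 0 < δ := by
      rw [Real.dist_eq, sub_zero]; exact lt_of_lt_of_le (abs_lt.2 ht) (min_le_left _ _)
    have h2 : dist y (c x₀) < δ := lt_of_lt_of_le hy (min_le_left _ _)
    rw [mem_ball, Prod.dist_eq]
    exact max_lt h1 h2
  have htε : Ioo (-η) η ⊆ Ioo (-ε) ε := fun t ht =>
    abs_lt.1 (lt_of_lt_of_le (abs_lt.2 ht) (min_le_right _ _))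
  have hbε : ball (c x₀) η ⊆ ball (c x₀) ε := ball_subset_ball (min_le_right _ _)
  let U : Set M := (chartAt H x₀).source ∩ c ⁻¹' ball (c x₀) η
  have hU : U ∈ 𝓝 x₀ := Filter.inter_mem (chart_source_mem_nhds H x₀)
    ((continuousAt_extChartAt x₀).preimage_mem_nhds (ball_mem_nhds _ hη))
  refine ⟨η, hη, U, hU, fun p => c.symm (φ (p.1, c p.2)), ?_, fun x hx => ⟨?_, ?_⟩⟩
  · have h1 : ContMDiffOn (𝓘(ℝ, ℝ).prod I) 𝓘(ℝ, ℝ × E) ∞ (fun p : ℝ × M => (p.1, c p.2))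
        (Ioo (-η) η ×ˢ U) := by
      refine contMDiffOn_fst.prodMk_space ?_
      exact contMDiffOn_extChartAt.comp contMDiffOn_snd fun p hp => hp.2.1
    have h2 : ContMDiffOn 𝓘(ℝ, ℝ × E) 𝓘(ℝ, E) ∞ φ (Ioo (-η) η ×ˢ ball (c x₀) η) :=
      (hφ.mono (prod_mono htε hbε)).contMDiffOn
    have h3 := h2.comp h1 (fun p hp => ⟨hp.1, hp.2.2⟩)
    exact ((contMDiffOn_extChartAt_symm x₀).mono interior_subset).comp h3
      (fun p hp => (hin p.1 hp.1 _ hp.2.2).1)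
  · change c.symm (φ (0, c x)) = x
    rw [(hφ' _ (hbε hx.2)).1]
    exact c.left_inv (by rw [hc]; exact hx.1)
  · intro t ht
    refine HasMFDerivAt.hasMFDerivWithinAt ?_
    obtain ⟨h1, h2⟩ := hin t ht _ hx.2
    have h3 := ((hφ' _ (hbε hx.2)).2 t (htε ht))
    set y := φ (t, c x) with hy
    have hyt : y ∈ c.target := interior_subset h1
    have hnr : range I ∈ 𝓝 y := Filter.mem_of_superset (isOpen_interior.mem_nhds h1)
      (interior_subset.trans (extChartAt_target_subset_range x₀))
    have h4 : HasMFDerivAt 𝓘(ℝ, E) I c.symm y (mfderivWithin 𝓘(ℝ, E) I c.symm (range I) y) :=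
      (mdifferentiableWithinAt_extChartAt_symm hyt).hasMFDerivWithinAt.hasMFDerivAt hnr
    have h5 : HasMFDerivAt 𝓘(ℝ, ℝ) 𝓘(ℝ, E) (fun s => φ (s, c x)) t
        ((1 : ℝ →L[ℝ] ℝ).smulRight (v' y)) := h3.hasFDerivAt.hasMFDerivAt
    have h6 := HasMFDerivAt.comp t h4 h5
    refine h6.congr_mfderiv ?_
    refine ContinuousLinearMap.ext fun (s : ℝ) => ?_
    have hz : c.symm y ∈ (chartAt H x₀).source := by rw [← hc]; exact c.map_target hyt
    have h7 : v y = mfderiv I 𝓘(ℝ, E) c (c.symm y) (V (c.symm y)) := by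
      rw [← TangentBundle.continuousLinearMapAt_trivializationAt hz]
      exact (e.continuousLinearMapAt_apply_of_mem ℝ (hsrc ▸ hz) _).symm
    have h8 := mfderivWithin_extChartAt_symm_comp_mfderiv_extChartAt hyt
    have h9 : mfderivWithin 𝓘(ℝ, E) I c.symm (range I) y (v y) = V (c.symm y) := by
      rw [h7]; exact DFunLike.congr_fun h8 (V (c.symm y))
    change mfderivWithin 𝓘(ℝ, E) I c.symm (range I) y ((s : ℝ) • v' y) = (s : ℝ) • V (c.symm y)
    rw [h2, ← h9]
    exact map_smul _ _ _

/-- Local integral curves are unique at points which are interior or near which the field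
vanishes. -/
theorem integralCurve_eventuallyEq {V : ∀ x : M, TangentSpace I x}
    (hV : IsSmoothVF I V) {γ γ' : ℝ → M} {t₀ : ℝ}
    (hx₀ : I.IsInteriorPoint (γ t₀) ∨ ∀ᶠ y in 𝓝 (γ t₀), V y = 0)
    (hγ : IsMIntegralCurveAt γ V t₀) (hγ' : IsMIntegralCurveAt γ' V t₀) (h : γ t₀ = γ' t₀) :
    γ =ᶠ[𝓝 t₀] γ' := by
  have : IsManifold I 1 M := IsManifold.of_le (n := ∞) (by exact_mod_cast le_top)
  rcases hx₀ with hx₀ | hx₀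
  · exact isMIntegralCurveAt_eventuallyEq_of_contMDiffAt hx₀
      ((hV.contMDiffAt).of_le (by exact_mod_cast le_top)) hγ hγ' h
  · have key : ∀ δ : ℝ → M, δ t₀ = γ t₀ → IsMIntegralCurveAt δ V t₀ →
        ∀ᶠ t in 𝓝 t₀, δ t = γ t₀ := by
      intro δ hδ hδ'
      let c := extChartAt I (γ t₀)
      have h1 : ∀ᶠ t in 𝓝 t₀, V (δ t) = 0 ∧ δ t ∈ (chartAt H (γ t₀)).source := by
        refine hδ'.continuousAt.eventually
          (p := fun y => V y = 0 ∧ y ∈ (chartAt H (γ t₀)).source) ?_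
        rw [hδ]
        exact hx₀.and (chart_source_mem_nhds H _)
      obtain ⟨ε, hε, hb⟩ := eventually_nhds_iff_ball.1 (h1.and hδ')
      have hd : ∀ t ∈ ball t₀ ε, HasFDerivAt (c ∘ δ) (0 : ℝ →L[ℝ] E) t := by
        intro t ht
        obtain ⟨⟨h2, h3⟩, h4⟩ := hb t ht
        have h5 := HasMFDerivAt.comp t (hasMFDerivAt_extChartAt (I := I) h3) h4
        refine hasMFDerivAt_iff_hasFDerivAt.1 (h5.congr_mfderiv ?_)
        rw [h2]
        refine ContinuousLinearMap.ext fun (s : ℝ) => ?_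
        change mfderiv I I (chartAt H (γ t₀)) (δ t) ((s : ℝ) • (0 : TangentSpace I (δ t))) = 0
        rw [smul_zero]; exact map_zero _
      filter_upwards [ball_mem_nhds t₀ hε] with t ht
      have h6 : (c ∘ δ) t = (c ∘ δ) t₀ := by
        have := (convex_ball t₀ ε).norm_image_sub_le_of_norm_hasFDerivWithin_le (𝕜 := ℝ)
          (f := c ∘ δ) (f' := fun _ => 0) (C := 0) (x := t₀) (y := t)
          (fun s hs => (hd s hs).hasFDerivWithinAt) (fun s _ => by simp)
          (mem_ball_self hε) ht
        rw [zero_mul] at this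
        exact sub_eq_zero.1 (norm_le_zero_iff.1 this)
      have h7 := c.injOn (x₁ := δ t) (x₂ := δ t₀)
        (by rw [extChartAt_source]; exact (hb t ht).1.2)
        (by rw [hδ]; exact mem_extChartAt_source _) h6
      rw [h7, hδ]
    filter_upwards [key γ rfl hγ, key γ' h.symm hγ'] with t h1 h2
    rw [h1, h2]

/-- A smooth vector field all of whose zeros at the boundary are zeros of a neighbourhood, so that
it generates a local flow. -/
structure IsLocallyIntegrable (I : ModelWithCorners ℝ E H) {M : Type w} [TopologicalSpace M]
    [ChartedSpace H M] [IsManifold I ∞ M] (V : ∀ x : M, TangentSpace I x) : Prop where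
  smooth : IsSmoothVF I V
  interior_or : ∀ x, I.IsInteriorPoint x ∨ ∀ᶠ y in 𝓝 x, V y = 0

variable {V : ∀ x : M, TangentSpace I x}

theorem IsLocallyIntegrable.exists_local_flow [FiniteDimensional ℝ E]
    (hV : IsLocallyIntegrable I V) (x₀ : M) :
    ∃ ε > 0, ∃ U ∈ 𝓝 x₀, ∃ φ : ℝ × M → M,
      ContMDiffOn (𝓘(ℝ, ℝ).prod I) I ∞ φ (Ioo (-ε) ε ×ˢ U) ∧
      ∀ x ∈ U, φ (0, x) = x ∧ IsMIntegralCurveOn (fun t => φ (t, x)) V (Ioo (-ε) ε) := by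
  rcases hV.interior_or x₀ with h | h
  · exact exists_local_flow_interior hV.smooth h
  · refine ⟨1, one_pos, _, h, fun p => p.2, contMDiffOn_snd, fun x hx => ⟨rfl, ?_⟩⟩
    exact (isMIntegralCurve_const hx).isMIntegralCurveOn _

theorem IsLocallyIntegrable.eqOn [T2Space M] (hV : IsLocallyIntegrable I V) {γ γ' : ℝ → M}
    {a b t₀ : ℝ} (ht₀ : t₀ ∈ Ioo a b) (hγ : IsMIntegralCurveOn γ V (Ioo a b))
    (hγ' : IsMIntegralCurveOn γ' V (Ioo a b)) (h : γ t₀ = γ' t₀) : EqOn γ γ' (Ioo a b) := by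
  set s := {t | γ t = γ' t} ∩ Ioo a b with hs
  suffices hsub : Ioo a b ⊆ s from fun t ht => (hsub ht).1
  apply isPreconnected_Ioo.subset_of_closure_inter_subset (s := Ioo a b) (u := s) _
    ⟨t₀, ⟨ht₀, ⟨h, ht₀⟩⟩⟩
  · rintro t ⟨htc, ht⟩
    refine ⟨?_, ht⟩
    have h1 : ContinuousAt γ t := (hγ.isMIntegralCurveAt (Ioo_mem_nhds ht.1 ht.2)).continuousAt
    have h2 : ContinuousAt γ' t := (hγ'.isMIntegralCurveAt (Ioo_mem_nhds ht.1 ht.2)).continuousAt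
    by_contra hne
    have h3 : ∀ᶠ r in 𝓝 t, γ r ≠ γ' r := by
      obtain ⟨u, v, hu, hv, hxu, hxv, huv⟩ := t2_separation hne
      filter_upwards [h1.preimage_mem_nhds (hu.mem_nhds hxu), h2.preimage_mem_nhds (hv.mem_nhds hxv)]
        with r hr hr' he
      exact disjoint_left.1 huv hr (by rw [mem_preimage] at hr'; rwa [he])
    obtain ⟨r, hr, hr'⟩ := mem_closure_iff_nhds.1 htc _ h3
    exact hr hr'.1
  · rw [isOpen_iff_mem_nhds]
    intro t₁ ht₁
    have hmem := Ioo_mem_nhds ht₁.2.1 ht₁.2.2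
    have heq : γ =ᶠ[𝓝 t₁] γ' := integralCurve_eventuallyEq hV.smooth (hV.interior_or _)
      (hγ.isMIntegralCurveAt hmem) (hγ'.isMIntegralCurveAt hmem) ht₁.1
    exact (heq.and hmem).mono fun _ ht => ht

theorem isMIntegralCurveOn_glue {γ γ' : ℝ → M} {s s' : Set ℝ} (hs : IsOpen s) (hs' : IsOpen s')
    (hγ : IsMIntegralCurveOn γ V s) (hγ' : IsMIntegralCurveOn γ' V s') (h : EqOn γ γ' (s ∩ s')) :
    ∃ δ : ℝ → M, IsMIntegralCurveOn δ V (s ∪ s') ∧ EqOn δ γ s := by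
  classical
  refine ⟨s.piecewise γ γ', ?_, fun t ht => piecewise_eq_of_mem _ _ _ ht⟩
  refine IsMIntegralCurveAt.isMIntegralCurveOn fun t ht => ?_
  have key : ∀ {δ : ℝ → M}, IsMIntegralCurveAt δ V t → s.piecewise γ γ' =ᶠ[𝓝 t] δ →
      IsMIntegralCurveAt (s.piecewise γ γ') V t := by
    intro δ h1 h2
    filter_upwards [h1, h2.eventuallyEq_nhds] with r hr hr'
    rw [hr'.self_of_nhds]
    exact hr.congr_of_eventuallyEq hr'
  rcases ht with ht | ht
  · refine key (hγ.isMIntegralCurveAt (hs.mem_nhds ht)) ?_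
    filter_upwards [hs.mem_nhds ht] with r hr
    exact piecewise_eq_of_mem _ _ _ hr
  · refine key (hγ'.isMIntegralCurveAt (hs'.mem_nhds ht)) ?_
    filter_upwards [hs'.mem_nhds ht] with r hr
    by_cases hr' : r ∈ s
    · rw [piecewise_eq_of_mem _ _ _ hr', h ⟨hr', hr⟩]
    · exact piecewise_eq_of_notMem _ _ _ hr'

/-- The integral curves through `x` which exist on an interval of length at most `2 N` stay in a
compact set. -/
def StaysCompact (V : ∀ x : M, TangentSpace I x) : Prop :=
  ∀ (x : M) (N : ℝ), ∃ K, IsCompact K ∧ ∀ T ≤ N, ∀ γ : ℝ → M, γ 0 = x →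
    IsMIntegralCurveOn γ V (Ioo (-T) T) → ∀ t ∈ Ioo (-T) T, γ t ∈ K

/-- The existence time is uniform on the compact set that curves from `x` cannot leave, so that they
can be prolonged in equal steps. -/
theorem IsLocallyIntegrable.exists_curve [FiniteDimensional ℝ E] [T2Space M]
    (hV : IsLocallyIntegrable I V) (hK : StaysCompact V) (x : M) (N : ℝ) :
    ∃ γ : ℝ → M, γ 0 = x ∧ IsMIntegralCurveOn γ V (Ioo (-N) N) := by
  classical
  obtain ⟨K, hKc, hKs⟩ := hK x N
  -- uniform existence time on `K ∪ {x}`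
  have hunif : ∃ ε > 0, ∀ p ∈ insert x K, ∃ γ : ℝ → M, γ 0 = p ∧
      IsMIntegralCurveOn γ V (Ioo (-ε) ε) := by
    refine (hKc.insert x).induction_on (p := fun S => ∃ ε > 0, ∀ p ∈ S, ∃ γ : ℝ → M, γ 0 = p ∧
      IsMIntegralCurveOn γ V (Ioo (-ε) ε)) ⟨1, one_pos, by simp⟩ ?_ ?_ ?_
    · rintro s t hst ⟨ε, hε, h⟩
      exact ⟨ε, hε, fun p hp => h p (hst hp)⟩
    · rintro s t ⟨ε, hε, h⟩ ⟨ε', hε', h'⟩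
      refine ⟨min ε ε', lt_min hε hε', fun p hp => ?_⟩
      rcases hp with hp | hp
      · obtain ⟨γ, h0, h1⟩ := h p hp
        exact ⟨γ, h0, h1.mono (Ioo_subset_Ioo (neg_le_neg (min_le_left _ _)) (min_le_left _ _))⟩
      · obtain ⟨γ, h0, h1⟩ := h' p hp
        exact ⟨γ, h0, h1.mono (Ioo_subset_Ioo (neg_le_neg (min_le_right _ _)) (min_le_right _ _))⟩
    · intro p _
      obtain ⟨ε, hε, U, hU, φ, -, hφ⟩ := hV.exists_local_flow p
      exact ⟨U, mem_nhdsWithin_of_mem_nhds hU, ε, hε, fun q hq =>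
        ⟨fun t => φ (t, q), (hφ q hq).1, (hφ q hq).2⟩⟩
  obtain ⟨ε, hε, hloc⟩ := hunif
  let P : ℝ → Prop := fun T => ∃ γ : ℝ → M, γ 0 = x ∧ IsMIntegralCurveOn γ V (Ioo (-T) T)
  have hmono : ∀ {T T' : ℝ}, T' ≤ T → P T → P T' := by
    rintro T T' h ⟨γ, h0, h1⟩
    exact ⟨γ, h0, h1.mono (Ioo_subset_Ioo (neg_le_neg h) h)⟩
  have hstep : ∀ T, ε ≤ T → T ≤ N → P T → P (T + ε / 2) := by
    rintro T hεT hTN ⟨γ, h0, h1⟩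
    have ext : ∀ t₁ : ℝ, t₁ ∈ Ioo (-T) T → ∃ δ : ℝ → M, δ t₁ = γ t₁ ∧
        IsMIntegralCurveOn δ V (Ioo (t₁ - ε) (t₁ + ε)) := by
      intro t₁ ht₁
      obtain ⟨δ, hδ0, hδ⟩ := hloc (γ t₁) (mem_insert_of_mem _ (hKs T hTN γ h0 h1 t₁ ht₁))
      refine ⟨δ ∘ (· + -t₁), by simp [hδ0], ?_⟩
      refine (hδ.comp_add (-t₁)).mono fun t ht => ?_
      exact ⟨by linarith [ht.1], by linarith [ht.2]⟩
    obtain ⟨δ, hδ0, hδ⟩ := ext (T - ε / 2) ⟨by linarith, by linarith⟩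
    obtain ⟨δ', hδ0', hδ'⟩ := ext (-(T - ε / 2)) ⟨by linarith, by linarith⟩
    have e1 : EqOn γ δ (Ioo (-T) T ∩ Ioo (T - ε / 2 - ε) (T - ε / 2 + ε)) := by
      intro t ht
      have h3 : EqOn γ δ (Ioo (T - ε / 2 - ε) T) := hV.eqOn (t₀ := T - ε / 2)
        ⟨by linarith, by linarith⟩ (h1.mono fun s hs => ⟨by linarith [hs.1], hs.2⟩)
        (hδ.mono fun s hs => ⟨hs.1, by linarith [hs.2]⟩) hδ0.symm
      exact h3 ⟨ht.2.1, ht.1.2⟩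
    obtain ⟨γ₁, g1, hγ₁γ⟩ := isMIntegralCurveOn_glue isOpen_Ioo isOpen_Ioo h1 hδ e1
    have hu1 : Ioo (-T) T ∪ Ioo (T - ε / 2 - ε) (T - ε / 2 + ε) = Ioo (-T) (T + ε / 2) := by
      ext t; simp only [mem_union, mem_Ioo]
      constructor
      · rintro (h | h) <;> constructor <;> linarith [h.1, h.2]
      · rintro ⟨h, h'⟩
        rcases lt_or_ge t T with h2 | h2
        · exact Or.inl ⟨h, h2⟩
        · exact Or.inr ⟨by linarith, by linarith⟩
    rw [hu1] at g1
    have e2 : EqOn γ₁ δ' (Ioo (-T) (T + ε / 2) ∩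
        Ioo (-(T - ε / 2) - ε) (-(T - ε / 2) + ε)) := by
      intro t ht
      have h3 : EqOn γ₁ δ' (Ioo (-T) (min (T + ε / 2) (-(T - ε / 2) + ε))) := by
        refine hV.eqOn (t₀ := -(T - ε / 2)) ⟨by linarith, lt_min (by linarith) (by linarith)⟩
          (g1.mono fun s hs => ⟨hs.1, lt_of_lt_of_le hs.2 (min_le_left _ _)⟩)
          (hδ'.mono fun s hs => ⟨by linarith [hs.1], lt_of_lt_of_le hs.2 (min_le_right _ _)⟩) ?_
        rw [hδ0', hγ₁γ (show -(T - ε / 2) ∈ Ioo (-T) T from ⟨by linarith, by linarith⟩)]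
      exact h3 ⟨ht.1.1, lt_min ht.1.2 ht.2.2⟩
    obtain ⟨γ₂, g2, hγ₂⟩ := isMIntegralCurveOn_glue isOpen_Ioo isOpen_Ioo g1 hδ' e2
    refine ⟨_, ?_, g2.mono fun t ht => ?_⟩
    · rw [hγ₂ (show (0 : ℝ) ∈ Ioo (-T) (T + ε / 2) from ⟨by linarith, by linarith⟩),
        hγ₁γ (show (0 : ℝ) ∈ Ioo (-T) T from ⟨by linarith, by linarith⟩), h0]
    · rcases lt_or_ge (-T) t with h2 | h2
      · exact Or.inl ⟨h2, ht.2⟩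
      · exact Or.inr ⟨by linarith [ht.1], by linarith⟩
  have hind : ∀ n : ℕ, P N ∨ P (ε + n * (ε / 2)) := by
    intro n
    induction n with
    | zero =>
      right
      obtain ⟨γ, h0, h1⟩ := hloc x (mem_insert _ _)
      refine ⟨γ, h0, h1.mono ?_⟩
      simp
    | succ n ih =>
      rcases ih with h | h
      · exact Or.inl h
      · rcases le_or_gt (ε + n * (ε / 2)) N with h2 | h2
        · right
          have := hstep _ (by have : 0 ≤ (n : ℝ) * (ε / 2) := by positivity
                              linarith) h2 h
          push_cast
          convert! this using 1
          ring
        · exact Or.inl (hmono h2.le h)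
  obtain ⟨n, hn⟩ := exists_nat_gt (N / (ε / 2))
  rcases hind n with h | h
  · exact h
  · refine hmono ?_ h
    rw [div_lt_iff₀ (by positivity)] at hn
    linarith

/-- The flow of a smooth vector field whose integral curves stay in compact sets: it is complete
and smooth. -/
theorem IsLocallyIntegrable.exists_flow [FiniteDimensional ℝ E] [T2Space M]
    (hV : IsLocallyIntegrable I V) (hK : StaysCompact V) :
    ∃ Φ : ℝ → M → M, ContMDiff (𝓘(ℝ, ℝ).prod I) I ∞ (fun p : ℝ × M => Φ p.1 p.2) ∧
      (∀ x, Φ 0 x = x) ∧ (∀ s t x, Φ (s + t) x = Φ s (Φ t x)) ∧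
      ∀ x, IsMIntegralCurve (fun t => Φ t x) V := by
  choose c hc0 hc using fun (x : M) (N : ℝ) => hV.exists_curve hK x N
  let Φ : ℝ → M → M := fun t x => c x (|t| + 1) t
  have hagree : ∀ (x : M) (N : ℝ) (t : ℝ), |t| < N → Φ t x = c x N t := by
    intro x N t ht
    have h1 : |t| < min (|t| + 1) N := lt_min (by linarith) ht
    have h3 : EqOn (c x (|t| + 1)) (c x N) (Ioo (-min (|t| + 1) N) (min (|t| + 1) N)) := hV.eqOn (t₀ := 0)
      ⟨by linarith [abs_nonneg t], by linarith [abs_nonneg t]⟩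
      ((hc x (|t| + 1)).mono (Ioo_subset_Ioo (neg_le_neg (min_le_left _ _)) (min_le_left _ _)))
      ((hc x N).mono (Ioo_subset_Ioo (neg_le_neg (min_le_right _ _)) (min_le_right _ _)))
      (by rw [hc0, hc0])
    exact h3 (abs_lt.1 h1)
  have hcurve : ∀ x, IsMIntegralCurve (fun t => Φ t x) V := by
    intro x t
    have h1 : t ∈ Ioo (-(|t| + 1)) (|t| + 1) := abs_lt.1 (by linarith)
    have h2 := (hc x (|t| + 1)).isMIntegralCurveAt (Ioo_mem_nhds h1.1 h1.2)
    have h3 : (fun t => Φ t x) =ᶠ[𝓝 t] c x (|t| + 1) := by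
      filter_upwards [Ioo_mem_nhds h1.1 h1.2] with s hs
      exact hagree x _ s (abs_lt.2 hs)
    have h4 := h2.hasMFDerivAt.congr_of_eventuallyEq h3
    rw [← h3.self_of_nhds] at h4
    exact h4
  have huniq : ∀ {γ γ' : ℝ → M}, IsMIntegralCurve γ V → IsMIntegralCurve γ' V → γ 0 = γ' 0 →
      ∀ t, γ t = γ' t := by
    intro γ γ' h h' h0 t
    have h3 : EqOn γ γ' (Ioo (-(|t| + 1)) (|t| + 1)) := hV.eqOn (t₀ := 0)
      ⟨by linarith [abs_nonneg t], by linarith [abs_nonneg t]⟩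
      (h.isMIntegralCurveOn _) (h'.isMIntegralCurveOn _) h0
    exact h3 (abs_lt.1 (by linarith))
  have h0 : ∀ x, Φ 0 x = x := fun x => hc0 x _
  have hadd : ∀ s t x, Φ (s + t) x = Φ s (Φ t x) := by
    intro s t x
    refine huniq (γ := (fun s => Φ s x) ∘ (· + t)) (γ' := fun s => Φ s (Φ t x))
      ((hcurve x).comp_add t) (hcurve _) ?_ s
    simp [h0]
  refine ⟨Φ, fun p => ?_, h0, hadd, hcurve⟩
  obtain ⟨t, x₀⟩ := p
  -- the set of times near which the flow is smooth
  let A : Set ℝ := {t | ∃ O ∈ 𝓝 ((t, x₀) : ℝ × M),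
    ContMDiffOn (𝓘(ℝ, ℝ).prod I) I ∞ (fun p : ℝ × M => Φ p.1 p.2) O}
  have key : ∀ t₀ : ℝ, ∃ ε > 0, ∀ t₁, |t₁ - t₀| < ε → t₁ ∈ A ∨ t₁ = 0 → ∀ t₂, |t₂ - t₀| < ε → t₂ ∈ A := by
    intro t₀
    obtain ⟨ε, hε, U, hU, φ, hφs, hφ⟩ := hV.exists_local_flow (Φ t₀ x₀)
    have hcon : ContinuousAt (fun t => Φ t x₀) t₀ := ((hcurve x₀).continuous).continuousAt
    obtain ⟨δ, hδ, hδ'⟩ := eventually_nhds_iff_ball.1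
      (hcon.eventually (p := fun y => y ∈ interior U) (isOpen_interior.mem_nhds
        (mem_interior_iff_mem_nhds.2 hU)))
    refine ⟨min δ (ε / 2), lt_min hδ (by positivity), fun t₁ ht₁ hA t₂ ht₂ => ?_⟩
    have hp : Φ t₁ x₀ ∈ interior U := hδ' t₁ (by
      rw [mem_ball, Real.dist_eq]; exact lt_of_lt_of_le ht₁ (min_le_left _ _))
    have h12 : |t₂ - t₁| < ε := by
      have a1 := lt_of_lt_of_le ht₁ (min_le_right _ _)
      have a2 := lt_of_lt_of_le ht₂ (min_le_right _ _)
      rw [abs_lt] at a1 a2 ⊢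
      constructor <;> linarith [a1.1, a1.2, a2.1, a2.2]
    -- smoothness of the time `t₁` map near `x₀`
    have hs1 : ∃ O ∈ 𝓝 x₀, ContMDiffOn I I ∞ (Φ t₁) O := by
      rcases hA with ⟨O, hO, hOs⟩ | rfl
      · have h1 : ContinuousAt (fun x : M => (t₁, x)) x₀ := by fun_prop
        refine ⟨_, h1.preimage_mem_nhds hO, ?_⟩
        exact hOs.comp (contMDiffOn_const.prodMk contMDiffOn_id) fun x hx => hx
      · exact ⟨univ, Filter.univ_mem, contMDiffOn_id.congr fun x _ => h0 x⟩
    obtain ⟨O, hO, hOs⟩ := hs1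
    have hcO : ContinuousAt (Φ t₁) x₀ := hOs.continuousOn.continuousAt hO
    have hO' : O ∩ Φ t₁ ⁻¹' (interior U) ∈ 𝓝 x₀ := Filter.inter_mem hO
      (hcO.preimage_mem_nhds (isOpen_interior.mem_nhds hp))
    refine ⟨(Ioo (t₁ - ε) (t₁ + ε)) ×ˢ (O ∩ Φ t₁ ⁻¹' (interior U)),
      prod_mem_nhds (Ioo_mem_nhds (by linarith [(abs_lt.1 h12).1])
        (by linarith [(abs_lt.1 h12).2])) hO', ?_⟩
    have h3 : ContMDiffOn (𝓘(ℝ, ℝ).prod I) (𝓘(ℝ, ℝ).prod I) ∞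
        (fun p : ℝ × M => (p.1 - t₁, Φ t₁ p.2))
        ((Ioo (t₁ - ε) (t₁ + ε)) ×ˢ (O ∩ Φ t₁ ⁻¹' (interior U))) := by
      refine ContMDiffOn.prodMk ?_ ?_
      · exact contMDiffOn_fst.sub contMDiffOn_const
      · exact hOs.comp contMDiffOn_snd fun p hp => hp.2.1
    refine (hφs.comp h3 ?_).congr ?_
    · rintro ⟨s, x⟩ ⟨hs, hx⟩
      exact ⟨⟨by linarith [hs.1], by linarith [hs.2]⟩, interior_subset hx.2⟩
    · rintro ⟨s, x⟩ ⟨hs, hx⟩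
      have hxU : Φ t₁ x ∈ U := interior_subset hx.2
      have e1 : Φ s x = Φ (s - t₁) (Φ t₁ x) := by rw [← hadd]; congr 1; ring
      change Φ s x = φ (s - t₁, Φ t₁ x)
      rw [e1]
      have h3 : EqOn (fun t => Φ t (Φ t₁ x)) (fun t => φ (t, Φ t₁ x)) (Ioo (-ε) ε) :=
        hV.eqOn (t₀ := 0) ⟨by linarith, hε⟩
        ((hcurve (Φ t₁ x)).isMIntegralCurveOn _) (hφ _ hxU).2
        (by rw [h0]; exact (hφ _ hxU).1.symm)
      exact h3 ⟨by linarith [hs.1], by linarith [hs.2]⟩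
  have hA0 : (0 : ℝ) ∈ A := by
    obtain ⟨ε, hε, h⟩ := key 0
    exact h 0 (by simpa using hε) (Or.inr rfl) 0 (by simpa using hε)
  have hclopen : IsClopen A := by
    constructor
    · refine isClosed_iff_clusterPt.2 fun t₀ ht₀ => ?_
      obtain ⟨ε, hε, h⟩ := key t₀
      obtain ⟨t₁, ht₁, ht₁'⟩ := (clusterPt_principal_iff.1 ht₀) _ (ball_mem_nhds t₀ hε)
      exact h t₁ (by rwa [mem_ball, Real.dist_eq] at ht₁) (Or.inl ht₁') t₀ (by simpa using hε)
    · refine isOpen_iff_mem_nhds.2 fun t₀ ht₀ => ?_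
      obtain ⟨ε, hε, h⟩ := key t₀
      refine Filter.mem_of_superset (ball_mem_nhds t₀ hε) fun t₂ ht₂ => ?_
      exact h t₀ (by simpa using hε) (Or.inl ht₀) t₂ (by rwa [mem_ball, Real.dist_eq] at ht₂)
  have hAt : t ∈ A := by
    rw [hclopen.eq_univ ⟨0, hA0⟩]; exact mem_univ t
  obtain ⟨O, hO, hOs⟩ := hAt
  exact hOs.contMDiffAt hO

end Flow

/-! ### Submanifolds carried by embedded subspaces -/

section Straightening

variable {E H M E' H' N : Type*} [NormedAddCommGroup E] [NormedSpace ℝ E]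
  [TopologicalSpace H] {I : ModelWithCorners ℝ E H}
  [TopologicalSpace M] [ChartedSpace H M]
  [NormedAddCommGroup E'] [NormedSpace ℝ E'] [TopologicalSpace H'] {I' : ModelWithCorners ℝ E' H'}
  [TopologicalSpace N]

/-- A chart near `x` of the subspace `N` of the manifold `M`, included by `ι`, which extends to a
smooth map `ext` on `M` and has a smooth inverse, as a map to `M`. -/
structure SliceChart (I : ModelWithCorners ℝ E H) (I' : ModelWithCorners ℝ E' H') (ι : N → M)
    (x : N) where
  chart : OpenPartialHomeomorph N H'
  mem_source : x ∈ chart.source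
  ext : M → E'
  smooth_ext : ∀ z ∈ chart.source, ContMDiffAt I 𝓘(ℝ, E') ∞ ext (ι z)
  ext_eq : ∀ z ∈ chart.source, ext (ι z) = I' (chart z)
  smooth_symm : ContMDiffOn 𝓘(ℝ, E') I ∞ (fun y => ι (chart.symm (I'.symm y)))
    (I'.symm ⁻¹' chart.target ∩ range I')

/-- The manifold structure on `N` whose charts are the slice charts. -/
@[reducible] def SliceChart.chartedSpace {ι : N → M} (s : ∀ x, SliceChart I I' ι x) :
    ChartedSpace H' N where
  atlas := range fun x => (s x).chart
  chartAt x := (s x).chart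
  mem_chart_source x := (s x).mem_source
  chart_mem_atlas x := mem_range_self x

theorem SliceChart.isManifold {ι : N → M} (s : ∀ x, SliceChart I I' ι x) :
    letI := SliceChart.chartedSpace s
    IsManifold I' ∞ N := by
  let _ := SliceChart.chartedSpace s
  refine isManifold_of_contDiffOn I' ∞ N ?_
  rintro _ _ ⟨x, rfl⟩ ⟨y, rfl⟩
  rw [← contMDiffOn_iff_contDiffOn]
  intro p hp
  have h1 : I'.symm p ∈ (s x).chart.target := hp.1.1
  have h2 : (s x).chart.symm (I'.symm p) ∈ (s y).chart.source := hp.1.2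
  have h3 : ContMDiffWithinAt 𝓘(ℝ, E') I ∞ (fun y => ι ((s x).chart.symm (I'.symm y)))
      (I'.symm ⁻¹' ((s x).chart.symm ≫ₕ (s y).chart).source ∩ range I') p :=
    ((s x).smooth_symm p ⟨h1, hp.2⟩).mono fun q hq => ⟨hq.1.1, hq.2⟩
  refine (((s y).smooth_ext _ h2).comp_contMDiffWithinAt p h3).congr (fun q hq => ?_) ?_
  · exact ((s y).ext_eq _ hq.1.2).symm
  · exact ((s y).ext_eq _ h2).symm

/-- Locally the inclusion `ι` has smooth left inverses: charts of `N` extend to smooth maps on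
`M`. Maps to `N` are then smooth when their compositions with `ι` are. -/
def IsInitial (I : ModelWithCorners ℝ E H) (I' : ModelWithCorners ℝ E' H') [ChartedSpace H' N]
    (ι : N → M) : Prop :=
  ∀ x, ∃ e : M → E', ContMDiffAt I 𝓘(ℝ, E') ∞ e (ι x) ∧ ∀ᶠ z in 𝓝 x, e (ι z) = extChartAt I' x z

theorem SliceChart.isInitial {ι : N → M} (s : ∀ x, SliceChart I I' ι x) :
    letI := SliceChart.chartedSpace s
    IsInitial I I' ι := by
  let _ := SliceChart.chartedSpace s
  intro x
  refine ⟨(s x).ext, (s x).smooth_ext x (s x).mem_source, ?_⟩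
  filter_upwards [(s x).chart.open_source.mem_nhds (s x).mem_source] with z hz
  exact (s x).ext_eq z hz

theorem SliceChart.contMDiff {ι : N → M} (s : ∀ x, SliceChart I I' ι x) :
    letI := SliceChart.chartedSpace s
    ContMDiff I' I ∞ ι := by
  let _ := SliceChart.chartedSpace s
  have : IsManifold I' ∞ N := SliceChart.isManifold s
  intro x
  have h1 : ContMDiffOn I' 𝓘(ℝ, E') ∞ (extChartAt I' x) (s x).chart.source := contMDiffOn_extChartAt
  have h2 := (s x).smooth_symm.comp h1 (fun z hz => ?_)
  · refine (h2.congr fun z hz => ?_).contMDiffAt ((s x).chart.open_source.mem_nhds (s x).mem_source)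
    change ι z = ι ((s x).chart.symm (I'.symm (I' ((s x).chart z))))
    rw [I'.left_inv, (s x).chart.left_inv hz]
  · refine ⟨?_, ?_⟩
    · change I'.symm (I' ((s x).chart z)) ∈ (s x).chart.target
      rw [I'.left_inv]; exact (s x).chart.map_source hz
    · exact mem_range_self _

section

variable [ChartedSpace H' N] {E₁ H₁ Q : Type*} [NormedAddCommGroup E₁] [NormedSpace ℝ E₁]
  [TopologicalSpace H₁] {J : ModelWithCorners ℝ E₁ H₁}
  [TopologicalSpace Q] [ChartedSpace H₁ Q]

theorem IsInitial.contMDiffAt {ι : N → M} (hι : IsInitial I I' ι) {h : Q → N} {q : Q}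
    (hc : ContinuousAt h q) (hs : ContMDiffAt J I ∞ (fun z => ι (h z)) q) :
    ContMDiffAt J I' ∞ h q := by
  rw [contMDiffAt_iff_target]
  refine ⟨hc, ?_⟩
  obtain ⟨e, he, he'⟩ := hι (h q)
  refine (ContMDiffAt.comp q he hs).congr_of_eventuallyEq ?_
  filter_upwards [hc.eventually he'] with z hz
  exact hz.symm

theorem IsInitial.injective_mfderiv [IsManifold I' ∞ N] {ι : N → M} (hι : IsInitial I I' ι)
    (hs : ContMDiff I' I ∞ ι) (x : N) : Function.Injective (mfderiv I' I ι x) := by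
  have : IsManifold I' 1 N := IsManifold.of_le (n := ∞) (by exact_mod_cast le_top)
  obtain ⟨e, he, he'⟩ := hι x
  have h1 : mfderiv I' 𝓘(ℝ, E') (e ∘ ι) x = mfderiv I' 𝓘(ℝ, E') (extChartAt I' x) x :=
    Filter.EventuallyEq.mfderiv_eq he'
  rw [mfderiv_comp x (he.mdifferentiableAt (by simp)) ((hs x).mdifferentiableAt (by simp))] at h1
  have h2 := (isInvertible_mfderiv_extChartAt (I := I') (mem_extChartAt_source x)).injective
  rw [← h1] at h2
  exact Function.Injective.of_comp h2

end

/-- A slice chart from a smooth chart `Ψ` of `M` with values in a vector space, in which the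
subspace `N` becomes the image of the model under the affine map `lift`. -/
def SliceChart.ofStraightening {ι : N → M} (hι : IsEmbedding ι)
    (Ψ : OpenPartialHomeomorph M E) (hΨ : ContMDiffOn I 𝓘(ℝ, E) ∞ Ψ Ψ.source)
    (hΨ' : ContMDiffOn 𝓘(ℝ, E) I ∞ Ψ.symm Ψ.target) (drop : E → E') (lift : E' → E)
    (hdrop : ContDiff ℝ ∞ drop) (hlift : ContDiff ℝ ∞ lift) (hdl : ∀ y, drop (lift y) = y)
    (hr : ∀ z ∈ Ψ.source, z ∈ range ι ↔ ∃ y ∈ range I', Ψ z = lift y) (x : N)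
    (hx : ι x ∈ Ψ.source) : SliceChart I I' ι x where
  chart :=
    { toFun := fun z => I'.symm (drop (Ψ (ι z)))
      invFun := fun h => (Function.extend ι id fun _ => x) (Ψ.symm (lift (I' h)))
      source := ι ⁻¹' Ψ.source
      target := (fun h => lift (I' h)) ⁻¹' Ψ.target
      map_source' := by
        intro z hz
        obtain ⟨y, ⟨h, rfl⟩, hy⟩ := (hr _ hz).1 (mem_range_self z)
        rw [mem_preimage, hy, hdl, I'.left_inv, ← hy]
        exact Ψ.map_source hz
      map_target' := by
        intro h hh
        obtain ⟨z, hz⟩ := (hr _ (Ψ.map_target hh)).2 ⟨I' h, mem_range_self h, Ψ.right_inv hh⟩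
        rw [mem_preimage, ← hz, hι.injective.extend_apply, id, hz]
        exact Ψ.map_target hh
      left_inv' := by
        intro z hz
        obtain ⟨y, ⟨h, rfl⟩, hy⟩ := (hr _ hz).1 (mem_range_self z)
        rw [hy, hdl, I'.left_inv, ← hy, Ψ.left_inv hz, hι.injective.extend_apply, id]
      right_inv' := by
        intro h hh
        obtain ⟨z, hz⟩ := (hr _ (Ψ.map_target hh)).2 ⟨I' h, mem_range_self h, Ψ.right_inv hh⟩
        rw [← hz, hι.injective.extend_apply, id, hz, Ψ.right_inv hh, hdl, I'.left_inv]
      open_source := Ψ.open_source.preimage hι.continuous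
      open_target := Ψ.open_target.preimage (hlift.continuous.comp I'.continuous)
      continuousOn_toFun := (I'.continuous_symm.comp hdrop.continuous).comp_continuousOn
        (Ψ.continuousOn.comp hι.continuous.continuousOn fun z hz => hz)
      continuousOn_invFun := by
        rw [hι.continuousOn_iff]
        refine (Ψ.continuousOn_symm.comp (hlift.continuous.comp I'.continuous).continuousOn
          fun h hh => hh).congr fun h hh => ?_
        obtain ⟨z, hz⟩ := (hr _ (Ψ.map_target hh)).2 ⟨I' h, mem_range_self h, Ψ.right_inv hh⟩
        simp only [Function.comp_apply] at hz ⊢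
        rw [← hz, hι.injective.extend_apply, id] }
  mem_source := hx
  ext := fun z => drop (Ψ z)
  smooth_ext := fun z hz => (hdrop.contMDiff.contMDiffAt).comp _
    (hΨ.contMDiffAt (Ψ.open_source.mem_nhds hz))
  ext_eq := by
    intro z hz
    obtain ⟨y, ⟨h, rfl⟩, hy⟩ := (hr _ hz).1 (mem_range_self z)
    change drop (Ψ (ι z)) = I' (I'.symm (drop (Ψ (ι z))))
    rw [hy, hdl, I'.left_inv]
  smooth_symm := by
    refine ((hΨ'.comp hlift.contMDiff.contMDiffOn (s := lift ⁻¹' Ψ.target) fun y hy => hy).mono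
      (s := lift ⁻¹' Ψ.target) (t := _) ?_).congr ?_
    · rintro _ ⟨hy, ⟨h, rfl⟩⟩
      rw [mem_preimage, I'.left_inv] at hy
      exact hy
    · rintro _ ⟨hy, ⟨h, rfl⟩⟩
      rw [mem_preimage, I'.left_inv] at hy
      obtain ⟨z, hz⟩ := (hr _ (Ψ.map_target hy)).2 ⟨I' h, mem_range_self h, Ψ.right_inv hy⟩
      change ι (Function.extend ι id (fun _ => x) (Ψ.symm (lift (I' (I'.symm (I' h)))))) = _
      rw [I'.left_inv, Function.comp_apply, ← hz, hι.injective.extend_apply, id]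

/-- The slice chart of a subspace which is a neighbourhood of `ι x` in `M`. -/
def SliceChart.ofNhds [IsManifold I ∞ M] {ι : N → M} (hι : IsEmbedding ι) (x : N)
    (hx : range ι ∈ 𝓝 (ι x)) : SliceChart I I ι x where
  chart :=
    { toFun := fun z => chartAt H (ι x) (ι z)
      invFun := fun h => (Function.extend ι id fun _ => x) ((chartAt H (ι x)).symm h)
      source := ι ⁻¹' ((chartAt H (ι x)).source ∩ interior (range ι))
      target := (chartAt H (ι x)).target ∩ (chartAt H (ι x)).symm ⁻¹' interior (range ι)
      map_source' := by
        intro z hz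
        refine ⟨(chartAt H (ι x)).map_source hz.1, ?_⟩
        rw [mem_preimage, (chartAt H (ι x)).left_inv hz.1]; exact hz.2
      map_target' := by
        intro h hh
        obtain ⟨z, hz⟩ := interior_subset hh.2
        rw [mem_preimage, ← hz, hι.injective.extend_apply, id, hz]
        exact ⟨(chartAt H (ι x)).map_target hh.1, hh.2⟩
      left_inv' := by
        intro z hz
        rw [(chartAt H (ι x)).left_inv hz.1, hι.injective.extend_apply, id]
      right_inv' := by
        intro h hh
        obtain ⟨z, hz⟩ := interior_subset hh.2
        rw [← hz, hι.injective.extend_apply, id, hz, (chartAt H (ι x)).right_inv hh.1]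
      open_source := ((chartAt H (ι x)).open_source.inter isOpen_interior).preimage hι.continuous
      open_target := (chartAt H (ι x)).isOpen_inter_preimage_symm isOpen_interior
      continuousOn_toFun := (chartAt H (ι x)).continuousOn.comp hι.continuous.continuousOn
        fun z hz => hz.1
      continuousOn_invFun := by
        rw [hι.continuousOn_iff]
        refine ((chartAt H (ι x)).continuousOn_symm.mono inter_subset_left).congr fun h hh => ?_
        obtain ⟨z, hz⟩ := interior_subset hh.2
        simp only [Function.comp_apply]
        rw [← hz, hι.injective.extend_apply, id] }
  mem_source := ⟨mem_chart_source H _, mem_interior_iff_mem_nhds.2 hx⟩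
  ext := extChartAt I (ι x)
  smooth_ext := fun z hz => contMDiffAt_extChartAt' hz.1
  ext_eq := fun z hz => rfl
  smooth_symm := by
    refine ((contMDiffOn_extChartAt_symm (I := I) (n := ∞) (ι x)).mono ?_).congr ?_
    · rintro _ ⟨hy, ⟨h, rfl⟩⟩
      rw [mem_preimage, I.left_inv] at hy
      rw [extChartAt_target]
      refine ⟨?_, mem_range_self _⟩
      rw [mem_preimage, I.left_inv]; exact hy.1
    · rintro _ ⟨hy, ⟨h, rfl⟩⟩
      rw [mem_preimage, I.left_inv] at hy
      obtain ⟨z, hz⟩ := interior_subset hy.2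
      change ι (Function.extend ι id (fun _ => x) ((chartAt H (ι x)).symm (I.symm (I h)))) =
        (chartAt H (ι x)).symm (I.symm (I h))
      rw [I.left_inv, ← hz, hι.injective.extend_apply, id]

/-- Near an interior point at which its differential does not vanish, a smooth function is a
positive multiple of the first coordinate of a smooth chart. -/
theorem exists_straightening {k : ℕ} {H : Type*} [TopologicalSpace H]
    {I : ModelWithCorners ℝ (𝔼 (k + 1)) H} {M : Type*} [TopologicalSpace M]
    [ChartedSpace H M] [IsManifold I ∞ M] {F : M → ℝ} (hF : ContMDiff I 𝓘(ℝ, ℝ) ∞ F) {p : M}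
    (hp : I.IsInteriorPoint p) (hd : mfderiv I 𝓘(ℝ, ℝ) F p ≠ 0) :
    ∃ (Ψ : OpenPartialHomeomorph M (𝔼 (k + 1))) (s : ℝ), 0 < s ∧
      p ∈ Ψ.source ∧ ContMDiffOn I 𝓘(ℝ, 𝔼 (k + 1)) ∞ Ψ Ψ.source ∧
      ContMDiffOn 𝓘(ℝ, 𝔼 (k + 1)) I ∞ Ψ.symm Ψ.target ∧
      ∀ z ∈ Ψ.source, Ψ z 0 = s * (F z - F p) := by
  have : IsManifold I 1 M := IsManifold.of_le (n := ∞) (by exact_mod_cast le_top)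
  let c := extChartAt I p
  let V := 𝔼 (k + 1)
  let Fh : V → ℝ := fun y => F (c.symm y)
  have hFh : ContDiffOn ℝ ∞ Fh (interior c.target) := by
    rw [← contMDiffOn_iff_contDiffOn]
    exact hF.comp_contMDiffOn ((contMDiffOn_extChartAt_symm p).mono interior_subset)
  have hy₀ : c p ∈ interior c.target := I.isInteriorPoint_iff.1 hp
  set y₀ := c p with hy₀def
  have hFhat : ∀ y ∈ interior c.target, ContDiffAt ℝ ∞ Fh y := fun y hy =>
    hFh.contDiffAt (isOpen_interior.mem_nhds hy)
  have hcp : c.symm y₀ = p := extChartAt_to_inv p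
  let ℓ : V →L[ℝ] ℝ := fderiv ℝ Fh y₀
  have hℓ : ℓ ≠ 0 := by
    intro h0
    apply hd
    have h1 : F =ᶠ[𝓝 p] Fh ∘ c := by
      filter_upwards [extChartAt_source_mem_nhds (I := I) p] with z hz
      change F z = F (c.symm (c z))
      rw [c.left_inv hz]
    rw [h1.mfderiv_eq, mfderiv_comp (I' := 𝓘(ℝ, V)) p
      ((hFhat _ hy₀).contMDiffAt.mdifferentiableAt (by simp))
      (contMDiffAt_extChartAt.mdifferentiableAt (n := ∞) (by simp))]
    rw [mfderiv_eq_fderiv]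
    change ContinuousLinearMap.comp ℓ _ = 0
    rw [h0]; exact ContinuousLinearMap.zero_comp _
  let a : V := (InnerProductSpace.toDual ℝ V).symm ℓ
  have ha : ∀ v, inner ℝ a v = ℓ v := fun v => InnerProductSpace.toDual_symm_apply
  have ha0 : a ≠ 0 := by
    intro h0; apply hℓ; ext v
    have := ha v; rw [h0, inner_zero_left] at this; rw [← this]; rfl
  have hna : 0 < ‖a‖ := norm_pos_iff.2 ha0
  obtain ⟨b, hb⟩ : ∃ b : OrthonormalBasis (Fin (k + 1)) ℝ V, b 0 = ‖a‖⁻¹ • a := by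
    have h1 : Orthonormal ℝ (({0} : Set (Fin (k + 1))).domRestrict
        fun _ : Fin (k + 1) => ‖a‖⁻¹ • a) := by
      constructor
      · intro i
        change ‖‖a‖⁻¹ • a‖ = 1
        rw [norm_smul, norm_inv, norm_norm, inv_mul_cancel₀ hna.ne']
      · intro i j hij
        exact absurd (Subtype.ext ((mem_singleton_iff.1 i.2).trans (mem_singleton_iff.1 j.2).symm)) hij
    obtain ⟨b, hb⟩ := h1.exists_orthonormalBasis_extension_of_card_eq (ι := Fin (k + 1)) (by simp [V])
    exact ⟨b, hb 0 rfl⟩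
  let A : V ≃L[ℝ] V := b.repr.toContinuousLinearEquiv
  have hA0 : ∀ v, A v 0 = ‖a‖⁻¹ * ℓ v := by
    intro v
    change b.repr v 0 = _
    rw [b.repr_apply_apply, hb, inner_smul_left, ha]; rfl
  let e₀ : V := EuclideanSpace.single 0 1
  have he₀ : e₀ 0 = 1 := by simp [e₀]
  let ψ : V → V := fun y => A y + (‖a‖⁻¹ * (Fh y - F p) - ‖a‖⁻¹ * ℓ y) • e₀
  have hψ0 : ∀ y, ψ y 0 = ‖a‖⁻¹ * (Fh y - F p) := by
    intro y
    change A y 0 + (‖a‖⁻¹ * (Fh y - F p) - ‖a‖⁻¹ * ℓ y) * e₀ 0 = _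
    rw [hA0, he₀]; ring
  have hψs : ∀ y ∈ interior c.target, ContDiffAt ℝ ∞ ψ y := by
    intro y hy
    have h1 := hFhat y hy
    have h2 : ContDiffAt ℝ ∞ (fun y => A y) y := A.contDiff.contDiffAt
    have h3 : ContDiffAt ℝ ∞ (fun y => ℓ y) y := ℓ.contDiff.contDiffAt
    exact h2.add (((contDiffAt_const.mul (h1.sub contDiffAt_const)).sub
      (contDiffAt_const.mul h3)).smul contDiffAt_const)
  have hψd : HasFDerivAt ψ (A : V →L[ℝ] V) y₀ := by
    have h1 : HasFDerivAt Fh ℓ y₀ := ((hFhat _ hy₀).differentiableAt (by simp)).hasFDerivAt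
    have h2 := (((h1.sub_const (F p)).const_mul ‖a‖⁻¹).sub
      ((ℓ.hasFDerivAt (x := y₀)).const_mul ‖a‖⁻¹)).smul_const e₀
    have h3 := (A : V →L[ℝ] V).hasFDerivAt (x := y₀) |>.add h2
    rw [sub_self] at h3
    convert! h3 using 1
    ext v; simp
  let Ψ₀ := (hψs y₀ hy₀).toOpenPartialHomeomorph ψ hψd (by simp)
  let G : Set V := {y | y ∈ interior c.target ∧
    fderiv ℝ ψ y ∈ range ((↑) : (V ≃L[ℝ] V) → V →L[ℝ] V)}
  have hG : IsOpen G := by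
    have h1 : ContinuousOn (fderiv ℝ ψ) (interior c.target) :=
      ContDiffOn.continuousOn_fderiv_of_isOpen (n := ∞)
        (fun y hy => (hψs y hy).contDiffWithinAt) isOpen_interior (by simp)
    exact h1.isOpen_inter_preimage isOpen_interior ContinuousLinearEquiv.isOpen
  have hyG : y₀ ∈ G := ⟨hy₀, A, hψd.fderiv.symm⟩
  let Ψ₁ := Ψ₀.restrOpen G hG
  let cc : OpenPartialHomeomorph M V :=
    { toPartialEquiv := (c.trans (PartialEquiv.ofSet (interior c.target)))
      open_source := by
        rw [PartialEquiv.trans_source, PartialEquiv.ofSet_source]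
        exact (continuousOn_extChartAt p).isOpen_inter_preimage (isOpen_extChartAt_source p)
          isOpen_interior
      open_target := by
        rw [PartialEquiv.trans_target, PartialEquiv.ofSet_target]
        convert! (isOpen_interior (s := c.target)) using 1
        exact inter_eq_left.2 interior_subset
      continuousOn_toFun := (continuousOn_extChartAt p).mono fun z hz => hz.1
      continuousOn_invFun := (continuousOn_extChartAt_symm p).mono fun y hy => hy.2 }
  have hcc : ∀ z, cc z = c z := fun z => rfl
  have hccs : ∀ z, cc.symm z = c.symm z := fun z => rfl
  have hccsrc : ∀ z, z ∈ cc.source ↔ z ∈ c.source ∧ c z ∈ interior c.target := fun z => Iff.rfl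
  refine ⟨cc.trans Ψ₁, ‖a‖⁻¹, inv_pos.2 hna, ?_, ?_, ?_, ?_⟩
  · refine ⟨⟨mem_extChartAt_source p, hy₀⟩, ?_, hyG⟩
    exact (hψs y₀ hy₀).mem_toOpenPartialHomeomorph_source hψd (by simp)
  · intro z hz
    have h1 : c z ∈ interior c.target := hz.1.2
    have h2 : ContMDiffAt I 𝓘(ℝ, V) ∞ c z := contMDiffAt_extChartAt' (by
      have h3 : z ∈ c.source := hz.1.1
      rwa [extChartAt_source] at h3)
    exact ((hψs _ h1).contMDiffAt.comp z h2).contMDiffWithinAt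
  · intro y hy
    have h1 : y ∈ Ψ₁.target := hy.1
    have h2 : Ψ₁.symm y ∈ G := (Ψ₁.map_target h1).2
    obtain ⟨B, hB⟩ := h2.2
    have h3 : ContDiffAt ℝ ∞ Ψ₁.symm y := by
      refine Ψ₁.contDiffAt_symm h1 (f₀' := B) ?_ (hψs _ h2.1)
      rw [hB]
      exact ((hψs _ h2.1).differentiableAt (by simp)).hasFDerivAt
    have h4 : ContMDiffAt 𝓘(ℝ, V) I ∞ c.symm (Ψ₁.symm y) :=
      ((contMDiffOn_extChartAt_symm p).mono interior_subset).contMDiffAt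
        (isOpen_interior.mem_nhds h2.1)
    exact (h4.comp y h3.contMDiffAt).contMDiffWithinAt
  · intro z hz
    change ψ (c z) 0 = _
    rw [hψ0]
    change ‖a‖⁻¹ * (F (c.symm (c z)) - F p) = _
    rw [c.left_inv hz.1.1]

end Straightening

section Strata

theorem nonempty_interior_range_HModel (k : ℕ) : (interior (range (HModel k))).Nonempty :=
  (HModel k).nonempty_interior

theorem range_HModel_succ (k : ℕ) : range (HModel (k + 1)) = {y | 0 ≤ y 0} :=
  range_modelWithCornersEuclideanHalfSpace (k + 1)

theorem frontier_range_HModel_succ (k : ℕ) : frontier (range (HModel (k + 1))) = {y | 0 = y 0} :=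
  frontier_range_modelWithCornersEuclideanHalfSpace (k + 1)

/-- A structure of smooth manifold on a subspace of a smooth manifold. -/
structure SubStructure (k : ℕ) {M : Type u} [TopologicalSpace M] [ChartedSpace (HSpace k) M]
    (k' : ℕ) {N : Type v} [TopologicalSpace N] (ι : N → M) where
  charted : ChartedSpace (HSpace k') N
  manifold : IsManifold (HModel k') ∞ N
  smooth : ContMDiff (HModel k') (HModel k) ∞ ι
  initial : IsInitial (HModel k) (HModel k') ι

variable {k : ℕ} {M : Type u} [TopologicalSpace M] [ChartedSpace (HSpace k) M]
  [IsManifold (HModel k) ∞ M] {N : Type v} [TopologicalSpace N]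

theorem SliceChart.exists_subStructure {k' : ℕ} {ι : N → M} (p : N → Prop)
    (h : ∀ x, ∃ s : SliceChart (HModel k) (HModel k') ι x,
      ((HModel k' (s.chart x)) ∈ frontier (range (HModel k')) ↔ p x)) :
    ∃ S : SubStructure k k' ι, letI := S.charted
      (HModel k').boundary N = {x | p x} := by
  choose s hs using h
  exact ⟨⟨SliceChart.chartedSpace s, SliceChart.isManifold s, SliceChart.contMDiff s,
    SliceChart.isInitial s⟩, Set.ext hs⟩

/-- A level set is a submanifold of codimension one at its interior regular points. -/
theorem exists_subStructure_level {F : M → ℝ} (hF : ContMDiff (HModel k) 𝓘(ℝ, ℝ) ∞ F) {c : ℝ}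
    {ι : N → M} (hι : IsEmbedding ι) (hr : range ι = F ⁻¹' {c})
    (hint : ∀ x, (HModel k).IsInteriorPoint (ι x)) (hd : ∀ x, dform (k := k) F (ι x) ≠ 0) :
    ∃ S : SubStructure k (k - 1) ι, letI := S.charted
      (HModel (k - 1)).boundary N = ∅ := by
  suffices h : ∃ S : SubStructure k (k - 1) ι, letI := S.charted
      (HModel (k - 1)).boundary N = {x | False} from h
  refine SliceChart.exists_subStructure _ fun x => ?_
  rcases k with - | k
  · exact absurd (ContinuousLinearMap.ext fun v => by
      have hv : v = 0 := Subsingleton.elim (α := 𝔼 0) v 0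
      rw [hv]; simp) (hd x)
  obtain ⟨Ψ, s, hs, hxs, h1, h2, h3⟩ := exists_straightening hF (hint x) (hd x)
  obtain ⟨q, hq⟩ := nonempty_interior_range_HModel k
  have hFx : F (ι x) = c := by
    have : ι x ∈ F ⁻¹' {c} := hr ▸ mem_range_self x
    exact this
  let drop₀ : 𝔼 (k + 1) → 𝔼 k :=
    fun y => WithLp.toLp 2 fun i => y i.succ
  have hdrop₀ : ContDiff ℝ ∞ drop₀ := by
    rw [contDiff_euclidean]; intro i; exact contDiff_euclidean.1 contDiff_id i.succ
  let v : 𝔼 k := q - drop₀ (Ψ (ι x))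
  let drop := fun y => drop₀ y + v
  have hdrop : ContDiff ℝ ∞ drop := hdrop₀.add contDiff_const
  let lift : 𝔼 k → 𝔼 (k + 1) :=
    fun y => WithLp.toLp 2 (Fin.cons 0 (WithLp.ofLp (y - v)))
  have hlift : ContDiff ℝ ∞ lift := by
    rw [contDiff_euclidean]; intro i
    refine Fin.cases ?_ (fun i => ?_) i
    · exact contDiff_const
    · exact contDiff_euclidean.1 (contDiff_id.sub contDiff_const) i
  have hdl : ∀ y, drop (lift y) = y := by
    intro y
    ext i
    change lift y i.succ + v i = y i
    change (y i - v i) + v i = y i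
    ring
  have hld : ∀ y, y 0 = 0 → lift (drop y) = y := by
    intro y hy
    ext i
    refine Fin.cases ?_ (fun i => ?_) i
    · exact hy.symm
    · change (y i.succ + v i) - v i = y i.succ
      ring
  let O : Set M := Ψ.source ∩ Ψ ⁻¹' (drop ⁻¹' interior (range (HModel k)))
  have hO : IsOpen O := Ψ.continuousOn.isOpen_inter_preimage Ψ.open_source
    (isOpen_interior.preimage hdrop.continuous)
  let Ψ' := Ψ.restrOpen O hO
  have hq' : drop (Ψ (ι x)) = q := by
    change drop₀ (Ψ (ι x)) + (q - drop₀ (Ψ (ι x))) = q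
    abel
  have hx' : ι x ∈ Ψ'.source := ⟨hxs, hxs, by rw [mem_preimage, mem_preimage, hq']; exact hq⟩
  refine ⟨SliceChart.ofStraightening hι Ψ' (h1.mono fun z hz => hz.1) (h2.mono fun y hy => hy.1)
    drop lift hdrop hlift hdl ?_ x hx', ?_⟩
  · intro z hz
    rw [hr]
    have hz0 : Ψ z 0 = s * (F z - c) := hFx ▸ h3 z hz.1
    constructor
    · intro h
      refine ⟨drop (Ψ z), interior_subset hz.2.2, (hld _ ?_).symm⟩
      have h' : F z = c := h
      change Ψ z 0 = 0
      rw [hz0, h']; ring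
    · rintro ⟨y, -, hy⟩
      have h4 : Ψ z 0 = 0 := by
        change Ψ z = lift y at hy
        rw [hy]; rfl
      rw [hz0] at h4
      exact sub_eq_zero.1 ((mul_eq_zero.1 h4).resolve_left hs.ne')
  · change HModel k ((HModel k).symm (drop (Ψ (ι x)))) ∈ _ ↔ False
    rw [hq', (HModel k).right_inv (interior_subset hq)]
    exact iff_of_false (fun h => (disjoint_interior_frontier.le_bot ⟨hq, h⟩)) id

/-- A subspace which is, near some of its points, a regular superlevel set, and which is a
neighbourhood of its other points, is a submanifold of codimension zero. -/
theorem exists_subStructure_slab {ι : N → M} (hι : IsEmbedding ι)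
    (h : ∀ x, (range ι ∈ 𝓝 (ι x) ∧ (HModel k).IsInteriorPoint (ι x)) ∨
      (range ι ∈ 𝓝 (ι x) ∧ (HModel k).IsBoundaryPoint (ι x)) ∨
      (HModel k).IsInteriorPoint (ι x) ∧ ∃ F : M → ℝ, ContMDiff (HModel k) 𝓘(ℝ, ℝ) ∞ F ∧
        F (ι x) = 0 ∧ dform (k := k) F (ι x) ≠ 0 ∧ ∀ᶠ z in 𝓝 (ι x), (z ∈ range ι ↔ 0 ≤ F z)) :
    ∃ S : SubStructure k k ι, letI := S.charted
      (HModel k).boundary N =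
        {x | ¬ (range ι ∈ 𝓝 (ι x) ∧ (HModel k).IsInteriorPoint (ι x))} := by
  refine SliceChart.exists_subStructure _ fun x => ?_
  rcases h x with h | h | h
  · refine ⟨SliceChart.ofNhds hι x h.1, ?_⟩
    refine iff_of_false (fun h' => ?_) (fun h' => h' h)
    exact disjoint_interior_frontier.le_bot ⟨h.2, h'⟩
  · refine ⟨SliceChart.ofNhds hι x h.1, ?_⟩
    refine iff_of_true h.2 (fun h' => ?_)
    exact disjoint_interior_frontier.le_bot ⟨h'.2, h.2⟩
  · obtain ⟨hint, F, hF, hF0, hd, hr⟩ := h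
    rcases k with - | k
    · exact absurd (ContinuousLinearMap.ext fun v => by
        have hv : v = 0 := Subsingleton.elim (α := 𝔼 0) v 0
        rw [hv]; simp) hd
    obtain ⟨Ψ, s, hs, hxs, h1, h2, h3⟩ := exists_straightening hF hint hd
    obtain ⟨O, hOr, hO, hxO⟩ := eventually_nhds_iff.1 hr
    let Ψ' := Ψ.restrOpen O hO
    have hΨx : Ψ (ι x) 0 = 0 := by rw [h3 _ hxs]; simp
    have hrr : ∀ z ∈ Ψ'.source, z ∈ range ι ↔ Ψ z ∈ range (HModel (k + 1)) := by
      intro z hz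
      rw [hOr z hz.2, range_HModel_succ, mem_ofPred_eq, h3 z hz.1, hF0, sub_zero]
      exact (mul_nonneg_iff_of_pos_left hs).symm
    refine ⟨SliceChart.ofStraightening hι Ψ' (h1.mono fun z hz => hz.1) (h2.mono fun y hy => hy.1)
      id id contDiff_id contDiff_id (fun _ => rfl) ?_ x ⟨hxs, hxO⟩, ?_⟩
    · intro z hz
      rw [hrr z hz]
      exact ⟨fun h => ⟨_, h, rfl⟩, by rintro ⟨y, hy, h⟩; exact h.symm ▸ hy⟩
    · change HModel (k + 1) ((HModel (k + 1)).symm (Ψ (ι x))) ∈ _ ↔ _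
      have h4 : Ψ (ι x) ∈ range (HModel (k + 1)) := by
        rw [range_HModel_succ]; exact hΨx.ge
      rw [(HModel (k + 1)).right_inv h4, frontier_range_HModel_succ]
      refine iff_of_true hΨx.symm fun ⟨hn, _⟩ => ?_
      -- the image of a neighbourhood of `ι x` would be a neighbourhood of a boundary point
      have h5 : Ψ.symm ⁻¹' (range ι ∩ O) ∈ 𝓝 (Ψ (ι x)) := by
        refine (Ψ.continuousAt_symm (Ψ.map_source hxs)).preimage_mem_nhds ?_
        rw [Ψ.left_inv hxs]
        exact Filter.inter_mem hn (hO.mem_nhds hxO)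
      have h6 : range (HModel (k + 1)) ∈ 𝓝 (Ψ (ι x)) := by
        filter_upwards [h5, Ψ.open_target.mem_nhds (Ψ.map_source hxs)] with y hy hy'
        have := (hrr (Ψ.symm y) ⟨Ψ.map_target hy', hy.2⟩).1 hy.1
        rwa [Ψ.right_inv hy'] at this
      have h7 : Ψ (ι x) ∈ frontier (range (HModel (k + 1))) := by
        rw [frontier_range_HModel_succ]; exact hΨx.symm
      exact disjoint_interior_frontier.le_bot ⟨mem_interior_iff_mem_nhds.2 h6, h7⟩

end Strata

/-! ### The topology of the tube -/

namespace StratData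

variable {n m : ℕ} {X : Type u} [TopologicalSpace X] (W : StratData n m X)

open Classical in
/-- The retraction `π` of the tube, extended by the identity. -/
def retr (x : X) : X := if h : x ∈ W.tube then (W.proj ⟨x, h⟩).1 else x

open Classical in
/-- The radial function `ρ` of the tube, extended by an irrelevant non-zero constant. -/
def rho (x : X) : ℝ := if h : x ∈ W.tube then W.rad ⟨x, h⟩ else 1

variable {W}

theorem retr_of_mem {x : X} (h : x ∈ W.tube) : W.retr x = (W.proj ⟨x, h⟩).1 := dif_pos h

theorem rho_of_mem {x : X} (h : x ∈ W.tube) : W.rho x = W.rad ⟨x, h⟩ := dif_pos h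

theorem retr_mem_sing {x : X} (h : x ∈ W.tube) : W.retr x ∈ W.sing := by
  rw [retr_of_mem h]; exact (W.proj ⟨x, h⟩).2

theorem retr_of_mem_sing {x : X} (h : x ∈ W.sing) : W.retr x = x := by
  rw [retr_of_mem (W.sing_subset_tube h), W.proj_sing x h]

theorem rho_eq_zero_iff {x : X} : W.rho x = 0 ↔ x ∈ W.sing := by
  by_cases h : x ∈ W.tube
  · rw [rho_of_mem h, W.rad_eq_zero_iff]
  · rw [rho, dif_neg h]
    exact iff_of_false one_ne_zero fun h' => h (W.sing_subset_tube h')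

theorem rho_nonneg (x : X) : 0 ≤ W.rho x := by
  by_cases h : x ∈ W.tube
  · rw [rho_of_mem h]; exact W.rad_nonneg _
  · rw [rho, dif_neg h]; exact zero_le_one

theorem rho_pos (x : W.Reg) : 0 < W.rho x.1 :=
  lt_of_le_of_ne (rho_nonneg _) fun h => x.2 (rho_eq_zero_iff.1 h.symm)

theorem projExt_val (y₀ : W.Sing) {x : W.Reg} (h : x.1 ∈ W.tube) :
    (W.projExt y₀ x).1 = W.retr x.1 := by
  rw [projExt, dif_pos h, retr_of_mem h]

theorem projExt_of_mem (y₀ : W.Sing) {x : W.Reg} (h : x.1 ∈ W.tube) :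
    W.projExt y₀ x = W.proj ⟨x.1, h⟩ := dif_pos h

theorem radExt_of_mem {x : W.Reg} (h : x.1 ∈ W.tube) : W.radExt x = W.rho x.1 := by
  rw [radExt, dif_pos h, rho_of_mem h]

theorem continuousOn_retr : ContinuousOn W.retr W.tube := by
  rw [continuousOn_iff_continuous_domRestrict]
  refine (continuous_subtype_val.comp W.continuous_proj).congr fun x => ?_
  exact (retr_of_mem x.2).symm

theorem continuousOn_rho : ContinuousOn W.rho W.tube := by
  rw [continuousOn_iff_continuous_domRestrict]
  refine W.continuous_rad.congr fun x => ?_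
  exact (rho_of_mem x.2).symm

theorem continuousAt_retr {x : X} (h : x ∈ W.tube) : ContinuousAt W.retr x :=
  continuousOn_retr.continuousAt (W.isOpen_tube.mem_nhds h)

theorem continuousAt_rho {x : X} (h : x ∈ W.tube) : ContinuousAt W.rho x :=
  continuousOn_rho.continuousAt (W.isOpen_tube.mem_nhds h)

theorem isOpen_reg : IsOpen W.singᶜ := W.isClosed_sing.isOpen_compl

theorem isCompact_sing : IsCompact W.sing := by
  have := W.compact
  exact W.isClosed_sing.isCompact

end StratData

variable {l n m : ℕ} {L : Type v} [TopologicalSpace L] [ChartedSpace (𝔼 l) L] [IsManifold (𝓡 l) ∞ L]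
  {X : Type u} [TopologicalSpace X]

open StratData

namespace FibPM

variable [CompactSpace L] (W : FibPM l L n m X)

/-- A basis of neighbourhoods of a point of the singular stratum. -/
theorem exists_tube_subset {y : X} (hy : y ∈ W.sing) {O : Set X} (hO : O ∈ 𝓝 y) :
    ∃ U ∈ 𝓝 y, ∃ ε > 0, ∀ x ∈ W.tube, W.retr x ∈ U → W.rho x < ε → x ∈ O := by
  obtain ⟨U, hU, hyU, ⟨τ⟩⟩ := W.exists_coneChart ⟨y, hy⟩
  obtain ⟨O', hO'O, hO', hyO'⟩ := mem_nhds_iff.1 hO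
  let G : W.Sing × L × ℝ → X :=
    fun q => open Classical in if 0 < q.2.2 then (τ.param q).1 else q.1.1
  have key : ∀ᶠ p : W.Sing × ℝ in 𝓝 (⟨y, hy⟩, 0), ∀ q ∈ (univ : Set L),
      p.1 ∈ U → 0 ≤ p.2 → G (p.1, q, p.2) ∈ O' := by
    refine isCompact_univ.eventually_forall_of_forall_eventually fun q _ => ?_
    have h1 : ContinuousWithinAt G {q | q.1 ∈ U ∧ 0 ≤ q.2.2} (⟨y, hy⟩, q, 0) :=
      τ.continuous_cone _ ⟨hyU, le_rfl⟩
    have hG : G (⟨y, hy⟩, q, 0) = y := if_neg (lt_irrefl _)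
    have h2 : ∀ᶠ p in 𝓝[{q | q.1 ∈ U ∧ 0 ≤ q.2.2}] ((⟨y, hy⟩, q, 0) : W.Sing × L × ℝ), G p ∈ O' :=
      h1.eventually (p := fun z => z ∈ O') (by rw [hG]; exact hO'.mem_nhds hyO')
    rw [eventually_nhdsWithin_iff] at h2
    have h3 : ContinuousAt (fun z : (W.Sing × ℝ) × L => (z.1.1, z.2, z.1.2)) ((⟨y, hy⟩, 0), q) := by
      fun_prop
    filter_upwards [h3.eventually h2] with z hz h4 h5
    exact hz ⟨h4, h5⟩
  obtain ⟨A, hA, B, hB, hAB⟩ := mem_nhds_prod_iff.1 key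
  obtain ⟨ε, hε, hεB⟩ := Metric.mem_nhds_iff.1 hB
  have hA' : A ∩ U ∈ 𝓝 (⟨y, hy⟩ : W.Sing) := Filter.inter_mem hA (hU.mem_nhds hyU)
  obtain ⟨A₁, hA₁, hA₁A⟩ := mem_nhds_subtype _ _ _ |>.1 hA'
  refine ⟨A₁ ∩ O', Filter.inter_mem hA₁ (hO'.mem_nhds hyO'), ε, hε, fun x hx h1 h2 => hO'O ?_⟩
  by_cases hxs : x ∈ W.sing
  · rw [retr_of_mem_sing hxs] at h1; exact h1.2
  · have h3 : W.proj ⟨x, hx⟩ ∈ A ∩ U := hA₁A (by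
      rw [mem_preimage, ← retr_of_mem hx]; exact h1.1)
    have h4 : W.rad ⟨x, hx⟩ ∈ B := hεB (by
      rw [Metric.mem_ball, Real.dist_eq, sub_zero, abs_of_nonneg (W.rad_nonneg _),
        ← rho_of_mem hx]; exact h2)
    have h5 := hAB (mk_mem_prod h3.1 h4) (τ.link ⟨x, hxs⟩) (mem_univ _) h3.2 (W.rad_nonneg _)
    have h6 : 0 < W.rad ⟨x, hx⟩ := by rw [← rho_of_mem hx]; exact rho_pos (⟨x, hxs⟩ : W.Reg)
    have h7 : G (W.proj ⟨x, hx⟩, τ.link ⟨x, hxs⟩, W.rad ⟨x, hx⟩) = x := by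
      change ite _ _ _ = _
      rw [if_pos h6, τ.param_link ⟨x, hxs⟩ hx h3.2]
    rwa [← h7]

/-- The closed tubes `ρ ≤ r` are compact. -/
theorem isCompact_rho_le (r : ℝ) : IsCompact {x | x ∈ W.tube ∧ W.rho x ≤ r} := by
  have := W.compact
  have := W.hausdorff
  have hcs : CompactSpace W.Sing := isCompact_iff_compactSpace.1 W.isCompact_sing
  have key : ∃ C : Set X, IsCompact C ∧ C ⊆ W.tube ∧
      ∀ x (hx : x ∈ W.tube), W.proj ⟨x, hx⟩ ∈ (univ : Set W.Sing) → W.rho x ≤ r → x ∈ C := by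
    refine isCompact_univ.induction_on (p := fun S : Set W.Sing => ∃ C : Set X, IsCompact C ∧
      C ⊆ W.tube ∧ ∀ x (hx : x ∈ W.tube), W.proj ⟨x, hx⟩ ∈ S → W.rho x ≤ r → x ∈ C) ?_ ?_ ?_ ?_
    · exact ⟨∅, isCompact_empty, empty_subset _, fun x hx h => absurd h (notMem_empty _)⟩
    · rintro s t hst ⟨C, h1, h2, h3⟩
      exact ⟨C, h1, h2, fun x hx h => h3 x hx (hst h)⟩
    · rintro s t ⟨C, h1, h2, h3⟩ ⟨C', h1', h2', h3'⟩
      refine ⟨C ∪ C', h1.union h1', union_subset h2 h2', fun x hx h hr => ?_⟩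
      rcases h with h | h
      · exact Or.inl (h3 x hx h hr)
      · exact Or.inr (h3' x hx h hr)
    · intro y _
      obtain ⟨U, hU, hyU, ⟨τ⟩⟩ := W.exists_coneChart y
      obtain ⟨K, hK, hKU, hKc⟩ := local_compact_nhds (hU.mem_nhds hyU)
      let G : W.Sing × L × ℝ → X :=
        fun q => open Classical in if 0 < q.2.2 then (τ.param q).1 else q.1.1
      have hG : ContinuousOn G (K ×ˢ (univ : Set L) ×ˢ Icc 0 r) :=
        τ.continuous_cone.mono fun q hq => ⟨hKU hq.1, hq.2.2.1⟩
      refine ⟨K, mem_nhdsWithin_of_mem_nhds hK, G '' (K ×ˢ (univ : Set L) ×ˢ Icc 0 r) ∪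
        Subtype.val '' K, ?_, ?_, ?_⟩
      · exact ((hKc.prod (isCompact_univ.prod isCompact_Icc)).image_of_continuousOn hG).union
          (hKc.image continuous_subtype_val)
      · rintro _ (⟨q, hq, rfl⟩ | ⟨y, _, rfl⟩)
        · change ite _ _ _ ∈ _
          split_ifs with h0
          · exact (τ.param_mem q.1 (hKU hq.1) q.2.1 q.2.2 h0).1
          · exact W.sing_subset_tube q.1.2
        · exact W.sing_subset_tube y.2
      · intro x hx hxK hxr
        by_cases hxs : x ∈ W.sing
        · right
          rw [W.proj_sing x hxs] at hxK
          exact ⟨_, hxK, rfl⟩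
        · left
          refine ⟨(W.proj ⟨x, hx⟩, τ.link ⟨x, hxs⟩, W.rad ⟨x, hx⟩),
            ⟨hxK, mem_univ _, W.rad_nonneg _, ?_⟩, ?_⟩
          · rw [← rho_of_mem hx]; exact hxr
          · have h6 : 0 < W.rad ⟨x, hx⟩ := by rw [← rho_of_mem hx]; exact rho_pos (⟨x, hxs⟩ : W.Reg)
            change ite _ _ _ = _
            rw [if_pos h6, τ.param_link ⟨x, hxs⟩ hx (hKU hxK)]
  obtain ⟨C, h1, h2, h3⟩ := key
  have h4 : {x | x ∈ W.tube ∧ W.rho x ≤ r} = {x ∈ C | W.rho x ≤ r} := by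
    ext x
    exact ⟨fun h => ⟨h3 x h.1 (mem_univ _) h.2, h.2⟩, fun h => ⟨h2 h.1, h.2⟩⟩
  rw [h4]
  exact h1.of_isClosed_subset
    ((continuousOn_rho.mono h2).preimage_isClosed_of_isClosed h1.isClosed isClosed_Iic)
    fun x hx => hx.1

theorem isClosed_rho_le (r : ℝ) : IsClosed {x | x ∈ W.tube ∧ W.rho x ≤ r} := by
  have := W.hausdorff
  exact (W.isCompact_rho_le r).isClosed

theorem isOpen_rho_lt (r : ℝ) : IsOpen {x | x ∈ W.tube ∧ W.rho x < r} :=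
  continuousOn_rho.isOpen_inter_preimage W.isOpen_tube isOpen_Iio

/-! ### A radial function on the whole space -/

/-- A smooth function on `ℝ` with `cap ε r = r` for `r ≤ ε` and `cap ε r = 3 ε` for `r ≥ 2 ε`. -/
def cap (ε r : ℝ) : ℝ := r + Real.smoothTransition ((r - ε) / ε) * (3 * ε - r)

theorem contDiff_cap (ε : ℝ) : ContDiff ℝ ∞ (cap ε) := by
  unfold cap
  have : ContDiff ℝ ∞ Real.smoothTransition := Real.smoothTransition.contDiff
  fun_prop

theorem cap_of_le {ε r : ℝ} (hε : 0 < ε) (h : r ≤ ε) : cap ε r = r := by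
  rw [cap, Real.smoothTransition.zero_of_nonpos (div_nonpos_of_nonpos_of_nonneg (by linarith) hε.le)]
  ring

theorem cap_of_ge {ε r : ℝ} (hε : 0 < ε) (h : 2 * ε ≤ r) : cap ε r = 3 * ε := by
  rw [cap, Real.smoothTransition.one_of_one_le (by rw [le_div_iff₀ hε]; linarith)]
  ring

theorem le_cap {ε r : ℝ} (hε : 0 < ε) (h : ε ≤ r) : ε ≤ cap ε r := by
  have h0 := Real.smoothTransition.nonneg ((r - ε) / ε)
  have h1 := Real.smoothTransition.le_one ((r - ε) / ε)
  rcases le_or_gt (2 * ε) r with h2 | h2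
  · rw [cap_of_ge hε h2]; linarith
  · rw [cap]; nlinarith

open Classical in
/-- A global version of the radial function `ρ`, which agrees with it where `ρ ≤ ε`, and is
constant where `ρ ≥ 2 ε`. -/
def capRho (ε : ℝ) (x : X) : ℝ := if x ∈ W.tube then cap ε (W.rho x) else 3 * ε

variable {W}

theorem capRho_of_mem {ε : ℝ} {x : X} (h : x ∈ W.tube) : W.capRho ε x = cap ε (W.rho x) := if_pos h

theorem capRho_lt_iff {ε : ℝ} (hε : 0 < ε) {x : X} :
    W.capRho ε x < ε ↔ x ∈ W.tube ∧ W.rho x < ε := by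
  by_cases h : x ∈ W.tube
  · rw [capRho_of_mem h]
    constructor
    · intro h1
      exact ⟨h, lt_of_not_ge fun h2 => absurd (le_cap hε h2) (not_le.2 h1)⟩
    · intro h1
      rw [cap_of_le hε h1.2.le]; exact h1.2
  · rw [capRho, if_neg h]
    exact iff_of_false (by linarith) fun h' => h h'.1

theorem capRho_of_rho_lt {ε : ℝ} (hε : 0 < ε) {x : X} (h : x ∈ W.tube) (h' : W.rho x < ε) :
    W.capRho ε x = W.rho x := by
  rw [capRho_of_mem h, cap_of_le hε h'.le]

theorem capRho_of_notMem {ε : ℝ} (hε : 0 < ε) {x : X} (h : ¬ (x ∈ W.tube ∧ W.rho x ≤ 2 * ε)) :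
    W.capRho ε x = 3 * ε := by
  by_cases h' : x ∈ W.tube
  · rw [capRho_of_mem h', cap_of_ge hε (not_le.1 fun h2 => h ⟨h', h2⟩).le]
  · exact if_neg h'

theorem capRho_ne_zero {ε : ℝ} (hε : 0 < ε) (x : W.Reg) : W.capRho ε x.1 ≠ 0 := by
  intro h
  have h1 := (capRho_lt_iff hε (x := x.1)).1 (by rw [h]; exact hε)
  rw [capRho_of_rho_lt hε h1.1 h1.2] at h
  exact x.2 (rho_eq_zero_iff.1 h)

variable (W)

theorem continuous_capRho {ε : ℝ} (hε : 0 < ε) : Continuous (W.capRho ε) := by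
  rw [continuous_iff_continuousAt]
  intro x
  by_cases h : x ∈ W.tube
  · have h1 : ContinuousAt (fun x => cap ε (W.rho x)) x :=
      (contDiff_cap ε).continuous.continuousAt.comp (continuousAt_rho h)
    refine h1.congr ?_
    filter_upwards [W.isOpen_tube.mem_nhds h] with z hz
    exact (capRho_of_mem hz).symm
  · refine (continuousAt_const (y := 3 * ε)).congr ?_
    have h1 : x ∈ {x | x ∈ W.tube ∧ W.rho x ≤ 2 * ε}ᶜ := fun h' => h h'.1
    filter_upwards [(W.isClosed_rho_le (2 * ε)).isOpen_compl.mem_nhds h1] with z hz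
    exact (capRho_of_notMem hε hz).symm

theorem contMDiff_capRho {ε : ℝ} (hε : 0 < ε) :
    ContMDiff (HModel n) 𝓘(ℝ, ℝ) ∞ (fun x : W.Reg => W.capRho ε x.1) := by
  intro x
  by_cases h : x.1 ∈ W.tube
  · have h1 : ContMDiffAt (HModel n) 𝓘(ℝ, ℝ) ∞ (fun x => cap ε (W.radExt x)) x :=
      (contDiff_cap ε).contMDiff.contMDiffAt.comp x (W.smooth_rad x h)
    refine h1.congr_of_eventuallyEq ?_
    filter_upwards [(W.isOpen_tube.preimage continuous_subtype_val).mem_nhds h] with z hz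
    rw [capRho_of_mem hz, radExt_of_mem hz]
  · refine (contMDiffAt_const (c := 3 * ε)).congr_of_eventuallyEq ?_
    have h1 : x.1 ∈ {x | x ∈ W.tube ∧ W.rho x ≤ 2 * ε}ᶜ := fun h' => h h'.1
    filter_upwards [((W.isClosed_rho_le (2 * ε)).isOpen_compl.preimage
      continuous_subtype_val).mem_nhds h1] with z hz
    exact capRho_of_notMem hε hz

end FibPM

/-! ### Linear algebra of wedge metrics -/

section LinearAlgebra

theorem exists_orthogonal_lift {T F : Type*} [AddCommGroup T] [Module ℝ T] [FiniteDimensional ℝ T]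
    [AddCommGroup F] [Module ℝ F] (b : T →ₗ[ℝ] T →ₗ[ℝ] ℝ)
    (hpos : ∀ v, v ≠ 0 → 0 < b v v) (j : F →ₗ[ℝ] T) (z : T) :
    ∃ w : F, ∀ w', b (z + j w) (j w') = 0 := by
  let S := LinearMap.range j
  let C : S →ₗ[ℝ] Module.Dual ℝ S := (LinearMap.lcomp ℝ ℝ S.subtype).comp (b.comp S.subtype)
  have hC : ∀ s t : S, C s t = b s t := fun s t => rfl
  have hinj : Function.Injective C := by
    rw [← LinearMap.ker_eq_bot, LinearMap.ker_eq_bot']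
    intro s hs
    by_contra hne
    have h1 : 0 < b s s := hpos s fun h => hne (Subtype.ext h)
    rw [← hC, hs] at h1
    exact lt_irrefl _ h1
  have hsurj : Function.Surjective C :=
    (LinearMap.injective_iff_surjective_of_finrank_eq_finrank
      (Subspace.dual_finrank_eq (K := ℝ) (V := S)).symm).1 hinj
  obtain ⟨⟨_, w, rfl⟩, hs⟩ := hsurj (-((b z).comp S.subtype))
  refine ⟨w, fun w' => ?_⟩
  have h1 := LinearMap.congr_fun hs ⟨j w', w', rfl⟩
  rw [hC] at h1
  rw [map_add, LinearMap.add_apply]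
  change b (j w) (j w') = -(b z (j w')) at h1
  rw [h1]; ring

variable {T Y F : Type*} [AddCommGroup T] [Module ℝ T] [FiniteDimensional ℝ T]
  [AddCommGroup Y] [Module ℝ Y] [FiniteDimensional ℝ Y]
  [AddCommGroup F] [Module ℝ F] [FiniteDimensional ℝ F]

theorem quadratic_add {T : Type*} [AddCommGroup T] [Module ℝ T] (b : T →ₗ[ℝ] T →ₗ[ℝ] ℝ)
    (hs : ∀ u v, b u v = b v u) (u v : T) :
    b (u + v) (u + v) = b u u + 2 * b u v + b v v := by
  simp only [map_add, LinearMap.add_apply]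
  rw [hs v u]; ring

/-- The core of the comparison between the gradients of a function on the two strata. For the
wedge metric `b`, close to `ds² + g + r² (h - g)`, let `G` be `b`-orthogonal to the link directions.
Then the functional `b G` takes on a suitable lift of `ζ` approximately the value `g v' ζ`, where
`v'` is the component of `G` along the singular stratum. The reason is that the vectors orthogonal
to the link have almost the norm of their components in the other directions, so that the
claim follows by polarisation. -/
theorem exists_lift_pairing (D : Y × F × ℝ →ₗ[ℝ] T)
    (b : T →ₗ[ℝ] T →ₗ[ℝ] ℝ) (hbs : ∀ u v, b u v = b v u) (hb : ∀ v, v ≠ 0 → 0 < b v v)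
    (g : Y →ₗ[ℝ] Y →ₗ[ℝ] ℝ) (hgs : ∀ u v, g u v = g v u) (hg : ∀ v, v ≠ 0 → 0 < g v v)
    (h : Y × F →ₗ[ℝ] Y × F →ₗ[ℝ] ℝ) (hhs : ∀ u v, h u v = h v u) (hh : ∀ v, v ≠ 0 → 0 < h v v)
    (hsub : ∀ v w, (∀ w', h (v, w) (0, w') = 0) → h (v, w) (v, w) = g v v)
    {κ₀ r : ℝ} (hκ1 : |κ₀| ≤ 1)
    (hest₀ : ∀ v w s, |b (D (v, w, s)) (D (v, w, s)) -
      (s ^ 2 + g v v + r ^ 2 * (h (v, w) (v, w) - g v v))| ≤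
        κ₀ * (s ^ 2 + g v v + r ^ 2 * (h (v, w) (v, w) - g v v)))
    (v' : Y) (w' : F) (s' : ℝ) (hK : ∀ w, b (D (v', w', s')) (D (0, w, 0)) = 0) (ζ : Y) :
    ∃ w, g v' ζ - |κ₀| / 2 * (s' ^ 2 + g v' v' + g ζ ζ) ≤ b (D (v', w', s')) (D (ζ, w, 0)) := by
  have hg0 : ∀ v, 0 ≤ g v v := fun v => by
    by_cases hv : v = 0
    · simp [hv]
    · exact (hg v hv).le
  have hb0 : ∀ v, 0 ≤ b v v := fun v => by
    by_cases hv : v = 0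
    · simp [hv]
    · exact (hb v hv).le
  have hh0 : ∀ v, 0 ≤ h v v := fun v => by
    by_cases hv : v = 0
    · simp [hv]
    · exact (hh v hv).le
  have hlift : ∀ v, ∃ w₀, ∀ w', h (v, w₀) (0, w') = 0 := by
    intro v
    obtain ⟨w₀, hw₀⟩ := exists_orthogonal_lift h hh (LinearMap.inr ℝ Y F) (v, 0)
    refine ⟨w₀, fun w' => ?_⟩
    have := hw₀ w'
    simpa using this
  have hge : ∀ v w, g v v ≤ h (v, w) (v, w) := by
    intro v w
    obtain ⟨w₀, hw₀⟩ := hlift v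
    have h1 : (v, w) = (v, w₀) + ((0 : Y), w - w₀) := by ext <;> simp
    rw [h1, quadratic_add h hhs, hw₀, hsub v w₀ hw₀]
    have := hh0 ((0 : Y), w - w₀)
    linarith
  set κ := |κ₀| with hκ
  have hest : ∀ v w s, |b (D (v, w, s)) (D (v, w, s)) -
      (s ^ 2 + g v v + r ^ 2 * (h (v, w) (v, w) - g v v))| ≤
        κ * (s ^ 2 + g v v + r ^ 2 * (h (v, w) (v, w) - g v v)) := fun v w s =>
    (hest₀ v w s).trans (mul_le_mul_of_nonneg_right (le_abs_self _) (add_nonneg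
      (add_nonneg (sq_nonneg _) (hg0 v)) (mul_nonneg (sq_nonneg _) (sub_nonneg.2 (hge v w)))))
  let K : F →ₗ[ℝ] T := D.comp ((LinearMap.inr ℝ Y (F × ℝ)).comp (LinearMap.inl ℝ F ℝ))
  have hKw : ∀ w, K w = D (0, w, 0) := fun w => rfl
  have hDadd : ∀ v w s w₁, D (v, w + w₁, s) = D (v, w, s) + K w₁ := by
    intro v w s w₁
    rw [hKw, ← map_add]; simp
  -- two-sided estimate for vectors orthogonal to the link directions
  have hperp : ∀ v w s, (∀ w₁, b (D (v, w, s)) (K w₁) = 0) →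
      (1 - κ) * (s ^ 2 + g v v) ≤ b (D (v, w, s)) (D (v, w, s)) ∧
      b (D (v, w, s)) (D (v, w, s)) ≤ (1 + κ) * (s ^ 2 + g v v) := by
    intro v w s hw
    constructor
    · have h1 := (abs_le.1 (hest v w s)).1
      have h2 : 0 ≤ r ^ 2 * (h (v, w) (v, w) - g v v) :=
        mul_nonneg (sq_nonneg _) (sub_nonneg.2 (hge v w))
      nlinarith [mul_nonneg (sub_nonneg.2 hκ1) h2]
    · obtain ⟨w₀, hw₀⟩ := hlift v
      have h1 := (abs_le.1 (hest v w₀ s)).2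
      rw [hsub v w₀ hw₀, sub_self, mul_zero, add_zero] at h1
      have h2 : D (v, w₀, s) = D (v, w, s) + K (w₀ - w) := by rw [← hDadd]; simp
      rw [h2, quadratic_add b hbs, hw] at h1
      have := hb0 (K (w₀ - w))
      linarith
  obtain ⟨w, hw⟩ := exists_orthogonal_lift b hb K (D (ζ, 0, 0))
  have hw1 : ∀ w₁, b (D (ζ, w, 0)) (K w₁) = 0 := by
    intro w₁
    have := hDadd ζ 0 0 w
    rw [zero_add] at this
    rw [this]; exact hw w₁
  refine ⟨w, ?_⟩
  have hp : D (v' + ζ, w' + w, s') = D (v', w', s') + D (ζ, w, 0) := by rw [← map_add]; simp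
  have hm : D (v' - ζ, w' - w, s') = D (v', w', s') - D (ζ, w, 0) := by rw [← map_sub]; simp
  have h1 := (hperp (v' + ζ) (w' + w) s' fun w₁ => by
    rw [hp, map_add, LinearMap.add_apply, hw1, hKw, hK]; ring).1
  have h2 := (hperp (v' - ζ) (w' - w) s' fun w₁ => by
    rw [hm, map_sub, LinearMap.sub_apply, hw1, hKw, hK]; ring).2
  rw [hp, quadratic_add b hbs, quadratic_add g hgs] at h1
  rw [hm, sub_eq_add_neg, sub_eq_add_neg, quadratic_add b hbs, quadratic_add g hgs] at h2
  simp only [map_neg, LinearMap.neg_apply, neg_neg] at h2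
  nlinarith

end LinearAlgebra

/-! ### Smooth functions and vector fields on manifolds -/

section Calculus

variable {E : Type*} [NormedAddCommGroup E] [NormedSpace ℝ E]
  {H : Type*} [TopologicalSpace H] {I : ModelWithCorners ℝ E H}
  {M : Type*} [TopologicalSpace M] [ChartedSpace H M] [IsManifold I ∞ M]

/-- The derivative of a smooth function along a smooth vector field is smooth. -/
theorem contMDiffAt_mfderiv_apply {f : M → ℝ} {x₀ : M} (hf : ContMDiff I 𝓘(ℝ, ℝ) ∞ f)
    {V : ∀ x : M, TangentSpace I x}
    (hV : ContMDiffAt I I.tangent ∞ (fun x => (⟨x, V x⟩ : TangentBundle I M)) x₀) :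
    ContMDiffAt I 𝓘(ℝ, ℝ) ∞ (fun x => (mfderiv I 𝓘(ℝ, ℝ) f x (V x) : ℝ)) x₀ := by
  have h1 : ContMDiff I.tangent 𝓘(ℝ, ℝ).tangent ∞ (tangentMap I 𝓘(ℝ, ℝ) f) :=
    hf.contMDiff_tangentMap (by simp)
  have h2 := (h1.contMDiffAt (x := ⟨x₀, V x₀⟩)).comp x₀ hV
  exact (contMDiff_snd_tangentBundle_modelSpace ℝ 𝓘(ℝ, ℝ)).contMDiffAt.comp x₀ h2

/-- The norm of `df` with respect to `g` is locally bounded. -/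
theorem exists_dform_sq_le {k : ℕ} {M : Type*} [TopologicalSpace M] [ChartedSpace (HSpace k) M]
    [IsManifold (HModel k) ∞ M] (g : Riem (HModel k) M) {f : M → ℝ}
    (hf : ContMDiff (HModel k) 𝓘(ℝ, ℝ) ∞ f) (p : M) :
    ∃ B : ℝ, ∀ᶠ y in 𝓝 p, ∀ v, (dform (k := k) f y v) ^ 2 ≤ B * g.inner y v v := by
  let _ : RiemannianBundle (fun x : M => TangentSpace (HModel k) x) := ⟨g.toRiemannianMetric⟩
  have : IsContinuousRiemannianBundle (𝔼 k)
      (fun x : M => TangentSpace (HModel k) x) :=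
    ⟨g.inner, g.contMDiff.continuous, fun _ _ _ => rfl⟩
  let V := 𝔼 k
  obtain ⟨C, hC, hC'⟩ := eventually_norm_trivializationAt_lt V
    (fun x : M => TangentSpace (HModel k) x) p
  have h1 : ContinuousAt (inTangentCoordinates (HModel k) 𝓘(ℝ, ℝ) id f
      (mfderiv (HModel k) 𝓘(ℝ, ℝ) f) p) p :=
    ((hf p).mfderiv_const (m := ∞) (by simp)).continuousAt
  let d := inTangentCoordinates (HModel k) 𝓘(ℝ, ℝ) id f (mfderiv (HModel k) 𝓘(ℝ, ℝ) f) p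
  let A := ‖d p‖ + 1
  have h2 : ∀ᶠ y in 𝓝 p, ‖d y‖ < A := h1.norm.eventually (gt_mem_nhds (lt_add_one _))
  refine ⟨(A * C) ^ 2, ?_⟩
  filter_upwards [hC', h2, chart_source_mem_nhds (HSpace k) p] with y hy1 hy2 hy3 v
  let e := trivializationAt V (fun x : M => TangentSpace (HModel k) x) p
  have hye : y ∈ e.baseSet := hy3
  have h3 : dform (k := k) f y v = d y (e.continuousLinearMapAt ℝ y v) := by
    have : IsManifold (HModel k) 1 M := IsManifold.of_le (n := ∞) (by exact_mod_cast le_top)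
    change _ = (inTangentCoordinates (HModel k) 𝓘(ℝ, ℝ) id f (mfderiv (HModel k) 𝓘(ℝ, ℝ) f) p y)
      (e.continuousLinearMapAt ℝ y v)
    rw [inTangentCoordinates_eq_mfderiv_comp (I := HModel k) (I' := 𝓘(ℝ, ℝ)) (f := id) (g := f)
      (x₀ := p) (x := y) hy3 (by rw [chartAt_self_eq]; exact mem_univ _),
      TangentBundle.continuousLinearMapAt_trivializationAt hy3]
    have h7 := DFunLike.congr_fun (mfderivWithin_extChartAt_symm_comp_mfderiv_extChartAt'
      (I := HModel k) (x := p) (y := y) (by rw [extChartAt_source]; exact hy3)) v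
    have h8 : mfderiv 𝓘(ℝ, ℝ) 𝓘(ℝ, ℝ) (extChartAt 𝓘(ℝ, ℝ) (f p)) (f y) =
        ContinuousLinearMap.id ℝ ℝ := by
      rw [extChartAt_model_space_eq_id]; exact mfderiv_id
    rw [h8]
    exact (congrArg (mfderiv (HModel k) 𝓘(ℝ, ℝ) f y) h7).symm
  have h4 : ‖e.continuousLinearMapAt ℝ y v‖ ≤ C * ‖v‖ :=
    ((e.continuousLinearMapAt ℝ y).le_opNorm v).trans
      (mul_le_mul_of_nonneg_right hy1.le (norm_nonneg _))
  have h5 : |dform (k := k) f y v| ≤ A * C * ‖v‖ := by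
    rw [h3]
    calc |d y (e.continuousLinearMapAt ℝ y v)| ≤ ‖d y‖ * ‖e.continuousLinearMapAt ℝ y v‖ :=
          (d y).le_opNorm _
      _ ≤ A * (C * ‖v‖) := mul_le_mul hy2.le h4 (norm_nonneg _) (by positivity)
      _ = _ := by ring
  have h6 : g.inner y v v = ‖v‖ ^ 2 := by
    rw [← real_inner_self_eq_norm_sq]; rfl
  rw [h6, ← sq_abs, ← mul_pow]
  exact pow_le_pow_left₀ (abs_nonneg _) h5 2

theorem continuousAt_riem_inner {k : ℕ} {M : Type*} [TopologicalSpace M]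
    [ChartedSpace (HSpace k) M]
    [IsManifold (HModel k) ∞ M] (g : Riem (HModel k) M) {V : ∀ x : M, TangentSpace (HModel k) x}
    {x : M} (hV : ContMDiffAt (HModel k) (HModel k).tangent ∞
      (fun x => (⟨x, V x⟩ : TangentBundle (HModel k) M)) x) :
    ContinuousAt (fun y => g.inner y (V y) (V y)) x := by
  let _ : RiemannianBundle (fun x : M => TangentSpace (HModel k) x) := ⟨g.toRiemannianMetric⟩
  have : IsContinuousRiemannianBundle (𝔼 k)
      (fun x : M => TangentSpace (HModel k) x) :=
    ⟨g.inner, g.contMDiff.continuous, fun _ _ _ => rfl⟩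
  exact ContinuousAt.inner_bundle (F := 𝔼 k) (b := fun x : M => x)
    (E := fun x : M => TangentSpace (HModel k) x) (v := V) (w := V)
    hV.continuousAt hV.continuousAt

end Calculus
/-! ### The differential of a cone chart -/

namespace ConeChart

variable {W : FibPM l L n m X}
  {U : Set W.Sing} (τ : ConeChart W♭ l L U)

/-- The differential of the cone chart. -/
def dparam (p : W.Sing × L × ℝ) :
    𝔼 m × 𝔼 l × ℝ →L[ℝ] 𝔼 n :=
  mfderiv ((HModel m).prod ((𝓡 l).prod 𝓘(ℝ, ℝ))) (HModel n) τ.param p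

theorem isOpen_domain (hU : IsOpen U) : IsOpen {q : W.Sing × L × ℝ | q.1 ∈ U ∧ 0 < q.2.2} :=
  (hU.preimage continuous_fst).inter (isOpen_Ioi.preimage (continuous_snd.comp continuous_snd))

theorem contMDiffAt_param (hU : IsOpen U) {p : W.Sing × L × ℝ} (hp : p.1 ∈ U) (hr : 0 < p.2.2) :
    ContMDiffAt ((HModel m).prod ((𝓡 l).prod 𝓘(ℝ, ℝ))) (HModel n) ∞ τ.param p :=
  τ.smooth_param.contMDiffAt ((isOpen_domain hU).mem_nhds ⟨hp, hr⟩)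

theorem hasMFDerivAt_param (hU : IsOpen U) {p : W.Sing × L × ℝ} (hp : p.1 ∈ U) (hr : 0 < p.2.2) :
    HasMFDerivAt ((HModel m).prod ((𝓡 l).prod 𝓘(ℝ, ℝ))) (HModel n) τ.param p (τ.dparam p) :=
  ((τ.contMDiffAt_param hU hp hr).mdifferentiableAt (by simp)).hasMFDerivAt

theorem mem_tube {p : W.Sing × L × ℝ} (hp : p.1 ∈ U) (hr : 0 < p.2.2) :
    (τ.param p).1 ∈ W.tube := (τ.param_mem p.1 hp p.2.1 p.2.2 hr).1

theorem projExt_param (y₀ : W.Sing) {p : W.Sing × L × ℝ} (hp : p.1 ∈ U) (hr : 0 < p.2.2) :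
    W.projExt y₀ (τ.param p) = p.1 := by
  obtain ⟨h, h1, -⟩ := τ.param_mem p.1 hp p.2.1 p.2.2 hr
  rw [projExt, dif_pos h]; exact h1

theorem radExt_param {p : W.Sing × L × ℝ} (hp : p.1 ∈ U) (hr : 0 < p.2.2) :
    W.radExt (τ.param p) = p.2.2 := by
  obtain ⟨h, -, h1⟩ := τ.param_mem p.1 hp p.2.1 p.2.2 hr
  rw [radExt, dif_pos h]; exact h1

theorem dproj_dparam (hU : IsOpen U) (y₀ : W.Sing) {p : W.Sing × L × ℝ} (hp : p.1 ∈ U)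
    (hr : 0 < p.2.2) (v : 𝔼 m) (w : 𝔼 l) (s : ℝ) :
    W.dproj y₀ (τ.param p) (τ.dparam p (v, w, s)) = v := by
  have h1 := ((W.smooth_proj y₀ _ (τ.mem_tube hp hr)).mdifferentiableAt (by simp)).hasMFDerivAt
  have h2 := h1.comp p (τ.hasMFDerivAt_param hU hp hr)
  have h3 : HasMFDerivAt ((HModel m).prod ((𝓡 l).prod 𝓘(ℝ, ℝ))) (HModel m)
      (W.projExt y₀ ∘ τ.param) p (ContinuousLinearMap.fst ℝ (𝔼 m)
        (𝔼 l × ℝ)) := by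
    refine (hasMFDerivAt_fst p).congr_of_eventuallyEq ?_
    filter_upwards [(isOpen_domain hU).mem_nhds ⟨hp, hr⟩] with q hq
    exact τ.projExt_param y₀ hq.1 hq.2
  exact DFunLike.congr_fun (hasMFDerivAt_unique h2 h3) (v, w, s)

theorem drad_dparam (hU : IsOpen U) {p : W.Sing × L × ℝ} (hp : p.1 ∈ U)
    (hr : 0 < p.2.2) (v : 𝔼 m) (w : 𝔼 l) (s : ℝ) :
    W.drad (τ.param p) (τ.dparam p (v, w, s)) = s := by
  have h1 := ((W.smooth_rad _ (τ.mem_tube hp hr)).mdifferentiableAt (by simp)).hasMFDerivAt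
  have h2 := h1.comp p (τ.hasMFDerivAt_param hU hp hr)
  have h3 : HasMFDerivAt ((HModel m).prod ((𝓡 l).prod 𝓘(ℝ, ℝ))) 𝓘(ℝ, ℝ)
      (W.radExt ∘ τ.param) p ((ContinuousLinearMap.snd ℝ (𝔼 l) ℝ).comp
        (ContinuousLinearMap.snd ℝ (𝔼 m) (𝔼 l × ℝ))) := by
    refine ((hasMFDerivAt_snd p.2).comp p (hasMFDerivAt_snd p)).congr_of_eventuallyEq ?_
    filter_upwards [(isOpen_domain hU).mem_nhds ⟨hp, hr⟩] with q hq
    exact τ.radExt_param hq.1 hq.2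
  exact DFunLike.congr_fun (hasMFDerivAt_unique h2 h3) (v, w, s)

/-- A tangent vector is determined by its images along `Y` and `ρ`, up to a vector along the link. -/
theorem dparam_surjective (hU : IsOpen U) (y₀ : W.Sing) {p : W.Sing × L × ℝ} (hp : p.1 ∈ U)
    (hr : 0 < p.2.2) (z : 𝔼 n) :
    ∃ w : 𝔼 l,
      τ.dparam p ((W.dproj y₀ (τ.param p) z : 𝔼 m), w,
        W.drad (τ.param p) z) = z := by
  have ht := τ.mem_tube hp hr
  have hpr : W.proj ⟨_, ht⟩ ∈ U := by
    obtain ⟨h, h1, -⟩ := τ.param_mem p.1 hp p.2.1 p.2.2 hr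
    rw [h1]; exact hp
  have h1 := ((W.smooth_proj y₀ _ ht).mdifferentiableAt (by simp)).hasMFDerivAt
  have h2 := ((W.smooth_rad _ ht).mdifferentiableAt (by simp)).hasMFDerivAt
  have h3 := ((τ.smooth_link _ ht hpr).mdifferentiableAt (by simp)).hasMFDerivAt
  have h4 := h1.prodMk (h3.prodMk h2)
  have hΨ : (W.projExt y₀ (τ.param p), τ.link (τ.param p), W.radExt (τ.param p)) = p := by
    rw [τ.projExt_param y₀ hp hr, τ.radExt_param hp hr, τ.link_param p.1 hp p.2.1 p.2.2 hr]
  have h5 : ∀ p', p' = p → HasMFDerivAt ((HModel m).prod ((𝓡 l).prod 𝓘(ℝ, ℝ))) (HModel n)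
      τ.param p' (τ.dparam p) := by
    rintro _ rfl; exact τ.hasMFDerivAt_param hU hp hr
  have h6 := HasMFDerivAt.comp (τ.param p) (h5 _ hΨ) h4
  have h7 : HasMFDerivAt (HModel n) (HModel n) (τ.param ∘ fun x => (W.projExt y₀ x, τ.link x,
      W.radExt x)) (τ.param p) (ContinuousLinearMap.id ℝ (𝔼 n)) := by
    refine (hasMFDerivAt_id (I := HModel n) (τ.param p)).congr_of_eventuallyEq ?_
    have hc : ContinuousAt (W.projExt y₀) (τ.param p) := (W.smooth_proj y₀ _ ht).continuousAt
    filter_upwards [hc.preimage_mem_nhds (hU.mem_nhds (by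
      rw [τ.projExt_param y₀ hp hr]; exact hp)), (W.isOpen_tube.preimage
      continuous_subtype_val).mem_nhds ht] with x hx hxt
    have h8 : W.projExt y₀ x = W.proj ⟨x.1, hxt⟩ := projExt_of_mem y₀ hxt
    have h9 : W.radExt x = W.rad ⟨x.1, hxt⟩ := dif_pos hxt
    rw [mem_preimage, h8] at hx
    change τ.param (W.projExt y₀ x, τ.link x, W.radExt x) = x
    rw [h8, h9]
    exact τ.param_link x hxt hx
  exact ⟨_, DFunLike.congr_fun (hasMFDerivAt_unique h6 h7) z⟩

end ConeChart

/-! ### Lifting vectors along which `f` increases -/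

section Lift

variable {W : FibPM l L n m X}

theorem grad_spec {k : ℕ} {M : Type*} [TopologicalSpace M] [ChartedSpace (HSpace k) M]
    [IsManifold (HModel k) ∞ M] (g : Riem (HModel k) M) (f : M → ℝ) (x : M)
    (v : TangentSpace (HModel k) x) : g.inner x (grad (k := k) g f x) v = dform (k := k) f x v :=
  (exists_grad (k := k) g f x).choose_spec v

/-- The bilinear form of a Riemannian metric at a point. -/
def Riem.form {E : Type*} [NormedAddCommGroup E] [NormedSpace ℝ E] {H : Type*} [TopologicalSpace H]
    {I : ModelWithCorners ℝ E H} {M : Type*} [TopologicalSpace M] [ChartedSpace H M]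
    [IsManifold I ∞ M] (g : Riem I M) (x : M) : E →ₗ[ℝ] E →ₗ[ℝ] ℝ :=
  LinearMap.mk₂ ℝ (fun u v : E => (g.inner x u v : ℝ))
    (fun u u' v => DFunLike.congr_fun ((g.inner x).map_add u u') v)
    (fun c u v => DFunLike.congr_fun ((g.inner x).map_smul c u) v)
    (fun u v v' => (g.inner x u).map_add v v') (fun c u v => (g.inner x u).map_smul c v)

/-- The pairing of `exists_lift_pairing` is positive close to the singular stratum, given bounds on
the vectors involved. -/
theorem pairing_pos {Y : Type*} [AddCommGroup Y] [Module ℝ Y] (g : Y →ₗ[ℝ] Y →ₗ[ℝ] ℝ)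
    (hs : ∀ u v, g u v = g v u) (hg : ∀ v, v ≠ 0 → 0 < g v v) {v' GY χ ζ : Y}
    {C r s' A a B Cχ D : ℝ} (hA : 0 < A) (ha : 0 < a) (hr : 0 < r) (hr1 : r ≤ 1)
    (hv' : v' = GY - r ^ 2 • χ) (hs' : |s'| < A * r) (e1 : a / 2 < g GY ζ) (e2 : g χ χ ≤ |Cχ|)
    (e3 : g ζ ζ ≤ |D|) (e4 : g GY GY ≤ |B|)
    (hra : r < a / (4 * ((|Cχ| + |D|) / 2 +
      (|C| + 1) / 2 * (A ^ 2 + 2 * |B| + 2 * |Cχ| + |D|) + 1))) :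
    0 < g v' ζ - |C| * r / 2 * (s' ^ 2 + g v' v' + g ζ ζ) := by
  have hg0 : ∀ v, 0 ≤ g v v := fun v => by
    by_cases hv : v = 0
    · simp [hv]
    · exact (hg v hv).le
  have hC := abs_nonneg C
  have hCχ := abs_nonneg Cχ
  have hD := abs_nonneg D
  have hB := abs_nonneg B
  have e5 : g v' ζ = g GY ζ - r ^ 2 * g χ ζ := by
    rw [hv']; simp [map_sub, map_smul]
  have e6 : g χ ζ ≤ (g χ χ + g ζ ζ) / 2 := by
    have h2 := quadratic_add g hs χ (-ζ)
    have h3 := hg0 (χ + -ζ)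
    rw [h2] at h3
    simp only [map_neg, LinearMap.neg_apply, neg_neg] at h3
    linarith
  have e7 : g v' v' ≤ 2 * g GY GY + 2 * (r ^ 4 * g χ χ) := by
    have h2 := quadratic_add g hs GY (-(r ^ 2 • χ))
    have h3 := quadratic_add g hs GY (r ^ 2 • χ)
    have h4 := hg0 (GY + r ^ 2 • χ)
    have h5 : v' = GY + -(r ^ 2 • χ) := by rw [hv']; abel
    rw [h5, h2]
    rw [h3] at h4
    simp only [map_neg, map_smul, LinearMap.neg_apply, LinearMap.smul_apply, smul_eq_mul]
      at h4 ⊢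
    linear_combination h4
  have e8 : s' ^ 2 ≤ A ^ 2 := by
    rw [sq_le_sq, abs_of_pos hA]
    nlinarith
  have hr22 : r ^ 2 ≤ r := by nlinarith
  have hr24 : r ^ 4 ≤ 1 := pow_le_one₀ hr.le hr1
  have hχ0 := hg0 χ
  have e9 : g v' v' ≤ 2 * |B| + 2 * |Cχ| := by
    have h2 : r ^ 4 * g χ χ ≤ 1 * |Cχ| := mul_le_mul hr24 e2 hχ0 zero_le_one
    linarith
  have e10 : r ^ 2 * g χ ζ ≤ r * ((|Cχ| + |D|) / 2) := by
    have h2 : g χ ζ ≤ (|Cχ| + |D|) / 2 := by linarith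
    calc r ^ 2 * g χ ζ ≤ r ^ 2 * ((|Cχ| + |D|) / 2) :=
          mul_le_mul_of_nonneg_left h2 (sq_nonneg r)
      _ ≤ r * ((|Cχ| + |D|) / 2) := mul_le_mul_of_nonneg_right hr22 (by positivity)
  have e11 : |C| * r / 2 * (s' ^ 2 + g v' v' + g ζ ζ) ≤
      r * ((|C| + 1) / 2 * (A ^ 2 + 2 * |B| + 2 * |Cχ| + |D|)) := by
    have h2 : s' ^ 2 + g v' v' + g ζ ζ ≤ A ^ 2 + 2 * |B| + 2 * |Cχ| + |D| := by linarith
    have h4 : 0 ≤ s' ^ 2 + g v' v' + g ζ ζ := by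
      have := hg0 v'; have := hg0 ζ; positivity
    have h3 : |C| * r / 2 ≤ r * ((|C| + 1) / 2) := by linarith
    calc |C| * r / 2 * (s' ^ 2 + g v' v' + g ζ ζ)
        ≤ r * ((|C| + 1) / 2) * (s' ^ 2 + g v' v' + g ζ ζ) := mul_le_mul_of_nonneg_right h3 h4
      _ ≤ r * ((|C| + 1) / 2) * (A ^ 2 + 2 * |B| + 2 * |Cχ| + |D|) :=
          mul_le_mul_of_nonneg_left h2 (by positivity)
      _ = _ := by ring
  set K := (|Cχ| + |D|) / 2 + (|C| + 1) / 2 * (A ^ 2 + 2 * |B| + 2 * |Cχ| + |D|) with hK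
  have hK0 : 0 ≤ K := by positivity
  have e12 : r * K ≤ a / 4 := by
    rw [lt_div_iff₀ (by positivity)] at hra
    linarith
  have e13 : r * K = r * ((|Cχ| + |D|) / 2) +
    r * ((|C| + 1) / 2 * (A ^ 2 + 2 * |B| + 2 * |Cχ| + |D|)) := by rw [hK]; ring
  rw [e5]
  linarith

/-- Let the vector field `ζ` on the singular stratum increase `f` at `p`. Near `p`, it has lifts
to the regular stratum tangent to the level sets of `ρ` which increase `f`. -/
theorem exists_lift_increasing (g : WedgeMetric W) {f : X → ℝ} (hf : IsSmoothFun W♭ f)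
    {ε₀ : ℝ} (hε₀ : 0 < ε₀) (hproj : WeakControlProj g (negGrad g f) ε₀)
    (hrad : WeakControlRad W♭ (negGrad g f) ε₀) (p : W.Sing)
    {ζ : ∀ y : W.Sing, TangentSpace (HModel m) y} (hζ : IsSmoothVF (HModel m) ζ)
    (hp : 0 < dform (k := m) (onSing W♭ f) p (ζ p)) :
    ∃ (U : Set W.Sing) (τ : ConeChart W♭ l L U) (ε : ℝ) (U' : Set W.Sing),
      IsOpen U ∧ IsOpen U' ∧ p ∈ U' ∧ U' ⊆ U ∧ 0 < ε ∧ ∀ y ∈ U', ∀ (q : L) (r : ℝ), 0 < r → r < ε →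
        ∃ w : 𝔼 l, 0 < dform (k := n) (onReg W♭ f)
          (τ.param (y, q, r)) (τ.dparam (y, q, r) ((ζ y : 𝔼 m), w, 0)) := by
  obtain ⟨U, τ, h, C, ε₁, hU, hpU, hε₁, hsub, hest⟩ := g.conic p
  obtain ⟨χ, Cχ, hχ, hproj⟩ := hproj
  obtain ⟨A, hA, hrad⟩ := hrad
  obtain ⟨B, hB⟩ := exists_dform_sq_le g.sing hf.smooth_sing p
  set a := dform (k := m) (onSing W♭ f) p (ζ p) with ha
  have hc1 : ContinuousAt (fun y => (dform (k := m) (onSing W♭ f) y (ζ y) : ℝ)) p :=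
    (contMDiffAt_mfderiv_apply hf.smooth_sing hζ.contMDiffAt).continuousAt
  have hc2 := continuousAt_riem_inner g.sing (hζ.contMDiffAt (x := p))
  let D₀ := g.sing.inner p (ζ p) (ζ p) + 1
  have hev : ∀ᶠ y in 𝓝 p, (∀ v, (dform (k := m) (onSing W♭ f) y v) ^ 2
      ≤ B * g.sing.inner y v v) ∧ a / 2 < dform (k := m) (onSing W♭ f) y (ζ y) ∧
      g.sing.inner y (ζ y) (ζ y) < D₀ ∧ y ∈ U :=
    hB.and ((hc1.eventually (lt_mem_nhds (by linarith))).and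
      ((hc2.eventually (gt_mem_nhds (lt_add_one _))).and (hU.mem_nhds hpU)))
  obtain ⟨U', hU', hU'o, hpU'⟩ := eventually_nhds_iff.1 hev
  -- constants
  let C' := |C| + 1
  let B' := |B|
  let Cχ' := |Cχ|
  let Kc := (Cχ' + |D₀|) / 2 + C' / 2 * (A ^ 2 + 2 * B' + 2 * Cχ' + |D₀|)
  have hC' : 0 < C' := by positivity
  have hKc : 0 ≤ Kc := by positivity
  let ε := min (min ε₀ ε₁) (min (min 1 (1 / C')) (a / (4 * (Kc + 1))))
  have hε : 0 < ε := by
    refine lt_min (lt_min hε₀ hε₁) (lt_min (lt_min one_pos (by positivity)) ?_)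
    exact div_pos hp (by positivity)
  refine ⟨U, τ, ε, U', hU, hU'o, hpU', fun y hy => (hU' y hy).2.2.2, hε, ?_⟩
  intro y hy q r hr hrε
  obtain ⟨hy1, hy2, hy3, hyU⟩ := hU' y hy
  have hr0 : r < ε₀ := hrε.trans_le ((min_le_left _ _).trans (min_le_left _ _))
  have hr1 : r < ε₁ := hrε.trans_le ((min_le_left _ _).trans (min_le_right _ _))
  have hr2 : r < 1 := hrε.trans_le ((min_le_right _ _).trans ((min_le_left _ _).trans
    (min_le_left _ _)))
  have hr3 : r < 1 / C' := hrε.trans_le ((min_le_right _ _).trans ((min_le_left _ _).trans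
    (min_le_right _ _)))
  have hr4 : r < a / (4 * (Kc + 1)) := hrε.trans_le ((min_le_right _ _).trans (min_le_right _ _))
  set P : W.Sing × L × ℝ := (y, q, r) with hP
  set x := τ.param P with hx
  by_cases hK : ∃ w₁ : 𝔼 l,
      dform (k := n) (onReg W♭ f) x (τ.dparam P (0, w₁, 0)) ≠ 0
  · obtain ⟨w₁, hw₁⟩ := hK
    set d := dform (k := n) (onReg W♭ f) x (τ.dparam P (0, w₁, 0)) with hd
    set d₀ := dform (k := n) (onReg W♭ f) x
      (τ.dparam P ((ζ y : 𝔼 m), 0, 0)) with hd₀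
    refine ⟨((1 - d₀) / d) • w₁, ?_⟩
    have h1 : ∀ z : 𝔼 m, ((z, ((1 - d₀) / d) • w₁, (0 : ℝ)) :
        𝔼 m × 𝔼 l × ℝ) =
        (z, 0, 0) + ((1 - d₀) / d) • (0, w₁, 0) := fun z => by
      ext <;> simp
    have h2 : τ.dparam P ((ζ y : 𝔼 m), ((1 - d₀) / d) • w₁, (0 : ℝ)) =
        τ.dparam P ((ζ y : 𝔼 m), 0, 0) +
          ((1 - d₀) / d) • τ.dparam P (0, w₁, 0) := by
      rw [← (τ.dparam P).map_smul, ← (τ.dparam P).map_add]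
      exact congrArg _ (h1 (ζ y))
    have h3 := (dform (k := n) (onReg W♭ f) x).map_add
      (τ.dparam P ((ζ y : 𝔼 m), 0, 0)) (((1 - d₀) / d) • τ.dparam P (0, w₁, 0))
    have h4 := (dform (k := n) (onReg W♭ f) x).map_smul ((1 - d₀) / d)
        (τ.dparam P (0, w₁, 0))
    have h5 : d₀ + (1 - d₀) / d * d = 1 := by field_simp; ring
    refine lt_of_lt_of_eq one_pos (h5.symm.trans ?_)
    rw [h2]
    refine Eq.trans ?_ h3.symm
    refine congrArg (d₀ + ·) h4.symm
  · push Not at hK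
    set G : 𝔼 n := grad (k := n) g.reg (onReg W♭ f) x with hG
    obtain ⟨w', hw'⟩ := τ.dparam_surjective hU y (p := P) hyU hr G
    set v' : 𝔼 m := W.dproj y x G with hv'
    set s' : ℝ := W.drad x G with hs'
    have hht : x.1 ∈ W.tube := τ.mem_tube (p := P) hyU hr
    have hrx : W.radExt x = r := τ.radExt_param (p := P) hyU hr
    have hpx : W.projExt y x = y := τ.projExt_param y (p := P) hyU hr
    set GY : 𝔼 m := grad (k := m) g.sing (onSing W♭ f) y with hGY
    set χy : 𝔼 m := χ y with hχy
    have hv'eq : v' = GY - r ^ 2 • χy := by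
      have h1 : W.dproj y x (-G) = _ := hproj y x hht (by rw [hrx]; exact hr0)
      have h2 : ∀ y', y' = y → ((negGrad g f).sing y' + r ^ 2 • χ y' : 𝔼 m) =
          -GY + r ^ 2 • χy := by rintro _ rfl; rfl
      have h3 : -v' = -GY + r ^ 2 • χy := by
        rw [← h2 _ hpx, ← hrx]
        exact ((map_neg (W.dproj y x) G).symm.trans h1)
      rw [← neg_inj, h3]; abel
    have hs'A : |s'| < A * r := by
      have h1 : |W.drad x (-G)| < A * W.radExt x := hrad x hht (by rw [hrx]; exact hr0)
      rw [hrx] at h1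
      have h2 : W.drad x (-G) = -s' := map_neg _ _
      rwa [h2, abs_neg] at h1
    let gY := Riem.form g.sing y
    have hgYs : ∀ u v, gY u v = gY v u := fun u v => g.sing.symm y u v
    have hgYp : ∀ v, v ≠ 0 → 0 < gY v v := fun v hv => g.sing.pos y v hv
    have hGYd : ∀ v, gY GY v = dform (k := m) (onSing W♭ f) y v := fun v =>
      grad_spec g.sing _ y v
    obtain ⟨w, hw⟩ := exists_lift_pairing (κ₀ := C * r) (r := r) (τ.dparam P).toLinearMap
      (Riem.form g.reg x) (fun u v => g.reg.symm x u v) (fun v hv => g.reg.pos x v hv)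
      gY hgYs hgYp (Riem.form h (y, q)) (fun u v => h.symm _ u v) (fun v hv => h.pos _ v hv)
      (fun v w hw => hsub y hyU q v w hw)
      (by
        have h1 : C' * r ≤ 1 := by
          rw [lt_div_iff₀ hC'] at hr3; linarith
        rw [abs_mul, abs_of_pos hr]
        have h2 : |C| * r ≤ C' * r := mul_le_mul_of_nonneg_right (by simp [C']) hr.le
        linarith)
      (fun v w s => hest y hyU q r hr hr1 v w s)
      v' w' s' (fun w₁ => by
        have h1 : (τ.dparam P).toLinearMap (v', w', s') = G := hw'
        rw [h1]
        exact (grad_spec g.reg _ x _).trans (hK w₁)) (ζ y)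
    refine ⟨w, ?_⟩
    have h1 : Riem.form g.reg x ((τ.dparam P).toLinearMap (v', w', s'))
        ((τ.dparam P).toLinearMap ((ζ y : 𝔼 m), w, 0)) =
        dform (k := n) (onReg W♭ f) x
          (τ.dparam P ((ζ y : 𝔼 m), w, 0)) := by
      have h1 : (τ.dparam P).toLinearMap (v', w', s') = G := hw'
      rw [h1]
      exact grad_spec g.reg _ x _
    rw [h1, abs_mul, abs_of_pos hr] at hw
    refine lt_of_lt_of_le ?_ hw
    refine pairing_pos gY hgYs hgYp (GY := GY) (χ := χy) hA hp hr hr2.le hv'eq hs'A ?_ ?_ ?_ ?_ hr4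
    · exact hy2.trans_eq (hGYd (ζ y)).symm
    · exact (hχ y).trans (le_abs_self _)
    · exact hy3.le.trans (le_abs_self _)
    · have h2 := hy1 GY
      rw [← hGYd] at h2
      have h3 : (gY GY GY) ^ 2 ≤ B * gY GY GY := h2
      by_cases h5 : GY = 0
      · rw [h5]; simp
      · have h6 := hgYp GY h5
        have : gY GY GY ≤ B := by nlinarith
        exact this.trans (le_abs_self _)

end Lift

/-! ### Controlled vector fields which increase `f` on a level set -/

section LocalFields

variable {E : Type*} [NormedAddCommGroup E] [NormedSpace ℝ E]
  {H : Type*} [TopologicalSpace H] {I : ModelWithCorners ℝ E H}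
  {M : Type*} [TopologicalSpace M] [ChartedSpace H M] [IsManifold I ∞ M]

theorem exists_local_field (x₀ : M) (v₀ : TangentSpace I x₀) :
    ∃ s : ∀ x : M, TangentSpace I x, ContMDiffOn I I.tangent ∞
      (fun x => (⟨x, s x⟩ : TangentBundle I M)) (chartAt H x₀).source ∧ s x₀ = v₀ ∧
      (v₀ = 0 → ∀ x, s x = 0) := by
  have : IsManifold I 1 M := IsManifold.of_le (n := ∞) (by exact_mod_cast le_top)
  let e := trivializationAt E (TangentSpace I) x₀
  have hb : e.baseSet = (chartAt H x₀).source := rfl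
  refine ⟨fun x => e.symmL ℝ x (e.continuousLinearMapAt ℝ x₀ v₀), ?_, ?_, ?_⟩
  · refine (e.contMDiffOn_section_iff (chartAt H x₀).open_source hb.ge).2 ?_
    refine (contMDiffOn_const (c := e.continuousLinearMapAt ℝ x₀ v₀)).congr fun x hx => ?_
    have h1 : e.continuousLinearMapAt ℝ x (e.symmL ℝ x (e.continuousLinearMapAt ℝ x₀ v₀)) =
      e.continuousLinearMapAt ℝ x₀ v₀ := e.continuousLinearMapAt_symmL (hb ▸ hx) _
    rw [e.continuousLinearMapAt_apply_of_mem ℝ (hb ▸ hx)] at h1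
    exact h1
  · exact e.symmL_continuousLinearMapAt (hb ▸ mem_chart_source H x₀) v₀
  · rintro rfl x
    change e.symmL ℝ x (e.continuousLinearMapAt ℝ x₀ 0) = 0
    rw [map_zero, map_zero]

end LocalFields

theorem exists_local_field_level {k : ℕ} {M : Type*} [TopologicalSpace M]
    [ChartedSpace (HSpace k) M] [IsManifold (HModel k) ∞ M] {f : M → ℝ}
    (hf : ContMDiff (HModel k) 𝓘(ℝ, ℝ) ∞ f) {c δ : ℝ} (hδ : 0 < δ)
    (hreg : ∀ x, f x = c → dform (k := k) f x ≠ 0) (x₀ : M) :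
    ∃ U ∈ 𝓝 x₀, ∃ s : ∀ x : M, TangentSpace (HModel k) x,
      ContMDiffOn (HModel k) (HModel k).tangent ∞
        (fun x => (⟨x, s x⟩ : TangentBundle (HModel k) M)) U ∧
      ∀ x ∈ U, (f x = c → 0 < dform (k := k) f x (s x)) ∧ (δ ≤ |f x - c| → s x = 0) := by
  by_cases hc : f x₀ = c
  · obtain ⟨v₀, hv₀⟩ : ∃ v₀, 0 < dform (k := k) f x₀ v₀ := by
      obtain ⟨v, hv⟩ : ∃ v, dform (k := k) f x₀ v ≠ 0 := by
        by_contra! h; exact hreg x₀ hc (ContinuousLinearMap.ext h)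
      rcases hv.lt_or_gt with h | h
      · exact ⟨-v, by rw [map_neg]; linarith⟩
      · exact ⟨v, h⟩
    obtain ⟨s, hs, hs0, -⟩ := exists_local_field (I := HModel k) x₀ v₀
    have h1 : ContinuousAt (fun x => (dform (k := k) f x (s x) : ℝ)) x₀ :=
      (contMDiffAt_mfderiv_apply hf (hs.contMDiffAt (chart_source_mem_nhds _ x₀))).continuousAt
    have h2 : ∀ᶠ x in 𝓝 x₀, 0 < dform (k := k) f x (s x) :=
      h1.eventually (lt_mem_nhds (hv₀.trans_eq (congrArg (dform (k := k) f x₀) hs0.symm)))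
    have h3 : ∀ᶠ x in 𝓝 x₀, |f x - c| < δ := by
      have : ContinuousAt (fun x => |f x - c|) x₀ :=
        ((hf.continuous.sub continuous_const).abs).continuousAt
      exact this.eventually (gt_mem_nhds (by simpa [hc] using hδ))
    refine ⟨_, Filter.inter_mem (chart_source_mem_nhds (HSpace k) x₀) (h2.and h3), s,
      hs.mono inter_subset_left, fun x hx => ⟨fun _ => hx.2.1, fun h => ?_⟩⟩
    exact absurd h (not_le.2 hx.2.2)
  · refine ⟨{x | f x ≠ c}, (isOpen_ne_fun hf.continuous continuous_const).mem_nhds hc,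
      fun x => 0, (contMDiff_zeroSection ℝ (TangentSpace (HModel k) : M → Type _)).contMDiffOn,
      fun x hx => ⟨fun h => absurd h hx, fun _ => rfl⟩⟩

/-- A smooth vector field which increases `f` on the level set `f = c` and vanishes away from it. -/
theorem exists_field_level {k : ℕ} {M : Type*} [TopologicalSpace M]
    [ChartedSpace (HSpace k) M] [IsManifold (HModel k) ∞ M] [SigmaCompactSpace M] [T2Space M]
    {f : M → ℝ} (hf : ContMDiff (HModel k) 𝓘(ℝ, ℝ) ∞ f) {c δ : ℝ} (hδ : 0 < δ)
    (hreg : ∀ x, f x = c → dform (k := k) f x ≠ 0) :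
    ∃ V : ∀ x : M, TangentSpace (HModel k) x, IsSmoothVF (HModel k) V ∧
      (∀ x, f x = c → 0 < dform (k := k) f x (V x)) ∧ ∀ x, δ ≤ |f x - c| → V x = 0 := by
  obtain ⟨s, hs⟩ := exists_contMDiffSection_forall_mem_convex_of_local (HModel k) (n := (⊤ : ℕ∞))
    (F_fiber := 𝔼 k) (fun x : M => TangentSpace (HModel k) x)
    (fun x => {v | (f x = c → 0 < dform (k := k) f x v) ∧ (δ ≤ |f x - c| → v = 0)})
    (fun x v hv w hw a b ha hb hab => ⟨fun h => by
      have h1 := hv.1 h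
      have h2 := hw.1 h
      rw [map_add, map_smul, map_smul, smul_eq_mul, smul_eq_mul]
      rcases ha.eq_or_lt with rfl | ha
      · have : b = 1 := by linarith
        rw [this]; linarith
      · have := mul_pos ha h1
        have := mul_nonneg hb h2.le
        linarith, fun h => by rw [hv.2 h, hw.2 h, smul_zero, smul_zero, add_zero]⟩)
    (fun x₀ => by
      obtain ⟨U, hU, s, hs, h⟩ := exists_local_field_level hf hδ hreg x₀
      exact ⟨U, hU, s, hs, h⟩)
  exact ⟨fun x => s x, s.contMDiff, fun x => (hs x).1, fun x => (hs x).2⟩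

section ConeFields

variable {W : FibPM l L n m X}

/-- The coordinates of a point in a cone chart. -/
def ConeChart.coord {U : Set W.Sing} (τ : ConeChart W♭ l L U) (y₀ : W.Sing)
    (x : W.Reg) : W.Sing × L × ℝ := (W.projExt y₀ x, τ.link x, W.radExt x)

theorem ConeChart.param_coord {U : Set W.Sing} (τ : ConeChart W♭ l L U) {y₀ : W.Sing}
    {x : W.Reg} (ht : x.1 ∈ W.tube) (hx : W.projExt y₀ x ∈ U) : τ.param (τ.coord y₀ x) = x := by
  have h8 : W.projExt y₀ x = W.proj ⟨x.1, ht⟩ := projExt_of_mem y₀ ht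
  have h9 : W.radExt x = W.rad ⟨x.1, ht⟩ := dif_pos ht
  rw [h8] at hx
  rw [ConeChart.coord, h8, h9]
  exact τ.param_link x ht hx

theorem radExt_pos {x : W.Reg} (ht : x.1 ∈ W.tube) : 0 < W.radExt x := by
  rw [radExt_of_mem ht]; exact rho_pos x

theorem isOpen_tube_reg : IsOpen {x : W.Reg | x.1 ∈ W.tube} :=
  W.isOpen_tube.preimage continuous_subtype_val

/-- Smooth local lifts of a vector field on the singular stratum, tangent to the levels of `ρ`. -/
theorem ConeChart.exists_local_lift {U : Set W.Sing} (τ : ConeChart W♭ l L U)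
    (hU : IsOpen U) {ζ : ∀ y : W.Sing, TangentSpace (HModel m) y} (hζ : IsSmoothVF (HModel m) ζ)
    (y₀ : W.Sing) {x₀ : W.Reg} (ht : x₀.1 ∈ W.tube) (hx₀ : W.projExt y₀ x₀ ∈ U)
    (w₀ : 𝔼 l) :
    ∃ O ∈ 𝓝 x₀, ∃ s : ∀ x : W.Reg, TangentSpace (HModel n) x,
      ContMDiffOn (HModel n) (HModel n).tangent ∞
        (fun x => (⟨x, s x⟩ : TangentBundle (HModel n) W.Reg)) O ∧
      (∀ x ∈ O, x.1 ∈ W.tube ∧ (∀ y₁, W.dproj y₁ x (s x) = ζ (W.projExt y₁ x)) ∧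
        W.drad x (s x) = 0 ∧ (ζ (W.projExt y₀ x) = 0 → w₀ = 0 → s x = 0)) ∧
      s x₀ = τ.dparam (τ.coord y₀ x₀) (ζ (W.projExt y₀ x₀), w₀, 0) := by
  have i1 : IsManifold (HModel m) 1 W.Sing := IsManifold.of_le (n := ∞) (by exact_mod_cast le_top)
  have i2 : IsManifold (𝓡 l) 1 L := IsManifold.of_le (n := ∞) (by exact_mod_cast le_top)
  obtain ⟨wf, hwf, hwf0, hwfz⟩ := exists_local_field (I := 𝓡 l) (τ.link x₀) w₀
  let S : Set L := (chartAt (𝔼 l) (τ.link x₀)).source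
  have hprojU : ∀ {x : W.Reg} (h : x.1 ∈ W.tube), W.projExt y₀ x ∈ U → W.proj ⟨x.1, h⟩ ∈ U := by
    intro x h hx; rwa [projExt_of_mem y₀ h] at hx
  let O : Set W.Reg := {x | x.1 ∈ W.tube ∧ W.projExt y₀ x ∈ U ∧ τ.link x ∈ S}
  have hO : O ∈ 𝓝 x₀ := by
    have h1 : ContinuousAt (W.projExt y₀) x₀ := (W.smooth_proj y₀ _ ht).continuousAt
    have h2 : ContinuousAt τ.link x₀ := (τ.smooth_link x₀ ht (hprojU ht hx₀)).continuousAt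
    filter_upwards [isOpen_tube_reg.mem_nhds ht, h1.preimage_mem_nhds (hU.mem_nhds hx₀),
      h2.preimage_mem_nhds (chart_source_mem_nhds (𝔼 l) (τ.link x₀))] with x h3 h4 h5
    exact ⟨h3, h4, h5⟩
  let s : ∀ x : W.Reg, TangentSpace (HModel n) x := fun x =>
    τ.dparam (τ.coord y₀ x) (ζ (W.projExt y₀ x), wf (τ.link x), 0)
  have hsplit : ∀ x ∈ O, W.dproj y₀ x (s x) = ζ (W.projExt y₀ x) ∧ W.drad x (s x) = 0 := by
    intro x hx
    have hr : 0 < (τ.coord y₀ x).2.2 := radExt_pos hx.1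
    have h1 := τ.dproj_dparam hU y₀ (p := τ.coord y₀ x) hx.2.1 hr (ζ (W.projExt y₀ x))
      (wf (τ.link x)) 0
    have h2 := τ.drad_dparam hU (p := τ.coord y₀ x) hx.2.1 hr (ζ (W.projExt y₀ x))
      (wf (τ.link x)) 0
    have h3 : ∀ z : W.Reg, z = x → (W.dproj y₀ z (s x) : 𝔼 m) =
        ζ (W.projExt y₀ x) → (W.dproj y₀ x (s x) : 𝔼 m) =
        ζ (W.projExt y₀ x) := by rintro _ rfl h; exact h
    have h4 : ∀ z : W.Reg, z = x → W.drad z (s x) = 0 → W.drad x (s x) = 0 := by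
      rintro _ rfl h; exact h
    exact ⟨h3 _ (τ.param_coord hx.1 hx.2.1) h1, h4 _ (τ.param_coord hx.1 hx.2.1) h2⟩
  refine ⟨O, hO, s, ?_, fun x hx => ⟨hx.1, ?_, (hsplit x hx).2, ?_⟩, ?_⟩
  · have hD := isOpen_domain (W := W) (L := L) hU
    have h1 : ContMDiffOn (HModel n) (HModel m).tangent ∞
        (fun x => (⟨W.projExt y₀ x, ζ (W.projExt y₀ x)⟩ : TangentBundle (HModel m) W.Sing)) O :=
      fun x hx => (hζ.contMDiffAt.comp x (W.smooth_proj y₀ x hx.1)).contMDiffWithinAt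
    have h2 : ContMDiffOn (HModel n) (𝓡 l).tangent ∞
        (fun x => (⟨τ.link x, wf (τ.link x)⟩ : TangentBundle (𝓡 l) L)) O := fun x hx =>
      ((hwf.contMDiffAt ((chartAt _ (τ.link x₀)).open_source.mem_nhds hx.2.2)).comp x
        (τ.smooth_link x hx.1 (hprojU hx.1 hx.2.1))).contMDiffWithinAt
    have h3 : ContMDiffOn (HModel n) 𝓘(ℝ, ℝ).tangent ∞
        (fun x => (⟨W.radExt x, 0⟩ : TangentBundle 𝓘(ℝ, ℝ) ℝ)) O := fun x hx =>
      ((contMDiff_zeroSection ℝ (TangentSpace 𝓘(ℝ, ℝ) : ℝ → Type _)).contMDiffAt.comp x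
        (W.smooth_rad x hx.1)).contMDiffWithinAt
    have h4 := (contMDiff_equivTangentBundleProd_symm (n := ∞) (I := 𝓡 l) (M := L) (I' := 𝓘(ℝ, ℝ))
      (M' := ℝ)).comp_contMDiffOn (h2.prodMk h3)
    have h5 := (contMDiff_equivTangentBundleProd_symm (n := ∞) (I := HModel m) (M := W.Sing)
      (I' := (𝓡 l).prod 𝓘(ℝ, ℝ)) (M' := L × ℝ)).comp_contMDiffOn (h1.prodMk h4)
    have h6 := τ.smooth_param.contMDiffOn_tangentMapWithin (m := ∞) (by simp) hD.uniqueMDiffOn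
    have h7 := h6.comp h5 (fun x hx => ⟨hx.2.1, radExt_pos hx.1⟩)
    refine h7.congr fun x hx => ?_
    have hr : 0 < (τ.coord y₀ x).2.2 := radExt_pos hx.1
    have h8 : mfderivWithin ((HModel m).prod ((𝓡 l).prod 𝓘(ℝ, ℝ))) (HModel n) τ.param
        {q | q.1 ∈ U ∧ 0 < q.2.2} (τ.coord y₀ x) =
        mfderiv ((HModel m).prod ((𝓡 l).prod 𝓘(ℝ, ℝ))) (HModel n) τ.param (τ.coord y₀ x) :=
      mfderivWithin_of_isOpen hD ⟨hx.2.1, hr⟩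
    have h9 : ∀ z : W.Reg, z = x → (⟨x, s x⟩ : TangentBundle (HModel n) W.Reg) = ⟨z, s x⟩ := by
      rintro _ rfl; rfl
    refine (h9 _ (τ.param_coord hx.1 hx.2.1)).trans ?_
    change _ = (⟨τ.param (τ.coord y₀ x), mfderivWithin ((HModel m).prod ((𝓡 l).prod 𝓘(ℝ, ℝ)))
      (HModel n) τ.param {q | q.1 ∈ U ∧ 0 < q.2.2} (τ.coord y₀ x)
      (ζ (W.projExt y₀ x), wf (τ.link x), 0)⟩ : TangentBundle (HModel n) W.Reg)
    rw [h8]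
    rfl
  · intro y₁
    have h1 : W.projExt y₁ =ᶠ[𝓝 x] W.projExt y₀ := by
      filter_upwards [isOpen_tube_reg.mem_nhds hx.1] with z hz
      rw [projExt_of_mem _ hz, projExt_of_mem _ hz]
    have h2 := h1.mfderiv_eq (I := HModel n) (I' := HModel m)
    have h3 : (W.dproj y₁ x (s x) : 𝔼 m) = W.dproj y₀ x (s x) :=
      DFunLike.congr_fun h2 (s x)
    have h4 : ∀ y, y = W.projExt y₀ x → (ζ (W.projExt y₀ x) : 𝔼 m) = ζ y := by
      rintro _ rfl; rfl
    exact (h3.trans (hsplit x hx).1).trans (h4 _ h1.self_of_nhds)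
  · intro h1 h2
    have h3 : wf (τ.link x) = 0 := hwfz h2 _
    change τ.dparam (τ.coord y₀ x) (ζ (W.projExt y₀ x), wf (τ.link x), 0) = 0
    rw [h3]
    have h4 : ∀ z : 𝔼 m, z = 0 →
      τ.dparam (τ.coord y₀ x) (z, (0 : 𝔼 l), 0) = 0 := by
      rintro _ rfl; exact map_zero _
    exact h4 _ h1
  · change τ.dparam (τ.coord y₀ x₀) (ζ (W.projExt y₀ x₀), wf (τ.link x₀), 0) = _
    rw [hwf0]

variable [CompactSpace L]

theorem dform_capRho_eq_zero {ε : ℝ} {x : W.Reg} (ht : x.1 ∈ W.tube)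
    {v : TangentSpace (HModel n) x} (hv : W.drad x v = 0) :
    dform (k := n) (fun x : W.Reg => W.capRho ε x.1) x v = 0 := by
  have h1 : (fun x : W.Reg => W.capRho ε x.1) =ᶠ[𝓝 x] (FibPM.cap ε) ∘ W.radExt := by
    filter_upwards [isOpen_tube_reg.mem_nhds ht] with z hz
    rw [Function.comp_apply, FibPM.capRho_of_mem hz, radExt_of_mem hz]
  have h2 : dform (k := n) (fun x : W.Reg => W.capRho ε x.1) x =
      mfderiv (HModel n) 𝓘(ℝ, ℝ) ((FibPM.cap ε) ∘ W.radExt) x := h1.mfderiv_eq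
  rw [h2, mfderiv_comp (I' := 𝓘(ℝ, ℝ)) x
    ((FibPM.contDiff_cap ε).contMDiff.mdifferentiableAt (by simp))
    ((W.smooth_rad x ht).mdifferentiableAt (by simp))]
  have h3 : mfderiv (HModel n) 𝓘(ℝ, ℝ) W.radExt x v = 0 := hv
  change (mfderiv 𝓘(ℝ, ℝ) 𝓘(ℝ, ℝ) (FibPM.cap ε) (W.radExt x))
    (mfderiv (HModel n) 𝓘(ℝ, ℝ) W.radExt x v) = 0
  rw [h3]
  exact ContinuousLinearMap.map_zero _

/-- Properties which hold near each point of the singular stratum hold on a tube. -/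
theorem FibPM.exists_uniform_rho (W : FibPM l L n m X) {P : X → Prop}
    (h : ∀ y ∈ W.sing, ∃ U ∈ 𝓝 y, ∃ ε > 0, ∀ x ∈ W.tube, W.retr x ∈ U → W.rho x < ε → P x) :
    ∃ ε > 0, ∀ x ∈ W.tube, W.rho x < ε → P x := by
  suffices h' : ∃ ε > 0, ∀ x ∈ W.tube, W.retr x ∈ W.sing → W.rho x < ε → P x by
    obtain ⟨ε, hε, h'⟩ := h'
    exact ⟨ε, hε, fun x hx => h' x hx (retr_mem_sing hx)⟩
  refine W.isCompact_sing.induction_on (p := fun S => ∃ ε > 0, ∀ x ∈ W.tube, W.retr x ∈ S →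
    W.rho x < ε → P x) ⟨1, one_pos, by simp⟩ ?_ ?_ ?_
  · rintro s t hst ⟨ε, hε, h⟩
    exact ⟨ε, hε, fun x hx h1 => h x hx (hst h1)⟩
  · rintro s t ⟨ε, hε, h⟩ ⟨ε', hε', h'⟩
    refine ⟨min ε ε', lt_min hε hε', fun x hx h1 h2 => ?_⟩
    rcases h1 with h3 | h3
    · exact h x hx h3 (lt_of_lt_of_le h2 (min_le_left _ _))
    · exact h' x hx h3 (lt_of_lt_of_le h2 (min_le_right _ _))
  · intro y hy
    obtain ⟨U, hU, ε, hε, h⟩ := h y hy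
    exact ⟨U, mem_nhdsWithin_of_mem_nhds hU, ε, hε, h⟩

theorem FibPM.exists_abs_sub_retr_lt (W : FibPM l L n m X) {f : X → ℝ} (hf : Continuous f) {η : ℝ}
    (hη : 0 < η) : ∃ ε > 0, ∀ x ∈ W.tube, W.rho x < ε → |f x - f (W.retr x)| < η := by
  refine W.exists_uniform_rho fun y hy => ?_
  have h1 : {x | |f x - f y| < η / 2} ∈ 𝓝 y := by
    have : ContinuousAt (fun x => |f x - f y|) y := (hf.sub continuous_const).abs.continuousAt
    exact this.eventually (gt_mem_nhds (by simpa using hη))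
  obtain ⟨U, hU, ε, hε, h⟩ := W.exists_tube_subset hy h1
  refine ⟨_, Filter.inter_mem hU h1, ε, hε, fun x hx h2 h3 => ?_⟩
  have h4 : |f x - f y| < η / 2 := h x hx h2.1 h3
  have h5 : |f (W.retr x) - f y| < η / 2 := h2.2
  rw [abs_lt] at *
  constructor <;> linarith [h4.1, h4.2, h5.1, h5.2]

instance (W : FibPM l L n m X) : T2Space W.Reg := have := W.hausdorff; inferInstance
instance (W : FibPM l L n m X) : T2Space W.Sing := have := W.hausdorff; inferInstance

theorem sigmaCompact_reg (W : FibPM l L n m X) : SigmaCompactSpace W.Reg := by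
  have := W.compact
  have := W.hausdorff
  have := W.secondCountable
  have : LocallyCompactSpace W.Reg := W.isClosed_sing.isOpen_compl.locallyCompactSpace
  infer_instance

theorem compactSpace_sing (W : FibPM l L n m X) : CompactSpace W.Sing :=
  isCompact_iff_compactSpace.1 W.isCompact_sing

/-- The vector fields generating the flow across a regular level set: `ζ` on the singular stratum,
and `V` on the regular one, which near the singular stratum lifts `ζ` and preserves `ρ`. -/
structure LevelFields (W : FibPM l L n m X) (f : X → ℝ) (c δ ε : ℝ) where
  V : ∀ x : W.Reg, TangentSpace (HModel n) x
  ζ : ∀ y : W.Sing, TangentSpace (HModel m) y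
  smooth_V : IsSmoothVF (HModel n) V
  smooth_ζ : IsSmoothVF (HModel m) ζ
  pos_V : ∀ x : W.Reg, f x.1 = c → 0 < dform (k := n) (onReg W♭ f) x (V x)
  pos_ζ : ∀ y : W.Sing, f y.1 = c → 0 < dform (k := m) (onSing W♭ f) y (ζ y)
  V_eq_zero : ∀ x : W.Reg, δ ≤ |f x.1 - c| → V x = 0
  ζ_eq_zero : ∀ y : W.Sing, δ ≤ |f y.1 - c| → ζ y = 0
  capRho_V : ∀ x, dform (k := n) (fun x : W.Reg => W.capRho ε x.1) x (V x) = 0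
  dproj_V : ∀ (y₀ : W.Sing) (x : W.Reg), x.1 ∈ W.tube → W.rho x.1 < ε →
    W.dproj y₀ x (V x) = ζ (W.projExt y₀ x)

/-- The local choices, from `exists_lift_increasing` near `Y`, obey convex conditions, hence can be
glued by a partition of unity. -/
theorem exists_levelFields (g : WedgeMetric W) {f : X → ℝ} (hf : IsSmoothFun W♭ f)
    {ε₀ : ℝ} (hε₀ : 0 < ε₀) (hproj : WeakControlProj g (negGrad g f) ε₀)
    (hrad : WeakControlRad W♭ (negGrad g f) ε₀) {c δ : ℝ} (hδ : 0 < δ)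
    (hc : IsRegularValue W♭ f c) :
    ∃ ε, 0 < ε ∧ Nonempty (LevelFields W f c δ ε) := by
  have i1 := sigmaCompact_reg W
  have i2 := compactSpace_sing W
  have hregR : ∀ x : W.Reg, onReg W♭ f x = c →
      dform (k := n) (onReg W♭ f) x ≠ 0 := fun x hx h =>
    hc x.1 hx (Or.inl ⟨x.2, h⟩)
  have hregS : ∀ x : W.Sing, onSing W♭ f x = c →
      dform (k := m) (onSing W♭ f) x ≠ 0 := fun x hx h =>
    hc x.1 hx (Or.inr ⟨x.2, h⟩)
  obtain ⟨ζ, hζ, hζ1, hζ2⟩ := exists_field_level hf.smooth_sing (half_pos hδ) hregS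
  obtain ⟨ε₁, hε₁, h1⟩ := W.exists_abs_sub_retr_lt hf.continuous (by positivity : 0 < δ / 4)
  obtain ⟨ε₂, hε₂, h2⟩ := W.exists_uniform_rho (P := fun x => ∀ (hx : x ∉ W.sing), f x = c →
      ∃ (U : Set W.Sing) (τ : ConeChart W♭ l L U), IsOpen U ∧ ∀ y₀,
      W.projExt y₀ ⟨x, hx⟩ ∈ U ∧ ∃ w : 𝔼 l,
        0 < dform (k := n) (onReg W♭ f) ⟨x, hx⟩ (τ.dparam (τ.coord y₀ ⟨x, hx⟩)
          (ζ (W.projExt y₀ ⟨x, hx⟩), w, 0))) fun y hy => by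
    by_cases hyc : f y = c
    · obtain ⟨U, τ, ε, U', hU, hU', hyU', hUU', hε, h⟩ := exists_lift_increasing g hf hε₀ hproj hrad
        ⟨y, hy⟩ hζ (hζ1 ⟨y, hy⟩ hyc)
      obtain ⟨A, hA, hAU⟩ := isOpen_induced_iff.1 hU'
      refine ⟨A, hA.mem_nhds (by have : (⟨y, hy⟩ : W.Sing) ∈ Subtype.val ⁻¹' A := hAU ▸ hyU'
                                 exact this), ε, hε, fun x hxt hxA hxε hx _ => ⟨U, τ, hU, ?_⟩⟩
      intro y₀
      have h3 : W.projExt y₀ ⟨x, hx⟩ ∈ U' := by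
        rw [← hAU, mem_preimage, projExt_val y₀ hxt]; exact hxA
      refine ⟨hUU' h3, ?_⟩
      obtain ⟨w, hw⟩ := h (W.projExt y₀ ⟨x, hx⟩) h3 (τ.link ⟨x, hx⟩) (W.radExt ⟨x, hx⟩)
        (radExt_pos hxt) (by rw [radExt_of_mem hxt]; exact hxε)
      refine ⟨w, ?_⟩
      have h4 : ∀ (z : W.Reg) (v : 𝔼 n), z = ⟨x, hx⟩ →
        0 < dform (k := n) (onReg W♭ f) z v →
          0 < dform (k := n) (onReg W♭ f) ⟨x, hx⟩ v := by rintro _ v rfl h; exact h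
      exact h4 _ _ (τ.param_coord hxt (hUU' h3)) hw
    · obtain ⟨U, hU, ε, hε, h⟩ := W.exists_tube_subset hy
        ((isOpen_ne_fun hf.continuous continuous_const).mem_nhds hyc)
      exact ⟨U, hU, ε, hε, fun x hxt hxU hxε _ hxc => absurd hxc (h x hxt hxU hxε)⟩
  let ε := min ε₁ ε₂ / 3
  have hε : 0 < ε := div_pos (lt_min hε₁ hε₂) (by norm_num)
  have hε1 : 2 * ε < ε₁ := by
    have := min_le_left ε₁ ε₂; have : 3 * ε = min ε₁ ε₂ := by simp only [ε]; ring
    linarith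
  have hε2 : 2 * ε < ε₂ := by
    have := min_le_right ε₁ ε₂; have : 3 * ε = min ε₁ ε₂ := by simp only [ε]; ring
    linarith
  refine ⟨ε, hε, ?_⟩
  let t : ∀ x : W.Reg, Set (TangentSpace (HModel n) x) := fun x =>
    {v | ((f x.1 = c → 0 < dform (k := n) (onReg W♭ f) x v) ∧
      (δ ≤ |f x.1 - c| → v = 0)) ∧
      dform (k := n) (fun x : W.Reg => W.capRho ε x.1) x v = 0 ∧
      ∀ y₀ : W.Sing, x.1 ∈ W.tube → W.rho x.1 < ε → W.dproj y₀ x v = ζ (W.projExt y₀ x)}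
  obtain ⟨s, hs⟩ := exists_contMDiffSection_forall_mem_convex_of_local (HModel n) (n := (⊤ : ℕ∞))
    (F_fiber := 𝔼 n) (fun x : W.Reg => TangentSpace (HModel n) x) t
    (fun x v hv w hw a b ha hb hab => ⟨⟨fun h => by
      have h1 := hv.1.1 h
      have h2 := hw.1.1 h
      rw [map_add, map_smul, map_smul, smul_eq_mul, smul_eq_mul]
      rcases ha.eq_or_lt with rfl | ha
      · have : b = 1 := by linarith
        rw [this]; linarith
      · have := mul_pos ha h1
        have := mul_nonneg hb h2.le
        linarith, fun h => by rw [hv.1.2 h, hw.1.2 h, smul_zero, smul_zero, add_zero]⟩,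
      by rw [map_add, map_smul, map_smul, hv.2.1, hw.2.1, smul_zero, smul_zero, add_zero],
      fun y₀ h h' => by
        rw [map_add, map_smul, map_smul, hv.2.2 y₀ h h', hw.2.2 y₀ h h', ← add_smul, hab,
          one_smul]⟩)
    (fun x₀ => by
      have hfx : ∀ x ∈ W.tube, W.rho x < ε₁ → δ ≤ |f x - c| → ∀ y : W.Sing, y.1 = W.retr x →
          ζ y = 0 := by
        intro x hx hxε h y hy
        apply hζ2
        change δ / 2 ≤ |f y.1 - c|
        rw [hy]
        have h3 := h1 x hx hxε
        have h4 : |f x - c| ≤ |f x - f (W.retr x)| + |f (W.retr x) - c| := abs_sub_le _ _ _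
        linarith
      by_cases hx₀ : x₀.1 ∈ W.tube ∧ W.rho x₀.1 ≤ 2 * ε
      · let y₀ : W.Sing := ⟨W.retr x₀.1, retr_mem_sing hx₀.1⟩
        have hnear : {x : W.Reg | x.1 ∈ W.tube ∧ W.rho x.1 < ε₁} ∈ 𝓝 x₀ :=
          ((W.isOpen_rho_lt ε₁).preimage continuous_subtype_val).mem_nhds
            ⟨hx₀.1, hx₀.2.trans_lt hε1⟩
        by_cases hfc : f x₀.1 = c
        · obtain ⟨U, τ, hU, h3⟩ := h2 x₀.1 hx₀.1 (hx₀.2.trans_lt hε2) x₀.2 hfc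
          obtain ⟨hyU, w, hw⟩ := h3 y₀
          obtain ⟨O, hO, s, hs, hs1, hs2⟩ := τ.exists_local_lift hU hζ y₀ hx₀.1 hyU w
          have h4 : ContinuousAt
              (fun x => (dform (k := n) (onReg W♭ f) x (s x) : ℝ)) x₀ :=
            (contMDiffAt_mfderiv_apply hf.smooth_reg (hs.contMDiffAt hO)).continuousAt
          have h5 : ∀ᶠ x in 𝓝 x₀, 0 < dform (k := n) (onReg W♭ f) x (s x) :=
            h4.eventually (lt_mem_nhds (hw.trans_eq
              (congrArg (dform (k := n) (onReg W♭ f) x₀) hs2.symm)))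
          have h6 : ∀ᶠ x : W.Reg in 𝓝 x₀, |f x.1 - c| < δ := by
            have : ContinuousAt (fun x : W.Reg => |f x.1 - c|) x₀ :=
              (((hf.continuous.comp continuous_subtype_val).sub continuous_const).abs).continuousAt
            exact this.eventually (gt_mem_nhds (by simpa [hfc] using hδ))
          refine ⟨_, Filter.inter_mem hO (h5.and h6), s, hs.mono inter_subset_left,
            fun x hx => ⟨⟨fun _ => hx.2.1, fun h => absurd h (not_le.2 hx.2.2)⟩,
            dform_capRho_eq_zero (hs1 x hx.1).1 (hs1 x hx.1).2.2.1,
            fun y₁ _ _ => (hs1 x hx.1).2.1 y₁⟩⟩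
        · obtain ⟨U, hU, hyU, ⟨τ⟩⟩ := W.exists_coneChart (W.projExt y₀ x₀)
          obtain ⟨O, hO, s, hs, hs1, hs2⟩ := τ.exists_local_lift hU hζ y₀ hx₀.1 hyU 0
          have h6 : {x : W.Reg | f x.1 ≠ c} ∈ 𝓝 x₀ := (isOpen_ne_fun
            (hf.continuous.comp continuous_subtype_val) continuous_const).mem_nhds hfc
          refine ⟨_, Filter.inter_mem hO (Filter.inter_mem h6 hnear), s, hs.mono inter_subset_left,
            fun x hx => ⟨⟨fun h => absurd h hx.2.1, fun h => (hs1 x hx.1).2.2.2 ?_ rfl⟩,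
            dform_capRho_eq_zero (hs1 x hx.1).1 (hs1 x hx.1).2.2.1,
            fun y₁ _ _ => (hs1 x hx.1).2.1 y₁⟩⟩
          exact hfx x.1 hx.2.2.1 hx.2.2.2 h _ (projExt_val _ (hs1 x hx.1).1)
      · obtain ⟨O, hO, s, hs, hs1⟩ := exists_local_field_level hf.smooth_reg hδ hregR x₀
        have h6 : {x : W.Reg | ¬ (x.1 ∈ W.tube ∧ W.rho x.1 ≤ 2 * ε)} ∈ 𝓝 x₀ :=
          ((W.isClosed_rho_le (2 * ε)).isOpen_compl.preimage continuous_subtype_val).mem_nhds hx₀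
        have h7 : IsOpen {x : W.Reg | ¬ (x.1 ∈ W.tube ∧ W.rho x.1 ≤ 2 * ε)} :=
          ((W.isClosed_rho_le (2 * ε)).isOpen_compl.preimage continuous_subtype_val)
        refine ⟨_, Filter.inter_mem hO h6, s, hs.mono inter_subset_left,
          fun x hx => ⟨hs1 x hx.1, ?_, fun y₁ h h' => ?_⟩⟩
        · have h8 : (fun x : W.Reg => W.capRho ε x.1) =ᶠ[𝓝 x] fun _ => 3 * ε := by
            filter_upwards [h7.mem_nhds hx.2] with z hz
            exact FibPM.capRho_of_notMem hε hz
          have h9 : dform (k := n) (fun x : W.Reg => W.capRho ε x.1) x = 0 :=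
            (h8.mfderiv_eq).trans mfderiv_const
          rw [h9]; rfl
        · exact absurd ⟨h, by linarith⟩ hx.2)
  exact ⟨⟨fun x => s x, ζ, s.contMDiff, hζ, fun x => (hs x).1.1, fun y => hζ1 y,
    fun x => (hs x).1.2, fun y h => hζ2 y ((half_le_self hδ.le).trans h), fun x => (hs x).2.1,
    fun y₀ x => (hs x).2.2 y₀⟩⟩

end ConeFields

/-! ### The flow across a regular level set -/

section LevelFlow

/-- The map of the regular stratum given by a map of `X` which preserves the strata. -/
def StratData.onRegular (W : StratData n m X) {φ : X → X} (h : ∀ x, φ x ∈ W.sing ↔ x ∈ W.sing)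
    (x : W.Reg) : W.Reg := ⟨φ x.1, fun h' => x.2 ((h x.1).1 h')⟩

/-- The map of the singular stratum given by a map of `X` which preserves the strata. -/
def StratData.onSingular (W : StratData n m X) {φ : X → X} (h : ∀ x, φ x ∈ W.sing ↔ x ∈ W.sing)
    (x : W.Sing) : W.Sing := ⟨φ x.1, (h x.1).2 x.2⟩

/-- A stratified flow which crosses the level set `h = 0` in the direction in which `h` increases,
and which preserves the control data near the singular stratum. -/
structure LevelFlow (W : FibPM l L n m X) (h : X → ℝ) where
  Φ : ℝ → X → X
  r₀ : ℝ
  r₀_pos : 0 < r₀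
  continuous : Continuous fun p : ℝ × X => Φ p.1 p.2
  zero : ∀ x, Φ 0 x = x
  add : ∀ s t x, Φ (s + t) x = Φ s (Φ t x)
  mem_sing : ∀ t x, Φ t x ∈ W.sing ↔ x ∈ W.sing
  smooth_reg : ContMDiff (𝓘(ℝ, ℝ).prod (HModel n)) (HModel n) ∞
    (fun p : ℝ × W.Reg => W.onRegular (mem_sing p.1) p.2)
  smooth_sing : ContMDiff (𝓘(ℝ, ℝ).prod (HModel m)) (HModel m) ∞
    (fun p : ℝ × W.Sing => W.onSingular (mem_sing p.1) p.2)
  mem_tube : ∀ t, ∀ x ∈ W.tube, W.rho x < r₀ → Φ t x ∈ W.tube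
  rho_eq : ∀ t, ∀ x ∈ W.tube, W.rho x < r₀ → W.rho (Φ t x) = W.rho x
  retr_eq : ∀ t, ∀ x ∈ W.tube, W.rho x < r₀ → W.retr (Φ t x) = Φ t (W.retr x)
  deriv_pos : ∀ x, h x = 0 → ∃ h', 0 < h' ∧ HasDerivAt (fun t => h (Φ t x)) h' 0
  interior_reg : ∀ (x : W.Reg) (t : ℝ), h (Φ t x.1) = 0 → (HModel n).IsInteriorPoint x
  interior_sing : ∀ (x : W.Sing) (t : ℝ), h (Φ t x.1) = 0 → (HModel m).IsInteriorPoint x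

theorem hasDerivAt_comp_integralCurve {k : ℕ} {M : Type*} [TopologicalSpace M]
    [ChartedSpace (HSpace k) M] [IsManifold (HModel k) ∞ M] {V : ∀ x : M, TangentSpace (HModel k) x}
    {F : M → ℝ} (hF : ContMDiff (HModel k) 𝓘(ℝ, ℝ) ∞ F) {γ : ℝ → M} {s : ℝ}
    (hγ : HasMFDerivAt 𝓘(ℝ, ℝ) (HModel k) γ s ((1 : ℝ →L[ℝ] ℝ).smulRight (V (γ s)))) :
    HasDerivAt (fun s => F (γ s)) (dform (k := k) F (γ s) (V (γ s))) s := by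
  have h1 := ((hF.mdifferentiableAt (x := γ s) (by simp)).hasMFDerivAt.comp s hγ).hasFDerivAt
  obtain ⟨D, hD⟩ : ∃ D : ℝ →L[ℝ] ℝ, D = (dform (k := k) F (γ s)).comp
    ((1 : ℝ →L[ℝ] ℝ).smulRight (V (γ s))) := ⟨_, rfl⟩
  have h2 : HasFDerivAt (fun s => F (γ s)) D s := by rw [hD]; exact h1
  have h4 : D 1 = dform (k := k) F (γ s) ((1 : ℝ →L[ℝ] ℝ) 1 • V (γ s)) := by rw [hD]; rfl
  have h3 := h2.hasDerivAt
  rwa [h4, one_apply_eq_self, one_smul] at h3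

/-- A function whose differential vanishes on a vector field is constant on integral curves. -/
theorem eq_of_dform_eq_zero {k : ℕ} {M : Type*} [TopologicalSpace M]
    [ChartedSpace (HSpace k) M] [IsManifold (HModel k) ∞ M] {V : ∀ x : M, TangentSpace (HModel k) x}
    {F : M → ℝ} (hF : ContMDiff (HModel k) 𝓘(ℝ, ℝ) ∞ F) (hV : ∀ x, dform (k := k) F x (V x) = 0)
    {γ : ℝ → M} {T : ℝ} (hγ : IsMIntegralCurveOn γ V (Ioo (-T) T)) {t : ℝ} (ht : t ∈ Ioo (-T) T) :
    F (γ t) = F (γ 0) := by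
  have hd : ∀ s ∈ Ioo (-T) T, HasDerivAt (fun s => F (γ s)) 0 s := by
    intro s hs
    have h1 := hasDerivAt_comp_integralCurve hF ((hγ s hs).hasMFDerivAt (Ioo_mem_nhds hs.1 hs.2))
    rwa [hV] at h1
  have h0 : (0 : ℝ) ∈ Ioo (-T) T := ⟨by linarith [ht.1, ht.2], by linarith [ht.1, ht.2]⟩
  exact isOpen_Ioo.is_const_of_deriv_eq_zero isPreconnected_Ioo
    (fun s hs => (hd s hs).differentiableAt.differentiableWithinAt) (fun s hs => (hd s hs).deriv)
    ht h0

variable [CompactSpace L] {W : FibPM l L n m X} {f : X → ℝ} {c δ ε : ℝ}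

namespace LevelFields

theorem interior_or_reg (F : LevelFields W f c δ ε) (hf : Continuous f)
    (hb : ∀ x ∈ W.boundary, δ < |f x - c|) :
    IsLocallyIntegrable (HModel n) F.V := by
  refine ⟨F.smooth_V, fun x => ?_⟩
  by_cases hx : (HModel n).IsInteriorPoint x
  · exact Or.inl hx
  · right
    have h1 : δ < |f x.1 - c| :=
      hb x.1 (Or.inl ⟨x, (HModel n).isBoundaryPoint_iff_not_isInteriorPoint x |>.2 hx, rfl⟩)
    have h2 : IsOpen {y : W.Reg | δ < |f y.1 - c|} := isOpen_lt continuous_const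
      (((hf.comp continuous_subtype_val).sub continuous_const).abs)
    filter_upwards [h2.mem_nhds h1] with y hy
    exact F.V_eq_zero y (le_of_lt hy)

theorem interior_or_sing (F : LevelFields W f c δ ε) (hf : Continuous f)
    (hb : ∀ x ∈ W.boundary, δ < |f x - c|) :
    IsLocallyIntegrable (HModel m) F.ζ := by
  refine ⟨F.smooth_ζ, fun x => ?_⟩
  by_cases hx : (HModel m).IsInteriorPoint x
  · exact Or.inl hx
  · right
    have h1 : δ < |f x.1 - c| :=
      hb x.1 (Or.inr ⟨x, (HModel m).isBoundaryPoint_iff_not_isInteriorPoint x |>.2 hx, rfl⟩)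
    have h2 : IsOpen {y : W.Sing | δ < |f y.1 - c|} := isOpen_lt continuous_const
      (((hf.comp continuous_subtype_val).sub continuous_const).abs)
    filter_upwards [h2.mem_nhds h1] with y hy
    exact F.ζ_eq_zero y (le_of_lt hy)

theorem staysCompact_V (F : LevelFields W f c δ ε) (hε : 0 < ε) : StaysCompact F.V := by
  intro x N
  refine ⟨{z : W.Reg | W.capRho ε z.1 = W.capRho ε x.1}, ?_, fun T _ γ h0 hγ t ht => ?_⟩
  · have := W.compact
    rw [Topology.IsEmbedding.subtypeVal.isCompact_iff]
    have h1 : Subtype.val '' {z : W.Reg | W.capRho ε z.1 = W.capRho ε x.1} =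
        {z | W.capRho ε z = W.capRho ε x.1} := by
      ext z
      refine ⟨?_, fun hz => ?_⟩
      · rintro ⟨z, hz, rfl⟩; exact hz
      · refine ⟨⟨z, fun hzs => ?_⟩, hz, rfl⟩
        have h2 : W.rho z = 0 := rho_eq_zero_iff.2 hzs
        have h3 := FibPM.capRho_of_rho_lt hε (W.sing_subset_tube hzs) (by rw [h2]; exact hε)
        refine FibPM.capRho_ne_zero hε x ?_
        have hz' : W.capRho ε z = W.capRho ε x.1 := hz
        rw [← hz', h3, h2]
    rw [h1]
    exact (isClosed_eq (W.continuous_capRho hε) continuous_const).isCompact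
  · have h1 := eq_of_dform_eq_zero (W.contMDiff_capRho hε) F.capRho_V hγ ht
    rw [h0] at h1
    exact h1

end LevelFields

/-- The differential of a curve `π ∘ γ`. -/
theorem hasMFDerivAt_projExt_comp {V : ∀ x : W.Reg, TangentSpace (HModel n) x}
    {ζ : ∀ y : W.Sing, TangentSpace (HModel m) y} (y₀ : W.Sing) {γ : ℝ → W.Reg} {t : ℝ}
    (hγ : HasMFDerivAt 𝓘(ℝ, ℝ) (HModel n) γ t ((1 : ℝ →L[ℝ] ℝ).smulRight (V (γ t))))
    (ht : (γ t).1 ∈ W.tube) (hV : W.dproj y₀ (γ t) (V (γ t)) = ζ (W.projExt y₀ (γ t))) :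
    HasMFDerivAt 𝓘(ℝ, ℝ) (HModel m) (fun t => W.projExt y₀ (γ t)) t
      ((1 : ℝ →L[ℝ] ℝ).smulRight (ζ (W.projExt y₀ (γ t)))) := by
  have h1 := ((W.smooth_proj y₀ (γ t) ht).mdifferentiableAt (by simp)).hasMFDerivAt.comp t hγ
  refine h1.congr_mfderiv (DFunLike.ext _ _ fun (r : ℝ) => Eq.symm ?_)
  change r • ζ (W.projExt y₀ (γ t)) = W.dproj y₀ (γ t) (r • V (γ t))
  exact (((W.dproj y₀ (γ t)).map_smul r (V (γ t))).trans (congrArg (r • ·) hV)).symm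

/-- The flows on the two strata fit together continuously, as near `Y` the flow on the regular
stratum commutes with `π` and preserves `ρ`. -/
theorem exists_levelFlow (hf : IsSmoothFun W♭ f) (hδ : 0 < δ) (hε : 0 < ε)
    (F : LevelFields W f c δ ε) (hb : ∀ x ∈ W.boundary, δ < |f x - c|) :
    Nonempty (LevelFlow W (fun x => f x - c)) := by
  have := compactSpace_sing W
  have hLR := F.interior_or_reg hf.continuous hb
  have hLS := F.interior_or_sing hf.continuous hb
  obtain ⟨ΦR, hR, hR0, hRadd, hRc⟩ := hLR.exists_flow (F.staysCompact_V hε)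
  obtain ⟨ΦS, hS, hS0, hSadd, hSc⟩ := hLS.exists_flow
    fun x N => ⟨univ, isCompact_univ, fun _ _ _ _ _ _ _ => mem_univ _⟩
  classical
  let Φ : ℝ → X → X := fun t x =>
    if h : x ∈ W.sing then (ΦS t ⟨x, h⟩).1 else (ΦR t ⟨x, h⟩).1
  have hΦS : ∀ t (x : W.Sing), Φ t x.1 = (ΦS t x).1 := fun t x => dif_pos x.2
  have hΦR : ∀ t (x : W.Reg), Φ t x.1 = (ΦR t x).1 := fun t x => dif_neg x.2
  have hcases : ∀ x : X, (∃ y : W.Sing, y.1 = x) ∨ (∃ y : W.Reg, y.1 = x) := fun x => by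
    by_cases h : x ∈ W.sing
    · exact Or.inl ⟨⟨x, h⟩, rfl⟩
    · exact Or.inr ⟨⟨x, h⟩, rfl⟩
  have hmem : ∀ t x, Φ t x ∈ W.sing ↔ x ∈ W.sing := by
    intro t x
    rcases hcases x with ⟨y, rfl⟩ | ⟨y, rfl⟩
    · rw [hΦS]; exact iff_of_true (ΦS t y).2 y.2
    · rw [hΦR]; exact iff_of_false (ΦR t y).2 y.2
  have hcap : ∀ t (x : W.Reg), W.capRho ε (ΦR t x).1 = W.capRho ε x.1 := by
    intro t x
    have h1 := eq_of_dform_eq_zero (T := |t| + 1) (W.contMDiff_capRho hε)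
      F.capRho_V ((hRc x).isMIntegralCurveOn _) (t := t)
      ⟨by linarith [neg_abs_le t], by linarith [le_abs_self t]⟩
    rwa [hR0] at h1
  have htube : ∀ t (x : W.Reg), x.1 ∈ W.tube → W.rho x.1 < ε →
      (ΦR t x).1 ∈ W.tube ∧ W.rho (ΦR t x).1 < ε ∧ W.rho (ΦR t x).1 = W.rho x.1 := by
    intro t x hx hxε
    have h1 : W.capRho ε (ΦR t x).1 < ε := by
      rw [hcap]; exact (FibPM.capRho_lt_iff hε).2 ⟨hx, hxε⟩
    obtain ⟨h2, h3⟩ := (FibPM.capRho_lt_iff hε).1 h1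
    refine ⟨h2, h3, ?_⟩
    rw [← FibPM.capRho_of_rho_lt hε h2 h3, hcap, FibPM.capRho_of_rho_lt hε hx hxε]
  have hretr : ∀ t (x : W.Reg) (hx : x.1 ∈ W.tube), W.rho x.1 < ε →
      W.projExt ⟨_, retr_mem_sing hx⟩ (ΦR t x) = ΦS t ⟨_, retr_mem_sing hx⟩ := by
    intro t x hx hxε
    set y₀ : W.Sing := ⟨_, retr_mem_sing hx⟩
    have h1 : IsMIntegralCurve (fun t => W.projExt y₀ (ΦR t x)) F.ζ := fun s => by
      obtain ⟨h2, h3, -⟩ := htube s x hx hxε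
      exact hasMFDerivAt_projExt_comp (W := W) y₀ (hRc x s) h2 (F.dproj_V y₀ _ h2 h3)
    have h2 : W.projExt y₀ (ΦR 0 x) = ΦS 0 y₀ := by
      rw [hR0, hS0]
      exact Subtype.ext (projExt_val y₀ hx)
    exact hLS.eqOn (a := -(|t| + 1)) (b := |t| + 1) (t₀ := 0)
      ⟨by linarith [abs_nonneg t], by linarith [abs_nonneg t]⟩
      (h1.isMIntegralCurveOn _) ((hSc y₀).isMIntegralCurveOn _) h2
      ⟨by linarith [neg_abs_le t], by linarith [le_abs_self t]⟩
  have htube' : ∀ t, ∀ x ∈ W.tube, W.rho x < ε → Φ t x ∈ W.tube ∧ W.rho (Φ t x) = W.rho x ∧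
      W.retr (Φ t x) = Φ t (W.retr x) := by
    intro t x hx hxε
    rcases hcases x with ⟨y, rfl⟩ | ⟨y, rfl⟩
    · have h1 : Φ t y.1 ∈ W.sing := (hmem t _).2 y.2
      refine ⟨W.sing_subset_tube h1, ?_, ?_⟩
      · rw [rho_eq_zero_iff.2 h1, rho_eq_zero_iff.2 y.2]
      · rw [retr_of_mem_sing h1, retr_of_mem_sing y.2]
    · obtain ⟨h1, h2, h3⟩ := htube t y hx hxε
      rw [hΦR]
      refine ⟨h1, h3, ?_⟩
      have h4 := congrArg Subtype.val (hretr t y hx hxε)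
      rw [projExt_val _ h1] at h4
      rw [h4]
      exact (hΦS t ⟨_, retr_mem_sing hx⟩).symm
  have hcont : Continuous fun p : ℝ × X => Φ p.1 p.2 := by
    rw [continuous_iff_continuousAt]
    rintro ⟨t, x⟩
    rcases hcases x with ⟨y, rfl⟩ | ⟨y, rfl⟩
    · intro O hO
      change Φ t y.1 |> fun z => O ∈ 𝓝 z at hO
      obtain ⟨U, hU, ε', hε', hUO⟩ := W.exists_tube_subset ((hmem t y.1).2 y.2) hO
      have h1 : ContinuousAt (fun p : ℝ × ↥W.tube => (ΦS p.1 (W.proj p.2)).1)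
          (t, ⟨y.1, W.sing_subset_tube y.2⟩) :=
        (continuous_subtype_val.comp (hS.continuous.comp
          (continuous_fst.prodMk (W.continuous_proj.comp continuous_snd)))).continuousAt
      have h2 : (ΦS t (W.proj ⟨y.1, W.sing_subset_tube y.2⟩)).1 = Φ t y.1 := by
        rw [hΦS, W.proj_sing y.1 y.2]
      have h3 : ∀ᶠ p : ℝ × ↥W.tube in 𝓝 (t, ⟨y.1, W.sing_subset_tube y.2⟩),
          (ΦS p.1 (W.proj p.2)).1 ∈ U := h1.eventually (p := fun z => z ∈ U) (by change U ∈ 𝓝 (ΦS t (W.proj ⟨y.1, W.sing_subset_tube y.2⟩)).1; rw [h2]; exact hU)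
      have h4 : IsOpenEmbedding (fun p : ℝ × ↥W.tube => (p.1, p.2.1)) :=
        IsOpenEmbedding.id.prodMap W.isOpen_tube.isOpenEmbedding_subtypeVal
      have h5 : 𝓝 (t, y.1) = Filter.map (fun p : ℝ × ↥W.tube => (p.1, p.2.1))
          (𝓝 (t, ⟨y.1, W.sing_subset_tube y.2⟩)) := (h4.map_nhds_eq (t, ⟨y.1, W.sing_subset_tube y.2⟩)).symm
      have h6 : ContinuousAt (fun p : ℝ × ↥W.tube => W.rho p.2.1)
          (t, ⟨y.1, W.sing_subset_tube y.2⟩) :=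
        ContinuousAt.comp (f := fun p : ℝ × ↥W.tube => p.2.1) (g := W.rho)
          (continuousAt_rho (W.sing_subset_tube y.2))
          (continuous_subtype_val.comp continuous_snd).continuousAt
      have h7 := h6.eventually_lt_const (u := min ε ε') (by
        change W.rho y.1 < _
        rw [rho_eq_zero_iff.2 y.2]; exact lt_min hε hε')
      rw [Filter.mem_map, h5, Filter.mem_map]
      filter_upwards [h3, h7] with p hp hp'
      obtain ⟨h8, h9, h10⟩ := htube' p.1 p.2.1 p.2.2 (hp'.trans_le (min_le_left _ _))
      refine hUO _ h8 ?_ (by rw [h9]; exact hp'.trans_le (min_le_right _ _))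
      rw [h10, retr_of_mem p.2.2, hΦS]
      exact hp
    · have h4 : IsOpenEmbedding (fun p : ℝ × W.Reg => (p.1, p.2.1)) :=
        IsOpenEmbedding.id.prodMap (isOpen_reg (W := W♭)).isOpenEmbedding_subtypeVal
      have h5 : ContinuousAt ((fun p : ℝ × X => Φ p.1 p.2) ∘ fun p : ℝ × W.Reg => (p.1, p.2.1))
          (t, y) := by
        refine (continuous_subtype_val.comp hR.continuous).continuousAt.congr ?_
        exact Filter.Eventually.of_forall fun p => (hΦR p.1 p.2).symm
      exact (h4.continuousAt_iff (x := (t, y))).1 h5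
  have hfix : ∀ x t, x ∈ W.boundary → Φ t x = x := by
    intro x t hx
    have h1 := hb x hx
    rcases hcases x with ⟨y, rfl⟩ | ⟨y, rfl⟩
    · rw [hΦS]
      exact congrArg Subtype.val (hLS.eqOn (a := -(|t| + 1)) (b := |t| + 1) (t₀ := 0)
        (γ' := fun _ => y) ⟨by linarith [abs_nonneg t], by linarith [abs_nonneg t]⟩
        ((hSc y).isMIntegralCurveOn _)
        ((isMIntegralCurve_const (F.ζ_eq_zero y h1.le)).isMIntegralCurveOn _) (hS0 y)
        ⟨by linarith [neg_abs_le t], by linarith [le_abs_self t]⟩)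
    · rw [hΦR]
      exact congrArg Subtype.val (hLR.eqOn (a := -(|t| + 1)) (b := |t| + 1) (t₀ := 0)
        (γ' := fun _ => y) ⟨by linarith [abs_nonneg t], by linarith [abs_nonneg t]⟩
        ((hRc y).isMIntegralCurveOn _)
        ((isMIntegralCurve_const (F.V_eq_zero y h1.le)).isMIntegralCurveOn _) (hR0 y)
        ⟨by linarith [neg_abs_le t], by linarith [le_abs_self t]⟩)
  have hnb : ∀ x t, f (Φ t x) - c = 0 → x ∉ W.boundary := by
    intro x t h1 h2
    rw [hfix x t h2] at h1
    have := hb x h2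
    rw [h1, abs_zero] at this
    exact absurd this (not_lt.2 hδ.le)
  refine ⟨⟨Φ, ε, hε, hcont, ?_, ?_, hmem, ?_, ?_, fun t x h h' => (htube' t x h h').1,
    fun t x h h' => (htube' t x h h').2.1, fun t x h h' => (htube' t x h h').2.2, ?_, ?_, ?_⟩⟩
  · intro x
    rcases hcases x with ⟨y, rfl⟩ | ⟨y, rfl⟩
    · rw [hΦS, hS0]
    · rw [hΦR, hR0]
  · intro s t x
    rcases hcases x with ⟨y, rfl⟩ | ⟨y, rfl⟩
    · rw [hΦS, hΦS, hΦS, hSadd]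
    · rw [hΦR, hΦR, hΦR, hRadd]
  · exact hR.congr fun p => Subtype.ext (hΦR p.1 p.2)
  · exact hS.congr fun p => Subtype.ext (hΦS p.1 p.2)
  · intro x hx
    rcases hcases x with ⟨y, rfl⟩ | ⟨y, rfl⟩
    · have h1 := hasDerivAt_comp_integralCurve hf.smooth_sing (hSc y 0)
      refine ⟨_, ?_, (h1.sub_const c).congr_of_eventuallyEq (Filter.Eventually.of_forall fun t => ?_)⟩
      · have : ∀ z, z = y → 0 < dform (k := m) (onSing W♭ f) z (F.ζ z) := by
          rintro _ rfl; exact F.pos_ζ _ (sub_eq_zero.1 hx)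
        exact this _ (hS0 y)
      · change f (Φ t y.1) - c = _
        rw [hΦS]; rfl
    · have h1 := hasDerivAt_comp_integralCurve hf.smooth_reg (hRc y 0)
      refine ⟨_, ?_, (h1.sub_const c).congr_of_eventuallyEq (Filter.Eventually.of_forall fun t => ?_)⟩
      · have : ∀ z, z = y → 0 < dform (k := n) (onReg W♭ f) z (F.V z) := by
          rintro _ rfl; exact F.pos_V _ (sub_eq_zero.1 hx)
        exact this _ (hR0 y)
      · change f (Φ t y.1) - c = _
        rw [hΦR]; rfl
  · intro x t h1
    by_contra h2
    exact hnb x.1 t h1 (Or.inl ⟨x, (HModel n).isBoundaryPoint_iff_not_isInteriorPoint x |>.2 h2, rfl⟩)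
  · intro x t h1
    by_contra h2
    exact hnb x.1 t h1 (Or.inr ⟨x, (HModel m).isBoundaryPoint_iff_not_isInteriorPoint x |>.2 h2, rfl⟩)

end LevelFlow

/-! ### The time at which the flow crosses the level set -/

section Real

/-- A continuous function which is increasing at its zeros is positive after each of them. -/
theorem pos_of_zero_of_deriv_pos {g : ℝ → ℝ} (hg : Continuous g)
    (hd : ∀ t, g t = 0 → ∃ g', 0 < g' ∧ HasDerivAt g g' t) {t₀ t : ℝ} (h₀ : g t₀ = 0)
    (ht : t₀ < t) : 0 < g t := by
  have hslope : ∀ s, g s = 0 → ∀ᶠ z in 𝓝[≠] s, 0 < g z * (z - s) := by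
    intro s hs
    obtain ⟨g', hg', h1⟩ := hd s hs
    filter_upwards [(hasDerivAt_iff_tendsto_slope.1 h1).eventually_const_lt hg',
      self_mem_nhdsWithin] with z hz hzs
    rw [slope_def_field, hs, sub_zero] at hz
    have h2 : 0 < (z - s) ^ 2 := by
      have : z - s ≠ 0 := sub_ne_zero.2 hzs
      positivity
    have h3 : g z * (z - s) = g z / (z - s) * (z - s) ^ 2 := by
      have : z - s ≠ 0 := sub_ne_zero.2 hzs
      field_simp
    rw [h3]; exact mul_pos hz h2
  by_contra hneg
  obtain ⟨t₂, ht₂, hpos⟩ : ∃ t₂ ∈ Ioo t₀ t, 0 < g t₂ := by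
    have h1 := (hslope t₀ h₀).filter_mono (nhdsGT_le_nhdsNE t₀)
    obtain ⟨z, hz, hz'⟩ := (h1.and (Ioo_mem_nhdsGT ht)).exists
    exact ⟨z, hz', pos_of_mul_pos_left hz (sub_nonneg.2 hz'.1.le)⟩
  let S := Icc t₂ t ∩ {s | g s ≤ 0}
  have hS : IsClosed S := isClosed_Icc.inter (isClosed_le hg continuous_const)
  have hSne : S.Nonempty := ⟨t, ⟨ht₂.2.le, le_rfl⟩, not_lt.1 hneg⟩
  have hSb : BddBelow S := ⟨t₂, fun s hs => hs.1.1⟩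
  have hm := hS.csInf_mem hSne hSb
  set s := sInf S
  have hlt : ∀ z ∈ Ico t₂ s, 0 < g z := by
    intro z hz
    by_contra h
    exact absurd (csInf_le hSb ⟨⟨hz.1, hz.2.le.trans hm.1.2⟩, not_lt.1 h⟩) (not_le.2 hz.2)
  have h2s : t₂ < s := lt_of_le_of_ne hm.1.1 fun h => by
    have : g s ≤ 0 := hm.2
    rw [← h] at this; exact absurd hpos (not_lt.2 this)
  have hev : ∀ᶠ z in 𝓝[<] s, 0 < g z := by
    filter_upwards [Ioo_mem_nhdsLT h2s] with z hz
    exact hlt z ⟨hz.1.le, hz.2⟩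
  have hs0 : g s = 0 := le_antisymm hm.2
    (ge_of_tendsto (hg.continuousAt.tendsto.mono_left nhdsWithin_le_nhds) (hev.mono fun _ h => h.le))
  obtain ⟨z, ⟨hz1, hz2⟩, hz3⟩ := (((hslope s hs0).filter_mono (nhdsLT_le_nhdsNE s)).and
    hev |>.and self_mem_nhdsWithin).exists
  have hz4 : z < s := hz3
  nlinarith

theorem neg_of_zero_of_deriv_pos {g : ℝ → ℝ} (hg : Continuous g)
    (hd : ∀ t, g t = 0 → ∃ g', 0 < g' ∧ HasDerivAt g g' t) {t₀ t : ℝ} (h₀ : g t₀ = 0)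
    (ht : t < t₀) : g t < 0 := by
  have h1 := pos_of_zero_of_deriv_pos (g := fun s => -g (-s)) (by fun_prop) (fun s hs => by
    obtain ⟨g', hg', h⟩ := hd (-s) (neg_eq_zero.1 hs)
    have h2 : HasDerivAt (fun s => -g (-s)) (-(g' * -1)) s :=
      (HasDerivAt.comp s h (hasDerivAt_neg s)).neg
    exact ⟨g', hg', by simpa using h2⟩) (t₀ := -t₀) (t := -t)
    (by simp [h₀]) (neg_lt_neg ht)
  simpa using h1

end Real

/-- The implicit function theorem for a continuous solution of an equation in one unknown, at an
interior point of a manifold with boundary. -/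
theorem contMDiffAt_of_implicit {k : ℕ} {M : Type*} [TopologicalSpace M]
    [ChartedSpace (HSpace k) M] [IsManifold (HModel k) ∞ M] {G : ℝ × M → ℝ}
    (hG : ContMDiff (𝓘(ℝ, ℝ).prod (HModel k)) 𝓘(ℝ, ℝ) ∞ G) {x : M}
    (hx : (HModel k).IsInteriorPoint x) {τ : M → ℝ} (hτ : ContinuousAt τ x)
    (hz : ∀ᶠ z in 𝓝 x, G (τ z, z) = 0)
    (hd : ∃ g', g' ≠ 0 ∧ HasDerivAt (fun t => G (t, x)) g' (τ x)) :
    ContMDiffAt (HModel k) 𝓘(ℝ, ℝ) ∞ τ x := by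
  let φ := extChartAt (HModel k) x
  have hφx : φ.symm (φ x) = x := extChartAt_to_inv x
  let f : 𝔼 k × ℝ → ℝ := fun p => G (p.2, φ.symm p.1)
  let u : 𝔼 k × ℝ := (φ x, τ x)
  have hfu : f u = 0 := by
    change G (τ x, φ.symm (φ x)) = 0
    rw [hφx]; exact hz.self_of_nhds
  have hsymm : ContMDiffAt 𝓘(ℝ, 𝔼 k) (HModel k) ∞ φ.symm (φ x) :=
    (contMDiffOn_extChartAt_symm x).contMDiffAt
      ((mem_interior_iff_mem_nhds.1 (by
        rw [ModelWithCorners.isInteriorPoint_iff] at hx; exact hx)))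
  have hf : ContDiffAt ℝ ∞ f u := by
    rw [← contMDiffAt_iff_contDiffAt]
    refine hG.contMDiffAt.comp u (ContMDiffAt.prodMk contDiff_snd.contMDiff.contMDiffAt ?_)
    exact ContMDiffAt.comp u (g := φ.symm) (f := Prod.fst) hsymm contDiff_fst.contMDiff.contMDiffAt
  obtain ⟨g', hg', hd⟩ := hd
  have hd2 : (fderiv ℝ f u ∘L .inr ℝ _ _) 1 = g' := by
    have h1 : HasFDerivAt (fun t : ℝ => ((φ x, t) : 𝔼 k × ℝ))
      (ContinuousLinearMap.inr ℝ (𝔼 k) ℝ) (τ x) := hasFDerivAt_prodMk_right _ _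
    have h2 := ((hf.differentiableAt (by simp)).hasFDerivAt.comp (τ x) h1).hasDerivAt
    refine h2.unique ?_
    have h3 : f ∘ (fun t : ℝ => ((φ x, t) : 𝔼 k × ℝ)) = fun t => G (t, x) := by
      funext t
      change G (t, φ.symm (φ x)) = _
      rw [hφx]
    rw [h3]; exact hd
  have hinv : (fderiv ℝ f u ∘L .inr ℝ _ _).IsInvertible := by
    refine ⟨ContinuousLinearEquiv.unitsEquivAut ℝ (Units.mk0 g' hg'), ?_⟩
    refine ContinuousLinearMap.ext_ring ?_
    rw [hd2]; simp
  have hne : (∞ : WithTop ℕ∞) ≠ 0 := by simp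
  have h1 := hf.eventually_apply_eq_iff_implicitFunction hne hinv
  have h2 := hf.contDiffAt_implicitFunction hne hinv
  have h3 : ContinuousAt (fun z => (φ z, τ z)) x := (continuousAt_extChartAt x).prodMk hτ
  have h4 : ∀ᶠ z in 𝓝 x, (hf.implicitFunction hne hinv) (φ z) = τ z := by
    filter_upwards [h3.eventually h1, hz, extChartAt_source_mem_nhds (I := HModel k) x] with z h5 h6 h7
    refine h5.1 ?_
    rw [hfu]
    change G (τ z, φ.symm (φ z)) = 0
    rw [φ.left_inv h7, h6]
  have h5 : ContMDiffAt (HModel k) 𝓘(ℝ, ℝ) ∞ (fun z => (hf.implicitFunction hne hinv) (φ z)) x :=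
    ContMDiffAt.comp x (g := hf.implicitFunction hne hinv) (f := φ) h2.contMDiffAt
      contMDiffAt_extChartAt
  exact h5.congr_of_eventuallyEq (h4.mono fun _ h => h.symm)

namespace LevelFlow

variable {W : FibPM l L n m X} {h : X → ℝ} (𝓕 : LevelFlow W h)

/-- The set of points whose trajectory crosses the level set. -/
def dom : Set X := {x | ∃ t, h (𝓕.Φ t x) = 0}

open Classical in
/-- The time needed to reach `x` from the level set, with the junk value `0` outside `dom`. -/
def time (x : X) : ℝ := if hx : x ∈ 𝓕.dom then -hx.choose else 0

theorem flow_neg_flow (t : ℝ) (x : X) : 𝓕.Φ (-t) (𝓕.Φ t x) = x := by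
  rw [← 𝓕.add, neg_add_cancel, 𝓕.zero]

theorem continuous_flow (t : ℝ) : Continuous (𝓕.Φ t) :=
  𝓕.continuous.comp (continuous_const.prodMk continuous_id)

theorem hasDerivAt_of_zero (x : X) {t : ℝ} (ht : h (𝓕.Φ t x) = 0) :
    ∃ h', 0 < h' ∧ HasDerivAt (fun t => h (𝓕.Φ t x)) h' t := by
  obtain ⟨h', h1, h2⟩ := 𝓕.deriv_pos _ ht
  refine ⟨h', h1, ?_⟩
  have h3 : HasDerivAt (fun s => h (𝓕.Φ s (𝓕.Φ t x))) h' (t - t) := by rwa [sub_self]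
  have h4 := h3.comp_sub_const t t
  refine h4.congr_of_eventuallyEq (Filter.Eventually.of_forall fun s => ?_)
  change _ = h (𝓕.Φ (s - t) (𝓕.Φ t x))
  rw [← 𝓕.add, sub_add_cancel]

section Time

theorem continuous_orbit (hh : Continuous h) (x : X) : Continuous fun t => h (𝓕.Φ t x) :=
  hh.comp (𝓕.continuous.comp (continuous_id.prodMk continuous_const))

theorem apply_neg_time {x : X} (hx : x ∈ 𝓕.dom) : h (𝓕.Φ (-𝓕.time x) x) = 0 := by
  rw [time, dif_pos hx, neg_neg]; exact hx.choose_spec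

theorem pos_of_lt (hh : Continuous h) {x : X} {s t : ℝ} (hs : h (𝓕.Φ s x) = 0) (hst : s < t) :
    0 < h (𝓕.Φ t x) :=
  pos_of_zero_of_deriv_pos (𝓕.continuous_orbit hh x) (fun _ h0 => 𝓕.hasDerivAt_of_zero x h0) hs hst

theorem neg_of_lt (hh : Continuous h) {x : X} {s t : ℝ} (hs : h (𝓕.Φ s x) = 0) (hst : t < s) :
    h (𝓕.Φ t x) < 0 :=
  neg_of_zero_of_deriv_pos (𝓕.continuous_orbit hh x) (fun _ h0 => 𝓕.hasDerivAt_of_zero x h0) hs hst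

theorem time_eq (hh : Continuous h) {x : X} {t : ℝ} (ht : h (𝓕.Φ t x) = 0) : 𝓕.time x = -t := by
  have hx : x ∈ 𝓕.dom := ⟨t, ht⟩
  have h1 := 𝓕.apply_neg_time hx
  rcases lt_trichotomy (-𝓕.time x) t with h2 | h2 | h2
  · exact absurd (𝓕.pos_of_lt hh h1 h2) (by rw [ht]; exact lt_irrefl _)
  · linarith
  · exact absurd (𝓕.pos_of_lt hh ht h2) (by rw [h1]; exact lt_irrefl _)

theorem mem_dom_of_zero {x : X} (hx : h x = 0) : x ∈ 𝓕.dom := ⟨0, by rw [𝓕.zero]; exact hx⟩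

theorem time_of_zero (hh : Continuous h) {x : X} (hx : h x = 0) : 𝓕.time x = 0 := by
  rw [𝓕.time_eq hh (t := 0) (by rw [𝓕.zero]; exact hx), neg_zero]

theorem flow_mem_dom (t : ℝ) {x : X} : 𝓕.Φ t x ∈ 𝓕.dom ↔ x ∈ 𝓕.dom := by
  constructor
  · rintro ⟨s, hs⟩
    exact ⟨s + t, by rw [𝓕.add]; exact hs⟩
  · rintro ⟨s, hs⟩
    exact ⟨s - t, by rw [← 𝓕.add, sub_add_cancel]; exact hs⟩

theorem time_flow (hh : Continuous h) {x : X} (hx : x ∈ 𝓕.dom) (t : ℝ) :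
    𝓕.time (𝓕.Φ t x) = 𝓕.time x + t := by
  have h1 := 𝓕.apply_neg_time hx
  rw [𝓕.time_eq hh (t := -𝓕.time x - t) (by rw [← 𝓕.add, sub_add_cancel]; exact h1)]
  ring

theorem time_pos_iff (hh : Continuous h) {x : X} (hx : x ∈ 𝓕.dom) : 0 < 𝓕.time x ↔ 0 < h x := by
  have h1 := 𝓕.apply_neg_time hx
  constructor
  · intro h2
    have := 𝓕.pos_of_lt hh h1 (neg_lt_zero.2 h2)
    rwa [𝓕.zero] at this
  · intro h2
    by_contra h3
    rcases (not_lt.1 h3).lt_or_eq with h4 | h4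
    · have := 𝓕.neg_of_lt hh h1 (t := 0) (by linarith)
      rw [𝓕.zero] at this; linarith
    · rw [h4, neg_zero, 𝓕.zero] at h1; linarith

theorem time_eq_zero_iff (hh : Continuous h) {x : X} (hx : x ∈ 𝓕.dom) : 𝓕.time x = 0 ↔ h x = 0 := by
  refine ⟨fun h2 => ?_, 𝓕.time_of_zero hh⟩
  have h1 := 𝓕.apply_neg_time hx
  rwa [h2, neg_zero, 𝓕.zero] at h1

theorem time_nonneg_iff (hh : Continuous h) {x : X} (hx : x ∈ 𝓕.dom) : 0 ≤ 𝓕.time x ↔ 0 ≤ h x := by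
  rw [le_iff_lt_or_eq, le_iff_lt_or_eq, 𝓕.time_pos_iff hh hx, eq_comm, 𝓕.time_eq_zero_iff hh hx,
    eq_comm]

theorem eventually_time (hh : Continuous h) {x : X} (hx : x ∈ 𝓕.dom) {ε : ℝ} (hε : 0 < ε) :
    ∀ᶠ z in 𝓝 x, z ∈ 𝓕.dom ∧ |𝓕.time z - 𝓕.time x| < ε := by
  have h1 := 𝓕.apply_neg_time hx
  have h2 := 𝓕.pos_of_lt hh h1 (t := -𝓕.time x + ε / 2) (by linarith)
  have h3 := 𝓕.neg_of_lt hh h1 (t := -𝓕.time x - ε / 2) (by linarith)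
  have hc : ∀ t, Continuous fun z => h (𝓕.Φ t z) := fun t => hh.comp (𝓕.continuous_flow t)
  filter_upwards [(hc _).continuousAt.eventually_const_lt h2,
    (hc _).continuousAt.eventually_lt_const h3] with z h4 h5
  obtain ⟨t, ht, ht0⟩ := intermediate_value_Icc (by linarith)
    (𝓕.continuous_orbit hh z).continuousOn ⟨h5.le, h4.le⟩
  refine ⟨⟨t, ht0⟩, ?_⟩
  rw [𝓕.time_eq hh ht0, abs_lt]
  constructor <;> linarith [ht.1, ht.2]

theorem isOpen_dom (hh : Continuous h) : IsOpen 𝓕.dom := by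
  rw [isOpen_iff_mem_nhds]
  intro x hx
  exact (𝓕.eventually_time hh hx one_pos).mono fun z hz => hz.1

theorem continuousAt_time (hh : Continuous h) {x : X} (hx : x ∈ 𝓕.dom) : ContinuousAt 𝓕.time x := by
  rw [Metric.continuousAt_iff']
  intro ε hε
  exact (𝓕.eventually_time hh hx hε).mono fun z hz => hz.2

theorem contMDiffAt_time_reg (hh : IsSmoothFun W♭ h) {x : W.Reg} (hx : x.1 ∈ 𝓕.dom) :
    ContMDiffAt (HModel n) 𝓘(ℝ, ℝ) ∞ (fun z : W.Reg => 𝓕.time z.1) x := by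
  have h1 : ContMDiffAt (HModel n) 𝓘(ℝ, ℝ) ∞ (fun z : W.Reg => -𝓕.time z.1) x := by
    refine contMDiffAt_of_implicit (hh.smooth_reg.comp 𝓕.smooth_reg)
      (𝓕.interior_reg x _ (𝓕.apply_neg_time hx))
      ((𝓕.continuousAt_time hh.continuous hx).comp continuous_subtype_val.continuousAt).neg ?_ ?_
    · filter_upwards [((𝓕.isOpen_dom hh.continuous).preimage continuous_subtype_val).mem_nhds hx]
        with z hz
      exact 𝓕.apply_neg_time hz
    · obtain ⟨g', hg', h2⟩ := 𝓕.hasDerivAt_of_zero x.1 (𝓕.apply_neg_time hx)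
      exact ⟨g', hg'.ne', h2⟩
  have h2 : ContMDiffAt (HModel n) 𝓘(ℝ, ℝ) ∞ (fun z : W.Reg => -(-𝓕.time z.1)) x :=
    contDiff_neg.contMDiff.contMDiffAt.comp x h1
  simpa using h2

theorem contMDiffAt_time_sing (hh : IsSmoothFun W♭ h) {x : W.Sing} (hx : x.1 ∈ 𝓕.dom) :
    ContMDiffAt (HModel m) 𝓘(ℝ, ℝ) ∞ (fun z : W.Sing => 𝓕.time z.1) x := by
  have h1 : ContMDiffAt (HModel m) 𝓘(ℝ, ℝ) ∞ (fun z : W.Sing => -𝓕.time z.1) x := by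
    refine contMDiffAt_of_implicit (hh.smooth_sing.comp 𝓕.smooth_sing)
      (𝓕.interior_sing x _ (𝓕.apply_neg_time hx))
      ((𝓕.continuousAt_time hh.continuous hx).comp continuous_subtype_val.continuousAt).neg ?_ ?_
    · filter_upwards [((𝓕.isOpen_dom hh.continuous).preimage continuous_subtype_val).mem_nhds hx]
        with z hz
      exact 𝓕.apply_neg_time hz
    · obtain ⟨g', hg', h2⟩ := 𝓕.hasDerivAt_of_zero x.1 (𝓕.apply_neg_time hx)
      exact ⟨g', hg'.ne', h2⟩
  have h2 : ContMDiffAt (HModel m) 𝓘(ℝ, ℝ) ∞ (fun z : W.Sing => -(-𝓕.time z.1)) x :=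
    contDiff_neg.contMDiff.contMDiffAt.comp x h1
  simpa using h2

/-- Points near the level set have small crossing times. -/
theorem exists_time_lt (hh : Continuous h) {η : ℝ} (hη : 0 < η) :
    ∃ σ > 0, ∀ x, |h x| < σ → x ∈ 𝓕.dom ∧ |𝓕.time x| < η := by
  have := W.compact
  let K : Set X := {x | x ∈ 𝓕.dom ∧ |𝓕.time x| < η}ᶜ
  have hK : IsCompact K := by
    refine IsClosed.isCompact (isClosed_compl_iff.2 ?_)
    rw [isOpen_iff_mem_nhds]
    rintro x ⟨hx, hx'⟩
    filter_upwards [(𝓕.isOpen_dom hh).mem_nhds hx,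
      (𝓕.continuousAt_time hh hx).abs.eventually_lt_const hx'] with z h1 h2
    exact ⟨h1, h2⟩
  rcases K.eq_empty_or_nonempty with h0 | h0
  · refine ⟨1, one_pos, fun x _ => ?_⟩
    by_contra hx
    exact (h0 ▸ (hx : x ∈ K) : x ∈ (∅ : Set X))
  · obtain ⟨x₀, hx₀, hmin⟩ := hK.exists_isMinOn h0 hh.abs.continuousOn
    refine ⟨|h x₀|, abs_pos.2 fun h1 => hx₀ ⟨𝓕.mem_dom_of_zero h1, ?_⟩, fun x hx => ?_⟩
    · rw [𝓕.time_of_zero hh h1, abs_zero]; exact hη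
    · by_contra hxK
      exact absurd (hmin hxK) (not_le.2 hx)

/-- Points with small crossing times are near the level set. -/
theorem exists_abs_lt (hh : Continuous h) {σ : ℝ} (hσ : 0 < σ) :
    ∃ η > 0, ∀ x ∈ 𝓕.dom, |𝓕.time x| < η → |h x| < σ := by
  have := W.compact
  have hK : IsCompact {x | h x = 0} := (isClosed_eq hh continuous_const).isCompact
  have h1 : ∀ᶠ t : ℝ in 𝓝 0, ∀ x ∈ {x | h x = 0}, |h (𝓕.Φ t x)| < σ := by
    refine hK.eventually_forall_of_forall_eventually fun x hx => ?_
    have h2 : ContinuousAt (fun z : ℝ × X => |h (𝓕.Φ z.1 z.2)|) (0, x) :=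
      (hh.comp 𝓕.continuous).abs.continuousAt
    refine h2.eventually_lt_const ?_
    change |h (𝓕.Φ 0 x)| < σ
    rw [𝓕.zero, show h x = 0 from hx, abs_zero]; exact hσ
  obtain ⟨η, hη, h2⟩ := Metric.eventually_nhds_iff.1 h1
  refine ⟨η, hη, fun x hx hxη => ?_⟩
  have h3 := h2 (y := 𝓕.time x) (by rwa [Real.dist_eq, sub_zero]) _ (𝓕.apply_neg_time hx)
  rwa [← 𝓕.add, add_neg_cancel, 𝓕.zero] at h3

theorem isClosed_time_le (hh : Continuous h) (η : ℝ) : IsClosed {x | x ∈ 𝓕.dom ∧ |𝓕.time x| ≤ η} := by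
  have := W.compact
  have := W.hausdorff
  have hK : IsCompact {x | h x = 0} := (isClosed_eq hh continuous_const).isCompact
  have h1 : {x | x ∈ 𝓕.dom ∧ |𝓕.time x| ≤ η} =
      (fun p : ℝ × X => 𝓕.Φ p.1 p.2) '' (Icc (-η) η ×ˢ {x | h x = 0}) := by
    ext x
    constructor
    · rintro ⟨hx, hx'⟩
      refine ⟨(𝓕.time x, 𝓕.Φ (-𝓕.time x) x), ⟨abs_le.1 hx', 𝓕.apply_neg_time hx⟩, ?_⟩
      change 𝓕.Φ _ (𝓕.Φ _ x) = x
      rw [← 𝓕.add, add_neg_cancel, 𝓕.zero]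
    · rintro ⟨⟨t, z⟩, ⟨ht, hz⟩, rfl⟩
      have hz' : z ∈ 𝓕.dom := 𝓕.mem_dom_of_zero hz
      refine ⟨(𝓕.flow_mem_dom t).2 hz', ?_⟩
      change |𝓕.time (𝓕.Φ t z)| ≤ η
      rw [𝓕.time_flow hh hz', 𝓕.time_of_zero hh hz, zero_add]
      exact abs_le.2 ht
  rw [h1]
  exact ((isCompact_Icc.prod hK).image 𝓕.continuous).isClosed

end Time

section Tube

variable [CompactSpace L]

/-- Near the singular stratum, the crossing times of `x` and `π x` are uniformly close. -/
theorem exists_time_sub_retr_lt (hh : Continuous h) {η : ℝ} (hη : 0 < η) :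
    ∃ r > 0, r ≤ 𝓕.r₀ ∧ ∀ x ∈ W.tube, W.rho x < r → (W.retr x ∈ 𝓕.dom ↔ x ∈ 𝓕.dom) ∧
      (x ∈ 𝓕.dom → |𝓕.time x - 𝓕.time (W.retr x)| < η) := by
  obtain ⟨σ, hσ, h1⟩ := 𝓕.exists_time_lt hh hη
  obtain ⟨r, hr, h2⟩ := W.exists_abs_sub_retr_lt hh hσ
  refine ⟨min r 𝓕.r₀, lt_min hr 𝓕.r₀_pos, min_le_right _ _, fun x hx hxr => ?_⟩
  have hr1 : W.rho x < r := hxr.trans_le (min_le_left _ _)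
  have hr2 : W.rho x < 𝓕.r₀ := hxr.trans_le (min_le_right _ _)
  have key : ∀ t, |h (𝓕.Φ t x) - h (𝓕.Φ t (W.retr x))| < σ := by
    intro t
    rw [← 𝓕.retr_eq t x hx hr2]
    exact h2 _ (𝓕.mem_tube t x hx hr2) (by rwa [𝓕.rho_eq t x hx hr2])
  have key2 : x ∈ 𝓕.dom → W.retr x ∈ 𝓕.dom ∧ |𝓕.time x - 𝓕.time (W.retr x)| < η := by
    intro hxd
    have h3 := key (-𝓕.time x)
    rw [𝓕.apply_neg_time hxd, zero_sub, abs_neg] at h3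
    obtain ⟨h4, h5⟩ := h1 _ h3
    have h6 := (𝓕.flow_mem_dom _).1 h4
    refine ⟨h6, ?_⟩
    rw [𝓕.time_flow hh h6] at h5
    rwa [abs_sub_comm, sub_eq_add_neg]
  refine ⟨⟨fun hxd => ?_, fun hxd => (key2 hxd).1⟩, fun hxd => (key2 hxd).2⟩
  have h3 := key (-𝓕.time (W.retr x))
  rw [𝓕.apply_neg_time hxd, sub_zero] at h3
  exact (𝓕.flow_mem_dom _).1 (h1 _ h3).1

end Tube

/-- The reversed flow, which crosses the level set in the direction in which `-h` increases. -/
def reverse {h' : X → ℝ} (hh' : ∀ x, h' x = -h x) : LevelFlow W h' where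
  Φ t x := 𝓕.Φ (-t) x
  r₀ := 𝓕.r₀
  r₀_pos := 𝓕.r₀_pos
  continuous := 𝓕.continuous.comp (continuous_fst.neg.prodMk continuous_snd)
  zero x := by rw [neg_zero, 𝓕.zero]
  add s t x := by rw [← 𝓕.add, neg_add]
  mem_sing t x := 𝓕.mem_sing (-t) x
  smooth_reg := 𝓕.smooth_reg.comp ((contDiff_neg.contMDiff.comp contMDiff_fst).prodMk contMDiff_snd)
  smooth_sing := 𝓕.smooth_sing.comp ((contDiff_neg.contMDiff.comp contMDiff_fst).prodMk contMDiff_snd)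
  mem_tube t := 𝓕.mem_tube (-t)
  rho_eq t := 𝓕.rho_eq (-t)
  retr_eq t := 𝓕.retr_eq (-t)
  deriv_pos x hx := by
    obtain ⟨g', hg', h1⟩ := 𝓕.deriv_pos x (by rw [hh', neg_eq_zero] at hx; exact hx)
    refine ⟨g', hg', ?_⟩
    have h2 : HasDerivAt (fun s => -h (𝓕.Φ (-s) x)) (-(g' * -1)) 0 :=
      (HasDerivAt.comp (h₂ := fun t => h (𝓕.Φ t x)) 0 (by rwa [neg_zero]) (hasDerivAt_neg 0)).neg
    simpa [hh'] using h2
  interior_reg x t ht := 𝓕.interior_reg x (-t) (by rw [hh', neg_eq_zero] at ht; exact ht)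
  interior_sing x t ht := 𝓕.interior_sing x (-t) (by rw [hh', neg_eq_zero] at ht; exact ht)

theorem mem_dom_reverse {h' : X → ℝ} (hh' : ∀ x, h' x = -h x) {x : X} :
    x ∈ (𝓕.reverse hh').dom ↔ x ∈ 𝓕.dom := by
  constructor
  · rintro ⟨t, ht⟩
    exact ⟨-t, by rw [hh', neg_eq_zero] at ht; exact ht⟩
  · rintro ⟨t, ht⟩
    refine ⟨-t, ?_⟩
    change h' (𝓕.Φ (- -t) x) = 0
    rw [hh', neg_neg, ht, neg_zero]

theorem time_reverse (hh : Continuous h) {h' : X → ℝ} (hh' : ∀ x, h' x = -h x) {x : X}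
    (hx : x ∈ 𝓕.dom) : (𝓕.reverse hh').time x = -𝓕.time x := by
  have h1 : Continuous h' := by
    have : h' = fun x => -h x := funext hh'
    rw [this]; exact hh.neg
  refine (𝓕.reverse hh').time_eq h1 ?_
  change h' (𝓕.Φ (-𝓕.time x) x) = 0
  rw [hh', 𝓕.apply_neg_time hx, neg_zero]

end LevelFlow

/-! ### Subspaces with modified control data -/

section Retube

/-- Near the point `x` of the regular stratum, the map `A` is a smooth map of this stratum. -/
def SmoothRegAt {n m : ℕ} {X : Type u} [TopologicalSpace X] (W : StratData n m X) (A : X → X)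
    (x : W.Reg) : Prop :=
  ∃ B : W.Reg → W.Reg, ContMDiffAt (HModel n) (HModel n) ∞ B x ∧ ∀ᶠ z in 𝓝 x, (B z).1 = A z.1

/-- Modified control data for a subset `R` of a pseudomanifold with fibered singularities. The
points of the new tube `T ∩ R` are identified by `Θ`, with inverse `Λ`, with the points `x` of the
old tube with `π x ∈ R` which are close to the singular stratum, in the sense that
`κ (π x) ρ x < 1`. The new retraction is `π ∘ Θ`, and the new radial function is `ρ / (1 - κ ρ)`,
which takes all values in `[0, ∞)`. -/
structure Retube (W : FibPM l L n m X) (R : Set X) where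
  κ : X → ℝ
  κ_nonneg : ∀ y, 0 ≤ κ y
  smooth_κ : ContMDiff (HModel m) 𝓘(ℝ, ℝ) ∞ (fun y : W.Sing => κ y.1)
  T : Set X
  N : Set X
  isOpen_T : IsOpen T
  Θ : X → X
  Λ : X → X
  continuousOn_Θ : ContinuousOn Θ T
  continuousOn_Λ : ContinuousOn Λ N
  smooth_Θ : ∀ x : W.Reg, x.1 ∈ T → SmoothRegAt W♭ Θ x
  smooth_Λ : ∀ x : W.Reg, x.1 ∈ N → SmoothRegAt W♭ Λ x
  mem_tube : ∀ x ∈ T, Θ x ∈ W.tube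
  rho_Θ : ∀ x ∈ T, W.rho (Θ x) = W.rho x
  Θ_sing : ∀ x ∈ T, x ∈ W.sing → Θ x = x
  sing_subset : W.sing ∩ R ⊆ T
  maps_Θ : ∀ x ∈ T ∩ R, W.retr (Θ x) ∈ R ∧ κ (W.retr (Θ x)) * W.rho x < 1 ∧ Λ (Θ x) = x
  maps_Λ : ∀ x ∈ W.tube, W.retr x ∈ R → κ (W.retr x) * W.rho x < 1 →
    x ∈ N ∧ Λ x ∈ T ∩ R ∧ Θ (Λ x) = x

variable {n' m' : ℕ} {Z : Type w} [TopologicalSpace Z] {W : FibPM l L n m X} {j : Z → X}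

/-- The restriction of `j` to the preimage of the regular stratum. -/
def StratData.pullReg (W : StratData n m X) (j : Z → X) (z : ↥(j ⁻¹' W.sing)ᶜ) : W.Reg := ⟨j z.1, z.2⟩

/-- The restriction of `j` to the preimage of the singular stratum. -/
def StratData.pullSing (W : StratData n m X) (j : Z → X) (z : ↥(j ⁻¹' W.sing)) : W.Sing :=
  ⟨j z.1, z.2⟩

theorem StratData.continuousAt_projExt {W : StratData n m X} (y₀ : W.Sing) {x : W.Reg}
    (hx : x.1 ∈ W.tube) : ContinuousAt (W.projExt y₀) x := by
  rw [IsInducing.subtypeVal.continuousAt_iff]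
  have h1 : ContinuousAt (fun x : W.Reg => W.retr x.1) x :=
    ContinuousAt.comp (g := W.retr) (continuousAt_retr hx) continuous_subtype_val.continuousAt
  refine h1.congr ?_
  filter_upwards [(W.isOpen_tube.preimage continuous_subtype_val).mem_nhds hx] with z hz
  exact (projExt_val y₀ hz).symm

theorem ConeChart.retr_param {U : Set W.Sing} (τ : ConeChart W♭ l L U) {y : W.Sing}
    (hy : y ∈ U) (q : L) {r : ℝ} (hr : 0 < r) : W.retr (τ.param (y, q, r)).1 = y.1 := by
  obtain ⟨h, h1, -⟩ := τ.param_mem y hy q r hr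
  rw [retr_of_mem h, h1]

theorem ConeChart.rho_param {U : Set W.Sing} (τ : ConeChart W♭ l L U) {y : W.Sing}
    (hy : y ∈ U) (q : L) {r : ℝ} (hr : 0 < r) : W.rho (τ.param (y, q, r)).1 = r := by
  obtain ⟨h, -, h1⟩ := τ.param_mem y hy q r hr
  rw [rho_of_mem h, h1]

namespace Retube

section Basic

variable {R : Set X} (E : Retube W R)

theorem Θ_mem_sing {x : X} (hx : x ∈ E.T) : E.Θ x ∈ W.sing ↔ x ∈ W.sing := by
  rw [← rho_eq_zero_iff, E.rho_Θ x hx, rho_eq_zero_iff]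

/-- The change of the radial coordinate. -/
theorem shrink_pos {k r : ℝ} (hk : 0 ≤ k) (hr : 0 < r) : 0 < r / (1 + k * r) := by positivity

theorem shrink_lt {k r : ℝ} (hk : 0 ≤ k) (hr : 0 ≤ r) : k * (r / (1 + k * r)) < 1 := by
  rw [mul_div_assoc', div_lt_one (by positivity)]; linarith

theorem stretch_shrink {k r : ℝ} (hk : 0 ≤ k) (hr : 0 ≤ r) :
    r / (1 + k * r) / (1 - k * (r / (1 + k * r))) = r := by
  have h : 0 < 1 + k * r := by positivity
  have h2 : 1 - k * (r / (1 + k * r)) = 1 / (1 + k * r) := by field_simp; ring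
  rw [h2]; field_simp

theorem shrink_stretch {k r : ℝ} (h : k * r < 1) :
    r / (1 - k * r) / (1 + k * (r / (1 - k * r))) = r := by
  have h1 : 1 - k * r ≠ 0 := by linarith
  have h2 : 1 + k * (r / (1 - k * r)) = 1 / (1 - k * r) := by field_simp; ring
  rw [h2, div_div_div_cancel_right₀ h1, div_one]

theorem param_mem {U : Set W.Sing} (τ : ConeChart W♭ l L U) {y : W.Sing} (hy : y ∈ U)
    (hyR : y.1 ∈ R) (q : L) {r : ℝ} (hr : 0 < r) :
    let x := (τ.param (y, q, r / (1 + E.κ y.1 * r))).1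
    x ∈ W.tube ∧ W.retr x = y.1 ∧ W.rho x = r / (1 + E.κ y.1 * r) ∧ W.retr x ∈ R ∧
      E.κ (W.retr x) * W.rho x < 1 := by
  have h0 := shrink_pos (E.κ_nonneg y.1) hr
  have h1 := τ.retr_param hy q h0
  have h2 := τ.rho_param hy q h0
  refine ⟨τ.mem_tube (p := (y, q, _)) hy h0, h1, h2, by rw [h1]; exact hyR, ?_⟩
  rw [h1, h2]
  exact shrink_lt (E.κ_nonneg y.1) hr.le

/-- The radial part of the trivialisations, up to the vertices of the cones. -/
theorem continuousOn_cone {U : Set W.Sing} (τ : ConeChart W♭ l L U) :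
    ContinuousOn (fun q : W.Sing × L × ℝ => open Classical in
      if 0 < q.2.2 then E.Λ (τ.param (q.1, q.2.1, q.2.2 / (1 + E.κ q.1.1 * q.2.2))).1 else q.1.1)
      {q | q.1 ∈ U ∧ q.1.1 ∈ R ∧ 0 ≤ q.2.2} := by
  classical
  let S : W.Sing × L × ℝ → W.Sing × L × ℝ := fun q => (q.1, q.2.1, q.2.2 / (1 + E.κ q.1.1 * q.2.2))
  have hκ : Continuous fun y : W.Sing => E.κ y.1 := E.smooth_κ.continuous
  have hS : ContinuousOn S {q | q.1 ∈ U ∧ q.1.1 ∈ R ∧ 0 ≤ q.2.2} := by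
    refine continuousOn_fst.prodMk ((continuousOn_fst.comp continuousOn_snd fun _ _ => mem_univ _).prodMk
      (ContinuousOn.div (by fun_prop) (Continuous.continuousOn ?_) fun q hq => ?_))
    · exact continuous_const.add ((hκ.comp continuous_fst).mul (by fun_prop))
    · have := mul_nonneg (E.κ_nonneg q.1.1) hq.2.2
      exact (by linarith : 0 < 1 + E.κ q.1.1 * q.2.2).ne'
  have h1 := (τ.continuous_cone.comp hS fun q hq => ⟨hq.1, div_nonneg hq.2.2 (by
    have := mul_nonneg (E.κ_nonneg q.1.1) hq.2.2; linarith)⟩)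
  have hval : ∀ q : W.Sing × L × ℝ, q.1 ∈ U → q.1.1 ∈ R → 0 ≤ q.2.2 →
      (if 0 < (S q).2.2 then (τ.param (S q)).1 else (S q).1.1) ∈ E.N ∧
      E.Λ (if 0 < (S q).2.2 then (τ.param (S q)).1 else (S q).1.1) =
      if 0 < q.2.2 then E.Λ (τ.param (q.1, q.2.1, q.2.2 / (1 + E.κ q.1.1 * q.2.2))).1
        else q.1.1 := by
    rintro ⟨y, q, r⟩ h2 h3 h4
    rcases h4.lt_or_eq with h5 | h5
    · have h6 : 0 < (S (y, q, r)).2.2 := shrink_pos (E.κ_nonneg y.1) h5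
      rw [if_pos h6, if_pos h5]
      obtain ⟨h7, h8, h9, h10, h11⟩ := E.param_mem τ h2 h3 q h5
      exact ⟨(E.maps_Λ _ h7 h10 h11).1, rfl⟩
    · have h6 : ¬ 0 < (S (y, q, r)).2.2 := by
        change ¬ 0 < r / _
        rw [← show (0 : ℝ) = r from h5, zero_div]; exact lt_irrefl _
      have h7 : ¬ (0 < r) := by rw [← show (0 : ℝ) = r from h5]; exact lt_irrefl _
      rw [if_neg h6, if_neg h7]
      have h8 : W.retr y.1 = y.1 := retr_of_mem_sing y.2
      have h9 := E.maps_Λ y.1 (W.sing_subset_tube y.2) (by rw [h8]; exact h3)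
        (by rw [rho_eq_zero_iff.2 y.2, mul_zero]; exact one_pos)
      refine ⟨h9.1, ?_⟩
      have h10 := (E.maps_Θ y.1 ⟨E.sing_subset ⟨y.2, h3⟩, h3⟩).2.2
      rwa [E.Θ_sing _ (E.sing_subset ⟨y.2, h3⟩) y.2] at h10
  refine (E.continuousOn_Λ.comp h1 fun q hq => (hval q hq.1 hq.2.1 hq.2.2).1).congr fun q hq => ?_
  exact (hval q hq.1 hq.2.1 hq.2.2).2.symm

end Basic

variable (E : Retube W (range j)) (hj : IsClosedEmbedding j)

theorem exists_proj (E : Retube W (range j)) (z : ↥(j ⁻¹' E.T)) :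
    ∃ y : ↥(j ⁻¹' W.sing), j y.1 = W.retr (E.Θ (j z.1)) := by
  obtain ⟨y, hy⟩ := (E.maps_Θ (j z.1) ⟨z.2, z.1, rfl⟩).1
  exact ⟨⟨y, by rw [mem_preimage, hy]; exact retr_mem_sing (E.mem_tube _ z.2)⟩, hy⟩

/-- The preimage of the regular stratum is dense. -/
theorem dense_pullReg [CompactSpace L] (E : Retube W (range j)) (hj : IsClosedEmbedding j) :
    Dense (j ⁻¹' W.sing)ᶜ := by
  classical
  intro z
  by_cases hz : j z ∈ W.sing
  swap
  · exact subset_closure hz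
  rw [mem_closure_iff_nhds]
  intro O hO
  rw [hj.isInducing.nhds_eq_comap, Filter.mem_comap] at hO
  obtain ⟨O', hO', hOO'⟩ := hO
  obtain ⟨U, hU, hyU, ⟨τ⟩⟩ := W.exists_coneChart ⟨j z, hz⟩
  obtain ⟨q⟩ : Nonempty L := by
    obtain ⟨x, hx, hx'⟩ := W.dense_reg.inter_open_nonempty W.tube W.isOpen_tube
      ⟨j z, W.sing_subset_tube hz⟩
    exact ⟨τ.link ⟨x, hx'⟩⟩
  have h1 := E.continuousOn_cone τ (⟨j z, hz⟩, q, 0) ⟨hyU, ⟨z, rfl⟩, le_rfl⟩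
  have h2 : Filter.Tendsto (fun r : ℝ => ((⟨j z, hz⟩, q, r) : W.Sing × L × ℝ)) (𝓝[>] 0)
      (𝓝[{q | q.1 ∈ U ∧ q.1.1 ∈ range j ∧ 0 ≤ q.2.2}] (⟨j z, hz⟩, q, 0)) := by
    refine tendsto_nhdsWithin_iff.2 ⟨?_, ?_⟩
    · have : Continuous fun r : ℝ => ((⟨j z, hz⟩, q, r) : W.Sing × L × ℝ) := by fun_prop
      exact this.continuousAt.tendsto.mono_left nhdsWithin_le_nhds
    · filter_upwards [self_mem_nhdsWithin] with r hr
      exact ⟨hyU, ⟨z, rfl⟩, le_of_lt hr⟩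
  have h3 := (h1.tendsto.comp h2).eventually (p := fun x => x ∈ O') (by
    change ∀ᶠ x in 𝓝 (if (0 : ℝ) < 0 then _ else j z), x ∈ O'
    rw [if_neg (lt_irrefl _)]; exact hO')
  obtain ⟨r, hr, hr0⟩ := (h3.and self_mem_nhdsWithin).exists
  have hr0 : 0 < r := hr0
  rw [Function.comp_apply, if_pos hr0] at hr
  obtain ⟨h7, h8, h9, h10, h11⟩ := E.param_mem τ hyU ⟨z, rfl⟩ q hr0
  obtain ⟨h12, ⟨h13, z', hz'⟩, h14⟩ := E.maps_Λ _ h7 h10 h11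
  refine ⟨z', hOO' (by rw [mem_preimage, hz']; exact hr), fun h15 => ?_⟩
  rw [mem_preimage, hz', ← E.Θ_mem_sing h13, h14] at h15
  exact (τ.param _).2 h15

variable [CompactSpace L]

/-- The stratified space with the modified control data. -/
def stratData (E : Retube W (range j)) (hj : IsClosedEmbedding j)
    (Sr : SubStructure n n' (W.pullReg j)) (Ss : SubStructure m m' (W.pullSing j)) :
    StratData n' m' Z where
  compact := have := W.compact; hj.compactSpace
  hausdorff := have := W.hausdorff; hj.isEmbedding.t2Space
  secondCountable := have := W.secondCountable; hj.isEmbedding.secondCountableTopology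
  sing := j ⁻¹' W.sing
  isClosed_sing := W.isClosed_sing.preimage hj.continuous
  dense_reg := E.dense_pullReg hj
  regCharted := Sr.charted
  regManifold := Sr.manifold
  singCharted := Ss.charted
  singManifold := Ss.manifold
  tube := j ⁻¹' E.T
  isOpen_tube := E.isOpen_T.preimage hj.continuous
  sing_subset_tube z hz := E.sing_subset ⟨hz, z, rfl⟩
  proj z := (E.exists_proj z).choose
  continuous_proj := by
    refine continuous_induced_rng.2 (hj.isInducing.continuous_iff.2 ?_)
    have h1 : (j ∘ Subtype.val ∘ fun z : ↥(j ⁻¹' E.T) => (E.exists_proj z).choose) =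
        fun z : ↥(j ⁻¹' E.T) => W.retr (E.Θ (j z.1)) := funext fun z => (E.exists_proj z).choose_spec
    rw [h1]
    exact continuousOn_retr.comp_continuous (E.continuousOn_Θ.comp_continuous
      (hj.continuous.comp continuous_subtype_val) fun z => z.2) fun z => E.mem_tube _ z.2
  proj_sing z hz := by
    refine Subtype.ext (hj.injective ?_)
    rw [(E.exists_proj _).choose_spec]
    change W.retr (E.Θ (j z)) = j z
    rw [E.Θ_sing _ (E.sing_subset ⟨hz, z, rfl⟩) hz, retr_of_mem_sing hz]
  rad z := W.rho (j z.1) / (1 - E.κ (W.retr (E.Θ (j z.1))) * W.rho (j z.1))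
  continuous_rad := by
    have h0 : Continuous fun z : ↥(j ⁻¹' E.T) => j z.1 := hj.continuous.comp continuous_subtype_val
    have h1 : Continuous fun z : ↥(j ⁻¹' E.T) => E.Θ (j z.1) :=
      E.continuousOn_Θ.comp_continuous h0 fun z => z.2
    have h2 : Continuous fun z : ↥(j ⁻¹' E.T) => W.retr (E.Θ (j z.1)) :=
      continuousOn_retr.comp_continuous h1 fun z => E.mem_tube _ z.2
    have h3 : Continuous fun z : ↥(j ⁻¹' E.T) => W.rho (j z.1) := by
      refine (continuousOn_rho.comp_continuous h1 fun z => E.mem_tube _ z.2).congr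
        fun z => E.rho_Θ _ z.2
    have h4 : Continuous fun z : ↥(j ⁻¹' E.T) => E.κ (W.retr (E.Θ (j z.1))) := by
      have h5 : Continuous fun y : W.Sing => E.κ y.1 := E.smooth_κ.continuous
      exact h5.comp (h2.subtype_mk fun z => retr_mem_sing (E.mem_tube _ z.2))
    refine h3.div (continuous_const.sub (h4.mul h3)) fun z => ?_
    exact (sub_pos.2 (E.maps_Θ (j z.1) ⟨z.2, z.1, rfl⟩).2.1).ne'
  rad_nonneg z := div_nonneg (rho_nonneg _)
    (sub_pos.2 (E.maps_Θ (j z.1) ⟨z.2, z.1, rfl⟩).2.1).le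
  rad_eq_zero_iff z := by
    rw [div_eq_zero_iff, rho_eq_zero_iff]
    refine or_iff_left ?_
    exact (sub_pos.2 (E.maps_Θ (j z.1) ⟨z.2, z.1, rfl⟩).2.1).ne'

section Structure

variable {E hj} {Sr : SubStructure n n' (W.pullReg j)} {Ss : SubStructure m m' (W.pullSing j)}

local notation "𝐙" => stratData E hj Sr Ss

theorem proj_spec {z : Z} (hz : z ∈ 𝐙.tube) :
    j (𝐙.proj ⟨z, hz⟩).1 = W.retr (E.Θ (j z)) :=
  (E.exists_proj ⟨z, hz⟩).choose_spec

theorem rad_spec {z : Z} (hz : z ∈ 𝐙.tube) :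
    𝐙.rad ⟨z, hz⟩ =
      W.rho (j z) / (1 - E.κ (W.retr (E.Θ (j z))) * W.rho (j z)) := rfl

theorem smooth_pullReg : ContMDiff (HModel n') (HModel n) ∞
    (fun z : 𝐙.Reg => W.pullReg j z) := Sr.smooth

theorem smooth_pullSing : ContMDiff (HModel m') (HModel m) ∞
    (fun z : 𝐙.Sing => W.pullSing j z) := Ss.smooth

theorem initial_pullReg : IsInitial (HModel n) (HModel n')
    (fun z : 𝐙.Reg => W.pullReg j z) := Sr.initial

theorem initial_pullSing : IsInitial (HModel m) (HModel m')
    (fun z : 𝐙.Sing => W.pullSing j z) := Ss.initial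

theorem continuous_pullReg (hj : IsClosedEmbedding j) : Continuous (W.pullReg j) :=
  (hj.continuous.comp continuous_subtype_val).subtype_mk _

theorem continuous_pullSing (hj : IsClosedEmbedding j) : Continuous (W.pullSing j) :=
  (hj.continuous.comp continuous_subtype_val).subtype_mk _

theorem projExt_spec {y₀ : 𝐙.Sing} {z : 𝐙.Reg}
    (hz : z.1 ∈ 𝐙.tube) :
    j (𝐙.projExt y₀ z).1 = W.retr (E.Θ (j z.1)) := by
  rw [projExt_of_mem y₀ hz]; exact proj_spec hz

theorem smooth_proj_stratData (y₀ : 𝐙.Sing) (z : 𝐙.Reg)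
    (hz : z.1 ∈ 𝐙.tube) :
    ContMDiffAt (HModel n') (HModel m') ∞ (𝐙.projExt y₀) z := by
  obtain ⟨B, hB, hB'⟩ := E.smooth_Θ (W.pullReg j z) hz
  refine initial_pullSing.contMDiffAt (continuousAt_projExt y₀ hz) ?_
  have hBz : (B (W.pullReg j z)).1 ∈ W.tube := by rw [hB'.self_of_nhds]; exact E.mem_tube _ hz
  have h1 : ContMDiffAt (HModel n') (HModel m) ∞
      (fun z : 𝐙.Reg => W.projExt (W.pullSing j y₀) (B (W.pullReg j z))) z :=
    (W.smooth_proj (W.pullSing j y₀) _ hBz).comp z (hB.comp z (smooth_pullReg z))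
  refine h1.congr_of_eventuallyEq ?_
  filter_upwards [(𝐙.isOpen_tube.preimage continuous_subtype_val).mem_nhds hz,
    (continuous_pullReg hj).continuousAt.eventually hB'] with z' hz' hBz'
  refine Subtype.ext ?_
  have hBz2 : (B (W.pullReg j z')).1 ∈ W.tube := by rw [hBz']; exact E.mem_tube _ hz'
  rw [projExt_val _ hBz2, hBz']
  exact projExt_spec hz'

theorem smooth_rad_stratData (z : 𝐙.Reg)
    (hz : z.1 ∈ 𝐙.tube) :
    ContMDiffAt (HModel n') 𝓘(ℝ, ℝ) ∞ 𝐙.radExt z := by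
  obtain ⟨B, hB, hB'⟩ := E.smooth_Θ (W.pullReg j z) hz
  have hBz : (B (W.pullReg j z)).1 ∈ W.tube := by rw [hB'.self_of_nhds]; exact E.mem_tube _ hz
  have h0 : ContMDiffAt (HModel n') (HModel n) ∞
      (fun z : 𝐙.Reg => B (W.pullReg j z)) z :=
    hB.comp z (smooth_pullReg z)
  have h1 : ContMDiffAt (HModel n') 𝓘(ℝ, ℝ) ∞
      (fun z : 𝐙.Reg => W.radExt (B (W.pullReg j z))) z :=
    (W.smooth_rad _ hBz).comp z h0
  let y₀ : W.Sing := ⟨_, retr_mem_sing hBz⟩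
  have h2 : ContMDiffAt (HModel n') 𝓘(ℝ, ℝ) ∞
      (fun z : 𝐙.Reg => E.κ (W.projExt y₀ (B (W.pullReg j z))).1) z :=
    (E.smooth_κ _).comp z ((W.smooth_proj y₀ _ hBz).comp z h0)
  have h3 := E.maps_Θ (j z.1) ⟨hz, z.1, rfl⟩
  have h4 : ContDiffAt ℝ ∞ (fun p : ℝ × ℝ => p.2 / (1 - p.1 * p.2))
      (E.κ (W.projExt y₀ (B (W.pullReg j z))).1, W.radExt (B (W.pullReg j z))) := by
    refine contDiffAt_snd.div (contDiffAt_const.sub (contDiffAt_fst.mul contDiffAt_snd)) ?_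
    change 1 - E.κ (W.projExt y₀ (B (W.pullReg j z))).1 * W.radExt (B (W.pullReg j z)) ≠ 0
    rw [projExt_val _ hBz, radExt_of_mem hBz, hB'.self_of_nhds]
    change 1 - E.κ (W.retr (E.Θ (j z.1))) * W.rho (E.Θ (j z.1)) ≠ 0
    rw [E.rho_Θ _ hz]
    exact (sub_pos.2 h3.2.1).ne'
  have h5 := h4.contMDiffAt.comp z (h2.prodMk_space h1)
  refine h5.congr_of_eventuallyEq ?_
  filter_upwards [(𝐙.isOpen_tube.preimage continuous_subtype_val).mem_nhds hz,
    (continuous_pullReg hj).continuousAt.eventually hB'] with z' hz' hBz'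
  have hBz2 : (B (W.pullReg j z')).1 ∈ W.tube := by rw [hBz']; exact E.mem_tube _ hz'
  change _ = W.radExt (B (W.pullReg j z')) /
    (1 - E.κ (W.projExt y₀ (B (W.pullReg j z'))).1 * W.radExt (B (W.pullReg j z')))
  rw [projExt_val _ hBz2, radExt_of_mem hBz2, hBz',
    radExt_of_mem hz', rho_of_mem hz']
  change _ = W.rho (E.Θ (j z'.1)) / (1 - E.κ (W.retr (E.Θ (j z'.1))) * W.rho (E.Θ (j z'.1)))
  rw [E.rho_Θ _ hz']
  rfl

/-- A cone chart of `W`, reparametrised radially and followed by `Λ`. -/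
theorem exists_coneChart_stratData (y : 𝐙.Sing) :
    ∃ U : Set 𝐙.Sing, IsOpen U ∧ y ∈ U ∧
      Nonempty (ConeChart 𝐙 l L U) := by
  classical
  obtain ⟨U, hU, hyU, ⟨τ⟩⟩ := W.exists_coneChart (W.pullSing j y)
  let U' : Set 𝐙.Sing := W.pullSing j ⁻¹' U
  have hU' : IsOpen U' := hU.preimage (continuous_pullSing hj)
  let S : 𝐙.Sing × L × ℝ → W.Sing × L × ℝ := fun p =>
    (W.pullSing j p.1, p.2.1, p.2.2 / (1 + E.κ (j p.1.1) * p.2.2))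
  have hpm := fun (p : 𝐙.Sing × L × ℝ) (hp : p.1 ∈ U') (hr : 0 < p.2.2) =>
    E.param_mem τ (y := W.pullSing j p.1) hp ⟨p.1.1, rfl⟩ p.2.1 hr
  have hmp := fun (p : 𝐙.Sing × L × ℝ) (hp : p.1 ∈ U') (hr : 0 < p.2.2) =>
    E.maps_Λ _ (hpm p hp hr).1 (hpm p hp hr).2.2.2.1 (hpm p hp hr).2.2.2.2
  have hex : ∀ p : 𝐙.Sing × L × ℝ, p.1 ∈ U' → 0 < p.2.2 →
      ∃ z : 𝐙.Reg, j z.1 = E.Λ (τ.param (S p)).1 := by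
    intro p hp hr
    obtain ⟨h1, ⟨h2, z, hz⟩, h3⟩ := hmp p hp hr
    refine ⟨⟨z, fun h4 => ?_⟩, hz⟩
    have h5 : j z ∈ W.sing := h4
    rw [hz, ← E.Θ_mem_sing h2, h3] at h5
    exact (τ.param _).2 h5
  have hex' : ∀ p : 𝐙.Sing × L × ℝ, ∃ z : 𝐙.Reg,
      p.1 ∈ U' → 0 < p.2.2 → j z.1 = E.Λ (τ.param (S p)).1 := by
    intro p
    by_cases hp : p.1 ∈ U' ∧ 0 < p.2.2
    · obtain ⟨z, hz⟩ := hex p hp.1 hp.2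
      exact ⟨z, fun _ _ => hz⟩
    · obtain ⟨z, hz⟩ := hex (y, p.2.1, 1) hyU one_pos
      exact ⟨z, fun h1 h2 => absurd ⟨h1, h2⟩ hp⟩
  choose param hparam using hex'
  have hjparam : ∀ p : 𝐙.Sing × L × ℝ, p.1 ∈ U' → 0 < p.2.2 →
      E.Θ (j (param p).1) = (τ.param (S p)).1 := fun p hp hr => by
    rw [hparam p hp hr]; exact (hmp p hp hr).2.2
  let link : 𝐙.Reg → L := fun z =>
    τ.link (if hz : E.Θ (j z.1) ∈ W.sing then W.pullReg j z else ⟨E.Θ (j z.1), hz⟩)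
  have hlink : ∀ z : 𝐙.Reg, ∀ x : W.Reg, E.Θ (j z.1) = x.1 →
      link z = τ.link x := by
    intro z x hx
    have h1 : E.Θ (j z.1) ∉ W.sing := by rw [hx]; exact x.2
    change τ.link (dite _ _ _) = _
    rw [dif_neg h1]
    exact congrArg τ.link (Subtype.ext hx)
  have hcone : ContinuousOn (fun q : 𝐙.Sing × L × ℝ =>
      if 0 < q.2.2 then (param q).1 else q.1.1) {q | q.1 ∈ U' ∧ 0 ≤ q.2.2} := by
    rw [hj.isInducing.continuousOn_iff]
    have h1 := (E.continuousOn_cone τ).comp (t := {q | q.1 ∈ U ∧ q.1.1 ∈ range j ∧ 0 ≤ q.2.2})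
      (f := fun q : 𝐙.Sing × L × ℝ => (W.pullSing j q.1, q.2))
      (s := {q | q.1 ∈ U' ∧ 0 ≤ q.2.2})
      (((continuous_pullSing hj).comp continuous_fst).prodMk continuous_snd).continuousOn
      fun q hq => ⟨hq.1, ⟨q.1.1, rfl⟩, hq.2⟩
    refine h1.congr fun q hq => ?_
    rw [Function.comp_apply, Function.comp_apply]
    by_cases hr : 0 < q.2.2
    · rw [if_pos hr, if_pos hr]
      exact hparam q hq.1 hr
    · rw [if_neg hr, if_neg hr]; rfl
  have hcontp : ∀ q : 𝐙.Sing × L × ℝ, q.1 ∈ U' → 0 < q.2.2 →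
      ContinuousAt param q := by
    intro q hq hr
    rw [IsInducing.subtypeVal.continuousAt_iff]
    have hO : {q : 𝐙.Sing × L × ℝ | q.1 ∈ U' ∧ 0 < q.2.2} ∈ 𝓝 q :=
      ((hU'.preimage continuous_fst).inter
        (isOpen_Ioi.preimage (continuous_snd.comp continuous_snd))).mem_nhds ⟨hq, hr⟩
    refine (hcone.continuousAt (Filter.mem_of_superset hO fun q h => ⟨h.1, h.2.le⟩)).congr ?_
    filter_upwards [hO] with q' hq'
    exact if_pos hq'.2
  have hmem : ∀ p : 𝐙.Sing × L × ℝ, p.1 ∈ U' → 0 < p.2.2 →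
      (param p).1 ∈ 𝐙.tube := fun p hp hr => by
    change j (param p).1 ∈ E.T
    rw [hparam p hp hr]; exact (hmp p hp hr).2.1.1
  refine ⟨U', hU', hyU, ⟨⟨param, link, ?_, ?_, ?_, ?_, ?_, hcone⟩⟩⟩
  · intro y' hy' q r hr
    have h1 := hmem (y', q, r) hy' hr
    have h2 := hjparam (y', q, r) hy' hr
    obtain ⟨-, h4, h5, -, -⟩ := hpm (y', q, r) hy' hr
    refine ⟨h1, ?_, ?_⟩
    · refine Subtype.ext (hj.injective ?_)
      refine (proj_spec h1).trans ?_
      rw [h2]; exact h4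
    · refine (rad_spec h1).trans ?_
      have h6 : W.rho (j (param (y', q, r)).1) = r / (1 + E.κ (j y'.1) * r) := by
        rw [← E.rho_Θ _ h1, h2]; exact h5
      have h7 : W.retr (E.Θ (j (param (y', q, r)).1)) = j y'.1 := by rw [h2]; exact h4
      rw [h6, h7]
      exact stretch_shrink (E.κ_nonneg _) hr.le
  · intro y' hy' q r hr
    rw [hlink _ _ (hjparam (y', q, r) hy' hr)]
    exact τ.link_param _ hy' q _ (shrink_pos (E.κ_nonneg _) hr)
  · intro x hx hxU
    have h1 := E.maps_Θ (j x.1) ⟨hx, x.1, rfl⟩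
    have h3 : E.Θ (j x.1) ∈ W.tube := E.mem_tube _ hx
    have h4 : E.Θ (j x.1) ∉ W.sing := fun h => x.2 ((E.Θ_mem_sing hx).1 h)
    have h5 : 0 < 𝐙.rad ⟨x.1, hx⟩ :=
      lt_of_le_of_ne (𝐙.rad_nonneg _) fun h =>
        x.2 ((𝐙.rad_eq_zero_iff _).1 h.symm)
    refine Subtype.ext (hj.injective ?_)
    rw [hparam _ hxU h5]
    have h6 : W.proj ⟨E.Θ (j x.1), h3⟩ = W.pullSing j (𝐙.proj ⟨x.1, hx⟩) := by
      refine Subtype.ext ?_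
      rw [← retr_of_mem h3]
      exact (proj_spec hx).symm
    have h7 : τ.param (S (𝐙.proj ⟨x.1, hx⟩, link x,
        𝐙.rad ⟨x.1, hx⟩)) = ⟨E.Θ (j x.1), h4⟩ := by
      have h8 := τ.param_link ⟨E.Θ (j x.1), h4⟩ h3 (by rw [h6]; exact hxU)
      refine Eq.trans (congrArg τ.param ?_) h8
      refine Prod.ext h6.symm (Prod.ext (hlink x ⟨E.Θ (j x.1), h4⟩ rfl) ?_)
      change 𝐙.rad ⟨x.1, hx⟩ / (1 +
        E.κ (j (𝐙.proj ⟨x.1, hx⟩).1) * 𝐙.rad ⟨x.1, hx⟩) =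
        W.rad ⟨E.Θ (j x.1), h3⟩
      rw [proj_spec hx, ← rho_of_mem h3, E.rho_Θ _ hx]
      exact shrink_stretch h1.2.1
    rw [h7]
    exact h1.2.2
  · intro q hq
    refine ContMDiffAt.contMDiffWithinAt ?_
    refine initial_pullReg.contMDiffAt (hcontp q hq.1 hq.2) ?_
    obtain ⟨B, hB, hB'⟩ := E.smooth_Λ (τ.param (S q)) (hmp q hq.1 hq.2).1
    have hκ : ContMDiffAt ((HModel m').prod ((𝓡 l).prod 𝓘(ℝ, ℝ))) 𝓘(ℝ, ℝ) ∞
        (fun p : 𝐙.Sing × L × ℝ => E.κ (j p.1.1)) q :=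
      ContMDiffAt.comp q (g := fun y : W.Sing => E.κ y.1)
        (f := fun p : 𝐙.Sing × L × ℝ => W.pullSing j p.1)
        (E.smooth_κ (W.pullSing j q.1)) ((smooth_pullSing q.1).comp q contMDiffAt_fst)
    have hr : ContMDiffAt ((HModel m').prod ((𝓡 l).prod 𝓘(ℝ, ℝ))) 𝓘(ℝ, ℝ) ∞
        (fun p : 𝐙.Sing × L × ℝ => p.2.2) q :=
      contMDiffAt_snd.comp q contMDiffAt_snd
    have h4 : ContDiffAt ℝ ∞ (fun p : ℝ × ℝ => p.2 / (1 + p.1 * p.2)) (E.κ (j q.1.1), q.2.2) := by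
      refine contDiffAt_snd.div (contDiffAt_const.add (contDiffAt_fst.mul contDiffAt_snd)) ?_
      have := mul_nonneg (E.κ_nonneg (j q.1.1)) hq.2.le
      exact (by linarith : 0 < 1 + E.κ (j q.1.1) * q.2.2).ne'
    have hS : ContMDiffAt ((HModel m').prod ((𝓡 l).prod 𝓘(ℝ, ℝ)))
        ((HModel m).prod ((𝓡 l).prod 𝓘(ℝ, ℝ))) ∞ S q :=
      ((smooth_pullSing q.1).comp q contMDiffAt_fst).prodMk
        ((contMDiffAt_fst.comp q contMDiffAt_snd).prodMk
          (h4.contMDiffAt.comp q (hκ.prodMk_space hr)))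
    have hp := τ.contMDiffAt_param hU (p := S q) hq.1 (shrink_pos (E.κ_nonneg _) hq.2)
    have hc : ContMDiffAt ((HModel m').prod ((𝓡 l).prod 𝓘(ℝ, ℝ))) (HModel n) ∞
        (fun p => τ.param (S p)) q := hp.comp q hS
    refine (hB.comp q hc).congr_of_eventuallyEq ?_
    have hO : {q : 𝐙.Sing × L × ℝ | q.1 ∈ U' ∧ 0 < q.2.2} ∈ 𝓝 q :=
      ((hU'.preimage continuous_fst).inter
        (isOpen_Ioi.preimage (continuous_snd.comp continuous_snd))).mem_nhds hq
    filter_upwards [hO, hc.continuousAt.eventually hB'] with p hp hBp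
    exact Subtype.ext ((hparam p hp.1 hp.2).trans hBp.symm)
  · intro x hx hxU
    obtain ⟨B, hB, hB'⟩ := E.smooth_Θ (W.pullReg j x) hx
    have hBx : (B (W.pullReg j x)).1 ∈ W.tube := by rw [hB'.self_of_nhds]; exact E.mem_tube _ hx
    have h1 : W.proj ⟨_, hBx⟩ = W.pullSing j (𝐙.proj ⟨x.1, hx⟩) := by
      refine Subtype.ext ?_
      rw [← retr_of_mem hBx, hB'.self_of_nhds]
      exact (proj_spec hx).symm
    have h2 := τ.smooth_link _ hBx (by rw [h1]; exact hxU)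
    have h3 : ContMDiffAt (HModel n') (𝓡 l) ∞
        (fun z : 𝐙.Reg => τ.link (B (W.pullReg j z))) x :=
      h2.comp x (hB.comp x (smooth_pullReg x))
    refine h3.congr_of_eventuallyEq ?_
    filter_upwards [(continuous_pullReg hj).continuousAt.eventually hB'] with z hz
    exact hlink z _ hz.symm

/-- A subspace with modified control data is a pseudomanifold with fibered singularities. -/
def fibPM (E : Retube W (range j)) (hj : IsClosedEmbedding j)
    (Sr : SubStructure n n' (W.pullReg j)) (Ss : SubStructure m m' (W.pullSing j))
    (hdim : (j ⁻¹' W.sing).Nonempty → m' + l + 1 = n' ∧ m' + 2 ≤ n') : FibPM l L n' m' Z where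
  toStratData := E.stratData hj Sr Ss
  smooth_proj := smooth_proj_stratData
  smooth_rad := smooth_rad_stratData
  dim_eq h := (hdim h).1
  codim h := (hdim h).2
  exists_coneChart := exists_coneChart_stratData

end Structure
end Retube
end Retube

/-! ### Interpolating between shifted and unshifted crossing times -/

/-- Smooth diffeomorphisms `ψ u` of the line, the identity on `(-∞, 3η]` and, for small `u`, the
translation by `u` on `[9η/2, ∞)`. -/
structure TimeChange (η : ℝ) where
  ψ : ℝ → ℝ → ℝ
  smooth : ContDiff ℝ ∞ (fun p : ℝ × ℝ => ψ p.1 p.2)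
  zero : ∀ s, ψ 0 s = s
  add : ∀ u v s, ψ (u + v) s = ψ u (ψ v s)
  eq_self : ∀ u s, s ≤ 3 * η → ψ u s = s
  abs_sub_le : ∀ u s, |ψ u s - s| ≤ |u|
  eq_add : ∀ u s, 9 / 2 * η ≤ s → |u| < η / 2 → ψ u s = s + u

namespace TimeChange

/-- Take the flow of `b ∂_s`, for a smooth step function `b` from `0` to `1`. -/
theorem nonempty {η : ℝ} (hη : 0 < η) : Nonempty (TimeChange η) := by
  let b : ℝ → ℝ := fun s => Real.smoothTransition ((s - 3 * η) / η)
  let V : ∀ s : ℝ, TangentSpace 𝓘(ℝ, ℝ) s := fun s => b s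
  have hb : ContDiff ℝ ∞ b :=
    Real.smoothTransition.contDiff.comp ((contDiff_id.sub contDiff_const).div_const η)
  have hV : IsLocallyIntegrable 𝓘(ℝ, ℝ) V :=
    ⟨contMDiff_vectorSpace_iff_contDiff.2 hb, fun x => Or.inl (BoundarylessManifold.isInteriorPoint)⟩
  have hder : ∀ (γ : ℝ → ℝ) (s : Set ℝ), IsOpen s → (IsMIntegralCurveOn γ V s ↔
      ∀ t ∈ s, HasDerivAt γ (b (γ t)) t) := by
    intro γ s hs
    refine forall₂_congr fun t ht => ?_
    have h1 : HasMFDerivWithinAt 𝓘(ℝ, ℝ) 𝓘(ℝ, ℝ) γ s t ((1 : ℝ →L[ℝ] ℝ).smulRight (V (γ t))) ↔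
        HasFDerivWithinAt γ ((1 : ℝ →L[ℝ] ℝ).smulRight (b (γ t))) s t :=
      hasMFDerivWithinAt_iff_hasFDerivWithinAt
    rw [h1, hasDerivAt_iff_hasFDerivAt, hasFDerivWithinAt_of_isOpen hs ht]
    have h2 : (1 : ℝ →L[ℝ] ℝ).smulRight (b (γ t)) =
        ContinuousLinearMap.toSpanSingleton ℝ (b (γ t)) := by ext; simp
    rw [h2]
  have hbound : ∀ (γ : ℝ → ℝ) (T : ℝ), IsMIntegralCurveOn γ V (Ioo (-T) T) → ∀ t ∈ Ioo (-T) T,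
      |γ t - γ 0| ≤ |t| := by
    intro γ T hγ t ht
    have h1 := (hder γ _ isOpen_Ioo).1 hγ
    have h2 := (convex_Ioo (-T) T).norm_image_sub_le_of_norm_hasDerivWithin_le (C := 1)
      (fun s hs => (h1 s hs).hasDerivWithinAt) (fun s _ => by
        rw [Real.norm_eq_abs, abs_of_nonneg (Real.smoothTransition.nonneg _)]
        exact Real.smoothTransition.le_one _) (x := 0) (y := t)
      ⟨by linarith [ht.1, ht.2], by linarith [ht.1, ht.2]⟩ ht
    simpa using h2
  obtain ⟨ψ, hs, h0, ha, hc⟩ := hV.exists_flow fun x N =>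
    ⟨Metric.closedBall x N, isCompact_closedBall x N, fun T hT γ hγ0 hγ t ht => by
      rw [Metric.mem_closedBall, Real.dist_eq]
      have h1 := hbound γ T hγ t ht
      rw [hγ0] at h1
      exact h1.trans ((abs_lt.2 ht).le.trans hT)⟩
  have hmem : ∀ u : ℝ, u ∈ Ioo (-(|u| + 1)) (|u| + 1) := fun u =>
    ⟨by linarith [neg_abs_le u], by linarith [le_abs_self u]⟩
  have hmem0 : ∀ u : ℝ, (0 : ℝ) ∈ Ioo (-(|u| + 1)) (|u| + 1) := fun u =>
    ⟨by linarith [abs_nonneg u], by linarith [abs_nonneg u]⟩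
  refine ⟨⟨ψ, ?_, h0, ha, fun u s hs => ?_, fun u s => ?_, fun u s hs hu => ?_⟩⟩
  · rw [← contMDiff_iff_contDiff, modelWithCornersSelf_prod, ← chartedSpaceSelf_prod]
    exact hs
  · have h1 : V s = 0 := Real.smoothTransition.zero_of_nonpos
      (div_nonpos_of_nonpos_of_nonneg (by linarith) hη.le)
    exact hV.eqOn (γ' := fun _ => s) (hmem0 u) ((hc s).isMIntegralCurveOn _)
      ((isMIntegralCurve_const h1).isMIntegralCurveOn _) (h0 s) (hmem u)
  · have h1 := hbound (fun t => ψ t s) (|u| + 1) ((hc s).isMIntegralCurveOn _) u (hmem u)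
    rwa [h0] at h1
  · refine hV.eqOn (γ' := fun t => s + t) (a := -(η / 2)) (b := η / 2) (t₀ := 0)
      ⟨by linarith, by linarith⟩ ((hc s).isMIntegralCurveOn _) ?_ (by rw [h0, add_zero])
      (abs_lt.1 hu)
    rw [hder _ _ isOpen_Ioo]
    intro t ht
    have h1 : b (s + t) = 1 := Real.smoothTransition.one_of_one_le (by
      rw [le_div_iff₀ hη]; linarith [ht.1])
    rw [h1]
    exact (hasDerivAt_id t).const_add s

variable {η : ℝ} (τ : TimeChange η)

theorem neg_apply (u s : ℝ) : τ.ψ (-u) (τ.ψ u s) = s := by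
  rw [← τ.add, neg_add_cancel, τ.zero]

theorem apply_neg (u s : ℝ) : τ.ψ u (τ.ψ (-u) s) = s := by
  rw [← τ.add, add_neg_cancel, τ.zero]

theorem le_iff (u s : ℝ) : τ.ψ u s ≤ 3 * η ↔ s ≤ 3 * η := by
  constructor
  · intro h
    have := τ.neg_apply u s
    rw [τ.eq_self _ _ h] at this
    rwa [← this]
  · intro h
    rwa [τ.eq_self _ _ h]

theorem nonneg_iff (hη : 0 < η) (u s : ℝ) : 0 ≤ τ.ψ u s ↔ 0 ≤ s := by
  rcases le_or_gt s (3 * η) with h | h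
  · rw [τ.eq_self _ _ h]
  · have h1 := mt (τ.le_iff u s).1 (not_le.2 h)
    exact iff_of_true (by linarith [not_le.1 h1]) (by linarith)

end TimeChange

namespace LevelFlow

variable {W : FibPM l L n m X} {h : X → ℝ} (𝓕 : LevelFlow W h)

/-- The points of the tube of radius `1 / κ₀` whose trajectories cross the level set. -/
def tubeDom (κ₀ : ℝ) : Set X := {x | x ∈ W.tube ∧ κ₀ * W.rho x < 1 ∧ x ∈ 𝓕.dom}

/-- The difference of the crossing times of `x` and `π x`; it is constant along trajectories. -/
def lag (x : X) : ℝ := 𝓕.time x - 𝓕.time (W.retr x)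

/-- The map along the trajectories such that `π ∘ straighten` has the crossing time `ψ (-u) s` at a
point with crossing time `s` and lag `u`. -/
def straighten (ψ : ℝ → ℝ → ℝ) (x : X) : X :=
  𝓕.Φ (ψ (-𝓕.lag x) (𝓕.time x) - 𝓕.time (W.retr x)) x

/-- The inverse of `straighten`. -/
def unstraighten (ψ : ℝ → ℝ → ℝ) (x : X) : X :=
  𝓕.Φ (ψ (𝓕.lag x) (𝓕.time (W.retr x)) - 𝓕.time x) x

/-- The number `κ₀` is large enough for the flow to preserve the control data on the tube of radius
`1 / κ₀`, and for `x` and `π x` to have the same type of trajectories. -/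
structure IsTubeBound (κ₀ : ℝ) : Prop where
  pos : 0 < κ₀
  lt_r₀ : ∀ x, κ₀ * W.rho x < 1 → W.rho x < 𝓕.r₀
  retr_mem : ∀ x ∈ W.tube, κ₀ * W.rho x < 1 → (W.retr x ∈ 𝓕.dom ↔ x ∈ 𝓕.dom)

variable {𝓕} {κ₀ : ℝ}

theorem isOpen_tubeDom [CompactSpace L] (hh : Continuous h) (hκ : 0 < κ₀) :
    IsOpen (𝓕.tubeDom κ₀) := by
  have h1 : 𝓕.tubeDom κ₀ = {x | x ∈ W.tube ∧ W.rho x < 1 / κ₀} ∩ 𝓕.dom := by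
    ext x
    change _ ∧ _ ∧ _ ↔ (_ ∧ _) ∧ _
    rw [lt_div_iff₀ hκ, mul_comm, and_assoc]
  rw [h1]
  exact (W.isOpen_rho_lt _).inter (𝓕.isOpen_dom hh)

theorem rho_flow (hκ : 𝓕.IsTubeBound κ₀) {x : X} (hx : x ∈ 𝓕.tubeDom κ₀) (t : ℝ) :
    W.rho (𝓕.Φ t x) = W.rho x := 𝓕.rho_eq t x hx.1 (hκ.lt_r₀ x hx.2.1)

theorem retr_flow (hκ : 𝓕.IsTubeBound κ₀) {x : X} (hx : x ∈ 𝓕.tubeDom κ₀) (t : ℝ) :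
    W.retr (𝓕.Φ t x) = 𝓕.Φ t (W.retr x) := 𝓕.retr_eq t x hx.1 (hκ.lt_r₀ x hx.2.1)

theorem retr_mem_dom (hκ : 𝓕.IsTubeBound κ₀) {x : X} (hx : x ∈ 𝓕.tubeDom κ₀) :
    W.retr x ∈ 𝓕.dom := (hκ.retr_mem x hx.1 hx.2.1).2 hx.2.2

theorem flow_mem_tubeDom (hκ : 𝓕.IsTubeBound κ₀) {x : X} (hx : x ∈ 𝓕.tubeDom κ₀) (t : ℝ) :
    𝓕.Φ t x ∈ 𝓕.tubeDom κ₀ :=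
  ⟨𝓕.mem_tube t x hx.1 (hκ.lt_r₀ x hx.2.1), by rw [rho_flow hκ hx]; exact hx.2.1,
    (𝓕.flow_mem_dom t).2 hx.2.2⟩

theorem mem_tubeDom_of_flow (hκ : 𝓕.IsTubeBound κ₀) {x : X} {t : ℝ}
    (hx : 𝓕.Φ t x ∈ 𝓕.tubeDom κ₀) : x ∈ 𝓕.tubeDom κ₀ := by
  have := flow_mem_tubeDom hκ hx (-t)
  rwa [𝓕.flow_neg_flow] at this

theorem time_retr_flow (hh : Continuous h) (hκ : 𝓕.IsTubeBound κ₀) {x : X}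
    (hx : x ∈ 𝓕.tubeDom κ₀) (t : ℝ) :
    𝓕.time (W.retr (𝓕.Φ t x)) = 𝓕.time (W.retr x) + t := by
  rw [retr_flow hκ hx, 𝓕.time_flow hh (retr_mem_dom hκ hx)]

theorem lag_flow (hh : Continuous h) (hκ : 𝓕.IsTubeBound κ₀) {x : X} (hx : x ∈ 𝓕.tubeDom κ₀)
    (t : ℝ) : 𝓕.lag (𝓕.Φ t x) = 𝓕.lag x := by
  rw [lag, time_retr_flow hh hκ hx, 𝓕.time_flow hh hx.2.2, lag]; ring

theorem time_retr_straighten (hh : Continuous h) (hκ : 𝓕.IsTubeBound κ₀) {x : X}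
    (hx : x ∈ 𝓕.tubeDom κ₀) (ψ : ℝ → ℝ → ℝ) :
    𝓕.time (W.retr (𝓕.straighten ψ x)) = ψ (-𝓕.lag x) (𝓕.time x) := by
  rw [straighten, time_retr_flow hh hκ hx]; ring

theorem time_unstraighten (hh : Continuous h) {x : X}
    (hx : x ∈ 𝓕.tubeDom κ₀) (ψ : ℝ → ℝ → ℝ) :
    𝓕.time (𝓕.unstraighten ψ x) = ψ (𝓕.lag x) (𝓕.time (W.retr x)) := by
  rw [unstraighten, 𝓕.time_flow hh hx.2.2]; ring

theorem unstraighten_straighten (hh : Continuous h) (hκ : 𝓕.IsTubeBound κ₀) {ψ : ℝ → ℝ → ℝ}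
    (hψ : ∀ u s, ψ u (ψ (-u) s) = s) {x : X} (hx : x ∈ 𝓕.tubeDom κ₀) :
    𝓕.unstraighten ψ (𝓕.straighten ψ x) = x := by
  rw [unstraighten, time_retr_straighten hh hκ hx]
  rw [straighten, lag_flow hh hκ hx, 𝓕.time_flow hh hx.2.2, ← 𝓕.add, hψ]
  convert 𝓕.zero x using 2
  rw [lag]; ring

theorem straighten_unstraighten (hh : Continuous h) (hκ : 𝓕.IsTubeBound κ₀) {ψ : ℝ → ℝ → ℝ}
    (hψ : ∀ u s, ψ (-u) (ψ u s) = s) {x : X} (hx : x ∈ 𝓕.tubeDom κ₀) :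
    𝓕.straighten ψ (𝓕.unstraighten ψ x) = x := by
  rw [straighten, time_unstraighten hh hx]
  rw [unstraighten, lag_flow hh hκ hx, time_retr_flow hh hκ hx, ← 𝓕.add, hψ]
  convert 𝓕.zero x using 2
  rw [lag]; ring

theorem straighten_of_mem_sing (ψ : ℝ → ℝ → ℝ) (hψ : ∀ s, ψ 0 s = s) {x : X} (hx : x ∈ W.sing) :
    𝓕.straighten ψ x = x := by
  rw [straighten, lag, retr_of_mem_sing hx, sub_self, neg_zero, hψ, sub_self, 𝓕.zero]

theorem continuousAt_time_retr (hh : Continuous h) (hκ : 𝓕.IsTubeBound κ₀) {x : X}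
    (hx : x ∈ 𝓕.tubeDom κ₀) : ContinuousAt (fun x => 𝓕.time (W.retr x)) x :=
  ContinuousAt.comp (g := 𝓕.time) (f := W.retr) (𝓕.continuousAt_time hh (retr_mem_dom hκ hx))
    (continuousAt_retr hx.1)

theorem continuousAt_straighten (hh : Continuous h) (hκ : 𝓕.IsTubeBound κ₀) {ψ : ℝ → ℝ → ℝ}
    (hψ : Continuous fun p : ℝ × ℝ => ψ p.1 p.2) {x : X} (hx : x ∈ 𝓕.tubeDom κ₀) :
    ContinuousAt (𝓕.straighten ψ) x := by
  have h1 := 𝓕.continuousAt_time hh hx.2.2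
  have h2 := continuousAt_time_retr hh hκ hx
  have h3 : ContinuousAt (fun x => (-𝓕.lag x, 𝓕.time x)) x := ((h1.sub h2).neg).prodMk h1
  have h4 : ContinuousAt (fun x => ψ (-𝓕.lag x) (𝓕.time x)) x :=
    ContinuousAt.comp (g := fun p : ℝ × ℝ => ψ p.1 p.2) hψ.continuousAt h3
  exact ContinuousAt.comp (g := fun p : ℝ × X => 𝓕.Φ p.1 p.2) 𝓕.continuous.continuousAt
    ((h4.sub h2).prodMk continuousAt_id)

theorem continuousAt_unstraighten (hh : Continuous h) (hκ : 𝓕.IsTubeBound κ₀) {ψ : ℝ → ℝ → ℝ}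
    (hψ : Continuous fun p : ℝ × ℝ => ψ p.1 p.2) {x : X} (hx : x ∈ 𝓕.tubeDom κ₀) :
    ContinuousAt (𝓕.unstraighten ψ) x := by
  have h1 := 𝓕.continuousAt_time hh hx.2.2
  have h2 := continuousAt_time_retr hh hκ hx
  have h3 : ContinuousAt (fun x => (𝓕.lag x, 𝓕.time (W.retr x))) x := (h1.sub h2).prodMk h2
  have h4 : ContinuousAt (fun x => ψ (𝓕.lag x) (𝓕.time (W.retr x))) x :=
    ContinuousAt.comp (g := fun p : ℝ × ℝ => ψ p.1 p.2) hψ.continuousAt h3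
  exact ContinuousAt.comp (g := fun p : ℝ × X => 𝓕.Φ p.1 p.2) 𝓕.continuous.continuousAt
    ((h4.sub h1).prodMk continuousAt_id)

/-- The flow for a smoothly varying time is smooth. -/
theorem smoothRegAt_flow {A : ℝ → ℝ → ℝ} (hA : ContDiff ℝ ∞ (fun p : ℝ × ℝ => A p.1 p.2))
    (hh : IsSmoothFun W♭ h) (hκ : 𝓕.IsTubeBound κ₀) {x : W.Reg}
    (hx : x.1 ∈ 𝓕.tubeDom κ₀) :
    SmoothRegAt W♭ (fun z => 𝓕.Φ (A (𝓕.time z) (𝓕.time (W.retr z))) z) x := by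
  let y₀ : W.Sing := ⟨_, retr_mem_sing hx.1⟩
  let a : W.Reg → ℝ := fun z => A (𝓕.time z.1) (𝓕.time (W.projExt y₀ z).1)
  have h1 := 𝓕.contMDiffAt_time_reg hh hx.2.2
  have h2 : ContMDiffAt (HModel n) 𝓘(ℝ, ℝ) ∞ (fun z : W.Reg => 𝓕.time (W.projExt y₀ z).1) x :=
    ContMDiffAt.comp x (g := fun y : W.Sing => 𝓕.time y.1) (f := W.projExt y₀)
      (𝓕.contMDiffAt_time_sing hh (by
        rw [projExt_val y₀ hx.1]; exact retr_mem_dom hκ hx)) (W.smooth_proj y₀ x hx.1)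
  have ha : ContMDiffAt (HModel n) 𝓘(ℝ, ℝ) ∞ a x :=
    ContMDiffAt.comp x (g := fun p : ℝ × ℝ => A p.1 p.2)
      (f := fun z : W.Reg => (𝓕.time z.1, 𝓕.time (W.projExt y₀ z).1))
      hA.contMDiff.contMDiffAt (h1.prodMk_space h2)
  refine ⟨fun z => W.onRegular (𝓕.mem_sing (a z)) z,
    𝓕.smooth_reg.contMDiffAt.comp x (ha.prodMk contMDiffAt_id), ?_⟩
  filter_upwards [(W.isOpen_tube.preimage continuous_subtype_val).mem_nhds hx.1] with z hz
  change 𝓕.Φ (A (𝓕.time z.1) (𝓕.time (W.projExt y₀ z).1)) z.1 = _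
  rw [projExt_val y₀ hz]

theorem smoothRegAt_straighten (hh : IsSmoothFun W♭ h) (hκ : 𝓕.IsTubeBound κ₀)
    {ψ : ℝ → ℝ → ℝ} (hψ : ContDiff ℝ ∞ (fun p : ℝ × ℝ => ψ p.1 p.2)) {x : W.Reg}
    (hx : x.1 ∈ 𝓕.tubeDom κ₀) : SmoothRegAt W♭ (𝓕.straighten ψ) x :=
  smoothRegAt_flow (A := fun s t => ψ (-(s - t)) s - t) (by
    have h1 : ContDiff ℝ ∞ (fun p : ℝ × ℝ => (-(p.1 - p.2), p.1)) := by fun_prop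
    exact (hψ.comp h1).sub contDiff_snd) hh hκ hx

theorem smoothRegAt_unstraighten (hh : IsSmoothFun W♭ h) (hκ : 𝓕.IsTubeBound κ₀)
    {ψ : ℝ → ℝ → ℝ} (hψ : ContDiff ℝ ∞ (fun p : ℝ × ℝ => ψ p.1 p.2)) {x : W.Reg}
    (hx : x.1 ∈ 𝓕.tubeDom κ₀) : SmoothRegAt W♭ (𝓕.unstraighten ψ) x :=
  smoothRegAt_flow (A := fun s t => ψ (s - t) t - s) (by
    have h1 : ContDiff ℝ ∞ (fun p : ℝ × ℝ => (p.1 - p.2, p.2)) := by fun_prop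
    exact (hψ.comp h1).sub contDiff_fst) hh hκ hx

theorem exists_isTubeBound [CompactSpace L] (𝓕 : LevelFlow W h)
    (hh : Continuous h) : ∃ κ₀, 𝓕.IsTubeBound κ₀ := by
  obtain ⟨r, hr, hr₀, h1⟩ := 𝓕.exists_time_sub_retr_lt hh one_pos
  have h2 : ∀ x, 1 / r * W.rho x < 1 → W.rho x < r := fun x hx => by
    rwa [one_div, inv_mul_lt_iff₀ hr, mul_one] at hx
  exact ⟨1 / r, by positivity, fun x hx => (h2 x hx).trans_le hr₀, fun x hx hxr =>
    (h1 x hx (h2 x hxr)).1⟩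

/-- The modified control data of the level set: the flow moves the tube of `W` over the level set
to the level set. -/
def levelRetube [CompactSpace L] (hh : IsSmoothFun W♭ h)
    (hκ : 𝓕.IsTubeBound κ₀) {R : Set X} (hR : ∀ x, x ∈ R ↔ h x = 0) : Retube W R where
  κ _ := κ₀
  κ_nonneg _ := hκ.pos.le
  smooth_κ := contMDiff_const
  T := 𝓕.tubeDom κ₀
  N := 𝓕.tubeDom κ₀
  isOpen_T := isOpen_tubeDom hh.continuous hκ.pos
  Θ := 𝓕.straighten fun _ s => s
  Λ := 𝓕.unstraighten fun _ s => s
  continuousOn_Θ x hx :=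
    (continuousAt_straighten hh.continuous hκ (by fun_prop) hx).continuousWithinAt
  continuousOn_Λ x hx :=
    (continuousAt_unstraighten hh.continuous hκ (by fun_prop) hx).continuousWithinAt
  smooth_Θ x hx := smoothRegAt_straighten hh hκ (by fun_prop) hx
  smooth_Λ x hx := smoothRegAt_unstraighten hh hκ (by fun_prop) hx
  mem_tube x hx := (flow_mem_tubeDom hκ hx _).1
  rho_Θ x hx := rho_flow hκ hx _
  Θ_sing x _ hxs := straighten_of_mem_sing _ (fun _ => rfl) hxs
  sing_subset x hx := ⟨W.sing_subset_tube hx.1, by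
    rw [rho_eq_zero_iff.2 hx.1, mul_zero]; exact one_pos,
    𝓕.mem_dom_of_zero ((hR x).1 hx.2)⟩
  maps_Θ x hx := by
    refine ⟨?_, hx.1.2.1, unstraighten_straighten hh.continuous hκ (fun _ _ => rfl) hx.1⟩
    have h1 := time_retr_straighten hh.continuous hκ hx.1 (fun _ s => s)
    rw [𝓕.time_of_zero hh.continuous ((hR x).1 hx.2)] at h1
    rw [hR]
    exact (𝓕.time_eq_zero_iff hh.continuous
      (retr_mem_dom hκ (flow_mem_tubeDom hκ hx.1 _))).1 h1
  maps_Λ x hx hxR hxκ := by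
    have h0 : W.retr x ∈ 𝓕.dom := 𝓕.mem_dom_of_zero ((hR _).1 hxR)
    have h1 : x ∈ 𝓕.tubeDom κ₀ := ⟨hx, hxκ, (hκ.retr_mem x hx hxκ).1 h0⟩
    have h2 := flow_mem_tubeDom hκ h1 ((fun _ s => s) (𝓕.lag x) (𝓕.time (W.retr x)) - 𝓕.time x)
    refine ⟨h1, ⟨h2, ?_⟩, straighten_unstraighten hh.continuous hκ (fun _ _ => rfl) h1⟩
    rw [hR]
    refine (𝓕.time_eq_zero_iff hh.continuous h2.2.2).1 ?_
    refine (time_unstraighten hh.continuous h1 (fun _ s => s)).trans ?_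
    exact 𝓕.time_of_zero hh.continuous ((hR _).1 hxR)

end LevelFlow

/-! ### Control data near an end of a slab -/

section Taper

/-- Modified control data near the level set `h = 0`, for the part `0 ≤ h` of `W`. They are given
by `Θ` and its inverse `Λ`, as for `Retube`. The radius `1 / k` of the tube is `1 / κ₀` near the
level set and `1 / K` far from it, where `h ≥ σ`; on the part `M` of the tube of radius `1 / K` the
control data of `W` are not modified. -/
structure Taper (W : FibPM l L n m X) (h : X → ℝ) (κ₀ K σ : ℝ) where
  k : X → ℝ
  smooth_k : ContMDiff (HModel m) 𝓘(ℝ, ℝ) ∞ (fun y : W.Sing => k y.1)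
  le_k : ∀ y, κ₀ ≤ k y
  k_eq : ∀ y, σ ≤ h y → k y = K
  T : Set X
  N : Set X
  M : Set X
  isOpen_T : IsOpen T
  isOpen_N : IsOpen N
  isOpen_M : IsOpen M
  Θ : X → X
  Λ : X → X
  continuousOn_Θ : ContinuousOn Θ T
  continuousOn_Λ : ContinuousOn Λ N
  smooth_Θ : ∀ x : W.Reg, x.1 ∈ T → SmoothRegAt W♭ Θ x
  smooth_Λ : ∀ x : W.Reg, x.1 ∈ N → SmoothRegAt W♭ Λ x
  mem_tube : ∀ x ∈ T, Θ x ∈ W.tube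
  rho_Θ : ∀ x ∈ T, W.rho (Θ x) = W.rho x
  Θ_sing : ∀ x ∈ T, x ∈ W.sing → Θ x = x
  T_lt : ∀ x ∈ T, h x < σ
  N_lt : ∀ x ∈ N, h (W.retr x) < σ
  maps_Θ : ∀ x ∈ T, 0 ≤ h x → Θ x ∈ N ∧ 0 ≤ h (W.retr (Θ x)) ∧ k (W.retr (Θ x)) * W.rho x < 1 ∧
    Λ (Θ x) = x
  maps_Λ : ∀ x ∈ N, 0 ≤ h (W.retr x) → k (W.retr x) * W.rho x < 1 →
    Λ x ∈ T ∧ 0 ≤ h (Λ x) ∧ Θ (Λ x) = x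
  M_subset : M ⊆ W.tube
  M_spec : ∀ x ∈ M, 0 < h x ∧ 0 < h (W.retr x) ∧ K * W.rho x < 1 ∧ k (W.retr x) = K
  Θ_eq : ∀ x ∈ M, x ∈ T → Θ x = x
  Λ_eq : ∀ x ∈ M, x ∈ N → Λ x = x
  N_cover : ∀ x ∈ W.tube, 0 ≤ h (W.retr x) → k (W.retr x) * W.rho x < 1 → x ∈ N ∨ x ∈ M

/-- A smooth step function of `h`, equal to `κ₀` for `h ≤ s` and to `K` for `h ≥ 2 s`. -/
def stepFun (κ₀ K s t : ℝ) : ℝ := κ₀ + (K - κ₀) * Real.smoothTransition ((t - s) / s)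

theorem contDiff_stepFun (κ₀ K s : ℝ) : ContDiff ℝ ∞ (stepFun κ₀ K s) := by
  unfold stepFun
  have : ContDiff ℝ ∞ Real.smoothTransition := Real.smoothTransition.contDiff
  fun_prop

theorem stepFun_of_le {κ₀ K s t : ℝ} (hs : 0 < s) (ht : t ≤ s) : stepFun κ₀ K s t = κ₀ := by
  rw [stepFun, Real.smoothTransition.zero_of_nonpos
    (div_nonpos_of_nonpos_of_nonneg (by linarith) hs.le)]
  ring

theorem stepFun_of_ge {κ₀ K s t : ℝ} (hs : 0 < s) (ht : 2 * s ≤ t) : stepFun κ₀ K s t = K := by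
  rw [stepFun, Real.smoothTransition.one_of_one_le (by rw [le_div_iff₀ hs]; linarith)]
  ring

theorem le_stepFun {κ₀ K : ℝ} (h : κ₀ ≤ K) (s t : ℝ) : κ₀ ≤ stepFun κ₀ K s t := by
  have := mul_nonneg (sub_nonneg.2 h) (Real.smoothTransition.nonneg ((t - s) / s))
  rw [stepFun]; linarith

theorem rho_lt_of_mul_lt_one {W : StratData n m X} {K r : ℝ} (hr : 0 < r) (hK : 1 / r ≤ K) {x : X}
    (hx : K * W.rho x < 1) : W.rho x < r := by
  have h1 := (mul_le_mul_of_nonneg_right hK (rho_nonneg (W := W) x)).trans_lt hx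
  rwa [one_div, inv_mul_lt_iff₀ hr, mul_one] at h1

theorem mul_rho_lt_of_le {W : StratData n m X} {k k' : ℝ} (hk : k ≤ k') {x : X}
    (hx : k' * W.rho x < 1) : k * W.rho x < 1 :=
  (mul_le_mul_of_nonneg_right hk (rho_nonneg (W := W) x)).trans_lt hx

variable [CompactSpace L] {W : FibPM l L n m X} {h : X → ℝ}

theorem isOpen_mul_rho_lt (W : FibPM l L n m X) {κ : ℝ} (hκ : 0 < κ) :
    IsOpen {x | x ∈ W.tube ∧ κ * W.rho x < 1} := by
  have h1 : {x | x ∈ W.tube ∧ κ * W.rho x < 1} = {x | x ∈ W.tube ∧ W.rho x < 1 / κ} := by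
    ext x
    change _ ∧ _ ↔ _ ∧ _
    rw [lt_div_iff₀ hκ, mul_comm]
  rw [h1]
  exact W.isOpen_rho_lt _

/-- The subset of a small tube given by an open condition on `π`. -/
theorem isOpen_retr_mem (W : FibPM l L n m X) {O : Set X} (hO : IsOpen O) :
    IsOpen {x | x ∈ W.tube ∧ W.retr x ∈ O} :=
  continuousOn_retr.isOpen_inter_preimage W.isOpen_tube hO

theorem continuousOn_k_retr {k : X → ℝ} (hk : ContMDiff (HModel m) 𝓘(ℝ, ℝ) ∞ (fun y : W.Sing => k y.1)) :
    ContinuousOn (fun x => k (W.retr x)) W.tube := by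
  rw [continuousOn_iff_continuous_domRestrict]
  refine (hk.continuous.comp W.continuous_proj).congr fun x => ?_
  change k (W.proj x).1 = k (W.retr x.1)
  rw [retr_of_mem x.2]

theorem isOpen_k_lt {k : X → ℝ} (hk : ContMDiff (HModel m) 𝓘(ℝ, ℝ) ∞ (fun y : W.Sing => k y.1)) :
    IsOpen {x | x ∈ W.tube ∧ k (W.retr x) * W.rho x < 1} :=
  ((continuousOn_k_retr hk).mul continuousOn_rho).isOpen_inter_preimage W.isOpen_tube
    isOpen_Iio

namespace LevelFlow

variable {𝓕 : LevelFlow W h} {κ₀ : ℝ}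

/-- Scales for the construction of a taper: the range `η` of crossing times in which the control
data are modified, the height `s` below which the tube has radius `1 / κ₀`, and the lower bound
`K₀` for the inverse of the radius of the tube far from the level set. -/
structure TaperScales (𝓕 : LevelFlow W h) (κ₀ σ : ℝ) where
  η : ℝ
  η_pos : 0 < η
  abs_lt : ∀ x ∈ 𝓕.dom, |𝓕.time x| < 7 * η → |h x| < σ
  s : ℝ
  s_pos : 0 < s
  s_le : 2 * s ≤ σ
  time_lt : ∀ x, |h x| < 3 * s → x ∈ 𝓕.dom ∧ |𝓕.time x| < 2 * η
  K₀ : ℝ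
  le_K₀ : κ₀ ≤ K₀
  lag_lt : ∀ x ∈ W.tube, K₀ * W.rho x < 1 → x ∈ 𝓕.dom → |𝓕.lag x| < η / 2
  sub_lt : ∀ x ∈ W.tube, K₀ * W.rho x < 1 → |h x - h (W.retr x)| < s

theorem nonempty_taperScales (hh : Continuous h) (κ₀ : ℝ) {σ : ℝ} (hσ : 0 < σ) :
    Nonempty (TaperScales 𝓕 κ₀ σ) := by
  obtain ⟨η₁, hη₁, h1⟩ := 𝓕.exists_abs_lt hh hσ
  obtain ⟨s₁, hs₁, h2⟩ := 𝓕.exists_time_lt hh (η := 2 * (η₁ / 7)) (by positivity)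
  obtain ⟨r, hr, -, h3⟩ := 𝓕.exists_time_sub_retr_lt hh (η := η₁ / 7 / 2) (by positivity)
  have hs : 0 < min (s₁ / 3) (σ / 2) := lt_min (by positivity) (by positivity)
  obtain ⟨r', hr', h4⟩ := W.exists_abs_sub_retr_lt hh hs
  refine ⟨⟨η₁ / 7, by positivity, fun x hx hxη => h1 x hx (by linarith), min (s₁ / 3) (σ / 2), hs,
    by linarith [min_le_right (s₁ / 3) (σ / 2)], fun x hx => h2 x (by
      linarith [min_le_left (s₁ / 3) (σ / 2)]), max κ₀ (max (1 / r) (1 / r')), le_max_left _ _,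
    fun x hx hxK hxd => ?_, fun x hx hxK => ?_⟩⟩
  · exact (h3 x hx (rho_lt_of_mul_lt_one hr ((le_max_left _ _).trans (le_max_right _ _)) hxK)).2 hxd
  · exact h4 x hx (rho_lt_of_mul_lt_one hr' ((le_max_right _ _).trans (le_max_right _ _)) hxK)

/-- The control data near an interior regular level set. -/
def taper (hh : IsSmoothFun W♭ h) (hκ : 𝓕.IsTubeBound κ₀) {σ : ℝ}
    (S : TaperScales 𝓕 κ₀ σ) (τ : TimeChange S.η) {K : ℝ} (hK : S.K₀ ≤ K) :
    Taper W h κ₀ K σ := by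
  have hη := S.η_pos
  have hκK : κ₀ ≤ K := S.le_K₀.trans hK
  have hsk : ContMDiff (HModel m) 𝓘(ℝ, ℝ) ∞ (fun y : W.Sing => stepFun κ₀ K S.s (h y.1)) :=
    (contDiff_stepFun κ₀ K S.s).contMDiff.comp hh.smooth_sing
  have hhuge : ∀ y ∈ 𝓕.dom, 2 * S.η ≤ 𝓕.time y → stepFun κ₀ K S.s (h y) = K := by
    intro y hy hyη
    refine stepFun_of_ge S.s_pos ?_
    by_contra hlt
    have h1 : 0 < h y := (𝓕.time_pos_iff hh.continuous hy).1 (by linarith)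
    have h2 := (S.time_lt y (by rw [_root_.abs_of_pos h1]; linarith [S.s_pos])).2
    linarith [le_abs_self (𝓕.time y)]
  have hlagK : ∀ x ∈ W.tube, K * W.rho x < 1 → x ∈ 𝓕.dom → |𝓕.lag x| < S.η / 2 :=
    fun x hx hxK => S.lag_lt x hx (mul_rho_lt_of_le hK hxK)
  have hlt : ∀ y ∈ 𝓕.dom, 𝓕.time y < 6 * S.η → h y < σ := by
    intro y hy hyη
    rcases le_or_gt 0 (𝓕.time y) with h1 | h1
    · have := S.abs_lt y hy (by rw [abs_of_nonneg h1]; linarith)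
      linarith [le_abs_self (h y)]
    · have h2 : ¬ 0 ≤ h y := fun h3 => absurd ((𝓕.time_nonneg_iff hh.continuous hy).2 h3) (not_le.2 h1)
      linarith [not_le.1 h2, S.s_pos, S.s_le]
  let N : Set X := 𝓕.tubeDom κ₀ ∩ {x | 𝓕.time (W.retr x) < 11 / 2 * S.η} ∩
    {x | x ∈ W.tube ∧ stepFun κ₀ K S.s (h (W.retr x)) * W.rho x < 1}
  have hN : IsOpen N := by
    refine IsOpen.inter ?_ (isOpen_k_lt (k := fun y => stepFun κ₀ K S.s (h y)) hsk)
    refine ContinuousOn.isOpen_inter_preimage (f := fun x => 𝓕.time (W.retr x)) (t := Iio _)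
      (fun x hx => ?_) (isOpen_tubeDom hh.continuous hκ.pos) isOpen_Iio
    exact (continuousAt_time_retr hh.continuous hκ hx).continuousWithinAt
  have hΘc : ContinuousOn (𝓕.straighten τ.ψ) (𝓕.tubeDom κ₀) := fun x hx =>
    (continuousAt_straighten hh.continuous hκ τ.smooth.continuous hx).continuousWithinAt
  have hΛc : ContinuousOn (𝓕.unstraighten τ.ψ) (𝓕.tubeDom κ₀) := fun x hx =>
    (continuousAt_unstraighten hh.continuous hκ τ.smooth.continuous hx).continuousWithinAt
  let T : Set X := 𝓕.tubeDom κ₀ ∩ 𝓕.straighten τ.ψ ⁻¹' N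
  let C : Set X := {x | x ∈ 𝓕.dom ∧ |𝓕.time x| ≤ 9 / 2 * S.η}
  have hC : IsClosed C := 𝓕.isClosed_time_le hh.continuous _
  have htimeC : ∀ x ∈ 𝓕.dom, x ∉ C → 0 < h x → 9 / 2 * S.η ≤ 𝓕.time x := by
    intro x hx hxC hxh
    have h1 := (𝓕.time_pos_iff hh.continuous hx).2 hxh
    by_contra h2
    exact hxC ⟨hx, by rw [_root_.abs_of_pos h1]; linarith⟩
  let M : Set X := ({x | x ∈ W.tube ∧ K * W.rho x < 1} ∩ {x | 0 < h x}) ∩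
    ({x | x ∈ W.tube ∧ W.retr x ∈ {y | 2 * S.s < h y} ∩ Cᶜ} ∩ Cᶜ)
  have hM : IsOpen M := ((isOpen_mul_rho_lt W (hκ.pos.trans_le hκK)).inter
    (isOpen_lt continuous_const hh.continuous)).inter ((isOpen_retr_mem W
    ((isOpen_lt continuous_const hh.continuous).inter hC.isOpen_compl)).inter hC.isOpen_compl)
  exact
  { k := fun y => stepFun κ₀ K S.s (h y)
    smooth_k := hsk
    le_k := fun y => le_stepFun hκK _ _
    k_eq := fun y hy => stepFun_of_ge S.s_pos (S.s_le.trans hy)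
    T := T
    N := N
    M := M
    isOpen_T := hΘc.isOpen_inter_preimage (isOpen_tubeDom hh.continuous hκ.pos) hN
    isOpen_N := hN
    isOpen_M := hM
    Θ := 𝓕.straighten τ.ψ
    Λ := 𝓕.unstraighten τ.ψ
    continuousOn_Θ := hΘc.mono inter_subset_left
    continuousOn_Λ := hΛc.mono fun x hx => hx.1.1
    smooth_Θ := fun x hx => smoothRegAt_straighten hh hκ τ.smooth hx.1
    smooth_Λ := fun x hx => smoothRegAt_unstraighten hh hκ τ.smooth hx.1.1
    mem_tube := fun x hx => hx.2.1.1.1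
    rho_Θ := fun x hx => rho_flow hκ hx.1 _
    Θ_sing := fun x _ hxs => straighten_of_mem_sing _ τ.zero hxs
    T_lt := fun x hx => by
      have h1 : 𝓕.time (W.retr (𝓕.straighten τ.ψ x)) < 11 / 2 * S.η := hx.2.1.2
      have h2 : stepFun κ₀ K S.s (h (W.retr (𝓕.straighten τ.ψ x))) *
        W.rho (𝓕.straighten τ.ψ x) < 1 := hx.2.2.2
      rw [straighten, rho_flow hκ hx.1, ← straighten] at h2
      have h3 := time_retr_straighten hh.continuous hκ hx.1 τ.ψ
      refine hlt x hx.1.2.2 ?_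
      rcases le_or_gt (𝓕.time x) (3 * S.η) with h4 | h4
      · linarith
      · have h5 : 3 * S.η < 𝓕.time (W.retr (𝓕.straighten τ.ψ x)) := by
          rw [h3]; exact not_le.1 (mt (τ.le_iff _ _).1 (not_le.2 h4))
        have h6 : K * W.rho x < 1 := by
          rwa [hhuge _ (retr_mem_dom hκ hx.2.1.1) (by linarith)] at h2
        have h7 := hlagK x hx.1.1 h6 hx.1.2.2
        have h8 := τ.abs_sub_le (-𝓕.lag x) (𝓕.time x)
        rw [← h3, abs_neg] at h8
        linarith [neg_abs_le (𝓕.time (W.retr (𝓕.straighten τ.ψ x)) - 𝓕.time x)]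
    N_lt := fun x hx => hlt _ (retr_mem_dom hκ hx.1.1) (by
      have h1 : 𝓕.time (W.retr x) < 11 / 2 * S.η := hx.1.2
      linarith)
    maps_Θ := fun x hx hxh => by
      have h2 : stepFun κ₀ K S.s (h (W.retr (𝓕.straighten τ.ψ x))) *
        W.rho (𝓕.straighten τ.ψ x) < 1 := hx.2.2.2
      rw [straighten, rho_flow hκ hx.1, ← straighten] at h2
      refine ⟨hx.2, ?_, h2, unstraighten_straighten hh.continuous hκ τ.apply_neg hx.1⟩
      rw [← 𝓕.time_nonneg_iff hh.continuous (retr_mem_dom hκ hx.2.1.1),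
        time_retr_straighten hh.continuous hκ hx.1, τ.nonneg_iff hη,
        𝓕.time_nonneg_iff hh.continuous hx.1.2.2]
      exact hxh
    maps_Λ := fun x hx hxh hxk => by
      have h1 := straighten_unstraighten hh.continuous hκ τ.neg_apply hx.1.1
      have h2 : 𝓕.unstraighten τ.ψ x ∈ 𝓕.tubeDom κ₀ := flow_mem_tubeDom hκ hx.1.1 _
      refine ⟨⟨h2, ?_⟩, ?_, h1⟩
      · rw [mem_preimage, h1]; exact hx
      · rw [← 𝓕.time_nonneg_iff hh.continuous h2.2.2, time_unstraighten hh.continuous hx.1.1,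
          τ.nonneg_iff hη, 𝓕.time_nonneg_iff hh.continuous (retr_mem_dom hκ hx.1.1)]
        exact hxh
    M_subset := fun x hx => hx.1.1.1
    M_spec := fun x hx => by
      have h1 : 2 * S.s < h (W.retr x) := hx.2.1.2.1
      exact ⟨hx.1.2, by linarith [S.s_pos], hx.1.1.2, stepFun_of_ge S.s_pos h1.le⟩
    Θ_eq := fun x hx hxT => by
      have h1 := htimeC x hxT.1.2.2 hx.2.2 hx.1.2
      have h2 := hlagK x hx.1.1.1 hx.1.1.2 hxT.1.2.2
      rw [straighten, τ.eq_add _ _ h1 (by rwa [abs_neg])]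
      convert 𝓕.zero x using 2
      rw [lag]; ring
    Λ_eq := fun x hx hxN => by
      have h3 : 2 * S.s < h (W.retr x) := hx.2.1.2.1
      have h1 := htimeC _ (retr_mem_dom hκ hxN.1.1) hx.2.1.2.2 (by linarith [S.s_pos])
      have h2 := hlagK x hx.1.1.1 hx.1.1.2 hxN.1.1.2.2
      rw [unstraighten, τ.eq_add _ _ h1 h2]
      convert 𝓕.zero x using 2
      rw [lag]; ring
    N_cover := fun x hx hxh hxk => by
      have h0 : κ₀ * W.rho x < 1 := mul_rho_lt_of_le (le_stepFun hκK _ _) hxk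
      by_cases h1 : W.retr x ∈ 𝓕.dom ∧ 𝓕.time (W.retr x) < 11 / 2 * S.η
      · exact Or.inl ⟨⟨⟨hx, h0, (hκ.retr_mem x hx h0).1 h1.1⟩, h1.2⟩, hx, hxk⟩
      · right
        have h2 : 3 * S.s ≤ h (W.retr x) := by
          by_contra h3
          have h4 := S.time_lt (W.retr x) (by rw [abs_of_nonneg hxh]; linarith)
          exact h1 ⟨h4.1, by linarith [le_abs_self (𝓕.time (W.retr x)), h4.2]⟩
        have h3 : K * W.rho x < 1 := by
          rwa [stepFun_of_ge S.s_pos (by linarith [S.s_pos])] at hxk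
        have h4 := abs_lt.1 (S.sub_lt x hx (mul_rho_lt_of_le hK h3))
        have h5 : 0 < h x := by linarith [h4.1, S.s_pos]
        refine ⟨⟨⟨hx, h3⟩, h5⟩, ⟨hx, ?_, fun h6 => h1 ⟨h6.1, ?_⟩⟩, fun h6 => h1 ?_⟩
        · change 2 * S.s < _
          linarith [S.s_pos]
        · linarith [le_abs_self (𝓕.time (W.retr x)), h6.2]
        · have h7 := hlagK x hx h3 h6.1
          refine ⟨(hκ.retr_mem x hx h0).2 h6.1, ?_⟩
          have h8 : 𝓕.time (W.retr x) = 𝓕.time x - 𝓕.lag x := by rw [lag]; ring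
          rw [h8]
          linarith [le_abs_self (𝓕.time x), h6.2, neg_abs_le (𝓕.lag x)] }

end LevelFlow

/-- Scales for the construction of a taper at a level set in the boundary. -/
structure BoundaryScales (W : FibPM l L n m X) (h : X → ℝ) (κ₀ σ : ℝ) where
  s : ℝ
  s_pos : 0 < s
  s_le : 3 * s ≤ σ
  lt : ∀ x ∈ W.tube, κ₀ * W.rho x < 1 → h (W.retr x) < 3 * s → h x < σ
  K₀ : ℝ
  le_K₀ : κ₀ ≤ K₀
  sub_lt : ∀ x ∈ W.tube, K₀ * W.rho x < 1 → |h x - h (W.retr x)| < s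

theorem nonempty_boundaryScales (hh : Continuous h) (hpos : ∀ x, 0 ≤ h x) {κ₀ : ℝ} (hκ : 0 < κ₀)
    (hzero : ∀ x ∈ W.tube, κ₀ * W.rho x ≤ 1 → h (W.retr x) = 0 → h x = 0) {σ : ℝ} (hσ : 0 < σ) :
    Nonempty (BoundaryScales W h κ₀ σ) := by
  let Q : Set X := {x | x ∈ W.tube ∧ W.rho x ≤ 1 / κ₀} ∩ {x | σ ≤ h x}
  have hQ : IsCompact Q := (W.isCompact_rho_le _).inter_right (isClosed_le continuous_const hh)
  obtain ⟨s, hs, hs'⟩ : ∃ s > 0, ∀ x ∈ Q, 3 * s ≤ h (W.retr x) := by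
    rcases Q.eq_empty_or_nonempty with h0 | h0
    · exact ⟨1, one_pos, fun x hx => absurd (h0 ▸ hx) (notMem_empty x)⟩
    · obtain ⟨x₀, hx₀, hmin⟩ := hQ.exists_isMinOn h0
        (hh.comp_continuousOn (continuousOn_retr.mono fun x hx => hx.1.1))
      have h1 : 0 < h (W.retr x₀) := lt_of_le_of_ne (hpos _) fun h2 => by
        have h3 := hzero x₀ hx₀.1.1 (by
          have h5 := hx₀.1.2
          rw [le_div_iff₀ hκ] at h5; linarith) h2.symm
        have h4 : σ ≤ h x₀ := hx₀.2
        linarith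
      exact ⟨h (W.retr x₀) / 3, by positivity, fun x hx => by
        have : h (W.retr x₀) ≤ h (W.retr x) := hmin hx
        linarith⟩
  have hs3 : 0 < min s (σ / 3) := lt_min hs (by positivity)
  obtain ⟨r, hr, h1⟩ := W.exists_abs_sub_retr_lt hh hs3
  refine ⟨⟨min s (σ / 3), hs3, by linarith [min_le_right s (σ / 3)], fun x hx hxκ hxs => ?_,
    max κ₀ (1 / r), le_max_left _ _, fun x hx hxK =>
      h1 x hx (rho_lt_of_mul_lt_one hr (le_max_right _ _) hxK)⟩⟩
  by_contra hlt
  have h2 := hs' x ⟨⟨hx, by rw [le_div_iff₀ hκ]; linarith⟩, not_lt.1 hlt⟩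
  linarith [min_le_left s (σ / 3)]

/-- The control data near a level set in the boundary: only the radius of the tube is modified. -/
def boundaryTaper (hh : IsSmoothFun W♭ h) (hpos : ∀ x, 0 ≤ h x) {κ₀ : ℝ} (hκ : 0 < κ₀) {σ : ℝ}
    (S : BoundaryScales W h κ₀ σ) {K : ℝ} (hK : S.K₀ ≤ K) : Taper W h κ₀ K σ := by
  have hκK : κ₀ ≤ K := S.le_K₀.trans hK
  have hsk : ContMDiff (HModel m) 𝓘(ℝ, ℝ) ∞ (fun y : W.Sing => stepFun κ₀ K S.s (h y.1)) :=
    (contDiff_stepFun κ₀ K S.s).contMDiff.comp hh.smooth_sing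
  let N : Set X := {x | x ∈ W.tube ∧ κ₀ * W.rho x < 1} ∩ {x | x ∈ W.tube ∧ W.retr x ∈
    {y | h y < 3 * S.s}} ∩ {x | x ∈ W.tube ∧ stepFun κ₀ K S.s (h (W.retr x)) * W.rho x < 1}
  have hN : IsOpen N := ((isOpen_mul_rho_lt W hκ).inter (isOpen_retr_mem W
    (isOpen_lt hh.continuous continuous_const))).inter
      (isOpen_k_lt (k := fun y => stepFun κ₀ K S.s (h y)) hsk)
  let M : Set X := {x | x ∈ W.tube ∧ K * W.rho x < 1} ∩ {x | 0 < h x} ∩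
    {x | x ∈ W.tube ∧ W.retr x ∈ {y | 2 * S.s < h y}}
  have hM : IsOpen M := ((isOpen_mul_rho_lt W (hκ.trans_le hκK)).inter
    (isOpen_lt continuous_const hh.continuous)).inter (isOpen_retr_mem W
    (isOpen_lt continuous_const hh.continuous))
  have hid : ∀ x : W.Reg, SmoothRegAt W♭ id x := fun x =>
    ⟨id, contMDiffAt_id, Filter.Eventually.of_forall fun _ => rfl⟩
  exact
  { k := fun y => stepFun κ₀ K S.s (h y)
    smooth_k := hsk
    le_k := fun y => le_stepFun hκK _ _
    k_eq := fun y hy => stepFun_of_ge S.s_pos (by linarith [S.s_le, S.s_pos])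
    T := N
    N := N
    M := M
    isOpen_T := hN
    isOpen_N := hN
    isOpen_M := hM
    Θ := id
    Λ := id
    continuousOn_Θ := continuousOn_id
    continuousOn_Λ := continuousOn_id
    smooth_Θ := fun x _ => hid x
    smooth_Λ := fun x _ => hid x
    mem_tube := fun x hx => hx.1.1.1
    rho_Θ := fun x hx => rfl
    Θ_sing := fun x _ _ => rfl
    T_lt := fun x hx => S.lt x hx.1.1.1 hx.1.1.2 hx.1.2.2
    N_lt := fun x hx => by
      have h1 : h (W.retr x) < 3 * S.s := hx.1.2.2
      linarith [S.s_le]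
    maps_Θ := fun x hx hxh => ⟨hx, hpos _, hx.2.2, rfl⟩
    maps_Λ := fun x hx hxh hxk => ⟨hx, hpos _, rfl⟩
    M_subset := fun x hx => hx.1.1.1
    M_spec := fun x hx => by
      have h1 : 2 * S.s < h (W.retr x) := hx.2.2
      exact ⟨hx.1.2, by linarith [S.s_pos], hx.1.1.2, stepFun_of_ge S.s_pos h1.le⟩
    Θ_eq := fun x _ _ => rfl
    Λ_eq := fun x _ _ => rfl
    N_cover := fun x hx hxh hxk => by
      have h0 : κ₀ * W.rho x < 1 := mul_rho_lt_of_le (le_stepFun hκK _ _) hxk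
      rcases lt_or_ge (h (W.retr x)) (3 * S.s) with h1 | h1
      · exact Or.inl ⟨⟨⟨hx, h0⟩, hx, h1⟩, hx, hxk⟩
      · right
        have h3 : K * W.rho x < 1 := by
          rwa [stepFun_of_ge S.s_pos (by linarith [S.s_pos])] at hxk
        have h4 := abs_lt.1 (S.sub_lt x hx (mul_rho_lt_of_le hK h3))
        refine ⟨⟨⟨hx, h3⟩, ?_⟩, hx, ?_⟩
        · change 0 < h x
          linarith [h4.1, S.s_pos]
        · change 2 * S.s < _
          linarith [S.s_pos] }

end Taper

/-! ### The slab between two level sets -/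

section Glue

open Classical in
/-- The map given by `A₀` on `S₀`, by `A₁` on `S₁`, and by the identity elsewhere. -/
def glue (S₀ S₁ : Set X) (A₀ A₁ : X → X) (x : X) : X :=
  if x ∈ S₀ then A₀ x else if x ∈ S₁ then A₁ x else x

variable {S₀ S₁ : Set X} {A₀ A₁ : X → X}

theorem glue_left {x : X} (hx : x ∈ S₀) : glue S₀ S₁ A₀ A₁ x = A₀ x := if_pos hx

theorem glue_right (hS : Disjoint S₀ S₁) {x : X} (hx : x ∈ S₁) : glue S₀ S₁ A₀ A₁ x = A₁ x := by
  rw [glue, if_neg fun h => hS.le_bot ⟨h, hx⟩, if_pos hx]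

theorem glue_mid {x : X} (h₀ : x ∈ S₀ → A₀ x = x) (h₁ : x ∈ S₁ → A₁ x = x) :
    glue S₀ S₁ A₀ A₁ x = x := by
  rw [glue]; split_ifs with h h'
  exacts [h₀ h, h₁ h', rfl]

theorem glue_cases (hS : Disjoint S₀ S₁) (h0 : IsOpen S₀) (h1 : IsOpen S₁) {M : Set X}
    (hM : IsOpen M) (hM₀ : ∀ x ∈ M, x ∈ S₀ → A₀ x = x) (hM₁ : ∀ x ∈ M, x ∈ S₁ → A₁ x = x) {x : X}
    (hx : x ∈ S₀ ∪ S₁ ∪ M) :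
    (x ∈ S₀ ∧ glue S₀ S₁ A₀ A₁ =ᶠ[𝓝 x] A₀) ∨ (x ∈ S₁ ∧ glue S₀ S₁ A₀ A₁ =ᶠ[𝓝 x] A₁) ∨
      (x ∈ M ∧ glue S₀ S₁ A₀ A₁ =ᶠ[𝓝 x] id) := by
  rcases hx with (hx | hx) | hx
  · exact Or.inl ⟨hx, by filter_upwards [h0.mem_nhds hx] with z hz using glue_left hz⟩
  · exact Or.inr (Or.inl ⟨hx, by filter_upwards [h1.mem_nhds hx] with z hz using glue_right hS hz⟩)
  · exact Or.inr (Or.inr ⟨hx, by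
      filter_upwards [hM.mem_nhds hx] with z hz using glue_mid (hM₀ z hz) (hM₁ z hz)⟩)

end Glue

section SlabRetube

variable {W : FibPM l L n m X}

theorem SmoothRegAt.congr {A B : X → X} {x : W.Reg} (h : SmoothRegAt W♭ A x)
    (hB : B =ᶠ[𝓝 x.1] A) : SmoothRegAt W♭ B x := by
  obtain ⟨C, h1, h2⟩ := h
  refine ⟨C, h1, ?_⟩
  filter_upwards [h2, continuous_subtype_val.continuousAt.eventually hB] with z hz hz'
  exact hz.trans hz'.symm

theorem smoothRegAt_id (x : W.Reg) : SmoothRegAt W♭ id x :=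
  ⟨id, contMDiffAt_id, Filter.Eventually.of_forall fun _ => rfl⟩

namespace Taper

variable {h₀ h₁ : X → ℝ} {κ₀ κ₁ K σ δ : ℝ} (E₀ : Taper W h₀ κ₀ K σ) (E₁ : Taper W h₁ κ₁ K σ)

theorem disjoint_T (hsum : ∀ x, h₀ x + h₁ x = δ) (hσ : 2 * σ ≤ δ) : Disjoint E₀.T E₁.T := by
  rw [Set.disjoint_left]
  intro x h2 h3
  linarith [E₀.T_lt x h2, E₁.T_lt x h3, hsum x]

theorem disjoint_N (hsum : ∀ x, h₀ x + h₁ x = δ) (hσ : 2 * σ ≤ δ) : Disjoint E₀.N E₁.N := by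
  rw [Set.disjoint_left]
  intro x h2 h3
  linarith [E₀.N_lt x h2, E₁.N_lt x h3, hsum (W.retr x)]

/-- The control data of the slab between two level sets. -/
def slabRetube (hκ₀ : 0 < κ₀) (hκ₁ : 0 < κ₁) (hsum : ∀ x, h₀ x + h₁ x = δ) (hσ : 2 * σ ≤ δ)
    {D : Set X} (hD : ∀ x, x ∈ D ↔ 0 ≤ h₀ x ∧ 0 ≤ h₁ x) : Retube W D := by
  have hT := disjoint_T E₀ E₁ hsum hσ
  have hN := disjoint_N E₀ E₁ hsum hσ
  have hκ : ∀ y, (σ ≤ h₀ y → E₀.k y + E₁.k y - K = E₁.k y) ∧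
      (σ ≤ h₁ y → E₀.k y + E₁.k y - K = E₀.k y) := fun y =>
    ⟨fun h => by rw [E₀.k_eq y h]; ring, fun h => by rw [E₁.k_eq y h]; ring⟩
  have hor : ∀ y, σ ≤ h₀ y ∨ σ ≤ h₁ y := fun y => by
    by_contra! h
    linarith [hsum y, h.1, h.2]
  have hTc : ∀ x ∈ E₀.T ∪ E₁.T ∪ (E₀.M ∩ E₁.M), _ := fun x hx =>
    glue_cases (A₀ := E₀.Θ) (A₁ := E₁.Θ) hT E₀.isOpen_T E₁.isOpen_T (E₀.isOpen_M.inter E₁.isOpen_M)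
      (fun x hx => E₀.Θ_eq x hx.1) (fun x hx => E₁.Θ_eq x hx.2) hx
  have hNc : ∀ x ∈ E₀.N ∪ E₁.N ∪ (E₀.M ∩ E₁.M), _ := fun x hx =>
    glue_cases (A₀ := E₀.Λ) (A₁ := E₁.Λ) hN E₀.isOpen_N E₁.isOpen_N (E₀.isOpen_M.inter E₁.isOpen_M)
      (fun x hx => E₀.Λ_eq x hx.1) (fun x hx => E₁.Λ_eq x hx.2) hx
  exact
  { κ := fun y => E₀.k y + E₁.k y - K
    κ_nonneg := fun y => by
      rcases hor y with h | h
      · rw [(hκ y).1 h]; linarith [E₁.le_k y]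
      · rw [(hκ y).2 h]; linarith [E₀.le_k y]
    smooth_κ := (E₀.smooth_k.add E₁.smooth_k).sub contMDiff_const
    T := E₀.T ∪ E₁.T ∪ (E₀.M ∩ E₁.M)
    N := E₀.N ∪ E₁.N ∪ (E₀.M ∩ E₁.M)
    isOpen_T := (E₀.isOpen_T.union E₁.isOpen_T).union (E₀.isOpen_M.inter E₁.isOpen_M)
    Θ := glue E₀.T E₁.T E₀.Θ E₁.Θ
    Λ := glue E₀.N E₁.N E₀.Λ E₁.Λ
    continuousOn_Θ := fun x hx => by
      refine ContinuousAt.continuousWithinAt ?_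
      rcases hTc x hx with ⟨h1, h2⟩ | ⟨h1, h2⟩ | ⟨h1, h2⟩
      · exact (E₀.continuousOn_Θ.continuousAt (E₀.isOpen_T.mem_nhds h1)).congr h2.symm
      · exact (E₁.continuousOn_Θ.continuousAt (E₁.isOpen_T.mem_nhds h1)).congr h2.symm
      · exact continuousAt_id.congr h2.symm
    continuousOn_Λ := fun x hx => by
      refine ContinuousAt.continuousWithinAt ?_
      rcases hNc x hx with ⟨h1, h2⟩ | ⟨h1, h2⟩ | ⟨h1, h2⟩
      · exact (E₀.continuousOn_Λ.continuousAt (E₀.isOpen_N.mem_nhds h1)).congr h2.symm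
      · exact (E₁.continuousOn_Λ.continuousAt (E₁.isOpen_N.mem_nhds h1)).congr h2.symm
      · exact continuousAt_id.congr h2.symm
    smooth_Θ := fun x hx => by
      rcases hTc x.1 hx with ⟨h1, h2⟩ | ⟨h1, h2⟩ | ⟨h1, h2⟩
      · exact (E₀.smooth_Θ x h1).congr h2
      · exact (E₁.smooth_Θ x h1).congr h2
      · exact (smoothRegAt_id x).congr h2
    smooth_Λ := fun x hx => by
      rcases hNc x.1 hx with ⟨h1, h2⟩ | ⟨h1, h2⟩ | ⟨h1, h2⟩
      · exact (E₀.smooth_Λ x h1).congr h2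
      · exact (E₁.smooth_Λ x h1).congr h2
      · exact (smoothRegAt_id x).congr h2
    mem_tube := fun x hx => by
      rcases hTc x hx with ⟨h1, h2⟩ | ⟨h1, h2⟩ | ⟨h1, h2⟩ <;> rw [h2.self_of_nhds]
      exacts [E₀.mem_tube x h1, E₁.mem_tube x h1, E₀.M_subset h1.1]
    rho_Θ := fun x hx => by
      rcases hTc x hx with ⟨h1, h2⟩ | ⟨h1, h2⟩ | ⟨h1, h2⟩ <;> rw [h2.self_of_nhds]
      exacts [E₀.rho_Θ x h1, E₁.rho_Θ x h1, rfl]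
    Θ_sing := fun x hx hxs => by
      rcases hTc x hx with ⟨h1, h2⟩ | ⟨h1, h2⟩ | ⟨h1, h2⟩ <;> rw [h2.self_of_nhds]
      exacts [E₀.Θ_sing x h1 hxs, E₁.Θ_sing x h1 hxs, rfl]
    sing_subset := fun x hx => by
      have hr := retr_of_mem_sing hx.1
      have h0 := rho_eq_zero_iff.2 hx.1
      have h1 := (hD x).1 hx.2
      have htube := W.sing_subset_tube hx.1
      -- a point of the singular stratum in `N` is in `T`, as `Λ` does not move it
      have key : ∀ {h : X → ℝ} {κ : ℝ} (E : Taper W h κ K σ), 0 ≤ h x → x ∈ E.T ∨ x ∈ E.M := by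
        intro h κ E hx0
        have hk : E.k (W.retr x) * W.rho x < 1 := by rw [h0, mul_zero]; exact one_pos
        rcases E.N_cover x htube (by rwa [hr]) hk with h2 | h2
        · obtain ⟨h3, -, h4⟩ := E.maps_Λ x h2 (by rwa [hr]) hk
          have h5 : E.Λ x ∈ W.sing := by
            rw [← rho_eq_zero_iff, ← E.rho_Θ _ h3, h4, h0]
          rw [E.Θ_sing _ h3 h5] at h4
          exact Or.inl (h4 ▸ h3)
        · exact Or.inr h2
      rcases key E₀ h1.1 with h2 | h2
      · exact Or.inl (Or.inl h2)
      rcases key E₁ h1.2 with h3 | h3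
      · exact Or.inl (Or.inr h3)
      exact Or.inr ⟨h2, h3⟩
    maps_Θ := fun x hx => by
      have hxD := (hD x).1 hx.2
      rcases hTc x hx.1 with ⟨h1, h2⟩ | ⟨h1, h2⟩ | ⟨h1, h2⟩ <;> rw [h2.self_of_nhds]
      · obtain ⟨h3, h4, h5, h6⟩ := E₀.maps_Θ x h1 hxD.1
        have h7 := E₀.N_lt _ h3
        have h8 : σ ≤ h₁ (W.retr (E₀.Θ x)) := by linarith [hsum (W.retr (E₀.Θ x))]
        refine ⟨(hD _).2 ⟨h4, by linarith [hsum (W.retr (E₀.Θ x))]⟩, ?_, ?_⟩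
        · rwa [(hκ _).2 h8]
        · rwa [glue_left h3]
      · obtain ⟨h3, h4, h5, h6⟩ := E₁.maps_Θ x h1 hxD.2
        have h7 := E₁.N_lt _ h3
        have h8 : σ ≤ h₀ (W.retr (E₁.Θ x)) := by linarith [hsum (W.retr (E₁.Θ x))]
        refine ⟨(hD _).2 ⟨by linarith [hsum (W.retr (E₁.Θ x))], h4⟩, ?_, ?_⟩
        · rwa [(hκ _).1 h8]
        · rwa [glue_right hN h3]
      · obtain ⟨-, h3, h4, h5⟩ := E₀.M_spec x h1.1
        obtain ⟨-, h6, -, h7⟩ := E₁.M_spec x h1.2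
        refine ⟨(hD _).2 ⟨h3.le, h6.le⟩, ?_, glue_mid (E₀.Λ_eq x h1.1) (E₁.Λ_eq x h1.2)⟩
        rw [id, h5, h7, add_sub_cancel_right]; exact h4
    maps_Λ := fun x hx hxD hxκ => by
      have hr := (hD _).1 hxD
      have h0N : x ∈ E₀.N → x ∈ E₀.N ∪ E₁.N ∪ (E₀.M ∩ E₁.M) ∧
          glue E₀.N E₁.N E₀.Λ E₁.Λ x ∈ (E₀.T ∪ E₁.T ∪ (E₀.M ∩ E₁.M)) ∩ D ∧
          glue E₀.T E₁.T E₀.Θ E₁.Θ (glue E₀.N E₁.N E₀.Λ E₁.Λ x) = x := fun hxN => by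
        have h1 := E₀.N_lt x hxN
        rw [(hκ _).2 (by linarith [hsum (W.retr x)])] at hxκ
        obtain ⟨h2, h3, h4⟩ := E₀.maps_Λ x hxN hr.1 hxκ
        have h5 := E₀.T_lt _ h2
        rw [glue_left hxN, glue_left h2]
        exact ⟨Or.inl (Or.inl hxN), ⟨Or.inl (Or.inl h2), (hD _).2 ⟨h3, by
          linarith [hsum (E₀.Λ x)]⟩⟩, h4⟩
      have h1N : x ∈ E₁.N → x ∈ E₀.N ∪ E₁.N ∪ (E₀.M ∩ E₁.M) ∧
          glue E₀.N E₁.N E₀.Λ E₁.Λ x ∈ (E₀.T ∪ E₁.T ∪ (E₀.M ∩ E₁.M)) ∩ D ∧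
          glue E₀.T E₁.T E₀.Θ E₁.Θ (glue E₀.N E₁.N E₀.Λ E₁.Λ x) = x := fun hxN => by
        have h1 := E₁.N_lt x hxN
        rw [(hκ _).1 (by linarith [hsum (W.retr x)])] at hxκ
        obtain ⟨h2, h3, h4⟩ := E₁.maps_Λ x hxN hr.2 hxκ
        have h5 := E₁.T_lt _ h2
        rw [glue_right hN hxN, glue_right hT h2]
        exact ⟨Or.inl (Or.inr hxN), ⟨Or.inl (Or.inr h2), (hD _).2 ⟨by
          linarith [hsum (E₁.Λ x)], h3⟩⟩, h4⟩
      -- if `x` is not in `N` for one end, then it is in `M` for this end, and it suffices to have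
      -- the bound of the radius which determines the other end
      have hM : x ∈ E₀.M → x ∈ E₁.M → x ∈ E₀.N ∪ E₁.N ∪ (E₀.M ∩ E₁.M) ∧
          glue E₀.N E₁.N E₀.Λ E₁.Λ x ∈ (E₀.T ∪ E₁.T ∪ (E₀.M ∩ E₁.M)) ∩ D ∧
          glue E₀.T E₁.T E₀.Θ E₁.Θ (glue E₀.N E₁.N E₀.Λ E₁.Λ x) = x := fun h1 h2 => by
        rw [glue_mid (A₀ := E₀.Λ) (E₀.Λ_eq x h1) (E₁.Λ_eq x h2)]
        exact ⟨Or.inr ⟨h1, h2⟩, ⟨Or.inr ⟨h1, h2⟩, (hD _).2 ⟨(E₀.M_spec x h1).1.le,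
          (E₁.M_spec x h2).1.le⟩⟩, glue_mid (E₀.Θ_eq x h1) (E₁.Θ_eq x h2)⟩
      rcases hor (W.retr x) with h | h
      · have hx1 : E₁.k (W.retr x) * W.rho x < 1 := by rwa [(hκ _).1 h] at hxκ
        rcases E₁.N_cover x hx hr.2 hx1 with h2 | h2
        · exact h1N h2
        · rcases E₀.N_cover x hx hr.1 (by rw [E₀.k_eq _ h]; exact (E₁.M_spec x h2).2.2.1) with h3 | h3
          exacts [h0N h3, hM h3 h2]
      · have hx1 : E₀.k (W.retr x) * W.rho x < 1 := by rwa [(hκ _).2 h] at hxκ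
        rcases E₀.N_cover x hx hr.1 hx1 with h2 | h2
        · exact h0N h2
        · rcases E₁.N_cover x hx hr.2 (by rw [E₁.k_eq _ h]; exact (E₀.M_spec x h2).2.2.1) with h3 | h3
          exacts [h1N h3, hM h2 h3] }

end Taper
end SlabRetube

section SlabStructure

theorem dform_eq_zero_of_isLocalMin {k : ℕ} {M : Type u} [TopologicalSpace M]
    [ChartedSpace (HSpace k) M] [IsManifold (HModel k) ∞ M] {h : M → ℝ}
    (hs : ContMDiff (HModel k) 𝓘(ℝ, ℝ) ∞ h) {x : M} (hx : (HModel k).IsInteriorPoint x)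
    (hmin : IsLocalMin h x) : dform (k := k) h x = 0 := by
  have h1 : dform (k := k) h x = fderivWithin ℝ (writtenInExtChartAt (HModel k) 𝓘(ℝ, ℝ) x h)
      (range (HModel k)) (extChartAt (HModel k) x x) :=
    (hs.mdifferentiableAt (by simp)).mfderiv
  rw [h1, fderivWithin_of_mem_nhds (range_mem_nhds_isInteriorPoint hx)]
  refine IsLocalMin.fderiv_eq_zero ?_
  have h2 : ContinuousAt (extChartAt (HModel k) x).symm (extChartAt (HModel k) x x) :=
    continuousAt_extChartAt_symm x
  have h3 : ∀ᶠ z in 𝓝 ((extChartAt (HModel k) x).symm (extChartAt (HModel k) x x)), h x ≤ h z := by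
    rw [extChartAt_to_inv]; exact hmin
  filter_upwards [h2.eventually h3] with y hy
  change h ((extChartAt (HModel k) x).symm (extChartAt (HModel k) x x)) ≤ _
  rw [extChartAt_to_inv]
  exact hy

/-- The slab between two level sets is a submanifold of codimension zero, whose boundary is the
union of the level sets. The level sets are regular or consist of boundary points. -/
theorem exists_subStructure_between {k : ℕ} {M : Type u} [TopologicalSpace M]
    [ChartedSpace (HSpace k) M] [IsManifold (HModel k) ∞ M] {N : Type v} [TopologicalSpace N]
    {ι : N → M} (hι : IsEmbedding ι) {h₀ h₁ : M → ℝ} (hs₀ : ContMDiff (HModel k) 𝓘(ℝ, ℝ) ∞ h₀)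
    (hs₁ : ContMDiff (HModel k) 𝓘(ℝ, ℝ) ∞ h₁) (hr : ∀ x, x ∈ range ι ↔ 0 ≤ h₀ x ∧ 0 ≤ h₁ x)
    (hne : ∀ x, h₀ x = 0 → 0 < h₁ x) (hint : ∀ x, 0 < h₀ x → 0 < h₁ x → (HModel k).IsInteriorPoint x)
    (he₀ : ∀ x, h₀ x = 0 → ((HModel k).IsBoundaryPoint x ∧ ∀ᶠ z in 𝓝 x, 0 ≤ h₀ z) ∨
      ((HModel k).IsInteriorPoint x ∧ dform (k := k) h₀ x ≠ 0))
    (he₁ : ∀ x, h₁ x = 0 → ((HModel k).IsBoundaryPoint x ∧ ∀ᶠ z in 𝓝 x, 0 ≤ h₁ z) ∨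
      ((HModel k).IsInteriorPoint x ∧ dform (k := k) h₁ x ≠ 0)) :
    ∃ S : SubStructure k k ι, letI := S.charted
      (HModel k).boundary N = {x | h₀ (ι x) = 0 ∨ h₁ (ι x) = 0} := by
  have hp : ∀ {h : M → ℝ}, ContMDiff (HModel k) 𝓘(ℝ, ℝ) ∞ h → ∀ x, 0 < h x → ∀ᶠ z in 𝓝 x, 0 ≤ h z :=
    fun hs x hx => (hs.continuous.continuousAt.eventually_const_lt hx).mono fun z hz => le_of_lt hz
  -- a regular level set in the interior is not a neighbourhood of its points in the superlevel set
  have hnot : ∀ {h : M → ℝ}, ContMDiff (HModel k) 𝓘(ℝ, ℝ) ∞ h → ∀ x, h x = 0 →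
      (HModel k).IsInteriorPoint x → dform (k := k) h x ≠ 0 → ¬ ∀ᶠ z in 𝓝 x, 0 ≤ h z := by
    intro h hs x hx hxi hd hn
    exact hd (dform_eq_zero_of_isLocalMin hs hxi (hn.mono fun z hz => by rw [hx]; exact hz))
  have hcases : ∀ x, x ∈ range ι → (0 < h₀ x ∧ 0 < h₁ x) ∨ (h₀ x = 0 ∧ 0 < h₁ x) ∨
      (h₁ x = 0 ∧ 0 < h₀ x) := by
    intro x hx
    obtain ⟨h1, h2⟩ := (hr x).1 hx
    rcases h1.lt_or_eq with h3 | h3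
    · rcases h2.lt_or_eq with h4 | h4
      exacts [Or.inl ⟨h3, h4⟩, Or.inr (Or.inr ⟨h4.symm, h3⟩)]
    · exact Or.inr (Or.inl ⟨h3.symm, hne x h3.symm⟩)
  obtain ⟨S, hS⟩ := exists_subStructure_slab (k := k) hι (fun x => by
    rcases hcases (ι x) (mem_range_self x) with ⟨h1, h2⟩ | ⟨h1, h2⟩ | ⟨h1, h2⟩
    · exact Or.inl ⟨by filter_upwards [hp hs₀ _ h1, hp hs₁ _ h2] with z h3 h4 using (hr z).2 ⟨h3, h4⟩,
        hint _ h1 h2⟩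
    · rcases he₀ _ h1 with ⟨h3, h4⟩ | ⟨h3, h4⟩
      · exact Or.inr (Or.inl ⟨by
          filter_upwards [h4, hp hs₁ _ h2] with z h3 h4 using (hr z).2 ⟨h3, h4⟩, h3⟩)
      · exact Or.inr (Or.inr ⟨h3, h₀, hs₀, h1, h4, by
          filter_upwards [hp hs₁ _ h2] with z hz
          rw [hr]; exact and_iff_left hz⟩)
    · rcases he₁ _ h1 with ⟨h3, h4⟩ | ⟨h3, h4⟩
      · exact Or.inr (Or.inl ⟨by
          filter_upwards [h4, hp hs₀ _ h2] with z h3 h4 using (hr z).2 ⟨h4, h3⟩, h3⟩)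
      · exact Or.inr (Or.inr ⟨h3, h₁, hs₁, h1, h4, by
          filter_upwards [hp hs₀ _ h2] with z hz
          rw [hr]; exact and_iff_right hz⟩))
  refine ⟨S, hS.trans ?_⟩
  ext x
  change ¬ (_ ∧ _) ↔ _ ∨ _
  have hsub : ∀ {y}, range ι ∈ 𝓝 y → (∀ᶠ z in 𝓝 y, 0 ≤ h₀ z) ∧ ∀ᶠ z in 𝓝 y, 0 ≤ h₁ z := fun hy =>
    ⟨Filter.mem_of_superset hy fun z hz => ((hr z).1 hz).1,
      Filter.mem_of_superset hy fun z hz => ((hr z).1 hz).2⟩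
  have hdis : ∀ {y}, (HModel k).IsBoundaryPoint y → ¬ (HModel k).IsInteriorPoint (M := M) y :=
    fun hy => (HModel k).isBoundaryPoint_iff_not_isInteriorPoint _ |>.1 hy
  rcases hcases (ι x) (mem_range_self x) with ⟨h1, h2⟩ | ⟨h1, h2⟩ | ⟨h1, h2⟩
  · refine iff_of_false (not_not.2 ⟨?_, hint _ h1 h2⟩) (by rintro (h | h) <;> linarith)
    filter_upwards [hp hs₀ _ h1, hp hs₁ _ h2] with z h3 h4 using (hr z).2 ⟨h3, h4⟩
  · refine iff_of_true (fun ⟨h3, h4⟩ => ?_) (Or.inl h1)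
    rcases he₀ _ h1 with ⟨h5, -⟩ | ⟨-, h6⟩
    exacts [hdis h5 h4, hnot hs₀ _ h1 h4 h6 (hsub h3).1]
  · refine iff_of_true (fun ⟨h3, h4⟩ => ?_) (Or.inr h1)
    rcases he₁ _ h1 with ⟨h5, -⟩ | ⟨-, h6⟩
    exacts [hdis h5 h4, hnot hs₁ _ h1 h4 h6 (hsub h3).2]

end SlabStructure

/-! ### Collars of the slab -/

section LevelEnd

/-- The inclusion of a subspace with modified control data. -/
def Retube.incl [CompactSpace L] {n n' m' : ℕ} {W : FibPM l L n m X} {Z : Type w}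
    [TopologicalSpace Z] {j : Z → X} (E : Retube W (range j)) (hj : IsClosedEmbedding j)
    (Sr : SubStructure n n' (W.pullReg j)) (Ss : SubStructure m m' (W.pullSing j)) :
    StratMap (E.stratData hj Sr Ss) W♭ := ⟨j, hj.continuous, fun _ => Iff.rfl⟩

theorem Retube.isImmersion_incl [CompactSpace L] {n n' m' : ℕ} {W : FibPM l L n m X} {Z : Type w}
    [TopologicalSpace Z] {j : Z → X} {E : Retube W (range j)} {hj : IsClosedEmbedding j}
    {Sr : SubStructure n n' (W.pullReg j)} {Ss : SubStructure m m' (W.pullSing j)} :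
    (E.incl hj Sr Ss).IsImmersion :=
  ⟨Retube.smooth_pullReg (hj := hj), Retube.smooth_pullSing (hj := hj),
    fun a => (Retube.initial_pullReg (hj := hj)).injective_mfderiv Retube.smooth_pullReg a,
    fun a => (Retube.initial_pullSing (hj := hj)).injective_mfderiv Retube.smooth_pullSing a⟩

/-- A level set `h = 0`, with its structure `P`, as an end of a slab: the modified control data near
the level set, and a collar on which these are the product of those of `P` with an interval. -/
structure LevelEnd (W : FibPM l L (n + 1) m X) {S : Set X} (P : FibPM l L n (m - 1) ↥S) (h : X → ℝ)
    (κ₀ K σ : ℝ) extends Taper W h κ₀ K σ where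
  mem_iff : ∀ x, x ∈ S ↔ h x = 0
  closed : P.boundary = ∅
  end_reg : ∀ x : W.Reg, h x.1 = 0 → ((HModel (n + 1)).IsBoundaryPoint x ∧
    ∀ᶠ z : W.Reg in 𝓝 x, 0 ≤ h z.1) ∨
    ((HModel (n + 1)).IsInteriorPoint x ∧ dform (k := n + 1) (onReg W♭ h) x ≠ 0)
  end_sing : ∀ x : W.Sing, h x.1 = 0 → ((HModel m).IsBoundaryPoint x ∧
    ∀ᶠ z : W.Sing in 𝓝 x, 0 ≤ h z.1) ∨
    ((HModel m).IsInteriorPoint x ∧ dform (k := m) (onSing W♭ h) x ≠ 0)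
  e : CollarMap P♭ W♭
  e_zero : ∀ x, e.toFun (x, 0) = x.1
  continuous_e : Continuous e.toFun
  injective_e : Function.Injective e.toFun
  e_nonneg : ∀ p, 0 ≤ h (e.toFun p)
  e_lt : ∀ p, h (e.toFun p) < σ
  e_nhds : ∀ x : ↥S, ∀ᶠ z in 𝓝 x.1, 0 ≤ h z → z ∈ range e.toFun
  smooth_reg : ContMDiff ((HModel n).prod (𝓡∂ 1)) (HModel (n + 1)) ∞ e.reg
  smooth_sing : ContMDiff ((HModel (m - 1)).prod (𝓡∂ 1)) (HModel m) ∞ e.sing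
  injective_reg : ∀ q,
    Function.Injective (mfderiv ((HModel n).prod (𝓡∂ 1)) (HModel (n + 1)) e.reg q)
  injective_sing : ∀ q,
    Function.Injective (mfderiv ((HModel (m - 1)).prod (𝓡∂ 1)) (HModel m) e.sing q)
  e_notMem : ∀ p, e.toFun p ∉ M
  e_mem_T : ∀ x t, e.toFun (x, t) ∈ T ↔ x ∈ P.tube
  k_e : ∀ x t, x ∈ P.tube → k (W.retr (Θ (e.toFun (x, t)))) = κ₀
  rho_e : ∀ x t, x ∈ P.tube → W.rho (e.toFun (x, t)) = W.rho x.1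
  retr_e : ∀ x t (hx : x ∈ P.tube), W.retr (Θ (e.toFun (x, t))) = e.toFun ((P.proj ⟨x, hx⟩).1, t)
  rad_P : ∀ x (hx : x ∈ P.tube), P.rad ⟨x, hx⟩ = W.rho x.1 / (1 - κ₀ * W.rho x.1)

theorem bijective_of_injective_prod {k k' : ℕ}
    {D : 𝔼 k × 𝔼 1 →L[ℝ] 𝔼 k'}
    (hk : k + 1 = k') (hD : Function.Injective D) : Function.Bijective D := by
  refine ⟨hD, (LinearMap.injective_iff_surjective_of_finrank_eq_finrank (f := D.toLinearMap) ?_).1 hD⟩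
  rw [Module.finrank_prod, finrank_euclideanSpace, finrank_euclideanSpace, finrank_euclideanSpace,
    Fintype.card_fin, Fintype.card_fin, Fintype.card_fin, hk]

variable [CompactSpace L] {W : FibPM l L (n + 1) m X} {S : Set X} {P : FibPM l L n (m - 1) ↥S}
  {h : X → ℝ} {κ₀ K σ : ℝ}

/-- The collar of an end, as a collar of a subspace `D` of `W` on which the modified control data
near the end are those of the end. -/
theorem LevelEnd.exists_collar (E : LevelEnd W P h κ₀ K σ) {D : Set X}
    (F : Retube W (range (Subtype.val : ↥D → X))) (hj : IsClosedEmbedding (Subtype.val : ↥D → X))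
    (Sr : SubStructure (n + 1) (n + 1) (W.pullReg (Subtype.val : ↥D → X)))
    (Ss : SubStructure m m (W.pullSing (Subtype.val : ↥D → X)))
    (hD : ∀ x ∈ D, 0 ≤ h x) (he : ∀ p, E.e.toFun p ∈ D)
    (hT : ∀ p, E.e.toFun p ∈ F.T ↔ E.e.toFun p ∈ E.T)
    (hΘ : ∀ p, E.e.toFun p ∈ E.T → F.Θ (E.e.toFun p) = E.Θ (E.e.toFun p))
    (hκ : ∀ y, h y < σ → F.κ y = E.k y)
    (hb : ∀ z : ↥D, h z.1 = 0 → z ∈ (F.stratData hj Sr Ss).boundary) :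
    ∃ C : Collar P♭ (F.stratData hj Sr Ss), ∀ p, (C.toFun p).1 = E.e.toFun p := by
  have := W.hausdorff
  have := P.compact
  let eV : CollarMap P♭ (F.stratData hj Sr Ss) :=
    ⟨fun p => ⟨E.e.toFun p, he p⟩, fun a t => E.e.mem_sing a t⟩
  have hc : Continuous eV.toFun := E.continuous_e.subtype_mk he
  have hcr : Continuous eV.reg := (hc.comp ((continuous_subtype_val.comp continuous_fst).prodMk
    continuous_snd)).subtype_mk _
  have hcs : Continuous eV.sing := (hc.comp ((continuous_subtype_val.comp continuous_fst).prodMk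
    continuous_snd)).subtype_mk _
  have hsr : ContMDiff ((HModel n).prod (𝓡∂ 1)) (HModel (n + 1)) ∞ eV.reg := fun q =>
    Retube.initial_pullReg.contMDiffAt hcr.continuousAt (E.smooth_reg q)
  have hss : ContMDiff ((HModel (m - 1)).prod (𝓡∂ 1)) (HModel m) ∞ eV.sing := fun q =>
    Retube.initial_pullSing.contMDiffAt hcs.continuousAt (E.smooth_sing q)
  have hP0 : ∀ x : ↥S, h x.1 = 0 := fun x => (E.mem_iff x.1).1 x.2
  refine ⟨{ toCollarMap := eV
            closed := E.closed
            isClosedEmbedding := hc.isClosedEmbedding fun p q hpq =>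
              E.injective_e (congrArg Subtype.val hpq)
            mem_boundary := fun a => hb _ ?_
            range_mem_nhds := fun a => ?_
            smooth_reg := hsr
            smooth_sing := hss
            bijective_reg := fun q => bijective_of_injective_prod rfl ?_
            bijective_sing := fun q => bijective_of_injective_prod ?_ ?_
            mem_tube := fun a t => (hT (a, t)).trans (E.e_mem_T a t)
            proj_eq := fun a t ha => Subtype.ext ?_
            rad_eq := fun a t ha => ?_ }, fun p => rfl⟩
  · change h (E.e.toFun (a, 0)) = 0
    rw [E.e_zero, hP0]
  · have h1 : ∀ᶠ z in 𝓝 (eV.toFun (a, 0)).1, 0 ≤ h z → z ∈ range E.e.toFun := by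
      change ∀ᶠ z in 𝓝 (E.e.toFun (a, 0)), _
      rw [E.e_zero]; exact E.e_nhds a
    filter_upwards [continuous_subtype_val.continuousAt.eventually h1] with z hz
    obtain ⟨p, hp⟩ := hz (hD z.1 z.2)
    exact ⟨p, Subtype.ext hp⟩
  · have h1 := (E.injective_reg q)
    have h2 : mfderiv ((HModel n).prod (𝓡∂ 1)) (HModel (n + 1)) E.e.reg q =
        (mfderiv (HModel (n + 1)) (HModel (n + 1))
          (fun z : (F.stratData hj Sr Ss).Reg => W.pullReg Subtype.val z) (eV.reg q)).comp
        (mfderiv ((HModel n).prod (𝓡∂ 1)) (HModel (n + 1)) eV.reg q) :=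
      mfderiv_comp q (Retube.smooth_pullReg.mdifferentiableAt (by simp))
        (hsr.mdifferentiableAt (by simp))
    rw [h2] at h1
    exact Function.Injective.of_comp h1
  · have hP : P.sing.Nonempty := ⟨q.1.1, q.1.2⟩
    have hW : W.sing.Nonempty := ⟨_, (E.e.mem_sing q.1.1 q.2).2 q.1.2⟩
    have := P.dim_eq hP
    have := W.dim_eq hW
    omega
  · have h1 := (E.injective_sing q)
    have h2 : mfderiv ((HModel (m - 1)).prod (𝓡∂ 1)) (HModel m) E.e.sing q =
        (mfderiv (HModel m) (HModel m)
          (fun z : (F.stratData hj Sr Ss).Sing => W.pullSing Subtype.val z) (eV.sing q)).comp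
        (mfderiv ((HModel (m - 1)).prod (𝓡∂ 1)) (HModel m) eV.sing q) :=
      mfderiv_comp q (Retube.smooth_pullSing.mdifferentiableAt (by simp))
        (hss.mdifferentiableAt (by simp))
    rw [h2] at h1
    exact Function.Injective.of_comp h1
  · refine (Retube.proj_spec _).trans ?_
    change W.retr (F.Θ (E.e.toFun (a, t))) = _
    rw [hΘ _ ((E.e_mem_T a t).2 ha)]
    exact E.retr_e a t ha
  · refine (Retube.rad_spec _).trans ?_
    change W.rho (E.e.toFun (a, t)) / (1 - F.κ (W.retr (F.Θ (E.e.toFun (a, t)))) *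
      W.rho (E.e.toFun (a, t))) = _
    rw [hΘ _ ((E.e_mem_T a t).2 ha), E.rho_e a t ha, E.rad_P a ha, hκ, E.k_e a t ha]
    rw [E.retr_e a t ha]
    exact E.e_lt _

theorem StratData.mem_boundary_reg {k k' : ℕ} {Y : Type w} [TopologicalSpace Y] {W : StratData k k' Y}
    (x : W.Reg) : x.1 ∈ W.boundary ↔ (HModel k).IsBoundaryPoint x := by
  constructor
  · rintro (⟨y, hy, h⟩ | ⟨y, hy, h⟩)
    · rwa [Subtype.val_injective h] at hy
    · exact absurd (h ▸ y.2) x.2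
  · exact fun h => Or.inl ⟨x, h, rfl⟩

theorem StratData.mem_boundary_sing {k k' : ℕ} {Y : Type w} [TopologicalSpace Y]
    {W : StratData k k' Y} (x : W.Sing) : x.1 ∈ W.boundary ↔ (HModel k').IsBoundaryPoint x := by
  constructor
  · rintro (⟨y, hy, h⟩ | ⟨y, hy, h⟩)
    · exact absurd (h ▸ x.2) y.2
    · rwa [Subtype.val_injective h] at hy
  · exact fun h => Or.inr ⟨x, h, rfl⟩

theorem StratData.boundary_eq_empty_iff {k k' : ℕ} {Y : Type w} [TopologicalSpace Y]
    {W : StratData k k' Y} : W.boundary = ∅ ↔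
      (HModel k).boundary W.Reg = ∅ ∧ (HModel k').boundary W.Sing = ∅ := by
  rw [StratData.boundary, union_empty_iff, image_eq_empty, image_eq_empty]

theorem isEmbedding_pullReg {k k' : ℕ} {Y : Type w} [TopologicalSpace Y] (W : StratData k k' Y)
    {Z : Type v} [TopologicalSpace Z] {j : Z → Y} (hj : IsEmbedding j) : IsEmbedding (W.pullReg j) :=
  IsEmbedding.of_comp (by exact (hj.continuous.comp continuous_subtype_val).subtype_mk _)
    continuous_subtype_val (hj.comp .subtypeVal)

theorem isEmbedding_pullSing {k k' : ℕ} {Y : Type w} [TopologicalSpace Y] (W : StratData k k' Y)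
    {Z : Type v} [TopologicalSpace Z] {j : Z → Y} (hj : IsEmbedding j) :
    IsEmbedding (W.pullSing j) :=
  IsEmbedding.of_comp (by exact (hj.continuous.comp continuous_subtype_val).subtype_mk _)
    continuous_subtype_val (hj.comp .subtypeVal)

/-- The slab between two ends is a bordism between the level sets. -/
theorem exists_slab {S₀ S₁ : Set X} {P₀ : FibPM l L n (m - 1) ↥S₀} {P₁ : FibPM l L n (m - 1) ↥S₁}
    {h₀ h₁ : X → ℝ} {κ₀ κ₁ K σ δ : ℝ} (E₀ : LevelEnd W P₀ h₀ κ₀ K σ) (E₁ : LevelEnd W P₁ h₁ κ₁ K σ)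
    (hs₀ : IsSmoothFun W♭ h₀) (hs₁ : IsSmoothFun W♭ h₁)
    (hκ₀ : 0 < κ₀) (hκ₁ : 0 < κ₁) (hsum : ∀ x, h₀ x + h₁ x = δ) (hδ : 0 < δ) (hσ : 2 * σ ≤ δ)
    {D : Set X} (hD : ∀ x, x ∈ D ↔ 0 ≤ h₀ x ∧ 0 ≤ h₁ x)
    (hint : ∀ x ∈ W.boundary, 0 < h₀ x → 0 < h₁ x → False) :
    ∃ (V : FibPM l L (n + 1) m ↥D) (i : StratMap V♭ W♭)
      (C : Cobordism P₀♭ P₁♭ V♭),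
      IsStratSubmanifold W♭ V♭ i ∧
      (∀ x, (C.c₀.toFun (x, 0)).1 = x.1) ∧ (∀ x, (C.c₁.toFun (x, 0)).1 = x.1) := by
  have hDc : IsClosed D := by
    have : D = {x | 0 ≤ h₀ x} ∩ {x | 0 ≤ h₁ x} := Set.ext hD
    rw [this]
    exact (isClosed_le continuous_const hs₀.continuous).inter
      (isClosed_le continuous_const hs₁.continuous)
  have hj : IsClosedEmbedding (Subtype.val : ↥D → X) := hDc.isClosedEmbedding_subtypeVal
  have hD' : ∀ x, x ∈ range (Subtype.val : ↥D → X) ↔ 0 ≤ h₀ x ∧ 0 ≤ h₁ x := fun x => by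
    rw [Subtype.range_val, hD]
  have hne : ∀ x, h₀ x = 0 → 0 < h₁ x := fun x h => by linarith [hsum x]
  obtain ⟨Sr, hSr⟩ := exists_subStructure_between (isEmbedding_pullReg W♭ hj.isEmbedding)
    hs₀.smooth_reg hs₁.smooth_reg (fun x => by
      refine Iff.trans ?_ (hD x.1)
      exact ⟨by rintro ⟨z, rfl⟩; exact z.1.2, fun h => ⟨⟨⟨x.1, h⟩, x.2⟩, rfl⟩⟩)
    (fun x => hne x.1) (fun x h h' => (HModel (n + 1)).isInteriorPoint_iff_not_isBoundaryPoint x |>.2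
      fun hx => hint x.1 ((mem_boundary_reg x).2 hx) h h') E₀.end_reg E₁.end_reg
  obtain ⟨Ss, hSs⟩ := exists_subStructure_between (isEmbedding_pullSing W♭ hj.isEmbedding)
    hs₀.smooth_sing hs₁.smooth_sing (fun x => by
      refine Iff.trans ?_ (hD x.1)
      exact ⟨by rintro ⟨z, rfl⟩; exact z.1.2, fun h => ⟨⟨⟨x.1, h⟩, x.2⟩, rfl⟩⟩)
    (fun x => hne x.1) (fun x h h' => (HModel m).isInteriorPoint_iff_not_isBoundaryPoint x |>.2
      fun hx => hint x.1 ((mem_boundary_sing x).2 hx) h h') E₀.end_sing E₁.end_sing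
  let F : Retube W (range (Subtype.val : ↥D → X)) :=
    Taper.slabRetube E₀.toTaper E₁.toTaper hκ₀ hκ₁ hsum hσ hD'
  have hdim : ((Subtype.val : ↥D → X) ⁻¹' W.sing).Nonempty → m + l + 1 = n + 1 ∧ m + 2 ≤ n + 1 :=
    fun ⟨z, hz⟩ => ⟨W.dim_eq ⟨z.1, hz⟩, W.codim ⟨z.1, hz⟩⟩
  have hbd : (F.stratData hj Sr Ss).boundary = {z | h₀ z.1 = 0 ∨ h₁ z.1 = 0} := by
    ext z
    by_cases hz : z.1 ∈ W.sing
    · refine (mem_boundary_sing (W := F.stratData hj Sr Ss) ⟨z, hz⟩).trans ?_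
      exact Set.ext_iff.1 hSs ⟨z, hz⟩
    · refine (mem_boundary_reg (W := F.stratData hj Sr Ss) ⟨z, hz⟩).trans ?_
      exact Set.ext_iff.1 hSr ⟨z, hz⟩
  have hT := Taper.disjoint_T E₀.toTaper E₁.toTaper hsum hσ
  have hT₀ : ∀ p, E₀.e.toFun p ∉ E₁.T := fun p hp => by
    linarith [E₁.T_lt _ hp, E₀.e_lt p, hsum (E₀.e.toFun p)]
  have hT₁ : ∀ p, E₁.e.toFun p ∉ E₀.T := fun p hp => by
    linarith [E₀.T_lt _ hp, E₁.e_lt p, hsum (E₁.e.toFun p)]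
  obtain ⟨C₀, hC₀⟩ := E₀.exists_collar F hj Sr Ss (fun x hx => ((hD x).1 hx).1)
    (fun p => (hD _).2 ⟨E₀.e_nonneg p, by linarith [E₀.e_lt p, hsum (E₀.e.toFun p)]⟩)
    (fun p => ⟨by
      rintro ((hp | hp) | hp)
      exacts [hp, absurd hp (hT₀ p), absurd hp.1 (E₀.e_notMem p)], fun hp => Or.inl (Or.inl hp)⟩)
    (fun p hp => glue_left hp) (fun y hy => by
      change E₀.k y + E₁.k y - K = _
      rw [E₁.k_eq y (by linarith [hsum y])]; ring)
    (fun z hz => by rw [hbd]; exact Or.inl hz)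
  obtain ⟨C₁, hC₁⟩ := E₁.exists_collar F hj Sr Ss (fun x hx => ((hD x).1 hx).2)
    (fun p => (hD _).2 ⟨by linarith [E₁.e_lt p, hsum (E₁.e.toFun p)], E₁.e_nonneg p⟩)
    (fun p => ⟨by
      rintro ((hp | hp) | hp)
      exacts [absurd hp (hT₁ p), hp, absurd hp.2 (E₁.e_notMem p)], fun hp => Or.inl (Or.inr hp)⟩)
    (fun p hp => glue_right hT hp) (fun y hy => by
      change E₀.k y + E₁.k y - K = _
      rw [E₀.k_eq y (by linarith [hsum y])]; ring)
    (fun z hz => by rw [hbd]; exact Or.inr hz)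
  have hC₀0 : ∀ x, (C₀.toFun (x, 0)).1 = x.1 := fun x => (hC₀ _).trans (E₀.e_zero x)
  have hC₁0 : ∀ x, (C₁.toFun (x, 0)).1 = x.1 := fun x => (hC₁ _).trans (E₁.e_zero x)
  refine ⟨F.fibPM hj Sr Ss hdim, F.incl hj Sr Ss,
    ⟨C₀, C₁, ?_, ?_⟩, ⟨rfl, ?_⟩, hC₀0, hC₁0⟩
  · rw [Set.disjoint_left]
    rintro _ ⟨p, rfl⟩ ⟨q, hq⟩
    have h1 := congrArg Subtype.val hq
    rw [hC₀, hC₁] at h1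
    have h2 := E₁.e_lt q
    rw [h1] at h2
    linarith [E₀.e_lt p, hsum (E₀.e.toFun p)]
  · refine hbd.trans ?_
    ext z
    constructor
    · rintro (hz | hz)
      · exact Or.inl ⟨⟨z.1, (E₀.mem_iff _).2 hz⟩, Subtype.ext (hC₀0 _)⟩
      · exact Or.inr ⟨⟨z.1, (E₁.mem_iff _).2 hz⟩, Subtype.ext (hC₁0 _)⟩
    · rintro (⟨x, rfl⟩ | ⟨x, rfl⟩)
      · exact Or.inl (by rw [hC₀0]; exact (E₀.mem_iff _).1 x.2)
      · exact Or.inr (by rw [hC₁0]; exact (E₁.mem_iff _).1 x.2)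
  · exact Retube.isImmersion_incl

end LevelEnd

/-! ### Interior ends -/

section CollarDeriv

theorem injective_mfderiv_Icc (t : unitInterval) :
    Function.Injective (mfderiv (𝓡∂ 1) 𝓘(ℝ, ℝ) (Subtype.val : unitInterval → ℝ) t) := by
  have h1 : MDifferentiableAt (𝓡∂ 1) 𝓘(ℝ, ℝ) (Subtype.val : unitInterval → ℝ) t :=
    (contMDiff_subtypeVal_Icc (n := 1)).mdifferentiableAt (by simp)
  have h2 : MDifferentiableWithinAt 𝓘(ℝ, ℝ) (𝓡∂ 1) (projIcc (0 : ℝ) 1 zero_le_one) (Icc 0 1) t.1 :=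
    (contMDiffOn_projIcc (n := 1) t.1 t.2).mdifferentiableWithinAt (by simp)
  have h3 := h2.hasMFDerivWithinAt.comp t h1.hasMFDerivAt.hasMFDerivWithinAt
    (s := univ) (fun s _ => s.2)
  rw [hasMFDerivWithinAt_univ] at h3
  have h4 : projIcc (0 : ℝ) 1 zero_le_one ∘ (Subtype.val : unitInterval → ℝ) = id :=
    funext fun s => projIcc_val zero_le_one s
  rw [h4] at h3
  have h5 := hasMFDerivAt_unique h3 (hasMFDerivAt_id t)
  refine Function.Injective.of_comp (f := mfderivWithin 𝓘(ℝ, ℝ) (𝓡∂ 1)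
    (projIcc (0 : ℝ) 1 zero_le_one) (Icc 0 1) t.1) ?_
  intro v v' hv
  have h6 : ∀ w, mfderivWithin 𝓘(ℝ, ℝ) (𝓡∂ 1) (projIcc (0 : ℝ) 1 zero_le_one) (Icc 0 1) t.1
      (mfderiv (𝓡∂ 1) 𝓘(ℝ, ℝ) (Subtype.val : unitInterval → ℝ) t w) = w := fun w =>
    congrArg (fun D : TangentSpace (𝓡∂ 1) t →L[ℝ] TangentSpace (𝓡∂ 1) t => D w) h5
  exact (h6 v).symm.trans (hv.trans (h6 v'))

theorem dtI_injective (t : unitInterval) {s : 𝔼 1} (hs : dtI t s = 0) :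
    s = 0 := by
  refine injective_mfderiv_Icc t (hs.trans ?_)
  exact (map_zero (mfderiv (𝓡∂ 1) 𝓘(ℝ, ℝ) (Subtype.val : unitInterval → ℝ) t)).symm

/-- The differential of a collar is injective if the time and the initial point are smooth functions
of the point of the collar. -/
theorem injective_mfderiv_collar {k k' : ℕ} {M : Type u} [TopologicalSpace M]
    [ChartedSpace (HSpace k) M] {N : Type v} [TopologicalSpace N]
    [ChartedSpace (HSpace k') N] {e : N × unitInterval → M}
    {ι : N → M} {τ : M → ℝ} {p : M → M} {a : ℝ} (ha : a ≠ 0) {q : N × unitInterval}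
    (he : ContMDiffAt ((HModel k').prod (𝓡∂ 1)) (HModel k) ∞ e q)
    (hτ : ContMDiffAt (HModel k) 𝓘(ℝ, ℝ) ∞ τ (e q))
    (hp : ContMDiffAt (HModel k) (HModel k) ∞ p (e q)) (h1 : ∀ q, τ (e q) = a * q.2.1)
    (h2 : ∀ q, p (e q) = ι q.1) (hι : ContMDiff (HModel k') (HModel k) ∞ ι)
    (hinj : Function.Injective (mfderiv (HModel k') (HModel k) ι q.1)) :
    Function.Injective (mfderiv ((HModel k').prod (𝓡∂ 1)) (HModel k) e q) := by
  have he' := (he.mdifferentiableAt (by simp)).hasMFDerivAt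
  have hτ' := ((hτ.mdifferentiableAt (by simp)).hasMFDerivAt.comp q he')
  have hp' := ((hp.mdifferentiableAt (by simp)).hasMFDerivAt.comp q he')
  have e1 : τ ∘ e = (fun x : ℝ => a * x) ∘ (Subtype.val : unitInterval → ℝ) ∘ Prod.snd := funext h1
  have e2 : p ∘ e = ι ∘ Prod.fst := funext h2
  have hv := ((contMDiff_subtypeVal_Icc (n := 1) (x := (0 : ℝ)) (y := 1)).mdifferentiableAt
    (by simp) (x := q.2)).hasMFDerivAt
  have hma : HasMFDerivAt 𝓘(ℝ, ℝ) 𝓘(ℝ, ℝ) (fun x : ℝ => a * x) q.2.1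
      (a • ContinuousLinearMap.id ℝ ℝ) :=
    ((hasFDerivAt_id (q.2.1 : ℝ)).const_mul a).hasMFDerivAt
  have hsnd := (hasMFDerivAt_snd (I := HModel k') (I' := 𝓡∂ 1) q)
  have h3 := hma.comp q (hv.comp q hsnd)
  have h4 := (hι.mdifferentiableAt (by simp) (x := q.1)).hasMFDerivAt.comp q
    (hasMFDerivAt_fst (I := HModel k') (I' := 𝓡∂ 1) q)
  rw [e1] at hτ'
  rw [e2] at hp'
  have h5 := hasMFDerivAt_unique hτ' h3
  have h6 := hasMFDerivAt_unique hp' h4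
  rw [injective_iff_map_eq_zero]
  rintro ⟨v, s⟩ hvs
  have h7 : (0 : ℝ) = a * dtI q.2 s := by
    refine Eq.trans ?_ (congrArg (fun D : 𝔼 k' × 𝔼 1 →L[ℝ] ℝ
      => D (v, s)) h5)
    change (0 : ℝ) = mfderiv (HModel k) 𝓘(ℝ, ℝ) τ (e q) (mfderiv ((HModel k').prod (𝓡∂ 1)) (HModel k) e q (v, s))
    rw [hvs]
    exact (map_zero (mfderiv (HModel k) 𝓘(ℝ, ℝ) τ (e q))).symm
  have h8 : mfderiv (HModel k') (HModel k) ι q.1 v = 0 := by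
    refine Eq.trans (congrArg (fun D : 𝔼 k' × 𝔼 1 →L[ℝ]
      𝔼 k => D (v, s)) h6).symm ?_
    change mfderiv (HModel k) (HModel k) p (e q) (mfderiv ((HModel k').prod (𝓡∂ 1)) (HModel k) e q (v, s)) = _
    rw [hvs]
    exact map_zero (mfderiv (HModel k) (HModel k) p (e q))
  have h9 : s = 0 := dtI_injective q.2 ((mul_eq_zero.1 h7.symm).resolve_left ha)
  have h10 : v = 0 := hinj (h8.trans (map_zero _).symm)
  rw [h9, h10]; rfl

theorem contMDiff_mul_snd {E' H N : Type*} [NormedAddCommGroup E'] [NormedSpace ℝ E']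
    [TopologicalSpace H] [TopologicalSpace N] [ChartedSpace H N] {I : ModelWithCorners ℝ E' H}
    (τ : ℝ) : ContMDiff (I.prod (𝓡∂ 1)) 𝓘(ℝ, ℝ) ∞ (fun p : N × unitInterval => τ * p.2.1) :=
  contMDiff_const.mul (contMDiff_subtypeVal_Icc.comp contMDiff_snd)

end CollarDeriv

section InteriorEnd

variable [CompactSpace L]
  {W : FibPM l L (n + 1) m X} {h : X → ℝ}

namespace LevelFlow

variable {𝓕 : LevelFlow W h} {κ₀ : ℝ}

theorem contMDiffAt_flow_neg_time_reg (hh : IsSmoothFun W♭ h) {x : W.Reg}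
    (hx : x.1 ∈ 𝓕.dom) : ContMDiffAt (HModel (n + 1)) (HModel (n + 1)) ∞
      (fun z : W.Reg => W.onRegular (𝓕.mem_sing (-𝓕.time z.1)) z) x :=
  𝓕.smooth_reg.contMDiffAt.comp x (((𝓕.contMDiffAt_time_reg hh hx).neg).prodMk contMDiffAt_id)

theorem contMDiffAt_flow_neg_time_sing (hh : IsSmoothFun W♭ h) {x : W.Sing}
    (hx : x.1 ∈ 𝓕.dom) : ContMDiffAt (HModel m) (HModel m) ∞
      (fun z : W.Sing => W.onSingular (𝓕.mem_sing (-𝓕.time z.1)) z) x :=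
  𝓕.smooth_sing.contMDiffAt.comp x (((𝓕.contMDiffAt_time_sing hh hx).neg).prodMk contMDiffAt_id)

/-- A regular level set in the interior is an end of the slabs on both sides: the collar is given
by the flow. The control data of the level set may have been defined with another flow. -/
theorem exists_levelEnd (𝓕 : LevelFlow W h) (hh : IsSmoothFun W♭ h)
    (hκ : 𝓕.IsTubeBound κ₀) {S : Set X} (hS : ∀ x, x ∈ S ↔ h x = 0)
    (R : Retube W (range (Subtype.val : ↥S → X))) (hj : IsClosedEmbedding (Subtype.val : ↥S → X))
    (Sr : SubStructure (n + 1) n (W.pullReg (Subtype.val : ↥S → X)))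
    (Ss : SubStructure m (m - 1) (W.pullSing (Subtype.val : ↥S → X)))
    (hdim : ((Subtype.val : ↥S → X) ⁻¹' W.sing).Nonempty → m - 1 + l + 1 = n ∧ m - 1 + 2 ≤ n)
    (hcl : (R.fibPM hj Sr Ss hdim).boundary = ∅) (hRκ : ∀ y, R.κ y = κ₀)
    (hRT : ∀ x, x ∈ R.T ↔ x ∈ 𝓕.tubeDom κ₀)
    (hRΘ : ∀ x ∈ R.T, R.Θ x = 𝓕.straighten (fun _ s => s) x)
    (hdr : ∀ x : W.Reg, h x.1 = 0 → dform (k := n + 1) (onReg W♭ h) x ≠ 0)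
    (hds : ∀ x : W.Sing, h x.1 = 0 → dform (k := m) (onSing W♭ h) x ≠ 0)
    {σ : ℝ} (hσ : 0 < σ) :
    ∃ K₀, ∀ K, K₀ ≤ K → Nonempty (LevelEnd W (R.fibPM hj Sr Ss hdim) h κ₀ K σ) := by
  obtain ⟨T⟩ := nonempty_taperScales (𝓕 := 𝓕) hh.continuous κ₀ hσ
  refine ⟨T.K₀, fun K hK => ?_⟩
  obtain ⟨tc⟩ := TimeChange.nonempty T.η_pos
  obtain ⟨η', hη', hs'⟩ := 𝓕.exists_abs_lt hh.continuous T.s_pos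
  obtain ⟨τ, hτ, hτη, hτη'⟩ : ∃ τ > 0, τ ≤ T.η ∧ τ < η' :=
    ⟨min T.η (η' / 2), lt_min T.η_pos (by positivity), min_le_left _ _, by
      linarith [min_le_right T.η (η' / 2)]⟩
  have hP0 : ∀ x : ↥S, h x.1 = 0 := fun x => (hS x.1).1 x.2
  have hdom : ∀ x : ↥S, x.1 ∈ 𝓕.dom := fun x => 𝓕.mem_dom_of_zero (hP0 x)
  have htime : ∀ (x : ↥S) t, 𝓕.time (𝓕.Φ t x.1) = t := fun x t => by
    rw [𝓕.time_flow hh.continuous (hdom x), 𝓕.time_of_zero hh.continuous (hP0 x), zero_add]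
  have hτt : ∀ t : unitInterval, 0 ≤ τ * t.1 ∧ τ * t.1 ≤ τ := fun t =>
    ⟨mul_nonneg hτ.le t.2.1, mul_le_of_le_one_right hτ.le t.2.2⟩
  have hlt : ∀ (x : X), x ∈ 𝓕.dom → ∀ t : unitInterval, 𝓕.time x = τ * t → |h x| < T.s :=
    fun x hx t ht => hs' x hx (by
      rw [ht, _root_.abs_of_nonneg (hτt t).1]; linarith [(hτt t).2])
  let e : CollarMap (R.fibPM hj Sr Ss hdim)♭ W♭ :=
    ⟨fun p => 𝓕.Φ (τ * p.2.1) p.1.1, fun a t => 𝓕.mem_sing _ _⟩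
  have hedom : ∀ p, e.toFun p ∈ 𝓕.dom := fun p => (𝓕.flow_mem_dom _).2 (hdom p.1)
  have hetime : ∀ p, 𝓕.time (e.toFun p) = τ * p.2.1 := fun p => htime p.1 _
  have hback : ∀ p, 𝓕.Φ (-𝓕.time (e.toFun p)) (e.toFun p) = p.1.1 := fun p => by
    rw [hetime]; exact 𝓕.flow_neg_flow _ _
  have hetube : ∀ p, e.toFun p ∈ 𝓕.tubeDom κ₀ ↔ p.1.1 ∈ 𝓕.tubeDom κ₀ := fun p =>
    ⟨fun hp => mem_tubeDom_of_flow hκ hp, fun hp => flow_mem_tubeDom hκ hp _⟩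
  -- on the collar, the time change is trivial
  have hΘt : ∀ p, e.toFun p ∈ 𝓕.tubeDom κ₀ →
      𝓕.time (W.retr (𝓕.straighten tc.ψ (e.toFun p))) = τ * p.2.1 := fun p hp => by
    rw [time_retr_straighten hh.continuous hκ hp, hetime, tc.eq_self]
    linarith [(hτt p.2).2, T.η_pos]
  have hΘ' : ∀ p, e.toFun p ∈ 𝓕.tubeDom κ₀ → 𝓕.straighten tc.ψ (e.toFun p) ∈ 𝓕.tubeDom κ₀ :=
    fun p hp => flow_mem_tubeDom hκ hp _
  have hk : ∀ p, e.toFun p ∈ 𝓕.tubeDom κ₀ →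
      stepFun κ₀ K T.s (h (W.retr (𝓕.straighten tc.ψ (e.toFun p)))) = κ₀ := fun p hp =>
    stepFun_of_le T.s_pos ((le_abs_self _).trans (hlt _ (retr_mem_dom hκ (hΘ' p hp)) p.2
      (hΘt p hp)).le)
  have hval : Continuous fun p : ↥S × unitInterval => τ * p.2.1 :=
    continuous_const.mul (continuous_subtype_val.comp continuous_snd)
  have hsr : ContMDiff ((HModel n).prod (𝓡∂ 1)) (HModel (n + 1)) ∞ e.reg :=
    𝓕.smooth_reg.comp ((contMDiff_mul_snd τ).prodMk ((Retube.smooth_pullReg (hj := hj)).comp contMDiff_fst))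
  have hss : ContMDiff ((HModel (m - 1)).prod (𝓡∂ 1)) (HModel m) ∞ e.sing :=
    𝓕.smooth_sing.comp ((contMDiff_mul_snd τ).prodMk ((Retube.smooth_pullSing (hj := hj)).comp contMDiff_fst))
  have htube : ∀ x : ↥S, x ∈ (R.fibPM hj Sr Ss hdim).tube ↔ x.1 ∈ 𝓕.tubeDom κ₀ := fun x => hRT x.1
  exact ⟨
  { toTaper := 𝓕.taper hh hκ T tc hK
    mem_iff := hS
    closed := hcl
    end_reg := fun x hx => Or.inr ⟨𝓕.interior_reg x 0 (by rw [𝓕.zero]; exact hx), hdr x hx⟩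
    end_sing := fun x hx => Or.inr ⟨𝓕.interior_sing x 0 (by rw [𝓕.zero]; exact hx), hds x hx⟩
    e := e
    e_zero := fun x => by
      change 𝓕.Φ (τ * 0) x.1 = x.1
      rw [mul_zero, 𝓕.zero]
    continuous_e := 𝓕.continuous.comp (hval.prodMk (continuous_subtype_val.comp continuous_fst))
    injective_e := fun p q hpq => by
      have h1 : τ * p.2.1 = τ * q.2.1 := by rw [← hetime, ← hetime, hpq]
      have h2 : p.1.1 = q.1.1 := by rw [← hback, ← hback, hpq]
      exact Prod.ext (Subtype.ext h2) (Subtype.ext (mul_left_cancel₀ hτ.ne' h1))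
    e_nonneg := fun p => by
      rw [← 𝓕.time_nonneg_iff hh.continuous (hedom p), hetime]; exact (hτt p.2).1
    e_lt := fun p => by
      have := hlt _ (hedom p) p.2 (hetime p)
      linarith [le_abs_self (h (e.toFun p)), T.s_le, T.s_pos]
    e_nhds := fun x => by
      obtain ⟨r, hr, h1⟩ := 𝓕.exists_time_lt hh.continuous hτ
      have h2 : ∀ᶠ z in 𝓝 x.1, |h z| < r :=
        (continuous_abs.comp hh.continuous).continuousAt.eventually_lt_const (by
          change |h x.1| < r
          rw [hP0, abs_zero]; exact hr)
      filter_upwards [h2] with z hz hz0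
      obtain ⟨h3, h4⟩ := h1 z hz
      have h5 := (𝓕.time_nonneg_iff hh.continuous h3).2 hz0
      rw [_root_.abs_of_nonneg h5] at h4
      refine ⟨(⟨_, (hS _).2 (𝓕.apply_neg_time h3)⟩, ⟨𝓕.time z / τ, by positivity,
        (div_le_one hτ).2 h4.le⟩), ?_⟩
      change 𝓕.Φ (τ * (𝓕.time z / τ)) (𝓕.Φ (-𝓕.time z) z) = z
      rw [mul_div_cancel₀ _ hτ.ne', ← 𝓕.add, add_neg_cancel, 𝓕.zero]
    smooth_reg := hsr
    smooth_sing := hss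
    injective_reg := fun q => injective_mfderiv_collar
      (ι := fun z : (R.fibPM hj Sr Ss hdim).Reg => W.pullReg Subtype.val z) hτ.ne' (hsr q)
      (𝓕.contMDiffAt_time_reg hh (hedom _)) (contMDiffAt_flow_neg_time_reg hh (hedom _))
      (fun q => hetime _) (fun q => Subtype.ext (hback _)) (Retube.smooth_pullReg (hj := hj))
      ((Retube.initial_pullReg (hj := hj)).injective_mfderiv Retube.smooth_pullReg q.1)
    injective_sing := fun q => injective_mfderiv_collar
      (ι := fun z : (R.fibPM hj Sr Ss hdim).Sing => W.pullSing Subtype.val z) hτ.ne' (hss q)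
      (𝓕.contMDiffAt_time_sing hh (hedom _)) (contMDiffAt_flow_neg_time_sing hh (hedom _))
      (fun q => hetime _) (fun q => Subtype.ext (hback _)) (Retube.smooth_pullSing (hj := hj))
      ((Retube.initial_pullSing (hj := hj)).injective_mfderiv Retube.smooth_pullSing q.1)
    e_notMem := fun p hp => by
      have h1 : ¬ (e.toFun p ∈ 𝓕.dom ∧ |𝓕.time (e.toFun p)| ≤ 9 / 2 * T.η) := hp.2.2
      refine h1 ⟨hedom p, ?_⟩
      rw [hetime, _root_.abs_of_nonneg (hτt p.2).1]
      linarith [(hτt p.2).2, T.η_pos]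
    e_mem_T := fun x t => by
      rw [htube, ← hetube (x, t)]
      refine ⟨fun hx => hx.1, fun hx => ⟨hx, ⟨hΘ' _ hx, ?_⟩, (hΘ' _ hx).1, ?_⟩⟩
      · change 𝓕.time (W.retr (𝓕.straighten tc.ψ (e.toFun (x, t)))) < _
        rw [hΘt _ hx]
        linarith [(hτt t).2, T.η_pos]
      · rw [hk _ hx]; exact (hΘ' _ hx).2.1
    k_e := fun x t hx => hk (x, t) ((hetube (x, t)).2 ((htube x).1 hx))
    rho_e := fun x t hx => rho_flow hκ ((htube x).1 hx) _
    retr_e := fun x t hx => by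
      have h1 := (htube x).1 hx
      have h2 := (hetube (x, t)).2 h1
      have h3 : ((R.fibPM hj Sr Ss hdim).proj ⟨x, hx⟩).1.1 = W.retr (R.Θ x.1) :=
        Retube.proj_spec (hj := hj) (Sr := Sr) (Ss := Ss) hx
      change W.retr (𝓕.straighten tc.ψ (e.toFun (x, t))) =
        𝓕.Φ (τ * t.1) ((R.fibPM hj Sr Ss hdim).proj ⟨x, hx⟩).1.1
      rw [h3, hRΘ _ hx, straighten, straighten, 𝓕.time_of_zero hh.continuous (hP0 x),
        retr_flow hκ h2, hetime, tc.eq_self _ _ (by linarith [(hτt t).2, T.η_pos])]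
      have h4 : W.retr (e.toFun (x, t)) = 𝓕.Φ (τ * t.1) (W.retr x.1) := retr_flow hκ h1 _
      rw [h4, 𝓕.time_flow hh.continuous (retr_mem_dom hκ h1), retr_flow hκ h1, ← 𝓕.add, ← 𝓕.add]
      congr 1
      change τ * t.1 - _ + _ = _
      ring
    rad_P := fun x hx => by
      refine (Retube.rad_spec (hj := hj) (Sr := Sr) (Ss := Ss) hx).trans ?_
      rw [hRκ] }⟩

end LevelFlow
end InteriorEnd

/-! ### Boundary ends -/

section BoundaryEnd

/-- The level set `h = 0`, with the structure `P`, is an end of the slabs `0 ≤ h ≤ δ`. -/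
def IsLevelEnd (W : FibPM l L (n + 1) m X) {S : Set X} (P : FibPM l L n (m - 1) ↥S) (h : X → ℝ) :
    Prop :=
  ∃ κ₀ > 0, ∀ σ > 0, ∃ K₀, ∀ K, K₀ ≤ K → Nonempty (LevelEnd W P h κ₀ K σ)

/-- Multiplication by `τ ≤ 1` on the unit interval. -/
def scaleI (τ : unitInterval) (t : unitInterval) : unitInterval := τ * t

theorem contMDiff_scaleI (τ : unitInterval) : ContMDiff (𝓡∂ 1) (𝓡∂ 1) ∞ (scaleI τ) := by
  have h1 : ContMDiff (𝓡∂ 1) 𝓘(ℝ, ℝ) ∞ (fun t : unitInterval => τ.1 * t.1) :=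
    contMDiff_const.mul contMDiff_subtypeVal_Icc
  have h2 := (contMDiffOn_projIcc (n := ∞) (x := (0 : ℝ)) (y := 1)).comp_contMDiff h1
    (fun t => (scaleI τ t).2)
  refine h2.congr fun t => ?_
  exact (projIcc_val zero_le_one (scaleI τ t)).symm

theorem injective_mfderiv_scaleI {τ : unitInterval} (hτ : 0 < τ.1) (t : unitInterval) :
    Function.Injective (mfderiv (𝓡∂ 1) (𝓡∂ 1) (scaleI τ) t) := by
  have hv : ∀ t : unitInterval, HasMFDerivAt (𝓡∂ 1) 𝓘(ℝ, ℝ) (Subtype.val : unitInterval → ℝ) t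
      (mfderiv (𝓡∂ 1) 𝓘(ℝ, ℝ) (Subtype.val : unitInterval → ℝ) t) := fun t =>
    ((contMDiff_subtypeVal_Icc (n := 1) (x := (0 : ℝ)) (y := 1)).mdifferentiableAt
      (by simp) (x := t)).hasMFDerivAt
  have h1 := (hv (scaleI τ t)).comp t
    ((contMDiff_scaleI τ).mdifferentiableAt (by simp) (x := t)).hasMFDerivAt
  have hma : HasMFDerivAt 𝓘(ℝ, ℝ) 𝓘(ℝ, ℝ) (fun x : ℝ => τ.1 * x) t.1
      (τ.1 • ContinuousLinearMap.id ℝ ℝ) :=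
    ((hasFDerivAt_id (t.1 : ℝ)).const_mul τ.1).hasMFDerivAt
  have h2 := hasMFDerivAt_unique h1 (hma.comp t (hv t))
  rw [injective_iff_map_eq_zero]
  intro s hs
  have h3 : (0 : ℝ) = τ.1 * dtI t s := by
    refine Eq.trans ?_ (congrArg (fun D : 𝔼 1 →L[ℝ] ℝ => D s) h2)
    change (0 : ℝ) = mfderiv (𝓡∂ 1) 𝓘(ℝ, ℝ) (Subtype.val : unitInterval → ℝ) (scaleI τ t)
      (mfderiv (𝓡∂ 1) (𝓡∂ 1) (scaleI τ) t s)
    rw [hs]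
    exact (map_zero (mfderiv (𝓡∂ 1) 𝓘(ℝ, ℝ) (Subtype.val : unitInterval → ℝ) (scaleI τ t))).symm
  exact dtI_injective t ((mul_eq_zero.1 h3.symm).resolve_left hτ.ne')

theorem injective_mfderiv_prodMap_scaleI {k k' : ℕ} {M : Type u} [TopologicalSpace M]
    [ChartedSpace (HSpace k) M] {N : Type v} [TopologicalSpace N] [ChartedSpace (HSpace k') N]
    {Q : Type w} [TopologicalSpace Q] [ChartedSpace (HSpace k') Q]
    {e : N × unitInterval → M} (he : ContMDiff ((HModel k').prod (𝓡∂ 1)) (HModel k) ∞ e)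
    (hinj : ∀ q, Function.Injective (mfderiv ((HModel k').prod (𝓡∂ 1)) (HModel k) e q))
    {ι : Q → N} (hι : ContMDiff (HModel k') (HModel k') ∞ ι)
    (hιinj : ∀ q, Function.Injective (mfderiv (HModel k') (HModel k') ι q))
    {τ : unitInterval} (hτ : 0 < τ.1) (q : Q × unitInterval) :
    Function.Injective (mfderiv ((HModel k').prod (𝓡∂ 1)) (HModel k)
      (fun q : Q × unitInterval => e (ι q.1, scaleI τ q.2)) q) := by
  have h1 := (hι.mdifferentiableAt (by simp) (x := q.1)).hasMFDerivAt.comp q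
    (hasMFDerivAt_fst (I := HModel k') (I' := 𝓡∂ 1) q)
  have h2 := ((contMDiff_scaleI τ).mdifferentiableAt (by simp) (x := q.2)).hasMFDerivAt.comp q
    (hasMFDerivAt_snd (I := HModel k') (I' := 𝓡∂ 1) q)
  have h3 := (he.mdifferentiableAt (by simp) (x := (ι q.1, scaleI τ q.2))).hasMFDerivAt.comp q
    (HasMFDerivAt.prodMk h1 h2)
  have h4 : mfderiv ((HModel k').prod (𝓡∂ 1)) (HModel k)
      (fun q : Q × unitInterval => e (ι q.1, scaleI τ q.2)) q = _ := h3.mfderiv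
  rw [h4]
  refine (hinj (ι q.1, scaleI τ q.2)).comp ?_
  rintro ⟨v, s⟩ ⟨v', s'⟩ h
  exact Prod.ext (hιinj q.1 (congrArg Prod.fst h))
    (injective_mfderiv_scaleI hτ q.2 (congrArg Prod.snd h))

variable [CompactSpace L] {W : FibPM l L (n + 1) m X} {h : X → ℝ} {A : Type w} [TopologicalSpace A]
  {X₁ : FibPM l L n (m - 1) A}

/-- The control data on a space which is identified with `X₁`, with a smaller tube. -/
def shrinkRetube (X₁ : FibPM l L n m A) {κ₀ : ℝ} (hκ : 0 < κ₀) {R : Set A} (hR : R = univ) :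
    Retube X₁ R where
  κ _ := κ₀
  κ_nonneg _ := hκ.le
  smooth_κ := contMDiff_const
  T := {x | x ∈ X₁.tube ∧ κ₀ * X₁.rho x < 1}
  N := {x | x ∈ X₁.tube ∧ κ₀ * X₁.rho x < 1}
  isOpen_T := isOpen_mul_rho_lt X₁ hκ
  Θ := id
  Λ := id
  continuousOn_Θ := continuousOn_id
  continuousOn_Λ := continuousOn_id
  smooth_Θ x _ := smoothRegAt_id x
  smooth_Λ x _ := smoothRegAt_id x
  mem_tube x hx := hx.1
  rho_Θ x hx := rfl
  Θ_sing x _ _ := rfl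
  sing_subset x hx := ⟨X₁.sing_subset_tube hx.1, by
    rw [rho_eq_zero_iff.2 hx.1, mul_zero]; exact one_pos⟩
  maps_Θ x hx := ⟨hR ▸ mem_univ _, hx.1.2, rfl⟩
  maps_Λ x hx _ hxκ := ⟨⟨hx, hxκ⟩, ⟨⟨hx, hxκ⟩, hR ▸ mem_univ _⟩, rfl⟩

theorem exists_subStructure_of_homeomorph {k : ℕ} {M : Type u} [TopologicalSpace M]
    [ChartedSpace (HSpace k) M] [IsManifold (HModel k) ∞ M] {N : Type v} [TopologicalSpace N]
    {ι : N → M} (hι : IsEmbedding ι) (hr : range ι = univ) (hb : (HModel k).boundary M = ∅) :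
    ∃ S : SubStructure k k ι, letI := S.charted; (HModel k).boundary N = ∅ := by
  have h1 : ∀ x, range ι ∈ 𝓝 (ι x) ∧ (HModel k).IsInteriorPoint (ι x) := fun x =>
    ⟨hr ▸ Filter.univ_mem, (HModel k).isInteriorPoint_iff_not_isBoundaryPoint _ |>.2 fun h => by
      have : ι x ∈ (HModel k).boundary M := h
      rw [hb] at this
      exact this⟩
  obtain ⟨S, hS⟩ := exists_subStructure_slab hι fun x => Or.inl (h1 x)
  exact ⟨S, hS.trans (Set.eq_empty_of_forall_notMem fun x hx => hx (h1 x))⟩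

namespace Collar

variable (C : Collar X₁♭ W♭)

theorem rho_toFun {a : A} (ha : a ∈ X₁.tube) (t : unitInterval) :
    W.rho (C.toFun (a, t)) = X₁.rho a := by
  rw [rho_of_mem ((C.mem_tube a t).2 ha), rho_of_mem ha, C.rad_eq a t ha]

theorem retr_toFun {a : A} (ha : a ∈ X₁.tube) (t : unitInterval) :
    W.retr (C.toFun (a, t)) = C.toFun (X₁.retr a, t) := by
  rw [retr_of_mem ((C.mem_tube a t).2 ha), retr_of_mem ha, C.proj_eq a t ha]

/-- Close to the singular stratum, only the points of the boundary are mapped to the boundary by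
the retraction. -/
theorem exists_zero_of_retr_zero (hh : Continuous h)
    (hzero : ∀ x, h x = 0 ↔ x ∈ range fun a => C.toFun (a, 0)) :
    ∃ κ₀ > 0, ∀ x ∈ W.tube, κ₀ * W.rho x ≤ 1 → h (W.retr x) = 0 → h x = 0 := by
  obtain ⟨ε, hε, h1⟩ := W.exists_uniform_rho (P := fun x => h (W.retr x) = 0 → h x = 0)
    fun y hy => by
      by_cases hy0 : h y = 0
      · obtain ⟨a, ha⟩ := (hzero y).1 hy0
        have h2 : range C.toFun ∈ 𝓝 y := ha ▸ C.range_mem_nhds a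
        obtain ⟨U, hU, ε, hε, h3⟩ := W.exists_tube_subset hy h2
        refine ⟨U, hU, ε, hε, fun x hx hxU hxε hx0 => ?_⟩
        obtain ⟨⟨a', t⟩, rfl⟩ := h3 x hx hxU hxε
        have h4 : a' ∈ X₁.tube := (C.mem_tube a' t).1 hx
        rw [C.retr_toFun h4] at hx0
        obtain ⟨b, hb⟩ := (hzero _).1 hx0
        have h5 := congrArg Prod.snd (C.isClosedEmbedding.injective hb)
        exact (hzero _).2 ⟨a', by change C.toFun (a', 0) = _; rw [show (0 : unitInterval) = t from h5]⟩
      · refine ⟨{x | h x ≠ 0}, (isOpen_ne_fun hh continuous_const).mem_nhds hy0, 1, one_pos,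
          fun x _ hxU _ hx0 => absurd hx0 hxU⟩
  refine ⟨2 / ε, by positivity, fun x hx hxκ => h1 x hx ?_⟩
  rw [div_mul_eq_mul_div, div_le_one hε] at hxκ
  have := rho_nonneg (W := W♭) x
  rcases this.lt_or_eq with h2 | h2 <;> linarith

theorem exists_lt (hh : Continuous h) (hzero : ∀ x, h x = 0 ↔ x ∈ range fun a => C.toFun (a, 0))
    {s : ℝ} (hs : 0 < s) :
    ∃ τ : unitInterval, 0 < τ.1 ∧ ∀ a t, t ≤ τ → h (C.toFun (a, t)) < s := by
  have := X₁.compact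
  have h1 : ∀ᶠ t : unitInterval in 𝓝 0, ∀ a ∈ (univ : Set A), h (C.toFun (a, t)) < s := by
    refine isCompact_univ.eventually_forall_of_forall_eventually fun a _ => ?_
    have h2 : Continuous fun p : A × unitInterval => h (C.toFun p) :=
      hh.comp C.isClosedEmbedding.continuous
    have h0 : h (C.toFun (a, 0)) < s := ((hzero _).2 ⟨a, rfl⟩).trans_lt hs
    have h3 : ∀ᶠ p in 𝓝 (a, (0 : unitInterval)), h (C.toFun p) < s :=
      h2.continuousAt.eventually_lt_const h0
    exact (continuous_swap.tendsto ((0 : unitInterval), a)).eventually h3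
  obtain ⟨r, hr, h2⟩ := Metric.eventually_nhds_iff.1 h1
  have h0 : 0 < min (r / 2) 1 := lt_min (by positivity) one_pos
  refine ⟨⟨min (r / 2) 1, h0.le, min_le_right _ _⟩, h0, fun a t ht => h2 ?_ a (mem_univ a)⟩
  rw [Subtype.dist_eq, Real.dist_eq]
  change |t.1 - 0| < r
  have h3 : t.1 ≤ min (r / 2) 1 := ht
  rw [sub_zero, abs_of_nonneg t.2.1]
  linarith [min_le_left (r / 2) 1]

/-- The boundary of `W`, at which the function `h ≥ 0` vanishes, is an end of slabs. -/
theorem exists_level (hh : IsSmoothFun W♭ h) (hpos : ∀ x, 0 ≤ h x)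
    (hzero : ∀ x, h x = 0 ↔ x ∈ range fun a => C.toFun (a, 0)) {S : Set X}
    (hS : ∀ x, x ∈ S ↔ h x = 0) :
    ∃ (P : FibPM l L n (m - 1) ↥S) (j : StratMap P♭ W♭),
      P.boundary = ∅ ∧ IsStratSubmanifold W♭ P♭ j ∧ IsLevelEnd W P h := by
  have := W.hausdorff
  have := X₁.hausdorff
  have := X₁.compact
  have hinj := C.isClosedEmbedding.injective
  have hex : ∀ x : ↥S, ∃ a, C.toFun (a, 0) = x.1 := fun x => (hzero x.1).1 ((hS x.1).1 x.2)
  have hS0 : ∀ x : ↥S, h x.1 = 0 := fun x => (hS x.1).1 x.2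
  choose j hj using hex
  let incl : A → ↥S := fun a => ⟨C.toFun (a, 0), (hS _).2 ((hzero _).2 ⟨a, rfl⟩)⟩
  have hincl : Continuous incl := (C.isClosedEmbedding.continuous.comp
    (continuous_id.prodMk continuous_const)).subtype_mk _
  have hji : ∀ a, j (incl a) = a := fun a => congrArg Prod.fst (hinj (hj (incl a)))
  have hij : ∀ x, incl (j x) = x := fun x => Subtype.ext (hj x)
  let e₀ : A ≃ₜ ↥S := (show Continuous (⟨incl, j, hji, hij⟩ : A ≃ ↥S) from
    hincl).homeoOfEquivCompactToT2
  have hjc : IsClosedEmbedding j := e₀.symm.isClosedEmbedding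
  have hjr : range j = univ := e₀.symm.surjective.range_eq
  obtain ⟨κ₀, hκ, hκ0⟩ := C.exists_zero_of_retr_zero hh.continuous hzero
  have hb := boundary_eq_empty_iff.1 C.closed
  obtain ⟨Sr, hSr⟩ := exists_subStructure_of_homeomorph
    (isEmbedding_pullReg X₁♭ hjc.isEmbedding)
    (Set.eq_univ_of_forall fun x => by
      obtain ⟨z, hz⟩ := hjr.symm ▸ mem_univ x.1
      exact ⟨⟨z, fun hz' => x.2 (hz ▸ hz')⟩, Subtype.ext hz⟩) hb.1
  obtain ⟨Ss, hSs⟩ := exists_subStructure_of_homeomorph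
    (isEmbedding_pullSing X₁♭ hjc.isEmbedding)
    (Set.eq_univ_of_forall fun x => by
      obtain ⟨z, hz⟩ := hjr.symm ▸ mem_univ x.1
      exact ⟨⟨z, by rw [mem_preimage, hz]; exact x.2⟩, Subtype.ext hz⟩) hb.2
  let R := shrinkRetube X₁ hκ hjr
  have hdim : (j ⁻¹' X₁.sing).Nonempty → m - 1 + l + 1 = n ∧ m - 1 + 2 ≤ n := fun ⟨z, hz⟩ =>
    ⟨X₁.dim_eq ⟨_, hz⟩, X₁.codim ⟨_, hz⟩⟩
  let P := R.fibPM hjc Sr Ss hdim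
  have hPb : P.boundary = ∅ := boundary_eq_empty_iff.2 ⟨hSr, hSs⟩
  have hmem : ∀ (τ : unitInterval) (x : ↥S) t,
      C.toFun (j x, scaleI τ t) ∈ W.sing ↔ x ∈ P.sing := fun τ x t => C.mem_sing _ _
  have hsmr : ContMDiff (HModel n) (HModel n) ∞ (fun z : P.Reg => X₁.pullReg j z) :=
    Retube.smooth_pullReg (hj := hjc)
  have hsms : ContMDiff (HModel (m - 1)) (HModel (m - 1)) ∞ (fun z : P.Sing => X₁.pullSing j z) :=
    Retube.smooth_pullSing (hj := hjc)
  have himr : ∀ q : P.Reg, Function.Injective (mfderiv (HModel n) (HModel n)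
      (fun z : P.Reg => X₁.pullReg j z) q) := fun q =>
    (Retube.initial_pullReg (hj := hjc)).injective_mfderiv hsmr q
  have hims : ∀ q : P.Sing, Function.Injective (mfderiv (HModel (m - 1)) (HModel (m - 1))
      (fun z : P.Sing => X₁.pullSing j z) q) := fun q =>
    (Retube.initial_pullSing (hj := hjc)).injective_mfderiv hsms q
  let e : unitInterval → CollarMap P♭ W♭ := fun τ =>
    ⟨fun p => C.toFun (j p.1, scaleI τ p.2), hmem τ⟩
  have her : ∀ τ, ContMDiff ((HModel n).prod (𝓡∂ 1)) (HModel (n + 1)) ∞ (e τ).reg := fun τ =>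
    C.smooth_reg.comp ((hsmr.comp contMDiff_fst).prodMk ((contMDiff_scaleI τ).comp contMDiff_snd))
  have hes : ∀ τ, ContMDiff ((HModel (m - 1)).prod (𝓡∂ 1)) (HModel m) ∞ (e τ).sing := fun τ =>
    C.smooth_sing.comp ((hsms.comp contMDiff_fst).prodMk ((contMDiff_scaleI τ).comp contMDiff_snd))
  have hir : ∀ τ : unitInterval, 0 < τ.1 → ∀ q, Function.Injective
      (mfderiv ((HModel n).prod (𝓡∂ 1)) (HModel (n + 1)) (e τ).reg q) := fun τ hτ q =>
    injective_mfderiv_prodMap_scaleI C.smooth_reg (fun q => (C.bijective_reg q).1) hsmr himr hτ q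
  have his : ∀ τ : unitInterval, 0 < τ.1 → ∀ q, Function.Injective
      (mfderiv ((HModel (m - 1)).prod (𝓡∂ 1)) (HModel m) (e τ).sing q) := fun τ hτ q =>
    injective_mfderiv_prodMap_scaleI C.smooth_sing (fun q => (C.bijective_sing q).1) hsms hims hτ q
  have he0 : ∀ τ x, (e τ).toFun (x, 0) = x.1 := fun τ x => by
    change C.toFun (j x, τ * 0) = x.1
    rw [mul_zero, hj]
  -- the inclusion is the restriction of the collar to the time zero
  have hcol : ∀ (k k' : ℕ) (N M : Type _) [TopologicalSpace N] [ChartedSpace (HSpace k') N]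
      [TopologicalSpace M] [ChartedSpace (HSpace k) M] (φ : N × unitInterval → M),
      ContMDiff ((HModel k').prod (𝓡∂ 1)) (HModel k) ∞ φ →
      (∀ q, Function.Injective (mfderiv ((HModel k').prod (𝓡∂ 1)) (HModel k) φ q)) →
      ContMDiff (HModel k') (HModel k) ∞ (fun x => φ (x, 0)) ∧
      ∀ x, Function.Injective (mfderiv (HModel k') (HModel k) (fun x => φ (x, 0)) x) := by
    intro k k' N M _ _ _ _ φ hφ hi
    refine ⟨hφ.comp (contMDiff_id.prodMk contMDiff_const), fun x => ?_⟩
    have h1 := (hφ.mdifferentiableAt (by simp) (x := (x, 0))).hasMFDerivAt.comp x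
      (HasMFDerivAt.prodMk (hasMFDerivAt_id x) (hasMFDerivAt_const (0 : unitInterval) x))
    have h2 : mfderiv (HModel k') (HModel k) (fun x => φ (x, 0)) x = _ := h1.mfderiv
    rw [h2]
    refine (hi (x, 0)).comp fun v v' hv => congrArg Prod.fst hv
  let ι : StratMap P♭ W♭ :=
    ⟨Subtype.val, continuous_subtype_val, fun x => by rw [← he0 1 x]; exact hmem 1 x 0⟩
  have hιr : ι.reg = fun x => (e 1).reg (x, 0) := funext fun x => Subtype.ext (he0 1 x.1).symm
  have hιs : ι.sing = fun x => (e 1).sing (x, 0) := funext fun x => Subtype.ext (he0 1 x.1).symm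
  have hcr := hcol _ _ _ _ _ (her 1) (hir 1 one_pos)
  have hcs := hcol _ _ _ _ _ (hes 1) (his 1 one_pos)
  refine ⟨P, ι, hPb, ⟨rfl, ?_⟩, κ₀, hκ, fun σ hσ => ?_⟩
  · exact ⟨hιr ▸ hcr.1, hιs ▸ hcs.1, hιr ▸ hcr.2, hιs ▸ hcs.2⟩
  obtain ⟨T⟩ := nonempty_boundaryScales hh.continuous hpos hκ hκ0 hσ
  refine ⟨T.K₀, fun K hK => ?_⟩
  obtain ⟨τ, hτ, hτs⟩ := C.exists_lt hh.continuous hzero T.s_pos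
  have hs : ∀ a t, h (C.toFun (a, scaleI τ t)) < T.s := fun a t =>
    hτs a _ (mul_le_of_le_one_right τ.2.1 t.2.2)
  have hrho : ∀ x : ↥S, j x ∈ X₁.tube → W.rho x.1 = X₁.rho (j x) := fun x hx => by
    rw [← C.rho_toFun hx 0, hj]
  have hbound : ∀ x, h x = 0 → x ∈ W.boundary := fun x hx => by
    obtain ⟨a, rfl⟩ := (hzero x).1 hx
    exact C.mem_boundary a
  have hjc' : Continuous fun p : ↥S × unitInterval => (j p.1, scaleI τ p.2) :=
    (hjc.continuous.comp continuous_fst).prodMk (continuous_const.mul continuous_snd)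
  exact ⟨
  { toTaper := boundaryTaper hh hpos hκ T hK
    mem_iff := hS
    closed := hPb
    end_reg := fun x hx => Or.inl ⟨(mem_boundary_reg x).1 (hbound _ hx),
      Filter.Eventually.of_forall fun z => hpos _⟩
    end_sing := fun x hx => Or.inl ⟨(mem_boundary_sing x).1 (hbound _ hx),
      Filter.Eventually.of_forall fun z => hpos _⟩
    e := e τ
    e_zero := he0 τ
    continuous_e := C.isClosedEmbedding.continuous.comp hjc'
    injective_e := fun p q hpq => by
      have h1 := hinj hpq
      refine Prod.ext (hjc.injective (congrArg Prod.fst h1)) (Subtype.ext ?_)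
      exact mul_left_cancel₀ hτ.ne' (congrArg (fun p : A × unitInterval => p.2.1) h1)
    e_nonneg := fun p => hpos _
    e_lt := fun p => (hs _ _).trans (by linarith [T.s_le, T.s_pos])
    e_nhds := fun x => by
      have h1 : range C.toFun ∈ 𝓝 x.1 := by rw [← hj x]; exact C.range_mem_nhds _
      have h2 : IsClosed (C.toFun '' {p | τ ≤ p.2}) :=
        C.isClosedEmbedding.isClosedMap _ (isClosed_le continuous_const continuous_snd)
      have h3 : x.1 ∉ C.toFun '' {p | τ ≤ p.2} := by
        rintro ⟨p, hp, hpx⟩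
        rw [← hj x] at hpx
        have h4 := congrArg Prod.snd (hinj hpx)
        have h5 : τ ≤ p.2 := hp
        rw [h4] at h5
        exact absurd hτ (not_lt.2 h5)
      filter_upwards [h1, h2.isOpen_compl.mem_nhds h3] with z hz hz' _
      obtain ⟨p, rfl⟩ := hz
      have h4 : p.2.1 < τ.1 := not_le.1 fun h => hz' ⟨p, h, rfl⟩
      refine ⟨(incl p.1, ⟨p.2.1 / τ.1, div_nonneg p.2.2.1 hτ.le, (div_le_one hτ).2 h4.le⟩), ?_⟩
      change C.toFun (j (incl p.1), _) = _
      rw [hji]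
      exact congrArg (fun t => C.toFun (p.1, t)) (Subtype.ext (mul_div_cancel₀ _ hτ.ne'))
    smooth_reg := her τ
    smooth_sing := hes τ
    injective_reg := hir τ hτ
    injective_sing := his τ hτ
    e_notMem := fun p hp => by
      have h1 : C.toFun (j p.1, scaleI τ p.2) ∈ W.tube := hp.1.1.1
      have h2 : 2 * T.s < h (W.retr (C.toFun (j p.1, scaleI τ p.2))) := hp.2.2
      rw [C.retr_toFun ((C.mem_tube _ _).1 h1)] at h2
      linarith [hs (X₁.retr (j p.1)) p.2, T.s_pos]
    e_mem_T := fun x t => by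
      change C.toFun (j x, scaleI τ t) ∈ (boundaryTaper hh hpos hκ T hK).T ↔ (j x ∈ X₁.tube ∧
        κ₀ * X₁.rho (j x) < 1)
      constructor
      · intro hx
        have h1 : C.toFun (j x, scaleI τ t) ∈ W.tube := hx.1.1.1
        have h2 : κ₀ * W.rho (C.toFun (j x, scaleI τ t)) < 1 := hx.1.1.2
        have h3 := (C.mem_tube _ _).1 h1
        exact ⟨h3, by rwa [C.rho_toFun h3] at h2⟩
      · rintro ⟨h1, h2⟩
        have h3 := (C.mem_tube (j x) (scaleI τ t)).2 h1
        have h4 : h (W.retr (C.toFun (j x, scaleI τ t))) < T.s := by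
          rw [C.retr_toFun h1]; exact hs _ _
        rw [← C.rho_toFun h1 (scaleI τ t)] at h2
        refine ⟨⟨⟨h3, h2⟩, h3, ?_⟩, h3, ?_⟩
        · change h (W.retr (C.toFun (j x, scaleI τ t))) < 3 * T.s
          linarith [T.s_pos]
        · rwa [stepFun_of_le T.s_pos h4.le]
    k_e := fun x t hx => by
      change stepFun κ₀ K T.s (h (W.retr (C.toFun (j x, scaleI τ t)))) = κ₀
      refine stepFun_of_le T.s_pos ?_
      rw [C.retr_toFun hx.1]; exact (hs _ _).le
    rho_e := fun x t hx => by
      rw [hrho x hx.1]; exact C.rho_toFun hx.1 _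
    retr_e := fun x t hx => by
      have h1 : j (P.proj ⟨x, hx⟩).1 = X₁.retr (j x) :=
        Retube.proj_spec (hj := hjc) (Sr := Sr) (Ss := Ss) hx
      change W.retr (C.toFun (j x, scaleI τ t)) = C.toFun (j (P.proj ⟨x, hx⟩).1, scaleI τ t)
      rw [h1, C.retr_toFun hx.1]
    rad_P := fun x hx => by
      refine (Retube.rad_spec (hj := hjc) (Sr := Sr) (Ss := Ss) hx).trans ?_
      rw [hrho x hx.1]; rfl }⟩

end Collar
end BoundaryEnd

/-! ### Regular level sets and slabs of a special Morse pair -/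

section Levels

theorem dform_affine {k : ℕ} {M : Type u} [TopologicalSpace M] [ChartedSpace (HSpace k) M]
    {F : M → ℝ} {x : M} (hF : MDifferentiableAt (HModel k) 𝓘(ℝ, ℝ) F x) (a b : ℝ)
    (v : TangentSpace (HModel k) x) :
    dform (k := k) (fun z => a * F z + b) x v = a * dform (k := k) F x v := by
  have h1 : HasMFDerivAt 𝓘(ℝ, ℝ) 𝓘(ℝ, ℝ) (fun r : ℝ => a * r + b) (F x)
      (a • ContinuousLinearMap.id ℝ ℝ) :=
    (((hasFDerivAt_id (F x)).const_mul a).add_const b).hasMFDerivAt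
  have h2 := (h1.comp x hF.hasMFDerivAt).mfderiv
  exact congrArg (fun D : 𝔼 k →L[ℝ] ℝ => D v) h2

theorem dform_affine_ne_zero {k : ℕ} {M : Type u} [TopologicalSpace M] [ChartedSpace (HSpace k) M]
    {F : M → ℝ} {x : M} (hF : MDifferentiableAt (HModel k) 𝓘(ℝ, ℝ) F x) {a b : ℝ} (ha : a ≠ 0)
    (h : dform (k := k) F x ≠ 0) : dform (k := k) (fun z => a * F z + b) x ≠ 0 := by
  refine fun h0 => h (ContinuousLinearMap.ext fun v => ?_)
  have h1 := dform_affine hF a b v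
  rw [h0] at h1
  exact (mul_eq_zero.1 h1.symm).resolve_left ha

theorem IsSmoothFun.affine {k k' : ℕ} {W : StratData k k' X} {f : X → ℝ} (hf : IsSmoothFun W f)
    (a b : ℝ) : IsSmoothFun W (fun x => a * f x + b) where
  continuous := (continuous_const.mul hf.continuous).add continuous_const
  smooth_reg := (contMDiff_const.mul hf.smooth_reg).add contMDiff_const
  smooth_sing := (contMDiff_const.mul hf.smooth_sing).add contMDiff_const

theorem IsRegularValue.dform_reg_ne_zero {k k' : ℕ} {W : StratData k k' X} {f : X → ℝ} {c : ℝ}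
    (hr : IsRegularValue W f c) (x : W.Reg) (hx : f x.1 = c) : dform (k := k) (onReg W f) x ≠ 0 :=
  fun h => hr x.1 hx (Or.inl ⟨x.2, h⟩)

theorem IsRegularValue.dform_sing_ne_zero {k k' : ℕ} {W : StratData k k' X} {f : X → ℝ} {c : ℝ}
    (hr : IsRegularValue W f c) (x : W.Sing) (hx : f x.1 = c) :
    dform (k := k') (onSing W f) x ≠ 0 := fun h => hr x.1 hx (Or.inr ⟨x.2, h⟩)

theorem IsRegularValue.affine {k k' : ℕ} {W : StratData k k' X} {f : X → ℝ} {c : ℝ}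
    (hr : IsRegularValue W f c) (hf : IsSmoothFun W f) {a b : ℝ} (ha : a ≠ 0) :
    IsRegularValue W (fun x => a * f x + b) (a * c + b) := by
  intro p hp
  have hp' : f p = c := mul_left_cancel₀ ha (add_right_cancel hp)
  rintro (⟨h, h0⟩ | ⟨h, h0⟩)
  · exact dform_affine_ne_zero (hf.smooth_reg.mdifferentiableAt (by simp)) ha
      (hr.dform_reg_ne_zero ⟨p, h⟩ hp') h0
  · exact dform_affine_ne_zero (hf.smooth_sing.mdifferentiableAt (by simp)) ha
      (hr.dform_sing_ne_zero ⟨p, h⟩ hp') h0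

variable [CompactSpace L] {W : FibPM l L (n + 1) m X} {h : X → ℝ}

theorem LevelFlow.isTubeBound_reverse {𝓕 : LevelFlow W h} {κ₀ : ℝ} (hκ : 𝓕.IsTubeBound κ₀)
    {h' : X → ℝ} (hh' : ∀ x, h' x = -h x) : (𝓕.reverse hh').IsTubeBound κ₀ :=
  ⟨hκ.pos, hκ.lt_r₀, fun x hx hxκ => by
    rw [𝓕.mem_dom_reverse hh', 𝓕.mem_dom_reverse hh']; exact hκ.retr_mem x hx hxκ⟩

/-- An interior regular level set is an end of the slabs on both sides. -/
theorem LevelFlow.exists_level (𝓕 : LevelFlow W h) (hh : IsSmoothFun W♭ h)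
    (hr : IsRegularValue W♭ h 0) {S : Set X} (hS : ∀ x, x ∈ S ↔ h x = 0) :
    ∃ (P : FibPM l L n (m - 1) ↥S) (j : StratMap P♭ W♭),
      P.boundary = ∅ ∧ IsStratSubmanifold W♭ P♭ j ∧ IsLevelEnd W P h ∧
      IsLevelEnd W P (fun x => -h x) := by
  obtain ⟨κ₀, hκ⟩ := exists_isTubeBound 𝓕 hh.continuous
  have hSc : IsClosed S := by
    have : S = {x | h x = 0} := Set.ext hS
    rw [this]; exact isClosed_eq hh.continuous continuous_const
  have hj : IsClosedEmbedding (Subtype.val : ↥S → X) := hSc.isClosedEmbedding_subtypeVal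
  have hdr := hr.dform_reg_ne_zero
  have hds := hr.dform_sing_ne_zero
  have hS0 : ∀ x : ↥S, h x.1 = 0 := fun x => (hS x.1).1 x.2
  obtain ⟨Sr, hSr⟩ := exists_subStructure_level (c := 0) hh.smooth_reg
    (isEmbedding_pullReg W♭ hj.isEmbedding) (by
      ext x
      refine Iff.trans ?_ (hS x.1)
      exact ⟨by rintro ⟨z, rfl⟩; exact z.1.2, fun h => ⟨⟨⟨x.1, h⟩, x.2⟩, rfl⟩⟩)
    (fun x => 𝓕.interior_reg _ 0 (by rw [𝓕.zero]; exact hS0 x.1)) (fun x => hdr _ (hS0 x.1))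
  obtain ⟨Ss, hSs⟩ := exists_subStructure_level (c := 0) hh.smooth_sing
    (isEmbedding_pullSing W♭ hj.isEmbedding) (by
      ext x
      refine Iff.trans ?_ (hS x.1)
      exact ⟨by rintro ⟨z, rfl⟩; exact z.1.2, fun h => ⟨⟨⟨x.1, h⟩, x.2⟩, rfl⟩⟩)
    (fun x => 𝓕.interior_sing _ 0 (by rw [𝓕.zero]; exact hS0 x.1)) (fun x => hds _ (hS0 x.1))
  let R : Retube W (range (Subtype.val : ↥S → X)) :=
    levelRetube hh hκ fun x => by rw [Subtype.range_val, hS]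
  have hdim : ((Subtype.val : ↥S → X) ⁻¹' W.sing).Nonempty → m - 1 + l + 1 = n ∧ m - 1 + 2 ≤ n := by
    rintro ⟨z, hz⟩
    have h1 := W.dim_eq ⟨z.1, hz⟩
    have h2 := W.codim ⟨z.1, hz⟩
    -- a point of a zero dimensional stratum is critical
    have h3 : m ≠ 0 := by
      rintro rfl
      refine hds ⟨z.1, hz⟩ (hS0 z) (ContinuousLinearMap.ext fun v => ?_)
      have hv : v = 0 := Subsingleton.elim (α := 𝔼 0) v 0
      rw [hv, map_zero]; rfl
    omega
  let P := R.fibPM hj Sr Ss hdim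
  have hPb : P.boundary = ∅ := boundary_eq_empty_iff.2 ⟨hSr, hSs⟩
  have hh' : ∀ x, -h x = -h x := fun _ => rfl
  have haff : (fun x => -h x) = fun x => (-1) * h x + 0 := by funext x; ring
  have hhn : IsSmoothFun W♭ (fun x => -h x) := haff ▸ hh.affine (-1) 0
  have hrn : IsRegularValue W♭ (fun x => -h x) 0 := by
    simpa using hr.affine (b := 0) hh (neg_ne_zero.2 one_ne_zero)
  refine ⟨P, R.incl hj Sr Ss, hPb, ⟨rfl, Retube.isImmersion_incl⟩, ⟨κ₀, hκ.pos, fun σ hσ => ?_⟩,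
    κ₀, hκ.pos, fun σ hσ => ?_⟩
  · exact 𝓕.exists_levelEnd hh hκ hS R hj Sr Ss hdim hPb (fun _ => rfl) (fun _ => Iff.rfl)
      (fun _ _ => rfl) hdr hds hσ
  · refine (𝓕.reverse hh').exists_levelEnd hhn (isTubeBound_reverse hκ hh')
      (fun x => by rw [hS, neg_eq_zero]) R hj Sr Ss hdim hPb (fun _ => rfl) (fun x => ?_)
      (fun x hx => ?_) hrn.dform_reg_ne_zero hrn.dform_sing_ne_zero hσ
    · change _ ∧ _ ∧ _ ↔ _ ∧ _ ∧ _
      rw [𝓕.mem_dom_reverse hh']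
    · -- the time changes its sign and the flow is reversed
      have h1 : x ∈ 𝓕.tubeDom κ₀ := hx
      change 𝓕.Φ (𝓕.time x - 𝓕.time (W.retr x)) x =
        𝓕.Φ (-((𝓕.reverse hh').time x - (𝓕.reverse hh').time (W.retr x))) x
      rw [𝓕.time_reverse hh.continuous hh' h1.2.2,
        𝓕.time_reverse hh.continuous hh' (retr_mem_dom hκ h1)]
      congr 1
      ring

variable {A B : Type*} [TopologicalSpace A] [TopologicalSpace B] {X₁ : FibPM l L n (m - 1) A}
  {X₂ : FibPM l L n (m - 1) B} {T : Cobordism X₁♭ X₂♭ W♭}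
  {f : X → ℝ} {g : WedgeMetric W} {a b : ℝ}

namespace IsSpecialMorsePair

theorem mem_boundary_iff (hfg : IsSpecialMorsePair T f g a b) (x : X) :
    x ∈ W.boundary ↔ f x = a ∨ f x = b := by
  rw [T.boundary_eq, ← hfg.preimage_a, ← hfg.preimage_b]; rfl

/-- A regular level set is a pseudomanifold with fibered singularities, and an end of slabs on each
side where the function takes values. -/
theorem exists_level (hfg : IsSpecialMorsePair T f g a b) {c : ℝ} (hc : c ∈ Icc a b)
    (hr : IsRegularValue W♭ f c) :
    ∃ (P : FibPM l L n (m - 1) ↥(f ⁻¹' {c})) (j : StratMap P♭ W♭),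
      P.boundary = ∅ ∧ IsStratSubmanifold W♭ P♭ j ∧
      (c < b → IsLevelEnd W P (fun x => f x - c)) ∧ (a < c → IsLevelEnd W P (fun x => c - f x)) := by
  have haff : (fun x => f x - c) = fun x => 1 * f x + -c := by funext x; ring
  have haff' : (fun x => c - f x) = fun x => (-1) * f x + c := by funext x; ring
  have hs : IsSmoothFun W♭ (fun x => f x - c) := haff ▸ hfg.smooth.affine 1 (-c)
  have hs' : IsSmoothFun W♭ (fun x => c - f x) := haff' ▸ hfg.smooth.affine (-1) c
  have hS : ∀ x, x ∈ f ⁻¹' {c} ↔ f x - c = 0 := fun x => sub_eq_zero.symm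
  have hS' : ∀ x, x ∈ f ⁻¹' {c} ↔ c - f x = 0 := fun x => by
    rw [sub_eq_zero, eq_comm]; rfl
  by_cases hca : c = a
  · subst hca
    obtain ⟨P, j, h1, h2, h3⟩ := T.c₀.exists_level hs
      (fun x => sub_nonneg.2 (hfg.mem_Icc x).1) (fun x => by rw [← hS, hfg.preimage_a]) hS
    exact ⟨P, j, h1, h2, fun _ => h3, fun h => absurd h (lt_irrefl _)⟩
  by_cases hcb : c = b
  · subst hcb
    obtain ⟨P, j, h1, h2, h3⟩ := T.c₁.exists_level hs'
      (fun x => sub_nonneg.2 (hfg.mem_Icc x).2) (fun x => by rw [← hS', hfg.preimage_b]) hS'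
    exact ⟨P, j, h1, h2, fun h => absurd h (lt_irrefl _), fun _ => h3⟩
  have hac : a < c := lt_of_le_of_ne hc.1 (Ne.symm hca)
  have hcb' : c < b := lt_of_le_of_ne hc.2 hcb
  obtain ⟨δ, hδ, hδa, hδb⟩ : ∃ δ > 0, δ < c - a ∧ δ < b - c :=
    ⟨min (c - a) (b - c) / 2, half_pos (lt_min (by linarith) (by linarith)), by
      linarith [min_le_left (c - a) (b - c)], by linarith [min_le_right (c - a) (b - c)]⟩
  obtain ⟨ε₀, hε₀, h1, h2, -⟩ := hfg.control
  obtain ⟨ε, hε, ⟨F⟩⟩ := exists_levelFields g hfg.smooth hε₀ h1 h2 hδ hr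
  obtain ⟨𝓕⟩ := exists_levelFlow hfg.smooth hδ hε F fun x hx => by
    rcases (hfg.mem_boundary_iff x).1 hx with h | h <;> rw [h]
    · rw [abs_sub_comm, abs_of_pos (by linarith)]; exact hδa
    · rw [abs_of_pos (by linarith)]; exact hδb
  have hr' : IsRegularValue W♭ (fun x => f x - c) 0 := by
    simpa [sub_eq_add_neg] using hr.affine (b := -c) hfg.smooth one_ne_zero
  obtain ⟨P, j, h3, h4, h5, h6⟩ := 𝓕.exists_level hs hr' hS
  refine ⟨P, j, h3, h4, fun _ => h5, fun _ => ?_⟩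
  have h7 : (fun x => c - f x) = fun x => -(f x - c) := by funext x; ring
  rw [h7]; exact h6

/-- The slab between two regular level sets is a bordism. -/
theorem exists_slab (hfg : IsSpecialMorsePair T f g a b) {c d : ℝ} (hc : c ∈ Icc a b)
    (hd : d ∈ Icc a b) (hcd : c < d) {P : FibPM l L n (m - 1) ↥(f ⁻¹' {c})}
    {Q : FibPM l L n (m - 1) ↥(f ⁻¹' {d})} (hP : IsLevelEnd W P (fun x => f x - c))
    (hQ : IsLevelEnd W Q (fun x => d - f x)) :
    ∃ (V : FibPM l L (n + 1) m ↥(f ⁻¹' Icc c d)) (i : StratMap V♭ W♭)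
      (C : Cobordism P♭ Q♭ V♭),
      IsStratSubmanifold W♭ V♭ i ∧
      (∀ x, (C.c₀.toFun (x, 0)).1 = x.1) ∧ (∀ x, (C.c₁.toFun (x, 0)).1 = x.1) := by
  have haff : (fun x => f x - c) = fun x => 1 * f x + -c := by funext x; ring
  have haff' : (fun x => d - f x) = fun x => (-1) * f x + d := by funext x; ring
  obtain ⟨κ₀, hκ₀, hP⟩ := hP
  obtain ⟨κ₁, hκ₁, hQ⟩ := hQ
  have hσ : 0 < (d - c) / 2 := by linarith
  obtain ⟨K₀, hK₀⟩ := hP _ hσ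
  obtain ⟨K₁, hK₁⟩ := hQ _ hσ
  obtain ⟨E₀⟩ := hK₀ (max K₀ K₁) (le_max_left _ _)
  obtain ⟨E₁⟩ := hK₁ (max K₀ K₁) (le_max_right _ _)
  refine FibSing.exists_slab E₀ E₁ (haff ▸ hfg.smooth.affine 1 (-c)) (haff' ▸ hfg.smooth.affine (-1) d)
    hκ₀ hκ₁ (δ := d - c) (fun x => by ring) (by linarith) (by linarith)
    (fun x => ?_) (fun x hx h1 h2 => ?_)
  · rw [sub_nonneg, sub_nonneg]; rfl
  · rcases (hfg.mem_boundary_iff x).1 hx with h | h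
    · linarith [hc.1]
    · linarith [hd.2]

end IsSpecialMorsePair
end Levels

/-! ### Maps of frames and pull back of spin structures -/

section Homotopy

theorem homotopic_of_comp {Y Z : Type*} [TopologicalSpace Y] [TopologicalSpace Z] {x y : Y} {a b : Z}
    {A B : Path x y} {p q : Path a b} (h : p.Homotopic q) {G : Z → Y} (hG : Continuous G)
    (hA : ∀ t, A t = G (p t)) (hB : ∀ t, B t = G (q t)) : A.Homotopic B := by
  obtain ⟨H⟩ := h
  exact ⟨{ toFun := fun z => G (H z)
           continuous_toFun := hG.comp H.continuous
           map_zero_left := fun t => by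
             rw [H.apply_zero]; exact (hA t).symm
           map_one_left := fun t => by
             rw [H.apply_one]; exact (hB t).symm
           prop' := fun s t ht => by
             have h1 := H.prop' s t ht
             refine (congrArg G h1).trans ?_
             exact (hA t).symm }⟩

/-- The class of a spin structure is invariant under free homotopy. -/
theorem SpinStr.cls_eq_of_homotopy {k : ℕ} {M : Type u} [TopologicalSpace M]
    [ChartedSpace (HSpace k) M] [IsManifold (HModel k) ∞ M] (σ : SpinStr k M)
    {G : unitInterval × unitInterval → ↥σ.pos} (hG : Continuous G) (h01 : ∀ s, G (s, 0) = G (s, 1))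
    {F F' : ↥σ.pos} (γ : Path F F) (γ' : Path F' F') (h0 : ∀ t, γ t = G (0, t))
    (h1 : ∀ t, γ' t = G (1, t)) : σ.cls γ = σ.cls γ' := by
  have e0 : G (0, 0) = F := by rw [← h0, γ.source]
  have e1 : G (1, 0) = F' := by rw [← h1, γ'.source]
  let δ : Path F F' := ⟨⟨fun s => G (s, 0), hG.comp (by fun_prop)⟩, e0, e1⟩
  rw [← σ.cls_conj γ δ]
  refine σ.cls_homotopic _ _ ?_
  -- both loops are images of paths in the square with the same end points
  let bot : Path ((0 : unitInterval), (0 : unitInterval)) (1, 0) :=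
    ⟨⟨fun s => (s, 0), by fun_prop⟩, rfl, rfl⟩
  let top' : Path ((0 : unitInterval), (1 : unitInterval)) (1, 1) :=
    ⟨⟨fun s => (s, 1), by fun_prop⟩, rfl, rfl⟩
  let left : Path ((0 : unitInterval), (0 : unitInterval)) (0, 1) :=
    ⟨⟨fun s => (0, s), by fun_prop⟩, rfl, rfl⟩
  let right : Path ((1 : unitInterval), (0 : unitInterval)) (1, 1) :=
    ⟨⟨fun s => (1, s), by fun_prop⟩, rfl, rfl⟩
  have : ContractibleSpace unitInterval :=
    (convex_Icc (0 : ℝ) 1).contractibleSpace ⟨0, unitInterval.zero_mem⟩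
  refine homotopic_of_comp (SimplyConnectedSpace.paths_homotopic ((bot.symm.trans left).trans top')
    right) hG (fun t => ?_) h1
  rw [Path.trans_apply, Path.trans_apply]
  split_ifs
  · rw [Path.trans_apply, Path.trans_apply]
    split_ifs
    · rfl
    · exact h0 _
  · exact h01 _

end Homotopy

section Frames

variable {k k' : ℕ} {M : Type u} [TopologicalSpace M] [ChartedSpace (HSpace k) M]
  [IsManifold (HModel k) ∞ M] {N : Type v} [TopologicalSpace N] [ChartedSpace (HSpace k') N]
  [IsManifold (HModel k') ∞ N]

theorem StabFrame.continuous_iff {Z : Type*} [TopologicalSpace Z] {φ : Z → StabFrame k M} :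
    Continuous φ ↔ ∀ i, Continuous (fun z => (⟨(φ z).pt, ((φ z).vec i).1⟩ :
      TangentBundle (HModel k) M)) ∧ Continuous fun z => ((φ z).vec i).2 := by
  rw [continuous_induced_rng, continuous_pi_iff]
  exact forall_congr' fun i => continuous_prodMk

theorem StabFrame.continuous_pt : Continuous (StabFrame.pt : StabFrame k M → M) :=
  (FiberBundle.continuous_proj (𝔼 k) (TangentSpace (HModel k) : M → Type _)).comp
    ((StabFrame.continuous_iff.1 continuous_id) 0).1

/-- Affine combinations of continuous vector fields along a map are continuous. -/
theorem continuous_lineMap_tangent {Z : Type*} [TopologicalSpace Z] {b : Z → M}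
    {u u' : ∀ z, TangentSpace (HModel k) (b z)}
    (hu : Continuous fun z => (⟨b z, u z⟩ : TangentBundle (HModel k) M))
    (hu' : Continuous fun z => (⟨b z, u' z⟩ : TangentBundle (HModel k) M)) {r : Z → ℝ}
    (hr : Continuous r) :
    Continuous fun z => (⟨b z, (1 - r z) • u z + r z • u' z⟩ : TangentBundle (HModel k) M) := by
  have hr1 : Continuous fun z => 1 - r z := by fun_prop
  rw [continuous_iff_continuousAt]
  intro z
  have h1 := (FiberBundle.continuousAt_totalSpace _ _).1 (hu.continuousAt (x := z))
  have h2 := (FiberBundle.continuousAt_totalSpace _ _).1 (hu'.continuousAt (x := z))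
  refine (FiberBundle.continuousAt_totalSpace _ _).2 ⟨h1.1, ?_⟩
  have h3 := ((hr1.continuousAt (x := z)).smul h1.2).add
    ((hr.continuousAt (x := z)).smul h2.2)
  refine h3.congr ?_
  let e := trivializationAt (𝔼 k) (TangentSpace (HModel k) : M → Type _) (b z)
  have h4 : ∀ᶠ y in 𝓝 z, b y ∈ e.baseSet :=
    h1.1.eventually (e.open_baseSet.mem_nhds (FiberBundle.mem_baseSet_trivializationAt' (b z)))
  filter_upwards [h4] with y hy
  have hl := e.linear ℝ hy
  change (1 - r y) • (e ⟨b y, u y⟩).2 + r y • (e ⟨b y, u' y⟩).2 =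
    (e ⟨b y, (1 - r y) • u y + r y • u' y⟩).2
  rw [hl.map_add, hl.map_smul, hl.map_smul]

/-- A map of frames which is compatible with changes of bases and with rotations. -/
structure IsFrameMap (Φ : StabFrame k M → StabFrame k' N) : Prop where
  continuous : Continuous Φ
  matrix : ∀ (x : M) (v v' : Fin (k + 3) → TangentSpace (HModel k) x × 𝔼 3)
    (hv : LinearIndependent ℝ v) (hv' : LinearIndependent ℝ v')
    (P : Matrix (Fin (k + 3)) (Fin (k + 3)) ℝ), (∀ i, v' i = ∑ j, P i j • v j) →
    ∃ (y : N) (w w' : Fin (k' + 3) → TangentSpace (HModel k') y × 𝔼 3)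
      (hw : LinearIndependent ℝ w) (hw' : LinearIndependent ℝ w')
      (P' : Matrix (Fin (k' + 3)) (Fin (k' + 3)) ℝ), Φ ⟨x, v, hv⟩ = ⟨y, w, hw⟩ ∧
      Φ ⟨x, v', hv'⟩ = ⟨y, w', hw'⟩ ∧ (∀ i, w' i = ∑ j, P' i j • w j) ∧ P'.det = P.det
  rotate : ∀ (F : StabFrame k M) (i j : Fin (k + 3)), i ≠ j → ∃ i' j', i' ≠ j' ∧
    ∀ (θ : ℝ) (h : LinearIndependent ℝ (rotate F.vec i j θ)), ∃ h',
      Φ ⟨F.pt, rotate F.vec i j θ, h⟩ = ⟨(Φ F).pt, FibSing.rotate (Φ F).vec i' j' θ, h'⟩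

/-- The spin structure pulled back by a map of frames. -/
def SpinStr.pullback (σ : SpinStr k' N) {Φ : StabFrame k M → StabFrame k' N} (hΦ : IsFrameMap Φ) :
    SpinStr k M :=
  have hc : Continuous fun F : ↥(Φ ⁻¹' σ.pos) => (⟨Φ F.1, F.2⟩ : ↥σ.pos) :=
    (hΦ.continuous.comp continuous_subtype_val).subtype_mk _
  { pos := Φ ⁻¹' σ.pos
    isClopen_pos := σ.isClopen_pos.preimage hΦ.continuous
    pos_iff := fun x v v' hv hv' P hP => by
      obtain ⟨y, w, w', hw, hw', P', h1, h2, h3, h4⟩ := hΦ.matrix x v v' hv hv' P hP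
      rw [mem_preimage, mem_preimage, h1, h2, ← h4]
      exact σ.pos_iff y w w' hw hw' P' h3
    cls := fun γ => σ.cls (γ.map hc)
    cls_homotopic := fun γ γ' h => σ.cls_homotopic _ _ (h.map ⟨_, hc⟩)
    cls_trans := fun γ γ' => by
      rw [Path.map_trans]; exact σ.cls_trans _ _
    cls_conj := fun γ δ => by
      rw [Path.map_trans, Path.map_trans, ← Path.map_symm]; exact σ.cls_conj _ _
    cls_rotate := fun F i j γ hij hγ => by
      obtain ⟨i', j', h1, h2⟩ := hΦ.rotate F.1 i j hij
      refine σ.cls_rotate _ i' j' _ h1 fun t => ?_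
      obtain ⟨h3, h4⟩ := hγ t
      obtain ⟨h5, h6⟩ := h2 _ h3
      exact ⟨h5, by rw [← h6, ← h4]; rfl⟩ }

theorem rotate_comp {n : ℕ} {V V' : Type*} [AddCommGroup V] [Module ℝ V] [AddCommGroup V']
    [Module ℝ V'] (L : V →ₗ[ℝ] V') (v : Fin n → V) (i j : Fin n) (θ : ℝ) :
    (fun a => L (rotate v i j θ a)) = rotate (fun a => L (v a)) i j θ := by
  funext a
  simp only [rotate, Function.update_apply]
  split_ifs <;> simp

theorem rotate_cons {n : ℕ} {V : Type*} [AddCommGroup V] [Module ℝ V] (x : V) (v : Fin n → V)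
    (i j : Fin n) (θ : ℝ) :
    (Fin.cons x (rotate v i j θ) : Fin (n + 1) → V) = rotate (Fin.cons x v) i.succ j.succ θ := by
  rw [rotate, rotate, Fin.cons_update, Fin.cons_update]
  simp only [Fin.cons_succ]

/-- The linear map on the stabilised tangent spaces. -/
def stabMap {p q : ℕ} (D : 𝔼 p →L[ℝ] 𝔼 q) :
    (𝔼 p × 𝔼 3) →ₗ[ℝ]
      (𝔼 q × 𝔼 3) :=
  (D.toLinearMap).prodMap LinearMap.id

theorem stabMap_injective {p q : ℕ} {D : 𝔼 p →L[ℝ] 𝔼 q}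
    (hD : Function.Injective D) : Function.Injective (stabMap D) :=
  Function.Injective.prodMap hD Function.injective_id

theorem linearIndependent_stabMap {p q r : ℕ}
    {D : 𝔼 p →L[ℝ] 𝔼 q} (hD : Function.Injective D)
    {v : Fin r → 𝔼 p × 𝔼 3} (hv : LinearIndependent ℝ v) :
    LinearIndependent ℝ (fun i => stabMap D (v i)) :=
  hv.map' _ (LinearMap.ker_eq_bot.2 (stabMap_injective hD))

theorem linearIndependent_cons_stabMap {p q r : ℕ}
    {D : 𝔼 p →L[ℝ] 𝔼 q} (hD : Function.Injective D)
    {v : Fin r → 𝔼 p × 𝔼 3} (hv : LinearIndependent ℝ v)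
    {α : 𝔼 q →L[ℝ] ℝ} (hα : ∀ u, α (D u) = 0) {ν : 𝔼 q}
    (hν : α ν ≠ 0) :
    LinearIndependent ℝ (Fin.cons ((ν, 0) : 𝔼 q × 𝔼 3)
      (fun i => stabMap D (v i)) : Fin (r + 1) → _) := by
  rw [linearIndependent_finCons]
  refine ⟨linearIndependent_stabMap hD hv, fun h => hν ?_⟩
  have h1 : Submodule.span ℝ (range fun i => stabMap D (v i)) ≤
      LinearMap.ker (α.toLinearMap.comp (LinearMap.fst ℝ _ (𝔼 3))) := by
    rw [Submodule.span_le]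
    rintro _ ⟨i, rfl⟩
    exact hα _
  exact h1 h

/-- The matrix with blocks `1` and `P`. -/
def consMatrix {r : ℕ} (P : Matrix (Fin r) (Fin r) ℝ) : Matrix (Fin (r + 1)) (Fin (r + 1)) ℝ :=
  Matrix.of (Fin.cons (Fin.cons 1 0) fun i => Fin.cons 0 (P i))

theorem det_consMatrix {r : ℕ} (P : Matrix (Fin r) (Fin r) ℝ) : (consMatrix P).det = P.det := by
  rw [Matrix.det_succ_row_zero, Fin.sum_univ_succ]
  have h1 : (consMatrix P).submatrix Fin.succ Fin.succ = P := by
    ext i j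
    simp [consMatrix]
  have h2 : ∀ i : Fin r, consMatrix P 0 i.succ = 0 := fun i => by simp [consMatrix]
  have h3 : consMatrix P 0 0 = 1 := by simp [consMatrix]
  rw [Finset.sum_eq_zero fun i _ => by rw [h2]; ring, h3, Fin.succAbove_zero, h1]
  simp

theorem cons_eq_sum {r : ℕ} {V : Type*} [AddCommGroup V] [Module ℝ V] (x : V) {v v' : Fin r → V}
    {P : Matrix (Fin r) (Fin r) ℝ} (h : ∀ i, v' i = ∑ j, P i j • v j) (i : Fin (r + 1)) :
    (Fin.cons x v' : Fin (r + 1) → V) i =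
      ∑ j, consMatrix P i j • (Fin.cons x v : Fin (r + 1) → V) j := by
  rw [Fin.sum_univ_succ]
  refine Fin.cases ?_ (fun i => ?_) i
  · simp [consMatrix]
  · simp [consMatrix, h]

end Frames

/-! ### Spin structures and embeddings of codimension zero and one -/

theorem StabFrame.mk_congr {k : ℕ} {M : Type u} [TopologicalSpace M] [ChartedSpace (HSpace k) M]
    {x : M} {v v' : Fin (k + 3) → TangentSpace (HModel k) x × 𝔼 3}
    {hv : LinearIndependent ℝ v} (h : v = v') :
    (⟨x, v, hv⟩ : StabFrame k M) = ⟨x, v', h ▸ hv⟩ := by subst h; rfl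

theorem SpinStr.corresponds_pullback {k k' : ℕ} {M : Type u} [TopologicalSpace M]
    [ChartedSpace (HSpace k) M] [IsManifold (HModel k) ∞ M] {N : Type v} [TopologicalSpace N]
    [ChartedSpace (HSpace k') N] [IsManifold (HModel k') ∞ N] (σ : SpinStr k' N)
    {Φ : StabFrame k M → StabFrame k' N} (hΦ : IsFrameMap Φ) :
    (σ.pullback hΦ).Corresponds σ (fun F F' => F' = Φ F) := by
  refine ⟨fun F F' h => by rw [h]; rfl, fun F F' γ γ' h => ?_⟩
  have h0 : F' = ⟨Φ F.1, F.2⟩ := Subtype.ext (by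
    have := h 0
    rwa [γ.source, γ'.source] at this)
  subst h0
  change σ.cls _ = σ.cls _
  congr 1
  ext t
  exact (h t).symm

theorem stabMap_sum {p q r : ℕ} (D : 𝔼 p →L[ℝ] 𝔼 q)
    {v v' : Fin r → 𝔼 p × 𝔼 3}
    {P : Matrix (Fin r) (Fin r) ℝ} (h : ∀ a, v' a = ∑ b, P a b • v b) (a : Fin r) :
    stabMap D (v' a) = ∑ b, P a b • stabMap D (v b) := by
  rw [h a, map_sum]
  exact Finset.sum_congr rfl fun b _ => map_smul _ _ _

section Push

variable {k : ℕ} {M : Type u} [TopologicalSpace M] [ChartedSpace (HSpace k) M]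
  [IsManifold (HModel k) ∞ M] {N : Type v} [TopologicalSpace N] [ChartedSpace (HSpace k) N]
  [IsManifold (HModel k) ∞ N] {i : M → N}

/-- The image of a frame under an immersion of codimension zero. -/
def StabFrame.push (hi : ∀ x, Function.Injective (mfderiv (HModel k) (HModel k) i x))
    (F : StabFrame k M) : StabFrame k N :=
  ⟨i F.pt, fun a => stabMap (mfderiv (HModel k) (HModel k) i F.pt) (F.vec a),
    linearIndependent_stabMap (hi F.pt) F.indep⟩

theorem StabFrame.isFrameMap_push (hs : ContMDiff (HModel k) (HModel k) ∞ i)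
    (hi : ∀ x, Function.Injective (mfderiv (HModel k) (HModel k) i x)) :
    IsFrameMap (StabFrame.push hi) where
  continuous := StabFrame.continuous_iff.2 fun a =>
    ⟨(hs.continuous_tangentMap (by simp)).comp (StabFrame.continuous_iff.1 continuous_id a).1,
      (StabFrame.continuous_iff.1 continuous_id a).2⟩
  matrix x v v' hv hv' P hP := by
    refine ⟨i x, _, _, linearIndependent_stabMap (hi x) hv, linearIndependent_stabMap (hi x) hv', P,
      rfl, rfl, stabMap_sum _ hP, rfl⟩
  rotate F a b hab := ⟨a, b, hab, fun θ h => ⟨_, StabFrame.mk_congr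
    (rotate_comp (stabMap (p := k) (q := k) (mfderiv (HModel k) (HModel k) i F.pt)) F.vec a b θ)⟩⟩

theorem SpinStr.corresponds_push (σ : SpinStr k N) (hs : ContMDiff (HModel k) (HModel k) ∞ i)
    (hi : ∀ x, Function.Injective (mfderiv (HModel k) (HModel k) i x)) :
    (σ.pullback (StabFrame.isFrameMap_push hs hi)).Corresponds σ (FrameImage i) := by
  obtain ⟨h1, h2⟩ := σ.corresponds_pullback (StabFrame.isFrameMap_push hs hi)
  have h3 : ∀ F F', FrameImage i F F' → F' = StabFrame.push hi F := fun F F' ⟨h, h'⟩ => h'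
  exact ⟨fun F F' h => h1 F F' (h3 _ _ h), fun F F' γ γ' h => h2 F F' γ γ' fun t => h3 _ _ (h t)⟩

end Push

section Extend

variable {k : ℕ} {M : Type u} [TopologicalSpace M] [ChartedSpace (HSpace k) M]
  [IsManifold (HModel k) ∞ M] {N : Type v} [TopologicalSpace N] [ChartedSpace (HSpace (k + 1)) N]
  [IsManifold (HModel (k + 1)) ∞ N] {j : M → N} {f : N → ℝ}

/-- The map `j` is an immersion of codimension one, into a level set of `f`. -/
structure IsLevelImmersion (k : ℕ) {M : Type u} [TopologicalSpace M] [ChartedSpace (HSpace k) M]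
    {N : Type v} [TopologicalSpace N] [ChartedSpace (HSpace (k + 1)) N] (j : M → N) (f : N → ℝ) : Prop where
  smooth : ContMDiff (HModel k) (HModel (k + 1)) ∞ j
  injective : ∀ a, Function.Injective (mfderiv (HModel k) (HModel (k + 1)) j a)
  dform_eq : ∀ a v, dform (k := k + 1) f (j a) (mfderiv (HModel k) (HModel (k + 1)) j a v) = 0

/-- A frame, extended by a vector along which the function increases. -/
def StabFrame.extend (hj : IsLevelImmersion k j f) (F : StabFrame k M)
    (ν : TangentSpace (HModel (k + 1)) (j F.pt)) (hν : 0 < dform (k := k + 1) f (j F.pt) ν) :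
    StabFrame (k + 1) N :=
  ⟨j F.pt, (Fin.cons ((ν, 0) : 𝔼 (k + 1) × 𝔼 3)
    (fun a => stabMap (mfderiv (HModel k) (HModel (k + 1)) j F.pt) (F.vec a)) : Fin (k + 3 + 1) → _),
    linearIndependent_cons_stabMap (hj.injective F.pt) F.indep (hj.dform_eq F.pt) hν.ne'⟩

theorem FrameExtension.eq_extend (hj : IsLevelImmersion k j f) {F : StabFrame k M}
    {F' : StabFrame (k + 1) N}
    (h : FrameExtension j (fun a ν => 0 < dform (k := k + 1) f (j a) ν) F F') :
    ∃ ν hν, F' = StabFrame.extend hj F ν hν := by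
  obtain ⟨ν, v, hv, rfl, hν, h0, h1⟩ := h
  refine ⟨ν, hν, StabFrame.mk_congr ?_⟩
  funext a
  refine Fin.cases (motive := fun a : Fin (k + 3 + 1) => v a = _) ?_ (fun a => ?_) a
  · exact h0 0 rfl
  · exact h1 _ a rfl

theorem StabFrame.extend_lineMap_congr (hj : IsLevelImmersion k j f) {F F' : StabFrame k M}
    {ν : TangentSpace (HModel (k + 1)) (j F.pt)} {ν' : TangentSpace (HModel (k + 1)) (j F'.pt)}
    {hν : 0 < dform (k := k + 1) f (j F.pt) ν} {hν' : 0 < dform (k := k + 1) f (j F'.pt) ν'}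
    (hF : F = F') (h : StabFrame.extend hj F ν hν = StabFrame.extend hj F' ν' hν')
    (V : ∀ x : N, TangentSpace (HModel (k + 1)) x) (r : ℝ) (h1 h2) :
    StabFrame.extend hj F ((1 - r) • V (j F.pt) + r • ν) h1 =
      StabFrame.extend hj F' ((1 - r) • V (j F'.pt) + r • ν') h2 := by
  subst hF
  have h3 : ν = ν' := congrArg (Prod.fst (α := 𝔼 (k + 1)))
    (congrFun (StabFrame.mk.inj h).2 (0 : Fin (k + 3 + 1)))
  subst h3
  rfl

theorem StabFrame.continuous_extend (hj : IsLevelImmersion k j f) {Z : Type*} [TopologicalSpace Z]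
    {φ : Z → StabFrame k M} (hφ : Continuous φ)
    {ν : ∀ z, TangentSpace (HModel (k + 1)) (j (φ z).pt)}
    (hν : Continuous fun z => (⟨j (φ z).pt, ν z⟩ : TangentBundle (HModel (k + 1)) N))
    (hpos : ∀ z, 0 < dform (k := k + 1) f (j (φ z).pt) (ν z)) :
    Continuous fun z => StabFrame.extend hj (φ z) (ν z) (hpos z) := by
  refine StabFrame.continuous_iff.2 fun a => ?_
  refine Fin.cases (motive := fun a : Fin (k + 3 + 1) =>
    (Continuous fun z => (⟨j (φ z).pt, ((StabFrame.extend hj (φ z) (ν z) (hpos z)).vec a).1⟩ :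
      TangentBundle (HModel (k + 1)) N)) ∧
      Continuous fun z => ((StabFrame.extend hj (φ z) (ν z) (hpos z)).vec a).2) ?_ (fun a => ?_) a
  · exact ⟨hν, continuous_const⟩
  · exact ⟨(hj.smooth.continuous_tangentMap (by simp)).comp (StabFrame.continuous_iff.1 hφ a).1,
      (StabFrame.continuous_iff.1 hφ a).2⟩

variable {V : ∀ x : N, TangentSpace (HModel (k + 1)) x}

theorem StabFrame.isFrameMap_extend (hj : IsLevelImmersion k j f)
    (hV : Continuous fun x => (⟨x, V x⟩ : TangentBundle (HModel (k + 1)) N))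
    (hpos : ∀ a, 0 < dform (k := k + 1) f (j a) (V (j a))) :
    IsFrameMap (fun F : StabFrame k M => StabFrame.extend hj F (V (j F.pt)) (hpos F.pt)) where
  continuous := StabFrame.continuous_extend hj continuous_id
    (hV.comp (hj.smooth.continuous.comp StabFrame.continuous_pt)) fun F => hpos F.pt
  matrix x v v' hv hv' P hP := by
    refine ⟨j x, _, _, linearIndependent_cons_stabMap (hj.injective x) hv (hj.dform_eq x)
      (hpos x).ne', linearIndependent_cons_stabMap (hj.injective x) hv' (hj.dform_eq x)
      (hpos x).ne', consMatrix P, rfl, rfl, cons_eq_sum _ (stabMap_sum _ hP), det_consMatrix P⟩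
  rotate F a b hab := ⟨a.succ, b.succ, fun h => hab (Fin.succ_injective _ h), fun θ h =>
    ⟨_, StabFrame.mk_congr (by
      refine Eq.trans ?_ (rotate_cons
        (V := 𝔼 (k + 1) × 𝔼 3) _ _ a b θ)
      exact congrArg (fun w => (Fin.cons _ w :
          Fin (k + 3 + 1) → 𝔼 (k + 1) × 𝔼 3))
        (rotate_comp (stabMap (p := k) (q := k + 1) (mfderiv (HModel k) (HModel (k + 1)) j F.pt))
          F.vec a b θ))⟩⟩

/-- A spin structure induces spin structures on immersed level sets. That the class of a loop of
extended frames does not depend on the transverse vectors is due to their convexity. -/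
theorem SpinStr.corresponds_extend (σ : SpinStr (k + 1) N) (hj : IsLevelImmersion k j f)
    (hV : Continuous fun x => (⟨x, V x⟩ : TangentBundle (HModel (k + 1)) N))
    (hpos : ∀ a, 0 < dform (k := k + 1) f (j a) (V (j a))) :
    (σ.pullback (StabFrame.isFrameMap_extend hj hV hpos)).Corresponds σ
      (FrameExtension j (fun a ν => 0 < dform (k := k + 1) f (j a) ν)) := by
  have hconv : ∀ (a : M) (ν ν' : TangentSpace (HModel (k + 1)) (j a)) (r : unitInterval),
      0 < dform (k := k + 1) f (j a) ν → 0 < dform (k := k + 1) f (j a) ν' →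
      0 < dform (k := k + 1) f (j a) ((1 - r.1) • ν + r.1 • ν') := fun a ν ν' r h h' => by
    rw [map_add, map_smul, map_smul]
    exact convex_Ioi (0 : ℝ) h h' (sub_nonneg.2 r.2.2) r.2.1 (by ring)
  -- frames joined by a path have the same orientation
  have hclopen : ∀ {Z : Type} [TopologicalSpace Z] [PreconnectedSpace Z] {G : Z → StabFrame (k + 1) N}
      (_ : Continuous G) (z z' : Z), G z ∈ σ.pos → G z' ∈ σ.pos := by
    intro Z _ _ G hG z z' hz
    rcases isClopen_iff.1 (σ.isClopen_pos.preimage hG) with h | h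
    · exact absurd hz (h ▸ notMem_empty z : z ∉ G ⁻¹' σ.pos)
    · exact (h ▸ mem_univ z' : z' ∈ G ⁻¹' σ.pos)
  refine ⟨fun F F' h => ?_, fun F F' γ γ' h => ?_⟩
  · obtain ⟨ν, hν, rfl⟩ := h.eq_extend hj
    have hG : Continuous fun r : unitInterval => StabFrame.extend hj F
        ((1 - r.1) • V (j F.pt) + r.1 • ν) (hconv _ _ _ r (hpos _) hν) :=
      StabFrame.continuous_extend hj continuous_const (continuous_lineMap_tangent
        continuous_const continuous_const continuous_subtype_val) _
    have e0 : StabFrame.extend hj F ((1 - (0 : unitInterval).1) • V (j F.pt) + (0 : unitInterval).1 • ν)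
        (hconv _ _ _ 0 (hpos _) hν) = StabFrame.extend hj F (V (j F.pt)) (hpos _) := by
      congr 1; simp
    have e1 : StabFrame.extend hj F ((1 - (1 : unitInterval).1) • V (j F.pt) + (1 : unitInterval).1 • ν)
        (hconv _ _ _ 1 (hpos _) hν) = StabFrame.extend hj F ν hν := by
      congr 1; simp
    change StabFrame.extend hj F (V (j F.pt)) (hpos _) ∈ σ.pos ↔ _
    rw [← e0, ← e1]
    exact ⟨hclopen hG 0 1, hclopen hG 1 0⟩
  · choose ν hν hγ' using fun t => (h t).eq_extend hj
    have hφ : Continuous fun t => (γ t).1 := continuous_subtype_val.comp γ.continuous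
    have hν' : Continuous fun t => (⟨j (γ t).1.pt, ν t⟩ : TangentBundle (HModel (k + 1)) N) := by
      have h1 := ((StabFrame.continuous_iff.1 continuous_id) 0).1.comp
        (continuous_subtype_val.comp γ'.continuous)
      refine h1.congr fun t => ?_
      have h2 := hγ' t
      change (⟨(γ' t).1.pt, ((γ' t).1.vec 0).1⟩ : TangentBundle (HModel (k + 1)) N) = _
      rw [h2]
      rfl
    have hG : Continuous fun z : unitInterval × unitInterval => StabFrame.extend hj (γ z.2).1
        ((1 - z.1.1) • V (j (γ z.2).1.pt) + z.1.1 • ν z.2) (hconv _ _ _ z.1 (hpos _) (hν _)) :=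
      StabFrame.continuous_extend hj (hφ.comp continuous_snd) (continuous_lineMap_tangent
        (hV.comp (hj.smooth.continuous.comp (StabFrame.continuous_pt.comp (hφ.comp continuous_snd))))
        (hν'.comp continuous_snd) (continuous_subtype_val.comp continuous_fst)) _
    have hr0 : ∀ t, StabFrame.extend hj (γ t).1
        ((1 - (0 : unitInterval).1) • V (j (γ t).1.pt) + (0 : unitInterval).1 • ν t)
        (hconv _ _ _ 0 (hpos _) (hν _)) = StabFrame.extend hj (γ t).1 (V (j (γ t).1.pt)) (hpos _) :=
      fun t => by congr 1; simp
    have hr1 : ∀ t, StabFrame.extend hj (γ t).1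
        ((1 - (1 : unitInterval).1) • V (j (γ t).1.pt) + (1 : unitInterval).1 • ν t)
        (hconv _ _ _ 1 (hpos _) (hν _)) = (γ' t).1 := fun t => by
      rw [hγ' t]; congr 1; simp
    have hmem : ∀ z : unitInterval × unitInterval, StabFrame.extend hj (γ z.2).1
        ((1 - z.1.1) • V (j (γ z.2).1.pt) + z.1.1 • ν z.2) (hconv _ _ _ z.1 (hpos _) (hν _)) ∈ σ.pos :=
      fun z => hclopen hG (0, 0) z (by rw [hr0 0]; exact (γ 0).2)
    refine σ.cls_eq_of_homotopy (hG.subtype_mk hmem) (fun s => Subtype.ext ?_) _ γ'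
      (fun t => Subtype.ext (hr0 t).symm) (fun t => Subtype.ext (hr1 t).symm)
    -- the two loops are closed, so that the homotopy is one of loops
    have h01 : (γ 0) = γ 1 := γ.source.trans γ.target.symm
    have h01' : (γ' 0).1 = (γ' 1).1 := congrArg _ (γ'.source.trans γ'.target.symm)
    rw [hγ' 0, hγ' 1] at h01'
    exact StabFrame.extend_lineMap_congr hj (congrArg _ h01) h01' V s.1
      (hconv _ _ _ s (hpos _) (hν 0)) (hconv _ _ _ s (hpos _) (hν 1))

end Extend

section SpinBoundary

variable {k k' : ℕ} {M : Type u} [TopologicalSpace M] [ChartedSpace (HSpace k') M]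
  {N : Type v} [TopologicalSpace N] [ChartedSpace (HSpace k) N]

/-- A non-negative function on a collar which vanishes on the boundary increases inwards. -/
theorem exists_mfderiv_collar_eq {ψ : M × unitInterval → ℝ} {a : M}
    (hψ : MDifferentiableAt ((HModel k').prod (𝓡∂ 1)) 𝓘(ℝ, ℝ) ψ (a, 0))
    (h0 : ∀ a, ψ (a, 0) = 0) (hpos : ∀ q, 0 ≤ ψ q) :
    ∃ r : ℝ, 0 ≤ r ∧ ∀ (v : 𝔼 k') (s : 𝔼 1),
      (mfderiv ((HModel k').prod (𝓡∂ 1)) 𝓘(ℝ, ℝ) ψ (a, 0) (v, s) : ℝ) = r * dtI 0 s := by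
  let χ : ℝ → ℝ := fun t => ψ (a, projIcc 0 1 zero_le_one t)
  have hsl : MDifferentiableAt (𝓡∂ 1) 𝓘(ℝ, ℝ) (fun t : unitInterval => ψ (a, t)) 0 :=
    MDifferentiableAt.comp (I' := (HModel k').prod (𝓡∂ 1)) (0 : unitInterval) hψ
      (mdifferentiableAt_const.prodMk mdifferentiableAt_id)
  have hp : MDifferentiableWithinAt 𝓘(ℝ, ℝ) (𝓡∂ 1) (projIcc (0 : ℝ) 1 zero_le_one) (Icc 0 1) 0 :=
    (contMDiffOn_projIcc (n := 1) 0 ⟨le_rfl, zero_le_one⟩).mdifferentiableWithinAt (by simp)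
  have e0 : projIcc (0 : ℝ) 1 zero_le_one 0 = 0 := projIcc_left zero_le_one
  have hχ : DifferentiableWithinAt ℝ χ (Icc 0 1) 0 := by
    refine mdifferentiableWithinAt_iff_differentiableWithinAt.1 ?_
    rw [← e0] at hsl
    exact hsl.comp_mdifferentiableWithinAt (0 : ℝ) hp
  have hu : UniqueDiffWithinAt ℝ (Icc (0 : ℝ) 1) 0 :=
    uniqueDiffOn_Icc zero_lt_one 0 ⟨le_rfl, zero_le_one⟩
  have hD := hχ.hasDerivWithinAt
  refine ⟨derivWithin χ (Icc 0 1) 0, ?_, fun v s => ?_⟩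
  · -- the right derivative at a minimum is non-negative
    have hχ0 : χ 0 = 0 := by
      change ψ (a, projIcc 0 1 zero_le_one 0) = 0
      rw [e0]; exact h0 a
    have hmin : IsLocalMinOn χ (Icc 0 1) 0 :=
      Filter.Eventually.of_forall fun t => by rw [hχ0]; exact hpos _
    have h1 := hmin.hasFDerivWithinAt_nonneg hD.hasFDerivWithinAt
      (mem_posTangentConeAt_of_segment_subset (y := 1) (by
        rw [zero_add, segment_eq_Icc zero_le_one]))
    simpa using h1
  · refine (mfderiv_prod_eq_add_apply (v := (v, s)) hψ).trans ?_
    have h1 : (fun z : M => ψ (z, ((a, 0) : M × unitInterval).2)) = fun _ => 0 := funext h0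
    have h2 : mfderiv (HModel k') 𝓘(ℝ, ℝ) (fun z : M => ψ (z, ((a, 0) : M × unitInterval).2)) a v
        = (0 : ℝ) := by
      rw [h1, mfderiv_const]; rfl
    have h3 : (fun t : unitInterval => ψ (a, t)) = χ ∘ Subtype.val :=
      funext fun t => by
        change _ = ψ (a, projIcc 0 1 zero_le_one t.1)
        rw [projIcc_val]
    have h4 := HasMFDerivWithinAt.comp (u := Icc (0 : ℝ) 1) (f := Subtype.val) (0 : unitInterval)
      hχ.hasFDerivWithinAt.hasMFDerivWithinAt
      ((contMDiff_subtypeVal_Icc (n := 1) (x := (0 : ℝ)) (y := 1)).mdifferentiableAt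
        (by simp) (x := 0)).hasMFDerivAt.hasMFDerivWithinAt (s := univ) (fun t _ => t.2)
    rw [hasMFDerivWithinAt_univ, ← h3] at h4
    refine (congrArg₂ (fun x y : ℝ => x + y) h2 (congrArg
      (fun D : 𝔼 1 →L[ℝ] ℝ => D s) h4.mfderiv)).trans ?_
    rw [zero_add, ← fderivWithin_derivWithin]
    change fderivWithin ℝ χ (Icc 0 1) 0 (dtI 0 s) = _
    have h5 := (fderivWithin ℝ χ (Icc 0 1) 0).map_smul (dtI 0 s) 1
    rw [smul_eq_mul, mul_one, smul_eq_mul] at h5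
    rw [h5, mul_comm]

variable [IsManifold (HModel k') ∞ M] [IsManifold (HModel k) ∞ N] {N' : Type w}
  [TopologicalSpace N'] [ChartedSpace (HSpace k) N'] [IsManifold (HModel k) ∞ N']

/-- The spin structures induced on the boundary, and on a level set. The collar is mapped by an
immersion of codimension zero; the boundary is mapped to a level set. -/
theorem SpinStr.corresponds_boundary {σ : SpinStr k N} {σM : SpinStr k' M} {i : N' → N}
    (hs : ContMDiff (HModel k) (HModel k) ∞ i)
    (hi : ∀ x, Function.Injective (mfderiv (HModel k) (HModel k) i x))
    {e : M × unitInterval → N'} (he : ContMDiff ((HModel k').prod (𝓡∂ 1)) (HModel k) ∞ e)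
    (hbij : ∀ q, Function.Bijective (mfderiv ((HModel k').prod (𝓡∂ 1)) (HModel k) e q))
    {f : N → ℝ} (hf : ContMDiff (HModel k) 𝓘(ℝ, ℝ) ∞ f) {c sgn : ℝ}
    (hc : ∀ a, f (i (e (a, 0))) = c) (hpos : ∀ q, 0 ≤ sgn * (f (i (e q)) - c))
    (hsgn : sgn ≠ 0) (hreg : ∀ a, dform (k := k) f (i (e (a, 0))) ≠ 0)
    (hσ : σM.Corresponds σ (FrameExtension (fun a => i (e (a, 0)))
      (fun a ν => 0 < dform (k := k) f (i (e (a, 0))) ν))) :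
    σM.Corresponds (σ.pullback (StabFrame.isFrameMap_push hs hi))
      (FrameExtension (fun a => e (a, 0)) (fun a ν => ∃ (v : 𝔼 k')
        (s : 𝔼 1), 0 < sgn * dtI 0 s ∧
        ν = mfderiv ((HModel k').prod (𝓡∂ 1)) (HModel k) e (a, 0) (v, s))) := by
  have hmf : ∀ x, MDifferentiableAt (HModel k) 𝓘(ℝ, ℝ) f x := hf.mdifferentiable (by simp)
  have hmi : ∀ x, MDifferentiableAt (HModel k) (HModel k) i x := hs.mdifferentiable (by simp)
  have hme : ∀ x, MDifferentiableAt ((HModel k').prod (𝓡∂ 1)) (HModel k) e x :=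
    he.mdifferentiable (by simp)
  have key : ∀ (a : M) (v : 𝔼 k') (s : 𝔼 1),
      0 < sgn * dtI 0 s → 0 < dform (k := k) f (i (e (a, 0)))
        (mfderiv (HModel k) (HModel k) i (e (a, 0))
          (mfderiv ((HModel k').prod (𝓡∂ 1)) (HModel k) e (a, 0) (v, s))) := by
    intro a
    have h1 : HasMFDerivAt 𝓘(ℝ, ℝ) 𝓘(ℝ, ℝ) (fun y : ℝ => sgn * (y - c)) (f (i (e (a, 0))))
        (sgn • ContinuousLinearMap.id ℝ ℝ) :=
      (((hasFDerivAt_id (f (i (e (a, 0))))).sub_const c).const_mul sgn).hasMFDerivAt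
    have h2 := h1.comp (a, (0 : unitInterval)) ((hmf _).hasMFDerivAt.comp (a, (0 : unitInterval))
      ((hmi _).hasMFDerivAt.comp (a, (0 : unitInterval)) (hme _).hasMFDerivAt))
    obtain ⟨r, hr, h3⟩ := exists_mfderiv_collar_eq h2.mdifferentiableAt
      (fun a => by simp [hc]) hpos
    have h4 : ∀ (v : 𝔼 k') (s : 𝔼 1),
        sgn * dform (k := k) f (i (e (a, 0))) (mfderiv (HModel k) (HModel k) i (e (a, 0))
          (mfderiv ((HModel k').prod (𝓡∂ 1)) (HModel k) e (a, 0) (v, s))) = r * dtI 0 s := fun v s =>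
      (congrArg (fun D : 𝔼 k' × 𝔼 1 →L[ℝ] ℝ => D (v, s))
        h2.mfderiv).symm.trans (h3 v s)
    have hr' : r ≠ 0 := by
      rintro rfl
      refine hreg a (ContinuousLinearMap.ext fun ν => ?_)
      have : FiniteDimensional ℝ (TangentSpace (HModel k) (e (a, 0))) :=
        inferInstanceAs (FiniteDimensional ℝ (𝔼 k))
      let D : 𝔼 k →ₗ[ℝ] 𝔼 k :=
        (mfderiv (HModel k) (HModel k) i (e (a, 0))).toLinearMap
      obtain ⟨w, hw⟩ := (LinearMap.injective_iff_surjective (f := D)).1 (hi _) ν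
      obtain ⟨⟨v, s⟩, hvs⟩ := (hbij (a, 0)).2 w
      have h5 := h4 v s
      rw [zero_mul, hvs] at h5
      have h6 := (mul_eq_zero.1 h5).resolve_left hsgn
      exact (congrArg _ hw.symm).trans h6
    intro v s h5
    have h6 : sgn * sgn * dform (k := k) f (i (e (a, 0))) (mfderiv (HModel k) (HModel k) i (e (a, 0))
          (mfderiv ((HModel k').prod (𝓡∂ 1)) (HModel k) e (a, 0) (v, s))) = r * (sgn * dtI 0 s) := by
      rw [mul_assoc, h4]; ring
    have h7 := mul_pos (lt_of_le_of_ne hr (Ne.symm hr')) h5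
    rw [← h6] at h7
    exact pos_of_mul_pos_right h7 (mul_self_nonneg _)
  have hext : ∀ (F : StabFrame k' M) (F' : StabFrame k N'),
      FrameExtension (fun a => e (a, 0)) (fun a ν => ∃ (v : 𝔼 k')
        (s : 𝔼 1), 0 < sgn * dtI 0 s ∧
        ν = mfderiv ((HModel k').prod (𝓡∂ 1)) (HModel k) e (a, 0) (v, s)) F F' →
      FrameExtension (fun a => i (e (a, 0)))
        (fun a ν => 0 < dform (k := k) f (i (e (a, 0))) ν) F (StabFrame.push hi F') := by
    rintro F F' ⟨ν, w, hw, rfl, ⟨v, s, hs, rfl⟩, h0, h1⟩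
    refine ⟨_, _, _, rfl, key F.pt v s hs, fun b hb => ?_, fun b b' hb => ?_⟩
    · exact congrArg (stabMap (mfderiv (HModel k) (HModel k) i (e (F.pt, 0)))) (h0 b hb)
    · refine (congrArg (stabMap (mfderiv (HModel k) (HModel k) i (e (F.pt, 0)))) (h1 b b' hb)).trans ?_
      have h2 : MDifferentiableAt (HModel k') (HModel k) (fun a => e (a, 0)) F.pt :=
        MDifferentiableAt.comp (I' := (HModel k').prod (𝓡∂ 1)) F.pt (hme (F.pt, 0))
          (mdifferentiableAt_id.prodMk mdifferentiableAt_const)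
      have h3 := ((hmi _).hasMFDerivAt.comp F.pt h2.hasMFDerivAt).mfderiv
      exact congrArg (fun D : 𝔼 k' →L[ℝ] 𝔼 k =>
        (D (F.vec b').1, (F.vec b').2)) h3.symm
  exact ⟨fun F F' h => hσ.1 F _ (hext F F' h), fun F F' γ γ' h => hσ.2 F
    ⟨StabFrame.push hi F'.1, F'.2⟩ γ (γ'.map (Continuous.subtype_mk
      ((StabFrame.isFrameMap_push hs hi).continuous.comp continuous_subtype_val) fun F => F.2))
    fun t => hext _ _ (h t)⟩

end SpinBoundary

section InducedSpin

/-- The unique spin structure on an empty manifold. -/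
def SpinStr.ofIsEmpty (k : ℕ) (M : Type u) [TopologicalSpace M] [ChartedSpace (HSpace k) M]
    [IsManifold (HModel k) ∞ M] [IsEmpty M] : SpinStr k M where
  pos := univ
  isClopen_pos := isClopen_univ
  pos_iff x := isEmptyElim x
  cls {F} := isEmptyElim F.1.pt
  cls_homotopic {F} := isEmptyElim F.1.pt
  cls_trans {F} := isEmptyElim F.1.pt
  cls_conj {F} := isEmptyElim F.1.pt
  cls_rotate F := isEmptyElim F.1.pt

theorem SpinStr.exists_level {k k' : ℕ} {M : Type u} [TopologicalSpace M]
    [ChartedSpace (HSpace k') M] [IsManifold (HModel k') ∞ M] {N : Type v} [TopologicalSpace N]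
    [ChartedSpace (HSpace k) N] [IsManifold (HModel k) ∞ N] [SigmaCompactSpace N] [T2Space N]
    (hk : IsEmpty M ∨ k = k' + 1) {j : M → N} (hj : ContMDiff (HModel k') (HModel k) ∞ j)
    (hinj : ∀ a, Function.Injective (mfderiv (HModel k') (HModel k) j a)) {f : N → ℝ}
    (hf : ContMDiff (HModel k) 𝓘(ℝ, ℝ) ∞ f) {c : ℝ} (hc : ∀ a, f (j a) = c)
    (hreg : ∀ x, f x = c → dform (k := k) f x ≠ 0) (σ : SpinStr k N) :
    ∃ σM : SpinStr k' M, σM.Corresponds σ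
      (FrameExtension j (fun a ν => 0 < dform (k := k) f (j a) ν)) := by
  rcases hk with h | rfl
  · exact ⟨SpinStr.ofIsEmpty k' M, fun F => isEmptyElim F.pt, fun F => isEmptyElim F.1.pt⟩
  · obtain ⟨V, hV, hpos, -⟩ := exists_field_level hf one_pos hreg
    refine ⟨_, σ.corresponds_extend ⟨hj, hinj, fun a v => ?_⟩ hV.continuous
      fun a => hpos _ (hc a)⟩
    have h1 := ((hf.mdifferentiable (by simp) (j a)).hasMFDerivAt.comp a
      (hj.mdifferentiable (by simp) a).hasMFDerivAt)
    have h2 : f ∘ j = fun _ => c := funext hc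
    rw [h2] at h1
    exact congrArg (fun D : 𝔼 k' →L[ℝ] ℝ => D v)
      (hasMFDerivAt_unique h1 (hasMFDerivAt_const c a))

variable {W : FibPM l L (n + 1) m X} {f : X → ℝ}
  {c : ℝ}

/-- Regular level sets inherit spin structures. If the singular stratum is discrete then it consists
of critical points, and the level sets have no singularities. -/
theorem SpinPM.exists_level [CompactSpace L] (hf : IsSmoothFun W♭ f)
    (hr : IsRegularValue W♭ f c) {P : FibPM l L n (m - 1) ↥(f ⁻¹' {c})}
    {j : StratMap P♭ W♭}
    (hj : IsStratSubmanifold W♭ P♭ j) (σ : SpinPM W♭) :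
    ∃ σP : SpinPM P♭, σP.IsInducedOnLevel σ j f := by
  have := W.hausdorff
  have := sigmaCompact_reg W
  have := compactSpace_sing W
  obtain ⟨hj0, hj1⟩ := hj
  have hc : ∀ a, f (j.toFun a) = c := fun a => by rw [hj0]; exact a.2
  obtain ⟨τ, hτ⟩ := SpinStr.exists_level (Or.inr rfl) hj1.smooth_reg hj1.injective_reg hf.smooth_reg
    (fun a => hc a.1) hr.dform_reg_ne_zero σ.reg
  have hm : IsEmpty P.Sing ∨ m = m - 1 + 1 := by
    by_cases h0 : m = 0
    · refine Or.inl ⟨fun a => hr.dform_sing_ne_zero (j.sing a) (hc a.1) ?_⟩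
      subst h0
      exact ContinuousLinearMap.ext fun v => by
        rw [Subsingleton.elim (α := 𝔼 0) v 0]
        exact map_zero _
    · exact Or.inr (by omega)
  obtain ⟨τ', hτ'⟩ := SpinStr.exists_level hm hj1.smooth_sing hj1.injective_sing hf.smooth_sing
    (fun a => hc a.1) hr.dform_sing_ne_zero σ.sing
  exact ⟨⟨τ, τ'⟩, hτ, hτ'⟩

/-- The restriction of a spin structure along a codimension zero immersion. -/
def SpinPM.restrict {Y : Type w} [TopologicalSpace Y] {V : FibPM l L (n + 1) m Y}
    {i : StratMap V♭ W♭} (hi : i.IsImmersion) (σ : SpinPM W♭) :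
    SpinPM V♭ where
  reg := σ.reg.pullback (StabFrame.isFrameMap_push hi.smooth_reg hi.injective_reg)
  sing := σ.sing.pullback (StabFrame.isFrameMap_push hi.smooth_sing hi.injective_sing)

theorem SpinPM.isRestriction_restrict {Y : Type w} [TopologicalSpace Y]
    {V : FibPM l L (n + 1) m Y} {i : StratMap V♭ W♭} (hi : i.IsImmersion)
    (σ : SpinPM W♭) : (σ.restrict hi).IsRestriction σ i :=
  ⟨σ.reg.corresponds_push hi.smooth_reg hi.injective_reg,
    σ.sing.corresponds_push hi.smooth_sing hi.injective_sing⟩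

/-- The gradient of `f` points along the collar up to the sign `sgn`, so the structure induced on the
level is the one induced on the boundary. -/
theorem SpinPM.isInducedOnBoundary_restrict (hf : IsSmoothFun W♭ f)
    (hr : IsRegularValue W♭ f c) {P : FibPM l L n (m - 1) ↥(f ⁻¹' {c})}
    {j : StratMap P♭ W♭} (hj : j.toFun = Subtype.val)
    {Y : Type w} [TopologicalSpace Y] {V : FibPM l L (n + 1) m Y}
    {i : StratMap V♭ W♭} (hi : i.IsImmersion)
    (e : Collar P♭ V♭) {sgn : ℝ} (hsgn : sgn ≠ 0)
    (h0 : ∀ a, i.toFun (e.toFun (a, 0)) = a.1)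
    (hpos : ∀ q, 0 ≤ sgn * (f (i.toFun (e.toFun q)) - c)) {σ : SpinPM W♭}
    {σP : SpinPM P♭} (hσ : σP.IsInducedOnLevel σ j f) :
    σP.IsInducedOnBoundary (σ.restrict hi) e sgn := by
  have hc : ∀ a, f (i.toFun (e.toFun (a, 0))) = c := fun a => by rw [h0]; exact a.2
  have e1 : j.reg = fun a => i.reg (e.reg (a, 0)) := funext fun a => Subtype.ext
    ((congrFun hj a.1).trans (h0 a.1).symm)
  have e2 : j.sing = fun a => i.sing (e.sing (a, 0)) := funext fun a => Subtype.ext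
    ((congrFun hj a.1).trans (h0 a.1).symm)
  obtain ⟨h1, h2⟩ := hσ
  rw [e1] at h1
  rw [e2] at h2
  exact ⟨SpinStr.corresponds_boundary hi.smooth_reg hi.injective_reg e.smooth_reg e.bijective_reg
      hf.smooth_reg (fun a => hc a.1) (fun q => hpos (q.1.1, q.2)) hsgn
      (fun a => hr.dform_reg_ne_zero _ (hc a.1)) h1,
    SpinStr.corresponds_boundary hi.smooth_sing hi.injective_sing e.smooth_sing e.bijective_sing
      hf.smooth_sing (fun a => hc a.1) (fun q => hpos (q.1.1, q.2)) hsgn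
      (fun a => hr.dform_sing_ne_zero _ (hc a.1)) h2⟩

end InducedSpin
end FibSing

end

open FibSing in
theorem proposition5
    -- the link: a closed smooth manifold of dimension `l`
    {l : ℕ} {L : Type*} [TopologicalSpace L] [ChartedSpace (EuclideanSpace ℝ (Fin l)) L]
    [IsManifold (𝓡 l) ∞ L] [CompactSpace L] [T2Space L] [SecondCountableTopology L]
    -- the triple `(W, X₁, X₂)`, with `dim W = n + 1` and singular stratum of dimension `m`
    {n m : ℕ} {X A B : Type*} [TopologicalSpace X] [TopologicalSpace A] [TopologicalSpace B]
    (W : FibPM l L (n + 1) m X) (X₁ : FibPM l L n (m - 1) A) (X₂ : FibPM l L n (m - 1) B)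
    (T : Cobordism X₁.toStratData X₂.toStratData W.toStratData)
    -- the special Morse pair, with `f : W → [a, b]`
    (f : X → ℝ) (g : WedgeMetric W) (a b : ℝ) (hfg : IsSpecialMorsePair T f g a b) :
    ∃ -- the structures on the regular level sets, their inclusions in `W`, and the spin
      -- structures which they inherit if `W` is spin
      (P : ∀ c ∈ Icc a b, IsRegularValue W.toStratData f c →
          FibPM l L n (m - 1) ↥(f ⁻¹' {c}))
      (j : ∀ (c : ℝ) (hc : c ∈ Icc a b) (hr : IsRegularValue W.toStratData f c),
          StratMap (P c hc hr).toStratData W.toStratData)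
      (σP : SpinPM W.toStratData →
          ∀ (c : ℝ) (hc : c ∈ Icc a b) (hr : IsRegularValue W.toStratData f c),
          SpinPM (P c hc hr).toStratData),
      -- regular level sets are pseudomanifolds with fibered `L`-singularities, without boundary
      (∀ c hc hr, (P c hc hr).boundary = ∅ ∧
        IsStratSubmanifold W.toStratData (P c hc hr).toStratData (j c hc hr) ∧
        ∀ σ, (σP σ c hc hr).IsInducedOnLevel σ (j c hc hr) f) ∧
      -- `f⁻¹([c, d])` is a pseudomanifold with fibered `L`-singularities with boundary
      -- `f⁻¹(c) ⊔ f⁻¹(d)`, and a spin bordism between these level sets if `W` is spin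
      ∀ (c d : ℝ) (hc : c ∈ Icc a b) (hcr : IsRegularValue W.toStratData f c)
        (hd : d ∈ Icc a b) (hdr : IsRegularValue W.toStratData f d), c < d →
        ∃ (V : FibPM l L (n + 1) m ↥(f ⁻¹' Icc c d))
          (i : StratMap V.toStratData W.toStratData)
          (S : Cobordism (P c hc hcr).toStratData (P d hd hdr).toStratData V.toStratData),
          IsStratSubmanifold W.toStratData V.toStratData i ∧
          (∀ x, (S.c₀.toFun (x, 0)).1 = x.1) ∧ (∀ x, (S.c₁.toFun (x, 0)).1 = x.1) ∧
          ∀ σ : SpinPM W.toStratData, ∃ σV : SpinPM V.toStratData,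
            σV.IsRestriction σ i ∧ S.IsSpin (σP σ c hc hcr) (σP σ d hd hdr) σV := by
  choose P j hP0 hj hPa hPb using fun (c : ℝ) (hc : c ∈ Icc a b)
    (hr : IsRegularValue W.toStratData f c) => hfg.exists_level hc hr
  choose σP hσP using fun (σ : SpinPM W.toStratData) (c : ℝ) (hc : c ∈ Icc a b)
    (hr : IsRegularValue W.toStratData f c) =>
    SpinPM.exists_level hfg.smooth hr (hj c hc hr) σ
  refine ⟨P, j, σP, fun c hc hr => ⟨hP0 c hc hr, hj c hc hr, fun σ => hσP σ c hc hr⟩,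
    fun c d hc hcr hd hdr hcd => ?_⟩
  obtain ⟨V, i, S, hi, h0, h1⟩ := hfg.exists_slab hc hd hcd
    (hPa c hc hcr (hcd.trans_le hd.2)) (hPb d hd hdr (hc.1.trans_lt hcd))
  have hv : ∀ x, i.toFun x = x.1 := fun x => congrFun hi.1 x
  refine ⟨V, i, S, hi, h0, h1, fun σ => ⟨σ.restrict hi.2, σ.isRestriction_restrict hi.2, ?_, ?_⟩⟩
  · refine SpinPM.isInducedOnBoundary_restrict hfg.smooth hcr (hj c hc hcr).1 hi.2 S.c₀ one_ne_zero
      (fun x => (hv _).trans (h0 x)) (fun q => ?_) (hσP σ c hc hcr)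
    rw [hv, one_mul, sub_nonneg]
    exact (S.c₀.toFun q).2.1
  · refine SpinPM.isInducedOnBoundary_restrict hfg.smooth hdr (hj d hd hdr).1 hi.2 S.c₁
      (neg_ne_zero.2 one_ne_zero) (fun x => (hv _).trans (h1 x)) (fun q => ?_) (hσP σ d hd hdr)
    rw [hv, neg_one_mul, neg_sub, sub_nonneg]
    exact (S.c₁.toFun q).2.2
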